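/- **Definitions.** All graphs are finite and simple. For a graph $G$ and a graph $F$ on $r$ vertices, an induced copy of $F$ in $G$ is a set $S\subseteq V(G)$ with $G[S]\cong F$, and $N_{ind}(G,F)$ is the number of such sets. For a set $L$ of non-negative integers, $G$ is $(F,L)$-intersecting if $|A\cap B|\in L$ for any two distinct induced copies $A,B$ of $F$ in $G$. Let $$\Psi_r(n,F,L)=\max\{N_{ind}(G,F): G \text{ is an } n\text{-vertex } (F,L)\text{-intersecting graph}\},$$ and let $C_r$ be the cycle on $r$ vertices. A flawless $1$-factorization of a $k$-regular graph $G$ is a partition of $E(G)$ into $k$ perfect matchings of $G$ such that the union of any two of them is a Hamiltonian cycle of $G$ and every Hamiltonian cycle of $G$ is the union of two of them. For even $n\ge 2$, $f(n)$ is the largest $k$ for which some $k$-regular graph on $n$ vertices has a flawless $1$-factorization. **Theorem.** Let $r\ge 4$ and $L=\{\ell_1<\ell_2<\dots<\ell_s\}\subseteq[1,r-1]$ with $s>1$ be fixed, and suppose that $\ell_1,\dots,\ell_s,r$ is an arithmetic progression with common difference $d$. Write $B(n)=\left(\frac{n-\ell_1}{r-\ell_1}\right)^s$; here $o(1)$ denotes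 a quantity that tends to $0$ as $n\to\infty$ with $r$ and $L$ fixed. Then: 1. If $d=1$, then $\Psi_r(n,C_r,L)=(1+o(1))B(n)$ when $(\ell_1,s)\notin\{(1,3),(2,2)\}$, and $\Psi_r(n,C_r,L)=(2+o(1))B(n)$ when $(\ell_1,s)\in\{(1,3),(2,2)\}$. 2. If $d\ge 2$, then $(1+o(1))B(n)\le\Psi_r(n,C_r,L)\le(2+o(1))B(n)$. 3. If $d\ge 2$ and $\ell_1>sd$, then $\Psi_r(n,C_r,L)=(1+o(1))B(n)$. 4. If $d\ge 2$, $s=2$, $\ell_1<2d$ and $\ell_1\in\{1,2\}$, then $\Psi_r(n,C_r,L)=(2+o(1))B(n)$. 5. If $d\ge 2$, $s=2$, $\ell_1<d/2$ and $\ell_1\in\{3,4\}$, then $\Psi_r(n,C_r,L)=(2+o(1))B(n)$. 6. If $d\ge 2$, $s=2$ and $\ell_1=2d$, then $$\left(\tfrac43+o(1)\right)B(n)\le\Psi_r(n,C_r,L)\le\left(2-\tfrac{2}{f(\ell_1)}+o(1)\right)B(n).$$ -/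

import Mathlib

open Filter Topology

namespace CycleIntersect

/-- The vertex sets `S` such that the subgraph of `G` induced on `S` is isomorphic to `F`
(the induced copies of `F` in `G`). -/
def inducedCopies {V W : Type*} (G : SimpleGraph V) (F : SimpleGraph W) : Set (Set V) :=
  {S | Nonempty (G.induce S ≃g F)}

/-- The number `N_ind(G, F)` of induced copies of `F` in `G`. -/
noncomputable def numInduced {V W : Type*} (G : SimpleGraph V) (F : SimpleGraph W) : ℕ :=
  (inducedCopies G F).ncard

/-- `G` is `(F, L)`-intersecting: any two (distinct) induced copies of `F` in `G` meet in a number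
of vertices that belongs to `L`. -/
def IsIntersecting {V W : Type*} (G : SimpleGraph V) (F : SimpleGraph W) (L : Set ℕ) : Prop :=
  ∀ A ∈ inducedCopies G F, ∀ B ∈ inducedCopies G F, A ≠ B → (A ∩ B).ncard ∈ L

open scoped Classical in
/-- `Ψ_r(n, F, L)`: the maximum of `N_ind(G, F)` over the `(F, L)`-intersecting graphs `G` on `n`
vertices. -/
noncomputable def Psi {r : ℕ} (n : ℕ) (F : SimpleGraph (Fin r)) (L : Set ℕ) : ℕ :=
  (Finset.univ.filter fun G : SimpleGraph (Fin n) => IsIntersecting G F L).sup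
    fun G => numInduced G F

/-- `M 0, …, M (k - 1)` is a flawless 1-factorization of `G`. -/
structure IsFlawlessFactorization {V : Type*} [DecidableEq V] (G : SimpleGraph V) {k : ℕ}
    (M : Fin k → G.Subgraph) : Prop where
  /-- each `M i` is a 1-factor, i.e. a perfect matching -/
  factor : ∀ i, (M i).IsPerfectMatching
  /-- the 1-factors partition the edges of `G` -/
  partition : ∀ e ∈ G.edgeSet, ∃! i, e ∈ (M i).edgeSet
  /-- the union of any two of the 1-factors is a Hamiltonian cycle -/
  perfect : ∀ i j, i ≠ j → ∃ (v : V) (p : G.Walk v v),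
    p.IsHamiltonianCycle ∧ {e | e ∈ p.edges} = (M i).edgeSet ∪ (M j).edgeSet
  /-- every Hamiltonian cycle of `G` is the union of two of the 1-factors -/
  flawless : ∀ (v : V) (p : G.Walk v v), p.IsHamiltonianCycle →
    ∃ i j, i ≠ j ∧ {e | e ∈ p.edges} = (M i).edgeSet ∪ (M j).edgeSet

/-- The degrees `k` for which some `k`-regular graph on `n` vertices has a flawless
1-factorization. -/
def flawlessDegrees (n : ℕ) : Set ℕ :=
  {k | ∃ (G : SimpleGraph (Fin n)) (M : Fin k → G.Subgraph),
    (∀ v, (G.neighborSet v).ncard = k) ∧ IsFlawlessFactorization G M}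

/-- The flawless 1-factorization function `f(n)`: the maximum of `flawlessDegrees n`. -/
noncomputable def flawlessNumber (n : ℕ) : ℕ := sSup (flawlessDegrees n)

/-- For `n > 0` the supremum defining `flawlessNumber n` is over a bounded set, so that it is an
honest maximum (of a set that always contains `0`). -/
theorem flawlessNumber_isGreatest {n : ℕ} (hn : 0 < n) :
    IsGreatest (flawlessDegrees n) (flawlessNumber n) := by
  have hb : BddAbove (flawlessDegrees n) := by
    refine ⟨n, ?_⟩
    rintro k ⟨G, M, hreg, -⟩
    have h := Set.ncard_le_card (G.neighborSet ⟨0, hn⟩)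
    rw [hreg, Nat.card_fin] at h
    exact h
  have h0 : (flawlessDegrees n).Nonempty := by
    refine ⟨0, ⊥, Fin.elim0, ?_, ⟨fun i => i.elim0, ?_, fun i => i.elim0, ?_⟩⟩
    · intro v
      have : (⊥ : SimpleGraph (Fin n)).neighborSet v = ∅ := by ext; simp
      rw [this]; simp
    · intro e he; simp at he
    · intro v p hp
      cases p with
      | nil => exact absurd rfl hp.isCycle.ne_nil
      | cons h _ => simp at h
  exact ⟨Nat.sSup_mem h0 hb, fun k hk => le_csSup hb hk⟩

/-- `u(n) ≥ (c + o(1)) B(n)` as `n → ∞`. -/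
def AsympGe (u : ℕ → ℕ) (c : ℝ) (B : ℕ → ℝ) : Prop :=
  ∃ ε : ℕ → ℝ, Tendsto ε atTop (𝓝 0) ∧ ∀ᶠ n in atTop, (c + ε n) * B n ≤ (u n : ℝ)

/-- `u(n) ≤ (c + o(1)) B(n)` as `n → ∞`. -/
def AsympLe (u : ℕ → ℕ) (c : ℝ) (B : ℕ → ℝ) : Prop :=
  ∃ ε : ℕ → ℝ, Tendsto ε atTop (𝓝 0) ∧ ∀ᶠ n in atTop, (u n : ℝ) ≤ (c + ε n) * B n

/-- `u(n) = (c + o(1)) B(n)` as `n → ∞`. -/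
def AsympEq (u : ℕ → ℕ) (c : ℝ) (B : ℕ → ℝ) : Prop :=
  ∃ ε : ℕ → ℝ, Tendsto ε atTop (𝓝 0) ∧ ∀ᶠ n in atTop, (u n : ℝ) = (c + ε n) * B n

/-- The benchmark `((n - ℓ₁) / (r - ℓ₁)) ^ s`. -/
noncomputable def bench (r ℓ₁ s : ℕ) (n : ℕ) : ℝ :=
  (((n : ℝ) - (ℓ₁ : ℝ)) / ((r : ℝ) - (ℓ₁ : ℝ))) ^ s

/-- `n ↦ Ψ_r(n, C_r, L)`, with `C_r` the cycle on `r` vertices. -/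
noncomputable def PsiCycle (r : ℕ) (L : Set ℕ) (n : ℕ) : ℕ :=
  Psi n (SimpleGraph.cycleGraph r) L

end CycleIntersect

/-! Write `r = l + s d` with `l = ℓ 1`.

Upper bounds. The induced `r`-cycles are `r`-sets whose pairwise intersections take `s` sizes. A
kernel argument (`exists_blocks`) shows that all but `O(n ^ (s - 1))` of them consist of a common
base `K₀` of `l` vertices and of `s` out of `N ≤ n / d` disjoint blocks of `d` vertices. It remains
to count `s`-sets of blocks, where `(N / s) ^ s` corresponds to the constant `1`. If a partial union
of blocks has an edge but is not yet the whole cycle, it has a vertex `p` of degree one. The next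
block must contain a neighbour of `p`, and afterwards `p` is saturated, so no other block touching
`p` can ever be used. Hence the candidates of different steps form disjoint sets, and the inequality
of means bounds the product of their sizes by `(N / s) ^ s`. This gives the constant `1` if the base
has an edge (`card_le_of_base_edge`), in particular if `l > s d`, since an independent set has at
most half of the vertices of a cycle. If a base vertex `v` is isolated in the base, its two
neighbours may have to be chosen as an unordered pair of blocks from one set, which costs a factor
`2` (`card_le_two_mul`). For `d = 1` and `r > 4` a weighted count of the cycles minus one neighbour
of `v` removes this factor (`card_le_of_singletons`).

Lower bounds. In each construction every induced `r`-cycle is forced to be the base plus `s` legs. A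
cyclic blow-up with `N` parallel paths in each of `s` places gives the constant `1`, unless `r = 2 d
+ 2`. For `s = 2` there are graphs in which any two of about `n / d` legs close up to a cycle, which
gives the constant `2`: theta graphs (`l = 2`), spiders whose ends form a clique (`l = 1`), and
rings of `l` spiders (`l = 3, 4`). For `r = 4`, `l = 1` a special graph gives `2`.

The case `s = 2`, `l = 2 d`. If the base is independent, it is half of each cycle. For at least
three pairwise compatible blocks, the vertices of a block subdivide the edges of a perfect matching
on the base, and the union of two of the matchings is a Hamiltonian cycle. If each of these blocks
can also be exchanged for another block with the same matching, the intersection condition forces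
the matchings to form a flawless factorization. So in every clique of `f + 1` compatible blocks some
block is determined by the others up to boundedly many choices. There are then only `O(N ^ f)` such
cliques, and Turán's theorem with sampling (`mul_numArcs_le`) gives `2 - 2 / f`. Conversely, `N`
copies of each matching of a cubic graph on `2 d` vertices give `4 / 3`; the same graph shows that
`f ≥ 3`. -/

namespace CycleIntersect
open scoped Classical

/-! ### Induced cycles as connected 2-regular vertex sets. -/

/-- The neighbours of `x` in the finite set `A`. -/
noncomputable def nbrs {V : Type*} (G : SimpleGraph V) (A : Finset V) (x : V) : Finset V :=
  A.filter (G.Adj x)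

@[simp] theorem mem_nbrs {V : Type*} {G : SimpleGraph V} {A : Finset V} {x y : V} :
    y ∈ nbrs G A x ↔ y ∈ A ∧ G.Adj x y := by simp [nbrs]

/-- `A` spans an induced cycle on `r` vertices: it is `2`-regular and connected. -/
def CycSet {V : Type*} (G : SimpleGraph V) (r : ℕ) (A : Finset V) : Prop :=
  A.card = r ∧ (∀ x ∈ A, (nbrs G A x).card = 2) ∧
    ∀ T ⊆ A, T.Nonempty → (∀ x ∈ T, ∀ y ∈ A, G.Adj x y → y ∈ T) → T = A

theorem preconnected_of_closed {W : Type*} [Fintype W] (H : SimpleGraph W)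
    (h : ∀ T : Finset W, T.Nonempty → (∀ x ∈ T, ∀ y, H.Adj x y → y ∈ T) → T = Finset.univ) :
    H.Preconnected := by
  intro u v
  have := h (Finset.univ.filter fun w => H.Reachable u w) ⟨u, by simp⟩ (by
    intro x hx y hxy
    simp only [Finset.mem_filter, Finset.mem_univ, true_and] at hx ⊢
    exact hx.trans hxy.reachable)
  have hv : v ∈ (Finset.univ.filter fun w => H.Reachable u w) := by rw [this]; simp
  simpa using hv

theorem closed_of_reachable {W : Type*} {H : SimpleGraph W} {T : Set W}
    (h : ∀ x ∈ T, ∀ y, H.Adj x y → y ∈ T) {u v : W} (hu : u ∈ T) (huv : H.Reachable u v) :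
    v ∈ T := by
  obtain ⟨p⟩ := huv
  induction p with
  | nil => exact hu
  | cons hadj p ih => exact ih (h _ hu _ hadj)

/-- A connected `2`-regular graph has a Hamiltonian cycle. -/
theorem exists_hamiltonian_of_two_regular {W : Type*} [Fintype W] [Nonempty W]
    (H : SimpleGraph W) (h2 : ∀ x, (Finset.univ.filter (H.Adj x)).card = 2)
    (hc : H.Preconnected) :
    ∃ (v : W) (p : H.Walk v v), p.IsCycle ∧ p.length = Fintype.card W := by
  have hcyc : H.IsCycles := by
    intro v _
    rw [Set.ncard_eq_toFinset_card', ← h2 v]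
    congr 1; ext; simp
  obtain ⟨v⟩ := ‹Nonempty W›
  have hn : (H.neighborSet v).Nonempty := by
    have := h2 v
    have h3 : (Finset.univ.filter (H.Adj v)).Nonempty := by
      rw [← Finset.card_pos]; omega
    obtain ⟨w, hw⟩ := h3
    exact ⟨w, by simpa using hw⟩
  obtain ⟨p, hp, hpv⟩ := hcyc.exists_cycle_toSubgraph_verts_eq_connectedComponentSupp
    (c := H.connectedComponentMk v) (v := v) rfl hn
  refine ⟨v, p, hp, ?_⟩
  have hall : ∀ w, w ∈ p.support := by
    intro w
    rw [← SimpleGraph.Walk.mem_verts_toSubgraph, hpv]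
    exact SimpleGraph.ConnectedComponent.sound (hc w v)
  have h1 : p.support.tail.toFinset = Finset.univ := by
    ext w
    simp only [List.mem_toFinset, Finset.mem_univ, iff_true]
    have := hall w
    rw [SimpleGraph.Walk.mem_support_iff] at this
    rcases this with rfl | h
    · exact SimpleGraph.Walk.end_mem_tail_support hp.not_nil
    · exact h
  have h3 : p.support.tail.length = p.length := by simp
  rw [← h3, ← List.toFinset_card_of_nodup hp.support_nodup, h1, Finset.card_univ]

theorem inducedCopies_card {V : Type*} {G : SimpleGraph V} {r : ℕ} {A : Finset V}
    (h : (A : Set V) ∈ inducedCopies G (SimpleGraph.cycleGraph r)) : A.card = r := by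
  obtain ⟨e⟩ := h
  have := Fintype.card_congr e.toEquiv
  simpa using this

theorem card_filter_subtype {V : Type*} (A : Finset V) (P : V → Prop) :
    (Finset.univ.filter fun y : ((A : Set V) : Type _) => P y).card = (A.filter P).card := by
  refine Finset.card_bij (fun y _ => y.1) ?_ ?_ ?_
  · intro y hy
    simp only [Finset.mem_filter, Finset.mem_univ, true_and] at hy
    exact Finset.mem_filter.2 ⟨by simpa using y.2, hy⟩
  · intro a _ b _ h; exact Subtype.ext h
  · intro b hb
    rw [Finset.mem_filter] at hb
    exact ⟨⟨b, by simpa using hb.1⟩, by simpa using hb.2, rfl⟩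

/-- A connected 2-regular graph on `r` vertices has a Hamiltonian cycle, hence contains a copy of
the cycle graph, and comparison of degrees shows that the copy is induced. Everything later uses
only the degree and closure conditions of `CycSet`. -/
theorem mem_inducedCopies_iff {V : Type*} {G : SimpleGraph V} {r : ℕ} (hr : 3 ≤ r)
    {A : Finset V} :
    (A : Set V) ∈ inducedCopies G (SimpleGraph.cycleGraph r) ↔ CycSet G r A := by
  obtain ⟨k, rfl⟩ : ∃ k, r = k + 3 := ⟨r - 3, by omega⟩
  constructor
  · intro h
    refine ⟨inducedCopies_card h, ?_, ?_⟩
    · obtain ⟨e⟩ := h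
      intro x hx
      have h2 := SimpleGraph.cycleGraph_degree_three_le (v := e ⟨x, by simpa using hx⟩)
      rw [nbrs, ← card_filter_subtype, ← h2, ← SimpleGraph.card_neighborFinset_eq_degree]
      refine Finset.card_bij (fun y _ => e y) ?_ ?_ ?_
      · intro y hy
        simp only [Finset.mem_filter, Finset.mem_univ, true_and] at hy
        rw [SimpleGraph.mem_neighborFinset, e.map_adj_iff]
        exact hy
      · intro a _ b _ hab; exact e.injective hab
      · intro b hb
        rw [SimpleGraph.mem_neighborFinset] at hb
        refine ⟨e.symm b, ?_, by simp⟩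
        have h3 : (G.induce (A : Set V)).Adj ⟨x, by simpa using hx⟩ (e.symm b) := by
          rw [← e.map_adj_iff]; simpa using hb
        simpa using h3
    · obtain ⟨e⟩ := h
      intro T hT hne hcl
      refine Finset.Subset.antisymm hT fun z hz => ?_
      obtain ⟨t, ht⟩ := hne
      have hc : (G.induce (A : Set V)).Preconnected :=
        e.symm.preconnected_iff.1 SimpleGraph.cycleGraph_preconnected
      have := closed_of_reachable (H := G.induce (A : Set V)) (T := {y | (y : V) ∈ T})
        (fun x hx y hxy => hcl x hx y (by simp) (by simpa using hxy))
        (u := ⟨t, by simpa using hT ht⟩) ht (hc _ ⟨z, by simpa using hz⟩)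
      exact this
  · rintro ⟨hcard, h2, hcl⟩
    have h2' : ∀ x : ((A : Set V) : Type _),
        (Finset.univ.filter ((G.induce (A : Set V)).Adj x)).card = 2 := by
      intro x
      rw [← h2 x (by simp), nbrs, ← card_filter_subtype]
      rfl
    have hcardW : Fintype.card ((A : Set V) : Type _) = k + 3 := by simpa using hcard
    have : Nonempty ((A : Set V) : Type _) := by
      rw [← Fintype.card_pos_iff]; omega
    have hpre : (G.induce (A : Set V)).Preconnected := by
      apply preconnected_of_closed
      intro T hne hT
      have h := hcl (T.map (Function.Embedding.subtype _)) (by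
        intro y hy
        simp only [Finset.mem_map, Function.Embedding.coe_subtype] at hy
        obtain ⟨a, _, rfl⟩ := hy
        simp) (by simpa using hne) (by
        intro x hx y hy hxy
        simp only [Finset.mem_map, Function.Embedding.coe_subtype] at hx ⊢
        obtain ⟨a, ha, rfl⟩ := hx
        exact ⟨⟨y, by simpa using hy⟩, hT a ha _ (by simpa using hxy), rfl⟩)
      ext y
      simp only [Finset.mem_univ, iff_true]
      have hy : (y : V) ∈ A := by simp
      have hy := h.symm.subset hy
      simp only [Finset.mem_map, Function.Embedding.coe_subtype] at hy
      obtain ⟨a, ha, hay⟩ := hy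
      rwa [Subtype.ext hay] at ha
    obtain ⟨v, p, hp, hlen⟩ := exists_hamiltonian_of_two_regular _ h2' hpre
    rw [hcardW] at hlen
    obtain ⟨f⟩ := (SimpleGraph.cycleGraph_isContained_iff (n := k + 3) (by omega)).2 ⟨v, p, hp, hlen⟩
    have hbij : Function.Bijective f := by
      rw [Fintype.bijective_iff_injective_and_card]
      exact ⟨f.injective, by simp [hcard]⟩
    have hadj : ∀ a b, (G.induce (A : Set V)).Adj (f a) (f b) ↔
        (SimpleGraph.cycleGraph (k + 3)).Adj a b := by
      intro a b
      refine ⟨fun h => ?_, fun h => f.toHom.map_adj h⟩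
      -- The images of the two cycle neighbours of `a` exhaust the two neighbours of `f a`, so `f`
      -- also reflects adjacency.
      have himg : ((SimpleGraph.cycleGraph (k + 3)).neighborFinset a).image f =
          Finset.univ.filter ((G.induce (A : Set V)).Adj (f a)) := by
        apply Finset.eq_of_subset_of_card_le
        · intro y hy
          simp only [Finset.mem_image, SimpleGraph.mem_neighborFinset] at hy
          obtain ⟨c, hc, rfl⟩ := hy
          simpa using f.toHom.map_adj hc
        · rw [h2', Finset.card_image_of_injective _ (show Function.Injective f from f.injective),
            SimpleGraph.card_neighborFinset_eq_degree, SimpleGraph.cycleGraph_degree_three_le]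
      have hb : f b ∈ Finset.univ.filter ((G.induce (A : Set V)).Adj (f a)) := by simpa using h
      rw [← himg, Finset.mem_image] at hb
      obtain ⟨c, hc, hcb⟩ := hb
      rw [f.injective hcb] at hc
      simpa using hc
    exact ⟨(RelIso.mk (Equiv.ofBijective f hbij) (by
      intro a b; exact hadj a b) : SimpleGraph.cycleGraph (k + 3) ≃g _).symm⟩

/-- The induced `r`-cycles of `G`, as a finite family of finite sets. -/
noncomputable def cycs {V : Type*} [Fintype V] (G : SimpleGraph V) (r : ℕ) : Finset (Finset V) :=
  Finset.univ.filter (CycSet G r)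

theorem mem_cycs {V : Type*} [Fintype V] {G : SimpleGraph V} {r : ℕ} {A : Finset V} :
    A ∈ cycs G r ↔ CycSet G r A := by simp [cycs]

theorem exists_finset_of_inducedCopies {V : Type*} [Fintype V] {G : SimpleGraph V} {r : ℕ}
    (hr : 3 ≤ r) {S : Set V} (hS : S ∈ inducedCopies G (SimpleGraph.cycleGraph r)) :
    ∃ A : Finset V, CycSet G r A ∧ (A : Set V) = S := by
  refine ⟨S.toFinset, ?_, by simp⟩
  rw [← mem_inducedCopies_iff hr]; simpa using hS

theorem numInduced_eq_card_cycs {V : Type*} [Fintype V] (G : SimpleGraph V) {r : ℕ} (hr : 3 ≤ r) :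
    numInduced G (SimpleGraph.cycleGraph r) = (cycs G r).card := by
  rw [numInduced, ← Set.ncard_coe_finset, eq_comm]
  refine Set.ncard_congr (fun A _ => (A : Set V)) ?_ ?_ ?_
  · intro A hA
    exact (mem_inducedCopies_iff hr).2 (mem_cycs.1 hA)
  · intro A B _ _ h
    exact Finset.coe_injective h
  · intro S hS
    obtain ⟨A, hA, rfl⟩ := exists_finset_of_inducedCopies hr hS
    exact ⟨A, mem_cycs.2 hA, rfl⟩

theorem isIntersecting_iff {V : Type*} [Fintype V] (G : SimpleGraph V) {r : ℕ} (hr : 3 ≤ r)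
    (L : Set ℕ) : IsIntersecting G (SimpleGraph.cycleGraph r) L ↔
      ∀ A B : Finset V, CycSet G r A → CycSet G r B → A ≠ B → (A ∩ B).card ∈ L := by
  constructor
  · intro h A B hA hB hne
    have := h A ((mem_inducedCopies_iff hr).2 hA) B ((mem_inducedCopies_iff hr).2 hB)
      (by simpa using hne)
    rwa [← Finset.coe_inter, Set.ncard_coe_finset] at this
  · intro h S hS T hT hne
    obtain ⟨A, hA, rfl⟩ := exists_finset_of_inducedCopies hr hS
    obtain ⟨B, hB, rfl⟩ := exists_finset_of_inducedCopies hr hT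
    rw [← Finset.coe_inter, Set.ncard_coe_finset]
    exact h A B hA hB (by simpa using hne)

theorem CycSet.map {V W : Type*} {G : SimpleGraph V} {r : ℕ} {A : Finset V} (f : V ↪ W)
    (hA : CycSet G r A) : CycSet (G.map f) r (A.map f) := by
  obtain ⟨h1, h2, h3⟩ := hA
  have hadj : ∀ x y, (G.map f).Adj (f x) (f y) ↔ G.Adj x y := fun x y => by simp
  refine ⟨by simpa using h1, ?_, ?_⟩
  · intro x hx
    obtain ⟨a, ha, rfl⟩ := Finset.mem_map.1 hx
    rw [← h2 a ha, ← Finset.card_map f]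
    congr 1
    ext y
    simp only [mem_nbrs, Finset.mem_map]
    constructor
    · rintro ⟨⟨b, hb, rfl⟩, h⟩; exact ⟨b, ⟨hb, (hadj _ _).1 h⟩, rfl⟩
    · rintro ⟨b, ⟨hb, h⟩, rfl⟩; exact ⟨⟨b, hb, rfl⟩, (hadj _ _).2 h⟩
  · intro T hT hne hcl
    have hT' : T = (A.filter fun a => f a ∈ T).map f := by
      ext y
      simp only [Finset.mem_map, Finset.mem_filter]
      constructor
      · intro hy
        obtain ⟨a, ha, rfl⟩ := Finset.mem_map.1 (hT hy)
        exact ⟨a, ⟨ha, hy⟩, rfl⟩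
      · rintro ⟨a, ⟨_, ha⟩, rfl⟩; exact ha
    rw [hT']
    congr 1
    apply h3 _ (Finset.filter_subset _ _)
    · obtain ⟨y, hy⟩ := hne
      rw [hT'] at hy
      obtain ⟨a, ha, rfl⟩ := Finset.mem_map.1 hy
      exact ⟨a, ha⟩
    · intro x hx y hy hxy
      rw [Finset.mem_filter] at hx ⊢
      exact ⟨hy, hcl _ hx.2 _ (Finset.mem_map_of_mem f hy) ((hadj _ _).2 hxy)⟩

/-- Vertices outside the range of `f` are isolated in `G.map f`, so padding a graph to `n` vertices
creates no new induced cycles. -/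
theorem exists_of_cycSet_map {V W : Type*} {G : SimpleGraph V} {r : ℕ} {A : Finset W}
    (f : V ↪ W) (hA : CycSet (G.map f) r A) : ∃ B : Finset V, CycSet G r B ∧ A = B.map f := by
  obtain ⟨h1, h2, h3⟩ := hA
  have hadj : ∀ x y, (G.map f).Adj (f x) (f y) ↔ G.Adj x y := fun x y => by simp
  have hr : ∀ y ∈ A, ∃ x, f x = y := by
    intro y hy
    have h0 : (nbrs (G.map f) A y).Nonempty := by
      rw [← Finset.card_pos, h2 y hy]; norm_num
    obtain ⟨z, hz⟩ := h0
    rw [mem_nbrs, SimpleGraph.map_adj] at hz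
    obtain ⟨_, u, v, _, hu, _⟩ := hz
    exact ⟨u, hu⟩
  let B : Finset V := A.preimage f f.injective.injOn
  have hAB : A = B.map f := by
    ext y
    simp only [B, Finset.mem_map, Finset.mem_preimage]
    constructor
    · intro hy; obtain ⟨x, rfl⟩ := hr y hy; exact ⟨x, hy, rfl⟩
    · rintro ⟨x, hx, rfl⟩; exact hx
  refine ⟨B, ⟨by rw [← h1, hAB, Finset.card_map], ?_, ?_⟩, hAB⟩
  · intro x hx
    have := h2 (f x) (by simpa [B] using hx)
    rw [← this, ← Finset.card_map f]
    congr 1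
    ext y
    simp only [mem_nbrs, Finset.mem_map, hAB]
    constructor
    · rintro ⟨b, ⟨hb, h⟩, rfl⟩; exact ⟨⟨b, hb, rfl⟩, (hadj _ _).2 h⟩
    · rintro ⟨⟨b, hb, rfl⟩, h⟩; exact ⟨b, ⟨hb, (hadj _ _).1 h⟩, rfl⟩
  · intro T hT hne hcl
    have := h3 (T.map f) (by rw [hAB]; exact Finset.map_subset_map.2 hT) (by simpa using hne) (by
      intro x hx y hy hxy
      obtain ⟨a, ha, rfl⟩ := Finset.mem_map.1 hx
      rw [hAB] at hy
      obtain ⟨b, hb, rfl⟩ := Finset.mem_map.1 hy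
      exact Finset.mem_map_of_mem f (hcl a ha b hb ((hadj _ _).1 hxy)))
    rw [hAB] at this
    exact Finset.map_injective f this

/-- A graph on at most `n` vertices all of whose induced `r`-cycles meet in a number of vertices
from `L` bounds `Ψ_r(n, C_r, L)` from below. -/
theorem card_le_psiCycle {V : Type*} [Fintype V] {G : SimpleGraph V} {r n : ℕ} (hr : 3 ≤ r)
    {L : Set ℕ} (hV : Fintype.card V ≤ n)
    (hL : ∀ A B : Finset V, CycSet G r A → CycSet G r B → A ≠ B → (A ∩ B).card ∈ L)
    {𝓕 : Finset (Finset V)} (h𝓕 : ∀ A ∈ 𝓕, CycSet G r A) : 𝓕.card ≤ PsiCycle r L n := by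
  obtain ⟨f⟩ : Nonempty (V ↪ Fin n) := by
    apply Function.Embedding.nonempty_of_card_le; simpa using hV
  have hint : IsIntersecting (G.map f) (SimpleGraph.cycleGraph r) L := by
    rw [isIntersecting_iff _ hr]
    intro A B hA hB hne
    obtain ⟨A, hA', rfl⟩ := exists_of_cycSet_map f hA
    obtain ⟨B, hB', rfl⟩ := exists_of_cycSet_map f hB
    have h : (A.map f ∩ B.map f).card = (A ∩ B).card := by
      rw [← Finset.card_map f, Finset.map_inter]
    have h2 := hL A B hA' hB' (fun h => hne (by rw [h]))
    rw [← h] at h2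
    convert h2
  have h1 : 𝓕.card ≤ (cycs (G.map f) r).card := by
    apply Finset.card_le_card_of_injOn (fun A => A.map f)
    · intro A hA
      exact mem_cycs.2 ((h𝓕 A hA).map f)
    · intro A _ B _ h; exact Finset.map_injective f h
  rw [← numInduced_eq_card_cycs _ hr] at h1
  refine h1.trans ?_
  exact Finset.le_sup (f := fun G : SimpleGraph (Fin n) =>
    numInduced G (SimpleGraph.cycleGraph r)) (by simpa using hint)

theorem psiCycle_le {r n m : ℕ} (hr : 3 ≤ r) {L : Set ℕ}
    (h : ∀ (V : Type) [Fintype V] (G : SimpleGraph V), Fintype.card V = n →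
      (∀ A B : Finset V, CycSet G r A → CycSet G r B → A ≠ B → (A ∩ B).card ∈ L) →
      (cycs G r).card ≤ m) : PsiCycle r L n ≤ m := by
  apply Finset.sup_le
  intro G hG
  rw [Finset.mem_filter, isIntersecting_iff _ hr] at hG
  rw [numInduced_eq_card_cycs _ hr]
  refine h (Fin n) G (by simp) fun A B hA hB hne => ?_
  convert hG.2 A B hA hB hne

/-! ### Asymptotic bookkeeping. -/

theorem eventually_bench_pos {r l s d : ℕ} (hr : r = l + s * d) (hs : 0 < s) (hd : 0 < d) :
    ∀ᶠ n in atTop, 0 < bench r l s n := by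
  filter_upwards [eventually_gt_atTop l] with n hn
  have h1 : (l : ℝ) < n := by exact_mod_cast hn
  have h2 : (l : ℝ) < r := by
    have : l < r := by rw [hr]; have := Nat.mul_pos hs hd; omega
    exact_mod_cast this
  unfold bench
  have : 0 < ((n : ℝ) - l) / ((r : ℝ) - l) := div_pos (by linarith) (by linarith)
  positivity

/-- Allows all bounds to be compared with `(n / (s d)) ^ s`, where the `l` base vertices are not
subtracted from `n`. -/
theorem tendsto_bench_div {r l s d : ℕ} (hr : r = l + s * d) (hs : 0 < s) (hd : 0 < d) :
    Tendsto (fun n : ℕ => ((n : ℝ) / (s * d)) ^ s / bench r l s n) atTop (𝓝 1) := by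
  have h0 : Tendsto (fun n : ℕ => (l : ℝ) / (n : ℝ)) atTop (𝓝 0) :=
    tendsto_const_div_atTop_nhds_zero_nat _
  have h1 : Tendsto (fun n : ℕ => ((1 - (l : ℝ) / (n : ℝ)) ^ s)⁻¹) atTop (𝓝 1) := by
    have := ((tendsto_const_nhds (x := (1 : ℝ))).sub h0).pow s
    simpa using this.inv₀ (by simp)
  refine h1.congr' ?_
  filter_upwards [eventually_gt_atTop l] with n hn
  have hn' : (n : ℝ) ≠ 0 := by
    have : 0 < n := by omega
    positivity
  have h1 : ((n : ℝ) - l) ≠ 0 := by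
    have : (l : ℝ) < n := by exact_mod_cast hn
    linarith
  have h2 : (r : ℝ) - l = s * d := by rw [hr]; push_cast; ring
  have hs' : (s : ℝ) ≠ 0 := by positivity
  have hd' : (d : ℝ) ≠ 0 := by positivity
  unfold bench
  rw [h2, ← div_pow, ← inv_pow]
  congr 1
  field_simp

theorem asympLe_of_eventually {u : ℕ → ℕ} {c : ℝ} {r l s d : ℕ} (hr : r = l + s * d)
    (hs : 0 < s) (hd : 0 < d)
    (h : ∀ δ : ℝ, 0 < δ → ∀ᶠ n : ℕ in atTop, (u n : ℝ) ≤ (c + δ) * ((n : ℝ) / (s * d)) ^ s) :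
    AsympLe u c (bench r l s) := by
  -- The relative excess over `c`, truncated at `0`: with only an upper bound at hand the ratio
  -- itself need not converge.
  refine ⟨fun n => max 0 (u n / bench r l s n - c), ?_, ?_⟩
  · have hb := eventually_bench_pos hr hs hd
    rw [Metric.tendsto_atTop']
    intro δ hδ
    have hlim : Tendsto (fun n : ℕ => (c + δ / 2) * (((n : ℝ) / (s * d)) ^ s / bench r l s n))
        atTop (𝓝 ((c + δ / 2) * 1)) := (tendsto_bench_div hr hs hd).const_mul _
    have h1 := (hlim.eventually_lt_const (show (c + δ / 2) * 1 < c + δ by linarith))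
    obtain ⟨N, hN⟩ := eventually_atTop.1 ((h (δ / 2) (by positivity)).and (hb.and h1))
    refine ⟨N, fun n hn => ?_⟩
    obtain ⟨h2, h3, h4⟩ := hN n hn.le
    have h5 : (u n : ℝ) / bench r l s n < c + δ := by
      refine lt_of_le_of_lt ?_ h4
      rw [← mul_div_assoc]
      gcongr
    rw [Real.dist_eq, sub_zero, abs_of_nonneg (le_max_left _ _)]
    exact max_lt hδ (by linarith)
  · filter_upwards [eventually_bench_pos hr hs hd] with n hn
    have h1 : (u n : ℝ) / bench r l s n ≤ c + max 0 (u n / bench r l s n - c) := by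
      have := le_max_right 0 ((u n : ℝ) / bench r l s n - c)
      linarith
    rwa [div_le_iff₀ hn] at h1

/-- Makes the `O(n ^ (s - 1))` exceptional cycles negligible. -/
theorem eventually_mul_pow_le {s d : ℕ} (hs : 0 < s) (hd : 0 < d) (C : ℝ) {δ : ℝ} (hδ : 0 < δ) :
    ∀ᶠ n : ℕ in atTop, C * (n : ℝ) ^ (s - 1) ≤ δ * ((n : ℝ) / (s * d)) ^ s := by
  have h := tendsto_natCast_atTop_atTop (R := ℝ) |>.eventually_ge_atTop (C * (s * d) ^ s / δ)
  filter_upwards [h, eventually_gt_atTop 0] with n hn hn0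
  have hsd : (0 : ℝ) < (s * d) ^ s := by positivity
  rw [div_le_iff₀ hδ] at hn
  rw [div_pow, ← mul_div_assoc, le_div_iff₀ hsd]
  obtain ⟨t, rfl⟩ : ∃ t, s = t + 1 := ⟨s - 1, by omega⟩
  rw [Nat.add_sub_cancel, pow_succ (n : ℝ)]
  have h2 : (0 : ℝ) ≤ (n : ℝ) ^ t := by positivity
  nlinarith [mul_le_mul_of_nonneg_left hn h2]

theorem tendsto_sub_div_div (l : ℕ) {k : ℕ} (hk : 0 < k) :
    Tendsto (fun n : ℕ => (((n - l) / k : ℕ) : ℝ) / n) atTop (𝓝 (1 / k)) := by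
  have hk' : (0 : ℝ) < k := by positivity
  have h1 : Tendsto (fun n : ℕ => (1 / (k : ℝ)) - ((l + k : ℕ) : ℝ) / n) atTop
      (𝓝 (1 / (k : ℝ) - 0)) :=
    tendsto_const_nhds.sub (tendsto_const_div_atTop_nhds_zero_nat _)
  rw [sub_zero] at h1
  refine tendsto_of_tendsto_of_tendsto_of_le_of_le' h1 tendsto_const_nhds ?_ ?_
  · filter_upwards [eventually_gt_atTop l] with n hn
    have hn' : (0 : ℝ) < n := by
      have : 0 < n := by omega
      positivity
    rw [← sub_nonneg]
    have h2 : n ≤ k * ((n - l) / k) + (l + k) := by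
      have := Nat.div_add_mod (n - l) k
      have := Nat.mod_lt (n - l) hk
      omega
    have h3 : (n : ℝ) ≤ k * (((n - l) / k : ℕ) : ℝ) + ((l + k : ℕ) : ℝ) := by exact_mod_cast h2
    have h4 : ((l + k : ℕ) : ℝ) ≤ k * ((l + k : ℕ) : ℝ) := by
      have : (1 : ℝ) ≤ k := by exact_mod_cast hk
      have : (0 : ℝ) ≤ ((l + k : ℕ) : ℝ) := by positivity
      nlinarith
    have : (((n - l) / k : ℕ) : ℝ) / n - (1 / (k : ℝ) - ((l + k : ℕ) : ℝ) / n) =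
      (k * (((n - l) / k : ℕ) : ℝ) + k * ((l + k : ℕ) : ℝ) - n) / (k * n) := by
      field_simp
      ring
    rw [this]
    apply div_nonneg _ (by positivity)
    linarith
  · filter_upwards [eventually_gt_atTop l] with n hn
    have hn' : (0 : ℝ) < n := by
      have : 0 < n := by omega
      positivity
    rw [div_le_div_iff₀ hn' hk', one_mul]
    have : (n - l) / k * k ≤ n := (Nat.div_mul_le_self _ _).trans (by omega)
    exact_mod_cast this

/-- A lower bound `p N` valid whenever `l + k * N ≤ n` gives an asymptotic lower bound. -/
theorem asympGe_of_le {u : ℕ → ℕ} {p : ℕ → ℝ} {c a : ℝ} {r l s d k : ℕ} (hr : r = l + s * d)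
    (hs : 0 < s) (hd : 0 < d) (hk : 0 < k)
    (hp : Tendsto (fun N : ℕ => p N / (N : ℝ) ^ s) atTop (𝓝 a))
    (hac : a * (s * d) ^ s = c * (k : ℝ) ^ s)
    (h : ∀ n N : ℕ, 0 < N → l + k * N ≤ n → p N ≤ u n) : AsympGe u c (bench r l s) := by
  -- For `l ≤ n`, the value `(n - l) / k` is the largest `N` for which the construction fits into
  -- `n` vertices.
  have hN : Tendsto (fun n : ℕ => (n - l) / k) atTop atTop :=
    (Nat.tendsto_div_const_atTop (by omega)).comp (tendsto_sub_atTop_nat l)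
  have hlim : Tendsto (fun n : ℕ => p ((n - l) / k) / (((n - l) / k : ℕ) : ℝ) ^ s *
      ((((n - l) / k : ℕ) : ℝ) / n) ^ s * (s * d) ^ s *
      (((n : ℝ) / (s * d)) ^ s / bench r l s n)) atTop (𝓝 (a * (1 / k) ^ s * (s * d) ^ s * 1)) :=
    (((hp.comp hN).mul ((tendsto_sub_div_div l hk).pow s)).mul_const _).mul
      (tendsto_bench_div hr hs hd)
  have hc : a * (1 / (k : ℝ)) ^ s * (s * d) ^ s * 1 = c := by
    have : (k : ℝ) ^ s ≠ 0 := by positivity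
    rw [mul_one, mul_right_comm, hac, one_div, inv_pow, mul_assoc, mul_inv_cancel₀ this, mul_one]
  rw [hc] at hlim
  have hlim2 : Tendsto (fun n : ℕ => p ((n - l) / k) / bench r l s n) atTop (𝓝 c) := by
    refine hlim.congr' ?_
    filter_upwards [hN.eventually_gt_atTop 0, eventually_gt_atTop 0,
      eventually_bench_pos hr hs hd] with n hn hn0 hb
    have h1 : ((((n - l) / k : ℕ) : ℝ)) ≠ 0 := by positivity
    have h2 : (n : ℝ) ≠ 0 := by positivity
    have h3 : (s : ℝ) ≠ 0 := by positivity
    have h4 : (d : ℝ) ≠ 0 := by positivity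
    simp only [div_pow, mul_pow]
    field_simp
  refine ⟨fun n => p ((n - l) / k) / bench r l s n - c, ?_, ?_⟩
  · simpa using hlim2.sub_const c
  · filter_upwards [hN.eventually_gt_atTop 0, eventually_gt_atTop l,
      eventually_bench_pos hr hs hd] with n hn hn0 hb
    have h1 : (c + (p ((n - l) / k) / bench r l s n - c)) * bench r l s n = p ((n - l) / k) := by
      field_simp
      ring
    rw [h1]
    apply h n _ hn
    have := Nat.mul_div_le (n - l) k
    omega

theorem AsympGe.mono {u : ℕ → ℕ} {c c' : ℝ} {r l s d : ℕ} (hr : r = l + s * d)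
    (hs : 0 < s) (hd : 0 < d) (h : AsympGe u c (bench r l s)) (hc : c' ≤ c) :
    AsympGe u c' (bench r l s) := by
  obtain ⟨ε, hε, h⟩ := h
  refine ⟨ε, hε, ?_⟩
  filter_upwards [h, eventually_bench_pos hr hs hd] with n hn hb
  nlinarith

theorem asympEq_of {u : ℕ → ℕ} {c : ℝ} {r l s d : ℕ} (hr : r = l + s * d)
    (hs : 0 < s) (hd : 0 < d) (h1 : AsympGe u c (bench r l s)) (h2 : AsympLe u c (bench r l s)) :
    AsympEq u c (bench r l s) := by
  obtain ⟨ε, hε, h1⟩ := h1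
  obtain ⟨ε', hε', h2⟩ := h2
  have hb := eventually_bench_pos hr hs hd
  refine ⟨fun n => u n / bench r l s n - c, ?_, ?_⟩
  · refine tendsto_of_tendsto_of_tendsto_of_le_of_le' hε hε' ?_ ?_
    · filter_upwards [h1, hb] with n hn hb
      rw [le_sub_iff_add_le, le_div_iff₀ hb]; linarith
    · filter_upwards [h2, hb] with n hn hb
      rw [sub_le_iff_le_add, div_le_iff₀ hb]; linarith
  · filter_upwards [hb] with n hb
    field_simp
    ring

/-! ### Set families with few intersection sizes, and the block structure. -/

/-- A branching step: `K` is enlarged by an element of `X` at the price of a factor `X.card`. -/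
theorem card_filter_subset_le {V : Type*} [Fintype V] (𝓗 : Finset (Finset V)) (K X : Finset V)
    (m : ℕ) (h : ∀ A ∈ 𝓗, K ⊆ A → ∃ x ∈ X, x ∉ K ∧ x ∈ A)
    (hm : ∀ x ∈ X, x ∉ K → (𝓗.filter (insert x K ⊆ ·)).card ≤ m) :
    (𝓗.filter (K ⊆ ·)).card ≤ X.card * m := by
  have hsub : 𝓗.filter (K ⊆ ·) ⊆ (X.filter (· ∉ K)).biUnion
      fun x => 𝓗.filter (insert x K ⊆ ·) := by
    intro A hA
    rw [Finset.mem_filter] at hA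
    obtain ⟨x, hx, hxK, hxA⟩ := h A hA.1 hA.2
    simp only [Finset.mem_biUnion, Finset.mem_filter]
    exact ⟨x, ⟨hx, hxK⟩, hA.1, Finset.insert_subset hxA hA.2⟩
  calc _ ≤ _ := Finset.card_le_card hsub
    _ ≤ ∑ x ∈ X.filter (· ∉ K), (𝓗.filter (insert x K ⊆ ·)).card := Finset.card_biUnion_le
    _ ≤ (X.filter (· ∉ K)).card * m := Finset.sum_le_card_nsmul _ _ _ fun x hx => by
        rw [Finset.mem_filter] at hx; exact hm x hx.1 hx.2
    _ ≤ X.card * m := Nat.mul_le_mul_right _ (Finset.card_filter_le _ _)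

/-- Every other member shares some `l`-subset with `A₀`, and `A₀` has at most `2 ^ A₀.card` of
these. -/
theorem card_le_of_filter_subset_le {V : Type*} [Fintype V] (𝓗 : Finset (Finset V))
    (A₀ : Finset V) (l m : ℕ) (h : ∀ A ∈ 𝓗, A ≠ A₀ → l ≤ (A₀ ∩ A).card)
    (hm : ∀ K ⊆ A₀, K.card = l → (𝓗.filter (K ⊆ ·)).card ≤ m) :
    𝓗.card ≤ 1 + 2 ^ A₀.card * m := by
  have hsub : 𝓗 ⊆ {A₀} ∪ (A₀.powerset.filter (·.card = l)).biUnion fun K => 𝓗.filter (K ⊆ ·) := by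
    intro A hA
    by_cases hA0 : A = A₀
    · simp [hA0]
    · obtain ⟨K, hK, hKl⟩ := Finset.exists_subset_card_eq (h A hA hA0)
      apply Finset.mem_union_right
      simp only [Finset.mem_biUnion, Finset.mem_filter, Finset.mem_powerset]
      exact ⟨K, ⟨hK.trans Finset.inter_subset_left, hKl⟩, hA, hK.trans Finset.inter_subset_right⟩
  calc _ ≤ _ := Finset.card_le_card hsub
    _ ≤ 1 + _ := Finset.card_union_le _ _
    _ ≤ 1 + ∑ K ∈ A₀.powerset.filter (·.card = l), (𝓗.filter (K ⊆ ·)).card := by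
        gcongr; exact Finset.card_biUnion_le
    _ ≤ 1 + (A₀.powerset.filter (·.card = l)).card * m := by
        gcongr
        exact Finset.sum_le_card_nsmul _ _ _ fun K hK => by
          rw [Finset.mem_filter, Finset.mem_powerset] at hK; exact hm K hK.1 hK.2
    _ ≤ 1 + 2 ^ A₀.card * m := by
        gcongr
        rw [← Finset.card_powerset]
        exact Finset.card_filter_le _ _

theorem inter_mem_erase {V : Type*} {L : Finset ℕ} {l : ℕ} {A B K : Finset V}
    (hK : l < K.card) (hA : K ⊆ A) (hB : K ⊆ B) (h : (A ∩ B).card ∈ L) :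
    (A ∩ B).card ∈ L.erase l := by
  refine Finset.mem_erase.2 ⟨?_, h⟩
  have := Finset.card_le_card (Finset.subset_inter hA hB)
  omega

/-- A family of `r`-sets whose pairwise intersections take at most `s` sizes has `O(n^s)` members. -/
theorem exists_card_le_of_inter_mem (r s : ℕ) : ∃ C : ℕ, ∀ {V : Type} [Fintype V] (L : Finset ℕ)
    (𝓗 : Finset (Finset V)), L.card ≤ s → 0 < Fintype.card V → (∀ A ∈ 𝓗, A.card = r) →
    (∀ A ∈ 𝓗, ∀ B ∈ 𝓗, A ≠ B → (A ∩ B).card ∈ L) → 𝓗.card ≤ C * Fintype.card V ^ s := by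
  induction s with
  | zero =>
    refine ⟨1, fun L 𝓗 hL hV hr h => ?_⟩
    rw [pow_zero, mul_one, Finset.card_le_one]
    intro A hA B hB
    by_contra hne
    have := h A hA B hB hne
    rw [Finset.card_eq_zero.1 (Nat.le_zero.1 hL)] at this
    simp at this
  | succ s ih =>
    obtain ⟨C, hC⟩ := ih
    refine ⟨1 + 2 ^ r * (1 + C), fun {V} _ L 𝓗 hL hV hr h => ?_⟩
    set n := Fintype.card V with hn
    rcases 𝓗.eq_empty_or_nonempty with rfl | ⟨A₀, hA₀⟩
    · simp
    rcases L.eq_empty_or_nonempty with rfl | hLne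
    · have := hC ∅ 𝓗 (by simp) hV hr h
      refine this.trans ?_
      have h1 : C ≤ 1 + 2 ^ r * (1 + C) := by
        have := Nat.one_le_two_pow (n := r)
        nlinarith
      exact Nat.mul_le_mul h1 (Nat.pow_le_pow_right hV (Nat.le_succ s))
    set l := L.min' hLne with hl
    have hlmem : l ∈ L := L.min'_mem hLne
    have hmin : ∀ x ∈ L, l ≤ x := fun x hx => L.min'_le x hx
    -- Above a set with more than `l` elements the intersection size `l` no longer occurs, so the
    -- induction hypothesis applies.
    have hext : ∀ K : Finset V, l < K.card → (𝓗.filter (K ⊆ ·)).card ≤ C * n ^ s := by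
      intro K hK
      apply hC (L.erase l) _ (by rw [Finset.card_erase_of_mem hlmem]; omega) hV
      · intro A hA; exact hr A (Finset.mem_filter.1 hA).1
      · intro A hA B hB hne
        rw [Finset.mem_filter] at hA hB
        exact inter_mem_erase hK hA.2 hB.2 (h A hA.1 B hB.1 hne)
    have hK : ∀ K : Finset V, K.card = l → (𝓗.filter (K ⊆ ·)).card ≤ 1 + n * (C * n ^ s) := by
      intro K hKl
      have h1 : ((𝓗.erase K).filter (K ⊆ ·)).card ≤ n * (C * n ^ s) := by
        rw [hn, ← Finset.card_univ]
        apply card_filter_subset_le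
        · intro A hA hKA
          rw [Finset.mem_erase] at hA
          obtain ⟨x, hx, hxK⟩ := Finset.exists_of_ssubset (hKA.ssubset_of_ne hA.1.symm)
          exact ⟨x, Finset.mem_univ _, hxK, hx⟩
        · intro x _ hx
          refine (Finset.card_le_card ?_).trans (hext (insert x K)
            (by rw [Finset.card_insert_of_notMem hx]; omega))
          exact Finset.filter_subset_filter _ (Finset.erase_subset _ _)
      have h2 : 𝓗.filter (K ⊆ ·) ⊆ insert K ((𝓗.erase K).filter (K ⊆ ·)) := by
        intro A hA
        rw [Finset.mem_filter] at hA
        simp only [Finset.mem_insert, Finset.mem_filter, Finset.mem_erase]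
        tauto
      have := (Finset.card_le_card h2).trans (Finset.card_insert_le _ _)
      omega
    have := card_le_of_filter_subset_le 𝓗 A₀ l (1 + n * (C * n ^ s))
      (fun A hA hne => hmin _ (h A₀ hA₀ A hA hne.symm)) (fun K _ hKl => hK K hKl)
    rw [hr A₀ hA₀] at this
    refine this.trans ?_
    have h1 : 1 ≤ n ^ (s + 1) := Nat.one_le_pow _ _ hV
    have h2 : n * (C * n ^ s) = C * n ^ (s + 1) := by ring
    rw [h2]
    calc 1 + 2 ^ r * (1 + C * n ^ (s + 1))
        ≤ n ^ (s + 1) + 2 ^ r * (n ^ (s + 1) + C * n ^ (s + 1)) := by gcongr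
      _ = (1 + 2 ^ r * (1 + C)) * n ^ (s + 1) := by ring

/-- Either the family is small, or all its members share a set of the smallest size of an
intersection. -/
theorem exists_kernel (r s : ℕ) : ∃ C : ℕ, ∀ {V : Type} [Fintype V] (L : Finset ℕ) (l : ℕ)
    (𝓗 : Finset (Finset V)), L.card ≤ s + 1 → l ∈ L → (∀ x ∈ L, l ≤ x) → 0 < Fintype.card V →
    (∀ A ∈ 𝓗, A.card = r) → (∀ A ∈ 𝓗, ∀ B ∈ 𝓗, A ≠ B → (A ∩ B).card ∈ L) →
    𝓗.card ≤ C * Fintype.card V ^ s ∨ ∃ K : Finset V, K.card = l ∧ ∀ A ∈ 𝓗, K ⊆ A := by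
  obtain ⟨C, hC⟩ := exists_card_le_of_inter_mem r s
  refine ⟨1 + 2 ^ r * (r * C), fun {V} _ L l 𝓗 hL hlmem hmin hV hr h => ?_⟩
  set n := Fintype.card V with hn
  rcases 𝓗.eq_empty_or_nonempty with rfl | ⟨A₀, hA₀⟩
  · left; simp
  have hext : ∀ K : Finset V, l < K.card → (𝓗.filter (K ⊆ ·)).card ≤ C * n ^ s := by
    intro K hK
    apply hC (L.erase l) _ (by rw [Finset.card_erase_of_mem hlmem]; omega) hV
    · intro A hA; exact hr A (Finset.mem_filter.1 hA).1
    · intro A hA B hB hne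
      rw [Finset.mem_filter] at hA hB
      exact inter_mem_erase hK hA.2 hB.2 (h A hA.1 B hB.1 hne)
  by_contra hcon
  push Not at hcon
  obtain ⟨h1, h2⟩ := hcon
  have := card_le_of_filter_subset_le 𝓗 A₀ l (r * (C * n ^ s))
    (fun A hA hne => hmin _ (h A₀ hA₀ A hA hne.symm)) (by
      intro K _ hKl
      -- `B` does not contain `K`. Every member `A ⊇ K` meets `B` outside `K`: otherwise `A ∩ B ⊆
      -- K`, and the minimality of `l = K.card` would force `K ⊆ B`. So `r` branches suffice where
      -- the trivial bound needs `n`.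
      obtain ⟨B, hB, hKB⟩ := h2 K hKl
      rw [← hr B hB]
      apply card_filter_subset_le
      · intro A hA hKA
        by_contra hno
        push Not at hno
        apply hKB
        have hAB : A ∩ B ⊆ K := by
          intro x hx
          rw [Finset.mem_inter] at hx
          by_contra hxK
          exact hno x hx.2 hxK hx.1
        have hne : A ≠ B := by rintro rfl; exact hKB hKA
        have hle := hmin _ (h A hA B hB hne)
        rw [← Finset.eq_of_subset_of_card_le hAB (by omega)]
        exact Finset.inter_subset_right
      · intro x _ hx
        exact hext (insert x K) (by rw [Finset.card_insert_of_notMem hx]; omega))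
  rw [hr A₀ hA₀] at this
  have h3 : 1 ≤ n ^ s := Nat.one_le_pow _ _ hV
  have h4 : 1 + 2 ^ r * (r * (C * n ^ s)) ≤ (1 + 2 ^ r * (r * C)) * n ^ s := by
    calc 1 + 2 ^ r * (r * (C * n ^ s)) ≤ n ^ s + 2 ^ r * (r * (C * n ^ s)) := by gcongr
      _ = _ := by ring
  omega

/-- A family of sets `K₀ ∪ ⋃ U`, where `U` consists of `s` of the disjoint `d`-sets in `Ω`. -/
structure IsBlockFamily {V : Type*} (K₀ : Finset V) (Ω : Finset (Finset V)) (s d : ℕ)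
    (𝓗 : Finset (Finset V)) : Prop where
  card_block : ∀ D ∈ Ω, D.card = d
  disjoint_base : ∀ D ∈ Ω, Disjoint D K₀
  pairwise_disjoint : ∀ D ∈ Ω, ∀ D' ∈ Ω, D ≠ D' → Disjoint D D'
  exists_eq : ∀ A ∈ 𝓗, ∃ U ⊆ Ω, U.card = s ∧ A = K₀ ∪ U.biUnion id
  exists_mem : ∀ D ∈ Ω, ∃ A ∈ 𝓗, D ⊆ A

/-- Two applications of `exists_kernel`. A large family has a kernel `K₀` of size `l`. Members
through a vertex `x` outside `K₀` meet in at least `l + d` vertices, so, unless there are only `O(n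
^ (s - 2))` of them, they have a kernel `κ x` of size `l + d`. The sets `κ x \ K₀` are the blocks.
Discarding the members that contain a light vertex costs `O(n ^ (s - 1))`. -/
theorem exists_blocks (r l s d : ℕ) (hs : 2 ≤ s) (hd : 0 < d) (hr : r = l + s * d) :
    ∃ C : ℕ, ∀ {V : Type} [Fintype V] (𝓗 : Finset (Finset V)), 0 < Fintype.card V →
    (∀ A ∈ 𝓗, A.card = r) →
    (∀ A ∈ 𝓗, ∀ B ∈ 𝓗, A ≠ B → (A ∩ B).card ∈ (Finset.range s).image (fun j => l + j * d)) →
    𝓗.card ≤ C * Fintype.card V ^ (s - 1) ∨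
    ∃ (K₀ : Finset V) (Ω 𝓗' : Finset (Finset V)), K₀.card = l ∧ 𝓗' ⊆ 𝓗 ∧
      𝓗.card ≤ 𝓗'.card + C * Fintype.card V ^ (s - 1) ∧ IsBlockFamily K₀ Ω s d 𝓗' := by
  obtain ⟨t, rfl⟩ : ∃ t, s = t + 2 := ⟨s - 2, by omega⟩
  obtain ⟨C₁, hC₁⟩ := exists_kernel r (t + 1)
  obtain ⟨C₂, hC₂⟩ := exists_kernel r t
  obtain ⟨C₃, hC₃⟩ := exists_card_le_of_inter_mem r t
  refine ⟨C₁ + (C₂ + C₃), fun {V} _ 𝓗 hV hcard hint => ?_⟩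
  set n := Fintype.card V with hn
  set L := (Finset.range (t + 2)).image (fun j => l + j * d) with hLdef
  have hLcard : L.card = t + 2 := by
    rw [hLdef, Finset.card_image_of_injective, Finset.card_range]
    intro a b hab
    simp only at hab
    exact Nat.eq_of_mul_eq_mul_right hd (by omega)
  have hl0 : l ∈ L := by rw [hLdef, Finset.mem_image]; exact ⟨0, by simp, by simp⟩
  have hl1 : l + d ∈ L := by rw [hLdef, Finset.mem_image]; exact ⟨1, by simp, by simp⟩
  have hl0min : ∀ x ∈ L, l ≤ x := by
    intro x hx
    rw [hLdef, Finset.mem_image] at hx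
    obtain ⟨j, _, rfl⟩ := hx; omega
  have hl1min : ∀ x ∈ L.erase l, l + d ≤ x := by
    intro x hx
    rw [Finset.mem_erase, hLdef, Finset.mem_image] at hx
    obtain ⟨hx, j, _, rfl⟩ := hx
    have : 1 ≤ j := by
      rcases Nat.eq_zero_or_pos j with rfl | h
      · simp at hx
      · exact h
    nlinarith
  have hl1' : l + d ∈ L.erase l := Finset.mem_erase.2 ⟨by omega, hl1⟩
  rcases hC₁ L l 𝓗 (by omega) hl0 hl0min hV hcard hint with h | ⟨K₀, hK₀, hsub⟩
  · left
    refine h.trans ?_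
    gcongr
    · omega
    · omega
  right
  -- The threshold serves twice: exceeding the `C₂` bound forces a kernel of size `l + d`, and
  -- exceeding the `C₃` bound excludes a larger common subset, so the kernel contains every common
  -- subset.
  let heavy : V → Prop := fun x => x ∉ K₀ ∧ (C₂ + C₃) * n ^ t < (𝓗.filter (x ∈ ·)).card
  have hsmall : ∀ x, x ∉ K₀ → ∀ M : Finset V, l + d < M.card →
      (∀ A ∈ 𝓗, x ∈ A → M ⊆ A) → (𝓗.filter (x ∈ ·)).card ≤ C₃ * n ^ t := by
    intro x hx M hM hMA
    apply hC₃ ((L.erase l).erase (l + d)) _ _ hV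
    · intro A hA; exact hcard A (Finset.mem_filter.1 hA).1
    · intro A hA B hB hne
      rw [Finset.mem_filter] at hA hB
      apply inter_mem_erase hM (hMA A hA.1 hA.2) (hMA B hB.1 hB.2)
      exact inter_mem_erase (show l < M.card by omega) (hMA A hA.1 hA.2) (hMA B hB.1 hB.2)
        (hint A hA.1 B hB.1 hne)
    · rw [Finset.card_erase_of_mem hl1', Finset.card_erase_of_mem hl0]; omega
  have hker : ∀ x, heavy x → ∃ K : Finset V, K.card = l + d ∧ (∀ A ∈ 𝓗, x ∈ A → K ⊆ A) ∧
      ∀ M : Finset V, (∀ A ∈ 𝓗, x ∈ A → M ⊆ A) → M ⊆ K := by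
    rintro x ⟨hx, hxh⟩
    have hxK : ∀ A ∈ 𝓗, x ∈ A → insert x K₀ ⊆ A := fun A hA hxA =>
      Finset.insert_subset hxA (hsub A hA)
    rcases hC₂ (L.erase l) (l + d) (𝓗.filter (x ∈ ·)) (by rw [Finset.card_erase_of_mem hl0]; omega)
      hl1' hl1min hV (fun A hA => hcard A (Finset.mem_filter.1 hA).1) (by
        intro A hA B hB hne
        rw [Finset.mem_filter] at hA hB
        exact inter_mem_erase (K := insert x K₀)
          (by rw [Finset.card_insert_of_notMem hx]; omega) (hxK A hA.1 hA.2) (hxK B hB.1 hB.2)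
          (hint A hA.1 B hB.1 hne)) with h | ⟨K, hK, hKA⟩
    · exfalso
      have h : (𝓗.filter (x ∈ ·)).card ≤ C₂ * n ^ t := h
      have : C₂ * n ^ t ≤ (C₂ + C₃) * n ^ t := by gcongr; omega
      omega
    · refine ⟨K, hK, fun A hA hxA => hKA A (Finset.mem_filter.2 ⟨hA, hxA⟩), fun M hM => ?_⟩
      by_contra hMK
      have h1 : K.card < (K ∪ M).card := by
        apply Finset.card_lt_card
        refine Finset.ssubset_iff_subset_ne.2 ⟨Finset.subset_union_left, fun h => hMK ?_⟩
        rw [h]; exact Finset.subset_union_right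
      have h2 := hsmall x hx (K ∪ M) (by omega) (fun A hA hxA =>
        Finset.union_subset (hKA A (Finset.mem_filter.2 ⟨hA, hxA⟩)) (hM A hA hxA))
      have : C₃ * n ^ t ≤ (C₂ + C₃) * n ^ t := by gcongr; omega
      omega
  choose! κ hκcard hκsub hκmax using hker
  have hxκ : ∀ x, heavy x → x ∈ κ x := fun x hx =>
    hκmax x hx {x} (fun A _ hxA => by simpa using hxA) (Finset.mem_singleton_self x)
  have hK₀κ : ∀ x, heavy x → K₀ ⊆ κ x := fun x hx => hκmax x hx K₀ fun A hA _ => hsub A hA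
  -- Members through `x` contain `y`, hence `κ y`, so `κ y ⊆ κ x` by maximality, and the sizes
  -- agree. Blocks are therefore equal or disjoint.
  have hκeq : ∀ x y, heavy x → heavy y → y ∈ κ x → κ y = κ x := by
    intro x y hx hy hyx
    apply Finset.eq_of_subset_of_card_le
    · apply hκmax x hx
      intro A hA hxA
      exact hκsub y hy A hA (hκsub x hx A hA hxA hyx)
    · rw [hκcard x hx, hκcard y hy]
  set 𝓗' := 𝓗.filter fun A => ∀ x ∈ A, x ∉ K₀ → heavy x with h𝓗'
  have h𝓗'sub : 𝓗' ⊆ 𝓗 := Finset.filter_subset _ _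
  let D : V → Finset V := fun x => κ x \ K₀
  set Ω := (Finset.univ.filter fun x => x ∉ K₀ ∧ ∃ A ∈ 𝓗', x ∈ A).image D with hΩ
  have hheavy : ∀ A ∈ 𝓗', ∀ x ∈ A, x ∉ K₀ → heavy x := fun A hA => (Finset.mem_filter.1 hA).2
  refine ⟨K₀, Ω, 𝓗', hK₀, h𝓗'sub, ?_, ?_, ?_, ?_, ?_, ?_⟩
  · have hcov : 𝓗 ⊆ 𝓗' ∪ (Finset.univ.filter fun x => x ∉ K₀ ∧ ¬ heavy x).biUnion
        fun x => 𝓗.filter (x ∈ ·) := by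
      intro A hA
      by_cases h : A ∈ 𝓗'
      · exact Finset.mem_union_left _ h
      · apply Finset.mem_union_right
        rw [h𝓗', Finset.mem_filter] at h
        push Not at h
        obtain ⟨x, hxA, hxK, hx⟩ := h hA
        simp only [Finset.mem_biUnion, Finset.mem_filter, Finset.mem_univ, true_and]
        exact ⟨x, ⟨hxK, hx⟩, hA, hxA⟩
    refine (Finset.card_le_card hcov).trans ((Finset.card_union_le _ _).trans ?_)
    gcongr
    refine Finset.card_biUnion_le.trans ((Finset.sum_le_card_nsmul _ _ ((C₂ + C₃) * n ^ t) ?_).trans ?_)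
    · intro x hx
      simp only [Finset.mem_filter, Finset.mem_univ, true_and] at hx
      by_contra hcon
      exact hx.2 ⟨hx.1, by omega⟩
    · have h1 : (Finset.univ.filter fun x => x ∉ K₀ ∧ ¬ heavy x).card ≤ n :=
        Finset.card_le_univ _
      rw [smul_eq_mul, show t + 2 - 1 = t + 1 by omega]
      calc _ ≤ n * ((C₂ + C₃) * n ^ t) := by gcongr
        _ = (C₂ + C₃) * n ^ (t + 1) := by ring
        _ ≤ _ := Nat.mul_le_mul_right _ (by omega)
  · intro B hB
    rw [hΩ, Finset.mem_image] at hB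
    obtain ⟨x, hx, rfl⟩ := hB
    simp only [Finset.mem_filter, Finset.mem_univ, true_and] at hx
    obtain ⟨hxK, A, hA, hxA⟩ := hx
    have hxh := hheavy A hA x hxA hxK
    change (κ x \ K₀).card = d
    rw [Finset.card_sdiff_of_subset (hK₀κ x hxh), hκcard x hxh, hK₀]; omega
  · intro B hB
    rw [hΩ, Finset.mem_image] at hB
    obtain ⟨x, hx, rfl⟩ := hB
    exact Finset.sdiff_disjoint
  · intro B hB B' hB' hne
    rw [hΩ, Finset.mem_image] at hB hB'
    obtain ⟨x, hx, rfl⟩ := hB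
    obtain ⟨x', hx', rfl⟩ := hB'
    simp only [Finset.mem_filter, Finset.mem_univ, true_and] at hx hx'
    obtain ⟨hxK, A, hA, hxA⟩ := hx
    obtain ⟨hxK', A', hA', hxA'⟩ := hx'
    rw [Finset.disjoint_left]
    intro y hy hy'
    apply hne
    simp only [D, Finset.mem_sdiff] at hy hy'
    have hxh := hheavy A hA x hxA hxK
    have hxh' := hheavy A' hA' x' hxA' hxK'
    have hyh := hheavy A hA y (hκsub x hxh A (h𝓗'sub hA) hxA hy.1) hy.2
    simp only [D]
    rw [← hκeq x y hxh hyh hy.1, ← hκeq x' y hxh' hyh hy'.1]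
  · intro A hA
    have hAD : ∀ x ∈ A \ K₀, D x ⊆ A \ K₀ := by
      intro x hx
      rw [Finset.mem_sdiff] at hx
      exact Finset.sdiff_subset_sdiff
        (hκsub x (hheavy A hA x hx.1 hx.2) A (h𝓗'sub hA) hx.1) (Finset.Subset.refl _)
    have hxD : ∀ x ∈ A \ K₀, x ∈ D x := by
      intro x hx
      rw [Finset.mem_sdiff] at hx
      exact Finset.mem_sdiff.2 ⟨hxκ x (hheavy A hA x hx.1 hx.2), hx.2⟩
    have hU : ((A \ K₀).image D).biUnion id = A \ K₀ := by
      ext y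
      simp only [Finset.mem_biUnion, Finset.mem_image, id]
      constructor
      · rintro ⟨_, ⟨x, hx, rfl⟩, hy⟩; exact hAD x hx hy
      · intro hy; exact ⟨_, ⟨y, hy, rfl⟩, hxD y hy⟩
    refine ⟨(A \ K₀).image D, ?_, ?_, ?_⟩
    · intro B hB
      rw [Finset.mem_image] at hB
      obtain ⟨x, hx, rfl⟩ := hB
      rw [Finset.mem_sdiff] at hx
      exact Finset.mem_image_of_mem _ (by simp only [Finset.mem_filter, Finset.mem_univ, true_and]; exact ⟨hx.2, A, hA, hx.1⟩)
    · have h1 : (((A \ K₀).image D).biUnion id).card = ∑ B ∈ (A \ K₀).image D, B.card := by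
        apply Finset.card_biUnion
        intro B hB B' hB' hne
        rw [Finset.mem_coe, Finset.mem_image] at hB hB'
        obtain ⟨x, hx, rfl⟩ := hB
        obtain ⟨x', hx', rfl⟩ := hB'
        change Disjoint (D x) (D x')
        rw [Finset.disjoint_left]
        intro y hy hy'
        apply hne
        have hyA := hAD x hx hy
        rw [Finset.mem_sdiff] at hx hx' hyA
        have hyh := hheavy A hA y hyA.1 hyA.2
        simp only [D, Finset.mem_sdiff] at hy hy' ⊢
        rw [← hκeq x y (hheavy A hA x hx.1 hx.2) hyh hy.1,
          ← hκeq x' y (hheavy A hA x' hx'.1 hx'.2) hyh hy'.1]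
      have h2 : ∑ B ∈ (A \ K₀).image D, B.card = ((A \ K₀).image D).card * d := by
        apply Finset.sum_const_nat
        intro B hB
        rw [Finset.mem_image] at hB
        obtain ⟨x, hx, rfl⟩ := hB
        rw [Finset.mem_sdiff] at hx
        have hxh := hheavy A hA x hx.1 hx.2
        change (κ x \ K₀).card = d
        rw [Finset.card_sdiff_of_subset (hK₀κ x hxh), hκcard x hxh, hK₀]; omega
      rw [hU, h2, Finset.card_sdiff_of_subset (hsub A (h𝓗'sub hA)), hcard A (h𝓗'sub hA), hK₀] at h1
      exact Nat.eq_of_mul_eq_mul_right hd (by omega)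
    · rw [hU, Finset.union_sdiff_of_subset (hsub A (h𝓗'sub hA))]
  · intro B hB
    rw [hΩ, Finset.mem_image] at hB
    obtain ⟨x, hx, rfl⟩ := hB
    simp only [Finset.mem_filter, Finset.mem_univ, true_and] at hx
    obtain ⟨hxK, A, hA, hxA⟩ := hx
    exact ⟨A, hA, Finset.sdiff_subset.trans
      (hκsub x (hheavy A hA x hxA hxK) A (h𝓗'sub hA) hxA)⟩

/-! ### Counting by successive extension. -/

/-- The inductive step of the inequality of means, for one factor `c` and `q` equal factors with
total `M`. It is Bernoulli's inequality for the ratio of the mean `a` of all factors to the mean `y`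
of the equal ones. -/
theorem mul_div_pow_le (q : ℕ) {c M : ℝ} (hc : 0 ≤ c) (hM : c ≤ M) :
    c * ((M - c) / q) ^ q ≤ (M / (q + 1 : ℕ)) ^ (q + 1) := by
  rcases Nat.eq_zero_or_pos q with rfl | hq
  · simpa using hM
  set y := (M - c) / q with hy
  set a := M / (q + 1 : ℕ) with ha
  have hq' : (0 : ℝ) < q := by exact_mod_cast hq
  have hy0 : 0 ≤ y := div_nonneg (by linarith) hq'.le
  have ha0 : 0 ≤ a := div_nonneg (by linarith) (by positivity)
  have h1 : (q + 1) * a = c + q * y := by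
    rw [ha, hy]; push_cast; field_simp; ring
  rcases hy0.eq_or_lt with h0 | h0
  · rw [← h0, zero_pow hq.ne', mul_zero]; positivity
  have h2 := one_add_mul_le_pow (a := a / y - 1) (by have : 0 ≤ a / y := by positivity
                                                     linarith) (q + 1)
  have h3 : (1 + ((q + 1 : ℕ) : ℝ) * (a / y - 1)) * y ^ (q + 1) ≤ (1 + (a / y - 1)) ^ (q + 1) * y ^ (q + 1) := by
    gcongr
  rw [← mul_pow] at h3
  have h4 : (1 + (a / y - 1)) * y = a := by field_simp; ring
  rw [h4] at h3
  refine le_trans (le_of_eq ?_) h3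
  have h5 : c = (q + 1) * a - q * y := by linarith
  rw [h5]
  push_cast
  field_simp
  ring

/-- Counting the `s`-sets of a family by extending partial sets one element at a time, when the
elements which may be chosen at different steps are different. -/
theorem card_filter_subset_le_pow {α : Type*} [DecidableEq α] (Ω : Finset α) (𝓕 : Finset (Finset α)) (s : ℕ)
    (X : Finset α → Finset α) (good : Finset α → Prop) (hX : ∀ U, X U ⊆ Ω)
    (h𝓕 : ∀ A ∈ 𝓕, A.card = s)
    (hstep : ∀ U, good U → (∃ A ∈ 𝓕, U ⊆ A ∧ U ≠ A) → ∃ C ⊆ Ω, Disjoint C (X U) ∧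
      (∀ A ∈ 𝓕, U ⊆ A → U ≠ A → ∃ D ∈ C, D ∈ A) ∧
      ∀ D ∈ C, D ∉ U ∧ ((∃ A ∈ 𝓕, insert D U ⊆ A) →
        good (insert D U) ∧ X U ∪ C ⊆ X (insert D U))) (q : ℕ) :
    ∀ U, good U → U.card + q = s →
      ((𝓕.filter (U ⊆ ·)).card : ℝ) ≤ (((Ω.card : ℝ) - (X U).card) / q) ^ q := by
  induction q with
  | zero =>
    intro U _ hU
    rw [pow_zero]
    have : (𝓕.filter (U ⊆ ·)).card ≤ 1 := by
      rw [Finset.card_le_one]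
      intro A hA B hB
      rw [Finset.mem_filter] at hA hB
      rw [← Finset.eq_of_subset_of_card_le hA.2 (by rw [h𝓕 A hA.1]; omega),
        ← Finset.eq_of_subset_of_card_le hB.2 (by rw [h𝓕 B hB.1]; omega)]
    exact_mod_cast this
  | succ q ih =>
    intro U hgood hU
    have hXU : ((X U).card : ℝ) ≤ Ω.card := by exact_mod_cast Finset.card_le_card (hX U)
    have hne : ∀ A ∈ 𝓕, U ≠ A := by
      rintro A hA rfl
      have := h𝓕 _ hA
      omega
    by_cases hex : ∃ A ∈ 𝓕, U ⊆ A ∧ U ≠ A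
    swap
    · have : 𝓕.filter (U ⊆ ·) = ∅ := by
        rw [Finset.filter_eq_empty_iff]
        intro A hA hUA
        exact hex ⟨A, hA, hUA, hne A hA⟩
      rw [this]
      have h0 : (0 : ℝ) ≤ ((Ω.card : ℝ) - (X U).card) / (q + 1 : ℕ) :=
        div_nonneg (by linarith) (by positivity)
      simp only [Finset.card_empty, Nat.cast_zero]
      positivity
    -- `X U` collects the elements already spent. Each of the `C.card` branches continues with at
    -- most `Ω.card - (X U).card - C.card` elements, and `mul_div_pow_le` recombines the branches.
    obtain ⟨C, hCΩ, hCX, hCA, hCD⟩ := hstep U hgood hex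
    have hCM : (C.card : ℝ) ≤ (Ω.card : ℝ) - (X U).card := by
      have h1 : C ∪ X U ⊆ Ω := Finset.union_subset hCΩ (hX U)
      have h2 := Finset.card_le_card h1
      rw [Finset.card_union_of_disjoint hCX] at h2
      have : (C.card : ℝ) + (X U).card ≤ Ω.card := by exact_mod_cast h2
      linarith
    have hcov : 𝓕.filter (U ⊆ ·) ⊆ C.biUnion fun D => 𝓕.filter (insert D U ⊆ ·) := by
      intro A hA
      rw [Finset.mem_filter] at hA
      obtain ⟨D, hDC, hDA⟩ := hCA A hA.1 hA.2 (hne A hA.1)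
      simp only [Finset.mem_biUnion, Finset.mem_filter]
      exact ⟨D, hDC, hA.1, Finset.insert_subset hDA hA.2⟩
    have hD : ∀ D ∈ C, ((𝓕.filter (insert D U ⊆ ·)).card : ℝ) ≤
        ((((Ω.card : ℝ) - (X U).card) - C.card) / q) ^ q := by
      intro D hDC
      obtain ⟨hDU, hgood'⟩ := hCD D hDC
      by_cases hex' : ∃ A ∈ 𝓕, insert D U ⊆ A
      · obtain ⟨hg, hXC⟩ := hgood' hex'
        refine (ih (insert D U) hg (by rw [Finset.card_insert_of_notMem hDU]; omega)).trans ?_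
        have h1 := Finset.card_le_card hXC
        rw [Finset.card_union_of_disjoint hCX.symm] at h1
        have h2 : ((X U).card : ℝ) + C.card ≤ (X (insert D U)).card := by exact_mod_cast h1
        have h3 : ((X (insert D U)).card : ℝ) ≤ Ω.card := by
          exact_mod_cast Finset.card_le_card (hX _)
        apply pow_le_pow_left₀
        · exact div_nonneg (by linarith) (by positivity)
        · exact div_le_div_of_nonneg_right (by linarith) (by positivity)
      · have : 𝓕.filter (insert D U ⊆ ·) = ∅ := by
          rw [Finset.filter_eq_empty_iff]
          intro A hA hUA
          exact hex' ⟨A, hA, hUA⟩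
        rw [this]
        have h0 : (0 : ℝ) ≤ (((Ω.card : ℝ) - (X U).card) - C.card) / q :=
          div_nonneg (by linarith) (by positivity)
        simp only [Finset.card_empty, Nat.cast_zero]
        positivity
    calc ((𝓕.filter (U ⊆ ·)).card : ℝ)
        ≤ ((∑ D ∈ C, (𝓕.filter (insert D U ⊆ ·)).card : ℕ) : ℝ) := by
          exact_mod_cast (Finset.card_le_card hcov).trans Finset.card_biUnion_le
      _ = ∑ D ∈ C, ((𝓕.filter (insert D U ⊆ ·)).card : ℝ) := by push_cast; rfl
      _ ≤ C.card • ((((Ω.card : ℝ) - (X U).card) - C.card) / q) ^ q :=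
          Finset.sum_le_card_nsmul _ _ _ hD
      _ = C.card * ((((Ω.card : ℝ) - (X U).card) - C.card) / q) ^ q := by rw [nsmul_eq_mul]
      _ ≤ _ := mul_div_pow_le q (by positivity) hCM

/-! ### Cycles composed of a base and blocks. -/

section Cycles
variable {V : Type*} {G : SimpleGraph V}

theorem nbrs_mono {S T : Finset V} (h : S ⊆ T) (x : V) : nbrs G S x ⊆ nbrs G T x := by
  intro y hy
  rw [mem_nbrs] at hy ⊢
  exact ⟨h hy.1, hy.2⟩

theorem CycSet.card_nbrs_le {r : ℕ} {A S : Finset V} (hA : CycSet G r A) (hS : S ⊆ A) {x : V}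
    (hx : x ∈ A) : (nbrs G S x).card ≤ 2 :=
  (Finset.card_le_card (nbrs_mono hS x)).trans (hA.2.1 x hx).le

/-- A set of vertices of an induced cycle all of which have two neighbours in the set is the
whole cycle. -/
theorem CycSet.eq_of_subset {r : ℕ} {A I : Finset V} (hA : CycSet G r A) (hI : I ⊆ A)
    (hne : I.Nonempty) (h : ∀ x ∈ I, 2 ≤ (nbrs G I x).card) : I = A := by
  apply hA.2.2 I hI hne
  intro x hx y hy hxy
  have h1 : nbrs G I x = nbrs G A x :=
    Finset.eq_of_subset_of_card_le (nbrs_mono hI x) (by rw [hA.2.1 x (hI hx)]; exact h x hx)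
  have : y ∈ nbrs G I x := by rw [h1]; simp [hy, hxy]
  exact (mem_nbrs.1 this).1

theorem two_le_card_nbrs {I : Finset V} {x y z : V} (hy : y ∈ I) (hz : z ∈ I) (hyz : y ≠ z)
    (hxy : G.Adj x y) (hxz : G.Adj x z) : 2 ≤ (nbrs G I x).card := by
  rw [← Finset.card_pair hyz]
  apply Finset.card_le_card
  intro w hw
  rw [Finset.mem_insert, Finset.mem_singleton] at hw
  rcases hw with rfl | rfl <;> simp [*]

/-- In an induced cycle other than `C₄` two vertices have at most one common neighbour. -/
theorem CycSet.no_four {r : ℕ} {A : Finset V} (hA : CycSet G r A) (hr : 4 < r)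
    {x x' y y' : V} (hx : x ∈ A) (hx' : x' ∈ A) (hy : y ∈ A) (hy' : y' ∈ A)
    (hxx : x ≠ x') (hyy : y ≠ y') (h1 : G.Adj x y) (h2 : G.Adj x y') (h3 : G.Adj x' y)
    (h4 : G.Adj x' y') : False := by
  have hI : ({x, x', y, y'} : Finset V) = A := by
    apply hA.eq_of_subset
    · intro z hz
      simp only [Finset.mem_insert, Finset.mem_singleton] at hz
      rcases hz with rfl | rfl | rfl | rfl <;> assumption
    · exact ⟨x, by simp⟩
    · intro z hz
      simp only [Finset.mem_insert, Finset.mem_singleton] at hz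
      rcases hz with rfl | rfl | rfl | rfl
      · exact two_le_card_nbrs (y := y) (z := y') (by simp) (by simp) hyy h1 h2
      · exact two_le_card_nbrs (y := y) (z := y') (by simp) (by simp) hyy h3 h4
      · exact two_le_card_nbrs (y := x) (z := x') (by simp) (by simp) hxx h1.symm h3.symm
      · exact two_le_card_nbrs (y := x) (z := x') (by simp) (by simp) hxx h2.symm h4.symm
  have h5 : ({x, x', y, y'} : Finset V).card ≤ 4 := Finset.card_le_four
  rw [hI, hA.1] at h5
  omega

theorem CycSet.no_triangle {r : ℕ} {A : Finset V} (hA : CycSet G r A) (hr : 3 < r)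
    {x y z : V} (hx : x ∈ A) (hy : y ∈ A) (hz : z ∈ A)
    (h1 : G.Adj x y) (h2 : G.Adj y z) (h3 : G.Adj x z) : False := by
  have hI : ({x, y, z} : Finset V) = A := by
    apply hA.eq_of_subset
    · intro w hw
      simp only [Finset.mem_insert, Finset.mem_singleton] at hw
      rcases hw with rfl | rfl | rfl <;> assumption
    · exact ⟨x, by simp⟩
    · intro w hw
      simp only [Finset.mem_insert, Finset.mem_singleton] at hw
      rcases hw with rfl | rfl | rfl
      · exact two_le_card_nbrs (y := y) (z := z) (by simp) (by simp) h2.ne h1 h3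
      · exact two_le_card_nbrs (y := x) (z := z) (by simp) (by simp) h3.ne h1.symm h2
      · exact two_le_card_nbrs (y := x) (z := y) (by simp) (by simp) h1.ne h3.symm h2.symm
  have h5 : ({x, y, z} : Finset V).card ≤ 3 := Finset.card_le_three
  rw [hI, hA.1] at h5
  omega

/-- Otherwise the non-isolated vertices of `S` have two neighbours among themselves and already make
up the whole cycle. -/
theorem CycSet.exists_card_nbrs_eq_one {r : ℕ} {A S : Finset V} (hA : CycSet G r A) (hS : S ⊆ A)
    (hne : S ≠ A) {x : V} (hx : x ∈ S) (hxn : (nbrs G S x).Nonempty) :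
    ∃ p ∈ S, (nbrs G S p).card = 1 := by
  by_contra hcon
  push Not at hcon
  have h2 : ∀ p ∈ S, (nbrs G S p).Nonempty → (nbrs G S p).card = 2 := by
    intro p hp hpn
    have := Finset.card_pos.2 hpn
    have := hcon p hp
    have := hA.card_nbrs_le hS (hS hp)
    omega
  have hI : (S.filter fun p => (nbrs G S p).Nonempty) = A := by
    apply hA.eq_of_subset ((Finset.filter_subset _ _).trans hS) ⟨x, by simp [hx, hxn]⟩
    intro p hp
    rw [Finset.mem_filter] at hp
    rw [← h2 p hp.1 hp.2]
    apply Finset.card_le_card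
    intro y hy
    have hy' := mem_nbrs.1 hy
    rw [mem_nbrs, Finset.mem_filter]
    exact ⟨⟨hy'.1, p, mem_nbrs.2 ⟨hp.1, hy'.2.symm⟩⟩, hy'.2⟩
  apply hne
  apply Finset.Subset.antisymm hS
  rw [← hI]
  exact Finset.filter_subset _ _

/-- The vertices in the base `K₀` or in one of the blocks in `U`. -/
noncomputable def blockSpan (K₀ : Finset V) (U : Finset (Finset V)) : Finset V :=
  K₀ ∪ U.biUnion id

theorem mem_blockSpan {K₀ : Finset V} {U : Finset (Finset V)} {x : V} :
    x ∈ blockSpan K₀ U ↔ x ∈ K₀ ∨ ∃ D ∈ U, x ∈ D := by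
  simp [blockSpan]

theorem blockSpan_mono {K₀ : Finset V} {U U' : Finset (Finset V)} (h : U ⊆ U') :
    blockSpan K₀ U ⊆ blockSpan K₀ U' := by
  intro x
  rw [mem_blockSpan, mem_blockSpan]
  rintro (hx | ⟨D, hD, hx⟩)
  · exact Or.inl hx
  · exact Or.inr ⟨D, h hD, hx⟩

/-- The blocks with a neighbour in `Z` or of a vertex which already has two neighbours. -/
noncomputable def touchSat (G : SimpleGraph V) (K₀ : Finset V) (Ω : Finset (Finset V))
    (Z : Finset V) (U : Finset (Finset V)) : Finset (Finset V) :=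
  Ω.filter fun D => ∃ x ∈ blockSpan K₀ U, (x ∈ Z ∨ 2 ≤ (nbrs G (blockSpan K₀ U) x).card) ∧
    ∃ y ∈ D, G.Adj x y

/-- Distinct blocks are disjoint, and blocks are disjoint from the base. -/
structure IsBlockSystem (K₀ : Finset V) (Ω : Finset (Finset V)) : Prop where
  disjoint_base : ∀ D ∈ Ω, Disjoint D K₀
  pairwise_disjoint : ∀ D ∈ Ω, ∀ D' ∈ Ω, D ≠ D' → Disjoint D D'

theorem IsBlockSystem.notMem_blockSpan {K₀ : Finset V} {Ω U : Finset (Finset V)}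
    (h : IsBlockSystem K₀ Ω) (hU : U ⊆ Ω) {D : Finset V} (hD : D ∈ Ω) (hDU : D ∉ U) {y : V}
    (hy : y ∈ D) : y ∉ blockSpan K₀ U := by
  rw [mem_blockSpan]
  rintro (hy' | ⟨D', hD', hy'⟩)
  · exact Finset.disjoint_left.1 (h.disjoint_base D hD) hy hy'
  · exact Finset.disjoint_left.1 (h.pairwise_disjoint D hD D' (hU hD')
      (fun e => hDU (e ▸ hD'))) hy hy'

/-- The central count. If `p` has degree one in the partial union, the next block must contain a
neighbour of `p`, and then `p` is saturated, so the blocks touching `p` are spent. This is the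
disjointness that `card_filter_subset_le_pow` demands. `Z` holds vertices that receive no further
neighbours although they are not saturated; `good` is the invariant which guarantees the next `p`.
-/
theorem card_filter_blockSpan_le {K₀ : Finset V} {Ω : Finset (Finset V)}
    (hΩ : IsBlockSystem K₀ Ω) (Z : Finset V) (𝓕 : Finset (Finset (Finset V))) (s : ℕ)
    (good : Finset (Finset V) → Prop) (hgood : ∀ U, good U → U ⊆ Ω)
    (h𝓕 : ∀ A ∈ 𝓕, A ⊆ Ω ∧ A.card = s)
    (hdeg : ∀ A ∈ 𝓕, ∀ x ∈ blockSpan K₀ A, (nbrs G (blockSpan K₀ A) x).card ≤ 2)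
    (hZ : ∀ U, good U → ∀ A ∈ 𝓕, U ⊆ A → ∀ D ∈ A, D ∉ U → ∀ x ∈ Z, ∀ y ∈ D, ¬ G.Adj x y)
    (hp : ∀ U, good U → (∃ A ∈ 𝓕, U ⊆ A ∧ U ≠ A) → ∃ p ∈ blockSpan K₀ U, p ∉ Z ∧
      (nbrs G (blockSpan K₀ U) p).card = 1 ∧
      (∀ A ∈ 𝓕, U ⊆ A → U ≠ A → 2 ≤ (nbrs G (blockSpan K₀ A) p).card) ∧
      ∀ A ∈ 𝓕, U ⊆ A → ∀ D ∈ A, D ∉ U → (∃ y ∈ D, G.Adj p y) → good (insert D U))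
    {U : Finset (Finset V)} {q : ℕ} (hU : good U) (hq : U.card + q = s) :
    ((𝓕.filter (U ⊆ ·)).card : ℝ) ≤ (((Ω.card : ℝ) - (touchSat G K₀ Ω Z U).card) / q) ^ q := by
  have key := card_filter_subset_le_pow Ω 𝓕 s (touchSat G K₀ Ω Z) good
    (fun U => Finset.filter_subset _ _) (fun A hA => (h𝓕 A hA).2) ?_ q U hU hq
  · convert key
  intro U hU hex
  obtain ⟨p, hpU, hpZ, hp1, hp2, hpg⟩ := hp U hU hex
  refine ⟨Ω.filter fun D => D ∉ U ∧ D ∉ touchSat G K₀ Ω Z U ∧ ∃ y ∈ D, G.Adj p y,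
    Finset.filter_subset _ _, ?_, ?_, ?_⟩
  · rw [Finset.disjoint_left]
    intro D hD
    exact (Finset.mem_filter.1 hD).2.2.1
  · intro A hA hUA hne
    have hUA' := blockSpan_mono (K₀ := K₀) hUA
    obtain ⟨y, hy, hyU⟩ : ∃ y ∈ nbrs G (blockSpan K₀ A) p, y ∉ nbrs G (blockSpan K₀ U) p := by
      by_contra hcon
      push Not at hcon
      have := Finset.card_le_card (show nbrs G (blockSpan K₀ A) p ⊆ nbrs G (blockSpan K₀ U) p
        from fun y hy => hcon y hy)
      have := hp2 A hA hUA hne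
      omega
    rw [mem_nbrs] at hy hyU
    have hyU' : y ∉ blockSpan K₀ U := fun h => hyU ⟨h, hy.2⟩
    obtain ⟨hyA, hpy⟩ := hy
    rw [mem_blockSpan] at hyA
    obtain ⟨D, hD, hyD⟩ := hyA.resolve_left fun h => hyU' (mem_blockSpan.2 (Or.inl h))
    have hDU : D ∉ U := fun h => hyU' (mem_blockSpan.2 (Or.inr ⟨D, h, hyD⟩))
    refine ⟨D, ?_, hD⟩
    rw [Finset.mem_filter]
    refine ⟨(h𝓕 A hA).1 hD, hDU, ?_, y, hyD, hpy⟩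
    -- A block in `touchSat` would add a third neighbour to a saturated vertex, or a neighbour to a
    -- vertex of `Z`.
    intro hsat
    obtain ⟨_, x, hxU, hx, z, hzD, hxz⟩ := Finset.mem_filter.1 hsat
    rcases hx with hx | hx
    · exact hZ U hU A hA hUA D hD hDU x hx z hzD hxz
    · have hzU := hΩ.notMem_blockSpan (hgood U hU) ((h𝓕 A hA).1 hD) hDU hzD
      have h1 : insert z (nbrs G (blockSpan K₀ U) x) ⊆ nbrs G (blockSpan K₀ A) x := by
        intro w hw
        rw [Finset.mem_insert] at hw
        rcases hw with rfl | hw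
        · exact mem_nbrs.2 ⟨mem_blockSpan.2 (Or.inr ⟨D, hD, hzD⟩), hxz⟩
        · exact nbrs_mono hUA' x hw
      have h2 := Finset.card_le_card h1
      rw [Finset.card_insert_of_notMem (fun h => hzU (mem_nbrs.1 h).1)] at h2
      have := hdeg A hA x (hUA' hxU)
      omega
  · intro D hD
    obtain ⟨hDΩ, hDU, hDX, y, hyD, hpy⟩ := Finset.mem_filter.1 hD
    refine ⟨hDU, ?_⟩
    rintro ⟨A, hA, hUA⟩
    have hsub : blockSpan K₀ U ⊆ blockSpan K₀ (insert D U) :=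
      blockSpan_mono (Finset.subset_insert _ _)
    refine ⟨hpg A hA ((Finset.subset_insert _ _).trans hUA) D (hUA (Finset.mem_insert_self _ _))
      hDU ⟨y, hyD, hpy⟩, ?_⟩
    have hyU := hΩ.notMem_blockSpan (hgood U hU) hDΩ hDU hyD
    apply Finset.union_subset
    · intro D' hD'
      obtain ⟨hD'Ω, x, hxU, hx, z, hzD, hxz⟩ := Finset.mem_filter.1 hD'
      refine Finset.mem_filter.2 ⟨hD'Ω, x, hsub hxU, ?_, z, hzD, hxz⟩
      exact hx.imp id fun h => h.trans (Finset.card_le_card (nbrs_mono hsub x))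
    -- The new block brings `p` to degree two, which puts every candidate of this step into
    -- `touchSat`.
    · intro D' hD'
      obtain ⟨hD'Ω, _, _, z, hzD, hpz⟩ := Finset.mem_filter.1 hD'
      refine Finset.mem_filter.2 ⟨hD'Ω, p, hsub hpU, Or.inr ?_, z, hzD, hpz⟩
      have h1 : insert y (nbrs G (blockSpan K₀ U) p) ⊆ nbrs G (blockSpan K₀ (insert D U)) p := by
        intro w hw
        rw [Finset.mem_insert] at hw
        rcases hw with rfl | hw
        · exact mem_nbrs.2 ⟨mem_blockSpan.2 (Or.inr ⟨D, Finset.mem_insert_self _ _, hyD⟩), hpy⟩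
        · exact nbrs_mono hsub p hw
      have h2 := Finset.card_le_card h1
      rw [Finset.card_insert_of_notMem (fun h => hyU (mem_nbrs.1 h).1), hp1] at h2
      exact h2

theorem blockSpan_ne {K₀ : Finset V} {Ω U A : Finset (Finset V)} (hΩ : IsBlockSystem K₀ Ω)
    (hpos : ∀ D ∈ Ω, D.Nonempty) (hA : A ⊆ Ω) (hUA : U ⊆ A) (hne : U ≠ A) :
    blockSpan K₀ U ≠ blockSpan K₀ A := by
  obtain ⟨D, hDA, hDU⟩ := Finset.exists_of_ssubset (hUA.ssubset_of_ne hne)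
  obtain ⟨y, hy⟩ := hpos D (hA hDA)
  intro h
  apply hΩ.notMem_blockSpan (hUA.trans hA) (hA hDA) hDU hy
  rw [h]
  exact mem_blockSpan.2 (Or.inr ⟨D, hDA, hy⟩)

/-- The invariant is the presence of an edge: a proper part of a cycle with an edge has a path
component, whose end serves as `p`. -/
theorem card_filter_cyc_le {K₀ : Finset V} {Ω : Finset (Finset V)} {r s : ℕ}
    (hΩ : IsBlockSystem K₀ Ω) (hpos : ∀ D ∈ Ω, D.Nonempty) {𝓕 : Finset (Finset (Finset V))}
    (h𝓕 : ∀ A ∈ 𝓕, A ⊆ Ω ∧ A.card = s ∧ CycSet G r (blockSpan K₀ A))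
    {U : Finset (Finset V)} {q : ℕ} (hUΩ : U ⊆ Ω) (hq : U.card + q = s)
    (hU : ∃ x ∈ blockSpan K₀ U, (nbrs G (blockSpan K₀ U) x).Nonempty) :
    ((𝓕.filter (U ⊆ ·)).card : ℝ) ≤ (((Ω.card : ℝ) - (touchSat G K₀ Ω ∅ U).card) / q) ^ q := by
  refine card_filter_blockSpan_le hΩ ∅ 𝓕 s (fun U => U ⊆ Ω ∧ ∃ x ∈ blockSpan K₀ U,
    (nbrs G (blockSpan K₀ U) x).Nonempty) (fun U h => h.1) (fun A hA => ⟨(h𝓕 A hA).1, (h𝓕 A hA).2.1⟩)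
    (fun A hA x hx => ((h𝓕 A hA).2.2.2.1 x hx).le) (by simp) ?_ ⟨hUΩ, hU⟩ hq
  rintro U ⟨hU, x, hx, hxn⟩ ⟨A, hA, hUA, hne⟩
  have hcyc := (h𝓕 A hA).2.2
  obtain ⟨p, hp, hp1⟩ := hcyc.exists_card_nbrs_eq_one (blockSpan_mono hUA)
    (blockSpan_ne hΩ hpos (h𝓕 A hA).1 hUA hne) hx hxn
  refine ⟨p, hp, by simp, hp1, ?_, ?_⟩
  · intro B hB hUB _
    exact ((h𝓕 B hB).2.2.2.1 p (blockSpan_mono hUB hp)).ge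
  · intro B hB hUB D hD _ _
    refine ⟨Finset.insert_subset ((h𝓕 B hB).1 hD) hU, x,
      blockSpan_mono (Finset.subset_insert _ _) hx, hxn.mono (nbrs_mono (blockSpan_mono (Finset.subset_insert _ _)) x)⟩

/-- If the base contains an edge, then there are at most `(N / s) ^ s` cycles. -/
theorem card_le_of_base_edge {K₀ : Finset V} {Ω : Finset (Finset V)} {r s : ℕ}
    (hΩ : IsBlockSystem K₀ Ω) (hpos : ∀ D ∈ Ω, D.Nonempty) {𝓕 : Finset (Finset (Finset V))}
    (h𝓕 : ∀ A ∈ 𝓕, A ⊆ Ω ∧ A.card = s ∧ CycSet G r (blockSpan K₀ A))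
    (hK : ∃ x ∈ K₀, (nbrs G K₀ x).Nonempty) : (𝓕.card : ℝ) ≤ ((Ω.card : ℝ) / s) ^ s := by
  obtain ⟨x, hx, hxn⟩ := hK
  have hsub : K₀ ⊆ blockSpan K₀ ∅ := by simp [blockSpan]
  have := card_filter_cyc_le hΩ hpos h𝓕 (U := ∅) (q := s) (by simp) (by simp)
    ⟨x, hsub hx, hxn.mono (nbrs_mono hsub x)⟩
  simp only [Finset.empty_subset, Finset.filter_true] at this
  refine this.trans ?_
  have h1 : ((touchSat G K₀ Ω ∅ ∅).card : ℝ) ≤ Ω.card := by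
    exact_mod_cast Finset.card_le_card (Finset.filter_subset _ _)
  apply pow_le_pow_left₀ (div_nonneg (by linarith) (by positivity))
  gcongr
  have : (0 : ℝ) ≤ (touchSat G K₀ Ω ∅ ∅).card := by positivity
  linarith

/-- The inequality of means with `a` split into two equal factors. -/
theorem sq_mul_pow_le (q : ℕ) {a M : ℝ} (ha : 0 ≤ a) (haM : a ≤ M) :
    (a / 2) ^ 2 * ((M - a) / q) ^ q ≤ (M / (q + 2 : ℕ)) ^ (q + 2) := by
  have h1 := mul_div_pow_le q (c := a / 2) (M := M - a / 2) (by linarith) (by linarith)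
  have h2 := mul_div_pow_le (q + 1) (c := a / 2) (M := M) (by linarith) (by linarith)
  have h3 : M - a / 2 - a / 2 = M - a := by ring
  rw [h3] at h1
  calc (a / 2) ^ 2 * ((M - a) / q) ^ q = a / 2 * (a / 2 * ((M - a) / q) ^ q) := by ring
    _ ≤ a / 2 * ((M - a / 2) / (q + 1 : ℕ)) ^ (q + 1) := by gcongr
    _ ≤ _ := h2

end Cycles

/-! ### The factor two for a base vertex without neighbours in the base. -/

section BaseVertex
variable {V : Type*} {G : SimpleGraph V}

/-- The blocks which contain a neighbour of `v`. -/
noncomputable def touching (G : SimpleGraph V) (Ω : Finset (Finset V)) (v : V) :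
    Finset (Finset V) :=
  Ω.filter fun D => (nbrs G D v).Nonempty

theorem mem_touching {Ω : Finset (Finset V)} {v : V} {D : Finset V} :
    D ∈ touching G Ω v ↔ D ∈ Ω ∧ ∃ y ∈ D, G.Adj v y := by
  simp [touching, Finset.Nonempty]

theorem nbrs_blockSpan {K₀ : Finset V} {v : V} (hv : nbrs G K₀ v = ∅) (A : Finset (Finset V)) :
    nbrs G (blockSpan K₀ A) v = (touching G A v).biUnion fun D => nbrs G D v := by
  ext y
  simp only [mem_nbrs, mem_blockSpan, Finset.mem_biUnion, mem_touching]
  constructor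
  · rintro ⟨hy | ⟨D, hD, hy⟩, hvy⟩
    · have : y ∈ nbrs G K₀ v := mem_nbrs.2 ⟨hy, hvy⟩
      simp [hv] at this
    · exact ⟨D, ⟨hD, y, hy, hvy⟩, hy, hvy⟩
  · rintro ⟨D, ⟨hD, -⟩, hy, hvy⟩
    exact ⟨Or.inr ⟨D, hD, hy⟩, hvy⟩

theorem card_nbrs_blockSpan {K₀ : Finset V} {Ω : Finset (Finset V)} (hΩ : IsBlockSystem K₀ Ω)
    {v : V} (hv : nbrs G K₀ v = ∅) {A : Finset (Finset V)} (hA : A ⊆ Ω) :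
    (nbrs G (blockSpan K₀ A) v).card = ∑ D ∈ touching G A v, (nbrs G D v).card := by
  rw [nbrs_blockSpan hv, Finset.card_biUnion]
  intro D hD D' hD' hne
  rw [Finset.mem_coe, mem_touching] at hD hD'
  exact (hΩ.pairwise_disjoint D (hA hD.1) D' (hA hD'.1) hne).mono
    (Finset.filter_subset _ _) (Finset.filter_subset _ _)

theorem touching_pos {Ω : Finset (Finset V)} {v : V} {D : Finset V} (hD : D ∈ touching G Ω v) :
    1 ≤ (nbrs G D v).card := by
  obtain ⟨-, y, hy, hvy⟩ := mem_touching.1 hD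
  exact Finset.card_pos.2 ⟨y, mem_nbrs.2 ⟨hy, hvy⟩⟩

/-- The two neighbours of `v` lie in one block of `T₂` or in two blocks of `T₁`. Once these are
chosen, `v` is saturated and all `a` blocks of `T₁` and `T₂` are spent. A pair from `T₁` can be
chosen in up to `T₁.card ^ 2 / 2` ways, whereas the inequality of means bounds `(a / 2) ^ 2 * Q`;
the discrepancy is the factor `2`. -/
theorem card_le_two_mul {K₀ : Finset V} {Ω : Finset (Finset V)} {r s : ℕ} (hs : 2 ≤ s)
    (hΩ : IsBlockSystem K₀ Ω) (hpos : ∀ D ∈ Ω, D.Nonempty) {𝓕 : Finset (Finset (Finset V))}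
    (h𝓕 : ∀ A ∈ 𝓕, A ⊆ Ω ∧ A.card = s ∧ CycSet G r (blockSpan K₀ A))
    {v : V} (hvK : v ∈ K₀) (hv : nbrs G K₀ v = ∅) :
    (𝓕.card : ℝ) ≤ 2 * ((Ω.card : ℝ) / s) ^ s := by
  obtain ⟨t, rfl⟩ : ∃ t, s = t + 2 := ⟨s - 2, by omega⟩
  set T₁ := (touching G Ω v).filter fun D => (nbrs G D v).card = 1 with hT₁
  set T₂ := (touching G Ω v).filter fun D => (nbrs G D v).card = 2 with hT₂
  have hT₁Ω : T₁ ⊆ Ω := (Finset.filter_subset _ _).trans (Finset.filter_subset _ _)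
  have hT₂Ω : T₂ ⊆ Ω := (Finset.filter_subset _ _).trans (Finset.filter_subset _ _)
  have hdisj : Disjoint T₁ T₂ := by
    rw [Finset.disjoint_left]
    intro D h1 h2
    have h1 := (Finset.mem_filter.1 h1).2
    have h2 := (Finset.mem_filter.1 h2).2
    omega
  set a : ℝ := (T₁.card : ℝ) + T₂.card with ha
  set N : ℝ := (Ω.card : ℝ) with hN
  have haN : a ≤ N := by
    have := Finset.card_le_card (Finset.union_subset hT₁Ω hT₂Ω)
    rw [Finset.card_union_of_disjoint hdisj] at this
    rw [ha, hN]
    exact_mod_cast this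
  have hext : ∀ (U : Finset (Finset V)) (q : ℕ), U ⊆ Ω → U.card + q = t + 2 →
      2 ≤ (nbrs G (blockSpan K₀ U) v).card →
      ((𝓕.filter (U ⊆ ·)).card : ℝ) ≤ ((N - a) / q) ^ q := by
    intro U q hU hq h2
    have hvU : v ∈ blockSpan K₀ U := mem_blockSpan.2 (Or.inl hvK)
    refine (card_filter_cyc_le hΩ hpos h𝓕 hU hq ⟨v, hvU, Finset.card_pos.1 (by omega)⟩).trans ?_
    have h1 : T₁ ∪ T₂ ⊆ touchSat G K₀ Ω ∅ U := by
      intro D hD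
      have hD' : D ∈ touching G Ω v := by
        rcases Finset.mem_union.1 hD with hD | hD <;> exact (Finset.mem_filter.1 hD).1
      obtain ⟨hDΩ, y, hy, hvy⟩ := mem_touching.1 hD'
      exact Finset.mem_filter.2 ⟨hDΩ, v, hvU, Or.inr h2, y, hy, hvy⟩
    have h1' := Finset.card_le_card h1
    rw [Finset.card_union_of_disjoint hdisj] at h1'
    have h3 : a ≤ (touchSat G K₀ Ω ∅ U).card := by rw [ha]; exact_mod_cast h1'
    have h4 : ((touchSat G K₀ Ω ∅ U).card : ℝ) ≤ N :=
      Nat.cast_le.2 (Finset.card_le_card (Finset.filter_subset _ _))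
    apply pow_le_pow_left₀ (div_nonneg (by linarith) (by positivity))
    exact div_le_div_of_nonneg_right (by linarith) (by positivity)
  have hcov : 𝓕 ⊆ (T₂.biUnion fun D => 𝓕.filter ({D} ⊆ ·)) ∪
      ((T₁.powersetCard 2).biUnion fun U => 𝓕.filter (U ⊆ ·)) := by
    intro A hA
    obtain ⟨hAΩ, -, hcyc⟩ := h𝓕 A hA
    have h2 := hcyc.2.1 v (mem_blockSpan.2 (Or.inl hvK))
    rw [card_nbrs_blockSpan hΩ hv hAΩ] at h2
    have hsub : touching G A v ⊆ touching G Ω v := Finset.filter_subset_filter _ hAΩ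
    rw [Finset.mem_union]
    by_cases hex : ∃ D ∈ touching G A v, (nbrs G D v).card = 2
    · left
      obtain ⟨D, hD, hD2⟩ := hex
      simp only [Finset.mem_biUnion, Finset.mem_filter]
      exact ⟨D, Finset.mem_filter.2 ⟨hsub hD, hD2⟩, hA,
        Finset.singleton_subset_iff.2 (mem_touching.1 hD).1⟩
    · right
      push Not at hex
      have h1 : ∀ D ∈ touching G A v, (nbrs G D v).card = 1 := by
        intro D hD
        have h3 := Finset.single_le_sum (f := fun D => (nbrs G D v).card)
          (fun _ _ => Nat.zero_le _) hD
        have h4 := touching_pos hD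
        have h5 := hex D hD
        omega
      rw [Finset.sum_congr rfl h1, Finset.sum_const, smul_eq_mul, mul_one] at h2
      simp only [Finset.mem_biUnion, Finset.mem_filter, Finset.mem_powersetCard]
      exact ⟨touching G A v, ⟨fun D hD => Finset.mem_filter.2 ⟨hsub hD, h1 D hD⟩, h2⟩, hA,
        Finset.filter_subset _ _⟩
  set P : ℝ := ((N - a) / (t + 1 : ℕ)) ^ (t + 1) with hP
  set Q : ℝ := ((N - a) / t) ^ t with hQ
  have hle : (𝓕.card : ℝ) ≤ T₂.card * P + (T₁.card.choose 2 : ℕ) * Q := by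
    have h1 := (Finset.card_le_card hcov).trans (Finset.card_union_le _ _)
    have h2 : (((T₂.biUnion fun D => 𝓕.filter ({D} ⊆ ·)).card : ℕ) : ℝ) ≤ T₂.card * P := by
      refine (Nat.cast_le.2 Finset.card_biUnion_le).trans ?_
      push_cast
      rw [← nsmul_eq_mul]
      apply Finset.sum_le_card_nsmul
      intro D hD
      apply hext {D} (t + 1) (Finset.singleton_subset_iff.2 (hT₂Ω hD)) (by simp; omega)
      rw [← (Finset.mem_filter.1 hD).2]
      exact Finset.card_le_card (nbrs_mono (fun y hy => mem_blockSpan.2 (Or.inr ⟨D, by simp, hy⟩)) v)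
    have h3 : ((((T₁.powersetCard 2).biUnion fun U => 𝓕.filter (U ⊆ ·)).card : ℕ) : ℝ) ≤
        (T₁.card.choose 2 : ℕ) * Q := by
      refine (Nat.cast_le.2 Finset.card_biUnion_le).trans ?_
      push_cast
      rw [← Finset.card_powersetCard, ← nsmul_eq_mul]
      apply Finset.sum_le_card_nsmul
      intro U hU
      rw [Finset.mem_powersetCard] at hU
      apply hext U t (hU.1.trans hT₁Ω) (by omega)
      rw [card_nbrs_blockSpan hΩ hv (hU.1.trans hT₁Ω)]
      have h5 : touching G U v = U := by
        apply Finset.filter_true_of_mem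
        intro D hD
        apply Finset.card_pos.1
        rw [(Finset.mem_filter.1 (hU.1 hD)).2]
        exact one_pos
      rw [h5, Finset.sum_congr rfl fun D hD => (Finset.mem_filter.1 (hU.1 hD)).2]
      simp [hU.2]
    have h1' : (𝓕.card : ℝ) ≤ _ := Nat.cast_le.2 h1
    push_cast at h1'
    linarith
  have hch : ((T₁.card.choose 2 : ℕ) : ℝ) ≤ (T₁.card : ℝ) ^ 2 / 2 := by
    rw [Nat.cast_choose_two]
    have : (0 : ℝ) ≤ T₁.card := by positivity
    nlinarith
  have ha0 : 0 ≤ a := by positivity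
  have hQ0 : 0 ≤ Q := pow_nonneg (div_nonneg (by linarith) (by positivity)) _
  have hP0 : 0 ≤ P := pow_nonneg (div_nonneg (by linarith) (by positivity)) _
  set T : ℝ := (N / (t + 2 : ℕ)) ^ (t + 2) with hT
  have hT0 : 0 ≤ T := by positivity
  have hPT : a * P ≤ T := by
    have := mul_div_pow_le (t + 1) ha0 haN
    exact this
  have hQT : (a / 2) ^ 2 * Q ≤ T := sq_mul_pow_le t ha0 haN
  have h0 : (0 : ℝ) ≤ T₁.card := by positivity
  have h0' : (0 : ℝ) ≤ T₂.card := by positivity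
  have hfin : (𝓕.card : ℝ) ≤ T₂.card * P + (T₁.card : ℝ) ^ 2 / 2 * Q := by
    refine hle.trans ?_
    gcongr
  rcases ha0.eq_or_lt with h | h
  · have e1 : (T₁.card : ℝ) = 0 := by linarith
    have e2 : (T₂.card : ℝ) = 0 := by linarith
    rw [e1, e2] at hfin
    have h2 : (𝓕.card : ℝ) ≤ 0 := by simpa using hfin
    linarith
  -- After multiplication by `a` the bound becomes a sum of `2 * T` with weights `T₁.card` and
  -- `T₂.card`, which add up to `a`.
  · refine le_of_mul_le_mul_left ?_ h
    calc a * (𝓕.card : ℝ) ≤ a * (T₂.card * P + (T₁.card : ℝ) ^ 2 / 2 * Q) := by gcongr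
      _ = T₂.card * (a * P) + T₁.card * (a * T₁.card / 2 * Q) := by ring
      _ ≤ T₂.card * T + T₁.card * (a * a / 2 * Q) := by
          gcongr
          linarith
      _ = T₂.card * T + T₁.card * (2 * ((a / 2) ^ 2 * Q)) := by ring
      _ ≤ T₂.card * (2 * T) + T₁.card * (2 * T) := by
          gcongr
          linarith
      _ = a * (2 * T) := by rw [ha]; ring

/-- The graph induced on `S` has exactly one vertex of degree one other than `v`. -/
def UniqueEnd (G : SimpleGraph V) (v : V) (S : Finset V) : Prop :=
  ∃ p ∈ S, p ≠ v ∧ (nbrs G S p).card = 1 ∧ ∀ x ∈ S, x ≠ v → (nbrs G S x).card = 1 → x = p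

theorem nbrs_insert_of_adj {S : Finset V} {x z : V} (h : G.Adj x z) :
    nbrs G (insert z S) x = insert z (nbrs G S x) := by
  ext y
  simp only [mem_nbrs, Finset.mem_insert]
  constructor
  · rintro ⟨rfl | hy, hxy⟩
    · exact Or.inl rfl
    · exact Or.inr ⟨hy, hxy⟩
  · rintro (rfl | ⟨hy, hxy⟩)
    · exact ⟨Or.inl rfl, h⟩
    · exact ⟨Or.inr hy, hxy⟩

theorem nbrs_insert_of_not_adj {S : Finset V} {x z : V} (h : ¬ G.Adj x z) :
    nbrs G (insert z S) x = nbrs G S x := by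
  ext y
  simp only [mem_nbrs, Finset.mem_insert]
  constructor
  · rintro ⟨rfl | hy, hxy⟩
    · exact absurd hxy h
    · exact ⟨hy, hxy⟩
  · rintro ⟨hy, hxy⟩
    exact ⟨Or.inr hy, hxy⟩

theorem card_nbrs_insert_of_adj {S : Finset V} {x z : V} (h : G.Adj x z) (hz : z ∉ S) :
    (nbrs G (insert z S) x).card = (nbrs G S x).card + 1 := by
  rw [nbrs_insert_of_adj h, Finset.card_insert_of_notMem fun h => hz (mem_nbrs.1 h).1]

theorem nbrs_insert_self {S : Finset V} {z : V} : nbrs G (insert z S) z = nbrs G S z :=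
  nbrs_insert_of_not_adj G.irrefl

theorem exists_pair_of_card_eq_two {α : Type*} {s : Finset α} (h : s.card = 2) {x : α}
    (hx : x ∈ s) : ∃ y, y ≠ x ∧ s = {x, y} := by
  obtain ⟨y, hy⟩ := Finset.card_eq_one.1 (show (s.erase x).card = 1 by
    rw [Finset.card_erase_of_mem hx, h])
  have hy' : y ∈ s.erase x := by rw [hy]; simp
  exact ⟨y, Finset.ne_of_mem_erase hy', by rw [← hy, Finset.insert_erase hx]⟩

/-- Attaching `z` to the end `p` moves the end to `z` or, if `z` has a second neighbour `y`, to `y`.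
In the latter case `y` was isolated before: it was not the end, and now its degree is at most two.
-/
theorem UniqueEnd.insert_vertex {v p z : V} {S : Finset V} (hz : z ∉ S) (hvS : v ∈ S)
    (hvz : ¬ G.Adj v z) (hpS : p ∈ S) (hp1 : (nbrs G S p).card = 1)
    (hpu : ∀ x ∈ S, x ≠ v → (nbrs G S x).card = 1 → x = p) (hpz : G.Adj p z)
    (hdeg : ∀ x ∈ insert z S, (nbrs G (insert z S) x).card ≤ 2) :
    UniqueEnd G v (insert z S) := by
  have hzv : z ≠ v := by rintro rfl; exact hz hvS
  have hpz' : p ∈ nbrs G S z := mem_nbrs.2 ⟨hpS, hpz.symm⟩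
  have hp2 : (nbrs G (insert z S) p).card = 2 := by rw [card_nbrs_insert_of_adj hpz hz, hp1]
  have hold : ∀ x ∈ S, x ≠ v → (nbrs G (insert z S) x).card = 1 → G.Adj x z ∧ x ≠ p := by
    intro x hx hxv hx1
    have hxp : x ≠ p := by rintro rfl; omega
    refine ⟨?_, hxp⟩
    by_contra hxz
    rw [nbrs_insert_of_not_adj hxz] at hx1
    exact hxp (hpu x hx hxv hx1)
  have hd := hdeg z (Finset.mem_insert_self _ _)
  rw [nbrs_insert_self] at hd
  have hd1 := Finset.card_pos.2 ⟨p, hpz'⟩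
  rcases (show (nbrs G S z).card = 1 ∨ (nbrs G S z).card = 2 by omega) with h1 | h2
  · refine ⟨z, Finset.mem_insert_self _ _, hzv, by rw [nbrs_insert_self, h1], ?_⟩
    intro x hx hxv hx1
    rw [Finset.mem_insert] at hx
    refine hx.resolve_right fun hx => ?_
    obtain ⟨hxz, hxp⟩ := hold x hx hxv hx1
    exact hxp (Finset.card_le_one.1 h1.le x (mem_nbrs.2 ⟨hx, hxz.symm⟩) p hpz')
  · obtain ⟨y, hyp, hpair⟩ := exists_pair_of_card_eq_two h2 hpz'
    have hy : y ∈ nbrs G S z := by rw [hpair]; simp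
    obtain ⟨hyS, hzy⟩ := mem_nbrs.1 hy
    have hyv : y ≠ v := by rintro rfl; exact hvz hzy.symm
    have hy0 := hdeg y (Finset.mem_insert_of_mem hyS)
    rw [card_nbrs_insert_of_adj hzy.symm hz] at hy0
    have hy1 : (nbrs G S y).card ≠ 1 := fun h => hyp (hpu y hyS hyv h)
    refine ⟨y, Finset.mem_insert_of_mem hyS, hyv, by
      rw [card_nbrs_insert_of_adj hzy.symm hz]; omega, ?_⟩
    intro x hx hxv hx1
    rw [Finset.mem_insert] at hx
    rcases hx with rfl | hx
    · rw [nbrs_insert_self] at hx1; omega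
    · obtain ⟨hxz, hxp⟩ := hold x hx hxv hx1
      have : x ∈ nbrs G S z := mem_nbrs.2 ⟨hx, hxz.symm⟩
      rw [hpair, Finset.mem_insert, Finset.mem_singleton] at this
      exact this.resolve_left hxp

/-- The start of the path at `v`: its end is `z`, or the second base vertex attached to `z`. -/
theorem UniqueEnd.of_independent {v z : V} {K : Finset V} (hK : ∀ x ∈ K, nbrs G K x = ∅)
    (hz : z ∉ K) (hv : v ∈ K) (hvz : G.Adj v z) (hd : (nbrs G K z).card ≤ 2) :
    UniqueEnd G v (insert z K) := by
  have hzv : z ≠ v := by rintro rfl; exact hz hv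
  have hvz' : v ∈ nbrs G K z := mem_nbrs.2 ⟨hv, hvz.symm⟩
  have hd1 := Finset.card_pos.2 ⟨v, hvz'⟩
  have hold : ∀ x ∈ K, (nbrs G (insert z K) x).card = 1 → G.Adj x z := by
    intro x hx hx1
    by_contra hxz
    rw [nbrs_insert_of_not_adj hxz, hK x hx] at hx1
    simp at hx1
  rcases (show (nbrs G K z).card = 1 ∨ (nbrs G K z).card = 2 by omega) with h1 | h2
  · refine ⟨z, Finset.mem_insert_self _ _, hzv, by rw [nbrs_insert_self, h1], ?_⟩
    intro x hx hxv hx1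
    rw [Finset.mem_insert] at hx
    refine hx.resolve_right fun hx => hxv ?_
    exact Finset.card_le_one.1 h1.le x (mem_nbrs.2 ⟨hx, (hold x hx hx1).symm⟩) v hvz'
  · obtain ⟨y, hyv, hpair⟩ := exists_pair_of_card_eq_two h2 hvz'
    have hy : y ∈ nbrs G K z := by rw [hpair]; simp
    obtain ⟨hyS, hzy⟩ := mem_nbrs.1 hy
    refine ⟨y, Finset.mem_insert_of_mem hyS, hyv, by
      rw [card_nbrs_insert_of_adj hzy.symm hz, hK y hyS]; simp, ?_⟩
    intro x hx hxv hx1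
    rw [Finset.mem_insert] at hx
    rcases hx with rfl | hx
    · rw [nbrs_insert_self] at hx1; omega
    · have : x ∈ nbrs G K z := mem_nbrs.2 ⟨hx, (hold x hx hx1).symm⟩
      rw [hpair, Finset.mem_insert, Finset.mem_singleton] at this
      exact this.resolve_left hxv

end BaseVertex

/-! ### The sharp bound for blocks of one vertex. -/

section SingletonBlocks
variable {V : Type*} {G : SimpleGraph V}

theorem blockSpan_insert_singleton {K₀ : Finset V} {U : Finset (Finset V)} {z : V} :
    blockSpan K₀ (insert {z} U) = insert z (blockSpan K₀ U) := by
  ext x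
  simp only [mem_blockSpan, Finset.mem_insert]
  constructor
  · rintro (h | ⟨D, rfl | hD, hx⟩)
    · exact Or.inr (Or.inl h)
    · exact Or.inl (Finset.mem_singleton.1 hx)
    · exact Or.inr (Or.inr ⟨D, hD, hx⟩)
  · rintro (rfl | h | ⟨D, hD, hx⟩)
    · exact Or.inr ⟨{x}, Or.inl rfl, Finset.mem_singleton_self x⟩
    · exact Or.inl h
    · exact Or.inr ⟨D, Or.inr hD, hx⟩

theorem card_touching_of_singletons {K₀ : Finset V} {Ω A : Finset (Finset V)} {r : ℕ}
    (hΩ : IsBlockSystem K₀ Ω) (hone : ∀ D ∈ Ω, D.card = 1) (hAΩ : A ⊆ Ω)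
    (hA : CycSet G r (blockSpan K₀ A)) {v : V} (hv : v ∈ K₀) (hvK : nbrs G K₀ v = ∅) :
    (touching G A v).card = 2 := by
  have h := hA.2.1 v (mem_blockSpan.2 (Or.inl hv))
  rw [card_nbrs_blockSpan hΩ hvK hAΩ, Finset.sum_congr rfl (g := fun _ => 1)] at h
  · simpa using h
  · intro D hD
    have h1 := touching_pos hD
    have h2 := Finset.card_le_card (Finset.filter_subset (fun y => G.Adj v y) D)
    rw [hone D (hAΩ (mem_touching.1 hD).1)] at h2
    exact le_antisymm h2 h1

/-- Cycles minus one neighbour `y` of the base vertex `v`, and containing the other one, `w`, can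
be reached from `w` by extending at the unique end other than `v`. -/
theorem card_filter_erase_le {K₀ : Finset V} {Ω : Finset (Finset V)} {r s : ℕ}
    (hΩ : IsBlockSystem K₀ Ω) (hone : ∀ D ∈ Ω, D.card = 1)
    {𝓢 : Finset (Finset (Finset V))} {v w : V} (hv : v ∈ K₀)
    (hK : ∀ x ∈ K₀, nbrs G K₀ x = ∅) (hw : {w} ∈ Ω) (hvw : G.Adj v w)
    (h𝓢 : ∀ P ∈ 𝓢, {w} ∈ P ∧ P ⊆ Ω ∧ P.card = s + 1 ∧ (∀ z, {z} ∈ P → G.Adj v z → z = w) ∧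
      ∃ y, y ∉ blockSpan K₀ P ∧ G.Adj v y ∧ CycSet G r (insert y (blockSpan K₀ P))) :
    (𝓢.card : ℝ) ≤ (((Ω.card : ℝ) - (touching G Ω v).card) / s) ^ s := by
  have htouch : touching G Ω v ⊆ touchSat G K₀ Ω {v} {{w}} := by
    intro D hD
    obtain ⟨hDΩ, y, hy, hvy⟩ := mem_touching.1 hD
    exact Finset.mem_filter.2 ⟨hDΩ, v, mem_blockSpan.2 (Or.inl hv), Or.inl (by simp), y, hy, hvy⟩
  have h1 : ((touching G Ω v).card : ℝ) ≤ (touchSat G K₀ Ω {v} {{w}}).card :=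
    Nat.cast_le.2 (Finset.card_le_card htouch)
  have h2 : ((touchSat G K₀ Ω {v} {{w}}).card : ℝ) ≤ Ω.card :=
    Nat.cast_le.2 (Finset.card_le_card (Finset.filter_subset _ _))
  rcases 𝓢.eq_empty_or_nonempty with rfl | ⟨P₀, hP₀⟩
  · rw [Finset.card_empty, Nat.cast_zero]
    exact pow_nonneg (div_nonneg (by linarith) (by positivity)) _
  have hdeg : ∀ P ∈ 𝓢, ∀ x ∈ blockSpan K₀ P, (nbrs G (blockSpan K₀ P) x).card ≤ 2 := by
    intro P hP x hx
    obtain ⟨-, -, -, -, y, -, -, hcyc⟩ := h𝓢 P hP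
    exact hcyc.card_nbrs_le (Finset.subset_insert _ _) (Finset.mem_insert_of_mem hx)
  have hwK : w ∉ K₀ := fun h => Finset.disjoint_left.1 (hΩ.disjoint_base _ hw) (by simp) h
  have hnotadj : ∀ U : Finset (Finset V), {w} ∈ U → ∀ P ∈ 𝓢, ∀ D ∈ P, D ∉ U → ∀ y ∈ D,
      ¬ G.Adj v y := by
    intro U hU P hP D hD hDU y hy hvy
    obtain ⟨z, rfl⟩ := Finset.card_eq_one.1 (hone D ((h𝓢 P hP).2.1 hD))
    rw [Finset.mem_singleton] at hy
    subst hy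
    rw [(h𝓢 P hP).2.2.2.1 y hD hvy] at hDU
    exact hDU hU
  -- With `v` in `Z`, the blocks touching `v` are excluded from the start: the only neighbour of `v`
  -- besides `w` is the removed vertex, so the path grows only at its other end.
  have key := card_filter_blockSpan_le hΩ {v} 𝓢 (s + 1)
    (fun U => U ⊆ Ω ∧ {w} ∈ U ∧ UniqueEnd G v (blockSpan K₀ U)) (fun U h => h.1)
    (fun P hP => ⟨(h𝓢 P hP).2.1, (h𝓢 P hP).2.2.1⟩) hdeg ?_ ?_ (U := {{w}}) (q := s) ?_
    (by simp; omega)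
  · have h3 : 𝓢.filter ({{w}} ⊆ ·) = 𝓢 :=
      Finset.filter_true_of_mem fun P hP => Finset.singleton_subset_iff.2 (h𝓢 P hP).1
    rw [h3] at key
    refine key.trans ?_
    apply pow_le_pow_left₀ (div_nonneg (by linarith) (by positivity))
    exact div_le_div_of_nonneg_right (by linarith) (by positivity)
  · rintro U ⟨-, hwU, -⟩ P hP - D hD hDU x hx y hy
    rw [Finset.mem_singleton] at hx
    subst hx
    exact hnotadj U hwU P hP D hD hDU y hy
  · rintro U ⟨hUΩ, hwU, p, hp, hpv, hp1, hpu⟩ -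
    have hvU : v ∈ blockSpan K₀ U := mem_blockSpan.2 (Or.inl hv)
    have hwU' : w ∈ blockSpan K₀ U := mem_blockSpan.2 (Or.inr ⟨_, hwU, by simp⟩)
    refine ⟨p, hp, by simpa using hpv, hp1, ?_, ?_⟩
    · intro P hP hUP hne
      obtain ⟨-, hPΩ, -, -, y, hy, hvy, hcyc⟩ := h𝓢 P hP
      have hUP' := blockSpan_mono (K₀ := K₀) hUP
      have hp2 := hcyc.2.1 p (Finset.mem_insert_of_mem (hUP' hp))
      by_cases hpy : G.Adj p y
      swap
      · rw [nbrs_insert_of_not_adj hpy] at hp2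
        exact hp2.ge
      -- If the missing vertex `y` were adjacent to the end `p`, the path from `v` to `p` and `y`
      -- would close up to the whole cycle, and nothing would be left to add.
      exfalso
      have hyU : y ∉ blockSpan K₀ U := fun h => hy (hUP' h)
      set I := insert y ((blockSpan K₀ U).filter fun x => (nbrs G (blockSpan K₀ U) x).Nonempty)
        with hI
      have hIA : I = insert y (blockSpan K₀ P) := by
        apply hcyc.eq_of_subset
        · exact Finset.insert_subset_insert _ ((Finset.filter_subset _ _).trans hUP')
        · exact ⟨y, Finset.mem_insert_self _ _⟩
        · have hvI : v ∈ I := by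
            refine Finset.mem_insert_of_mem (Finset.mem_filter.2 ⟨hvU, w, ?_⟩)
            exact mem_nbrs.2 ⟨hwU', hvw⟩
          have hwI : w ∈ I := by
            refine Finset.mem_insert_of_mem (Finset.mem_filter.2 ⟨hwU', v, ?_⟩)
            exact mem_nbrs.2 ⟨hvU, hvw.symm⟩
          have hpI : p ∈ I := by
            refine Finset.mem_insert_of_mem (Finset.mem_filter.2 ⟨hp, ?_⟩)
            exact Finset.card_pos.1 (by omega)
          have hsubI : ∀ x ∈ blockSpan K₀ U, nbrs G (blockSpan K₀ U) x ⊆ nbrs G I x := by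
            intro x hx z hz
            have hz' := mem_nbrs.1 hz
            refine mem_nbrs.2 ⟨Finset.mem_insert_of_mem (Finset.mem_filter.2 ⟨hz'.1, x, ?_⟩), hz'.2⟩
            exact mem_nbrs.2 ⟨hx, hz'.2.symm⟩
          intro x hx
          by_cases hxy : x = y
          · subst hxy
            exact two_le_card_nbrs hvI hpI hpv.symm hvy.symm hpy.symm
          by_cases hxv : x = v
          · subst hxv
            refine two_le_card_nbrs hwI (Finset.mem_insert_self _ _) ?_ hvw hvy
            rintro rfl
            exact hyU hwU'
          obtain ⟨hxU, hxn⟩ := Finset.mem_filter.1 (Finset.mem_of_mem_insert_of_ne hx hxy)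
          by_cases hxp : x = p
          · subst hxp
            obtain ⟨z, hz⟩ := hxn
            refine two_le_card_nbrs (mem_nbrs.1 (hsubI x hxU hz)).1 (Finset.mem_insert_self _ _) ?_
              (mem_nbrs.1 hz).2 hpy
            rintro rfl
            exact hyU (mem_nbrs.1 hz).1
          · refine le_trans ?_ (Finset.card_le_card (hsubI x hxU))
            have h4 := Finset.card_pos.2 hxn
            have h5 : (nbrs G (blockSpan K₀ U) x).card ≠ 1 := fun h => hxp (hpu x hxU hxv h)
            omega
      refine blockSpan_ne hΩ (fun D hD => Finset.card_pos.1 (by rw [hone D hD]; exact one_pos))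
        hPΩ hUP hne ?_
      apply Finset.Subset.antisymm hUP'
      intro x hx
      have hxy : x ≠ y := by rintro rfl; exact hy hx
      have hxI : x ∈ I := by rw [hIA]; exact Finset.mem_insert_of_mem hx
      exact (Finset.mem_filter.1 (Finset.mem_of_mem_insert_of_ne hxI hxy)).1
    · intro P hP hUP D hD hDU hDp
      have hPΩ := (h𝓢 P hP).2.1
      refine ⟨Finset.insert_subset (hPΩ hD) hUΩ, Finset.mem_insert_of_mem hwU, ?_⟩
      have hDv := hnotadj U hwU P hP D hD hDU
      obtain ⟨z, rfl⟩ := Finset.card_eq_one.1 (hone D (hPΩ hD))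
      have hzU : z ∉ blockSpan K₀ U := hΩ.notMem_blockSpan hUΩ (hPΩ hD) hDU (by simp)
      rw [blockSpan_insert_singleton]
      refine UniqueEnd.insert_vertex hzU hvU (hDv z (by simp)) hp hp1 hpu (by simpa using hDp) ?_
      have hsub : insert z (blockSpan K₀ U) ⊆ blockSpan K₀ P := by
        rw [← blockSpan_insert_singleton]
        exact blockSpan_mono (Finset.insert_subset hD hUP)
      intro x hx
      exact (Finset.card_le_card (nbrs_mono hsub x)).trans (hdeg P hP x (hsub hx))
  · refine ⟨by simpa using hw, by simp, ?_⟩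
    have h3 : blockSpan K₀ {{w}} = insert w K₀ := by
      have := blockSpan_insert_singleton (K₀ := K₀) (U := ∅) (z := w)
      simpa [blockSpan] using this
    rw [h3]
    refine UniqueEnd.of_independent hK hwK hv hvw ?_
    have h4 : K₀ ⊆ blockSpan K₀ P₀ := fun x hx => mem_blockSpan.2 (Or.inl hx)
    exact (Finset.card_le_card (nbrs_mono h4 w)).trans
      (hdeg P₀ hP₀ w (mem_blockSpan.2 (Or.inr ⟨_, (h𝓢 P₀ hP₀).1, by simp⟩)))

/-- Removing one of the two neighbours of `v` from a cycle leaves a path; by `card_filter_erase_le`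
there are at most `a * Q` paths, `a` being the number of possible neighbours. Each pair of a cycle
and one of its paths gets weight `1 / c`, where `c` counts the completions of the path, so the total
weight is at most `a * Q`. The two paths of a cycle have disjoint sets of completions, so the cycle
has weight at least `4 / a`. Hence there are at most `(a / 2) ^ 2 * Q` cycles, without the factor
`2` of `card_le_two_mul`. -/
theorem card_le_of_singletons {K₀ : Finset V} {Ω : Finset (Finset V)} {r s : ℕ} (hr : 4 < r)
    (hs : 2 ≤ s) (hΩ : IsBlockSystem K₀ Ω) (hone : ∀ D ∈ Ω, D.card = 1)
    {𝓕 : Finset (Finset (Finset V))}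
    (h𝓕 : ∀ A ∈ 𝓕, A ⊆ Ω ∧ A.card = s ∧ CycSet G r (blockSpan K₀ A))
    {v : V} (hv : v ∈ K₀) (hK : ∀ x ∈ K₀, nbrs G K₀ x = ∅) :
    (𝓕.card : ℝ) ≤ ((Ω.card : ℝ) / s) ^ s := by
  obtain ⟨t, rfl⟩ : ∃ t, s = t + 2 := ⟨s - 2, by omega⟩
  set T := touching G Ω v with hT
  have hTΩ : T ⊆ Ω := Finset.filter_subset _ _
  have hsing : ∀ D ∈ Ω, ∃ z, D = {z} := fun D hD => Finset.card_eq_one.1 (hone D hD)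
  have htwo : ∀ A ∈ 𝓕, (touching G A v).card = 2 := fun A hA =>
    card_touching_of_singletons hΩ hone (h𝓕 A hA).1 (h𝓕 A hA).2.2 hv (hK v hv)
  set 𝓢 := 𝓕.biUnion fun A => (touching G A v).image fun D => A.erase D with h𝓢
  set Q : ℝ := (((Ω.card : ℝ) - T.card) / t) ^ t with hQ
  -- the number of paths
  have hP1 : (𝓢.card : ℝ) ≤ T.card * Q := by
    have hcov : 𝓢 ⊆ T.biUnion fun W => 𝓢.filter (W ∈ ·) := by
      intro P hP
      obtain ⟨A, hA, hP'⟩ := Finset.mem_biUnion.1 hP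
      obtain ⟨Y, hY, rfl⟩ := Finset.mem_image.1 hP'
      obtain ⟨W, hWY, hpair⟩ := exists_pair_of_card_eq_two (htwo A hA) hY
      have hW : W ∈ touching G A v := by rw [hpair]; simp
      obtain ⟨hWA, hWv⟩ := mem_touching.1 hW
      refine Finset.mem_biUnion.2 ⟨W, mem_touching.2 ⟨(h𝓕 A hA).1 hWA, hWv⟩,
        Finset.mem_filter.2 ⟨hP, Finset.mem_erase.2 ⟨hWY, hWA⟩⟩⟩
    refine (Nat.cast_le.2 ((Finset.card_le_card hcov).trans Finset.card_biUnion_le)).trans ?_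
    push_cast
    rw [← nsmul_eq_mul]
    apply Finset.sum_le_card_nsmul
    intro W hW
    obtain ⟨hWΩ, w', hw', hvw⟩ := mem_touching.1 hW
    obtain ⟨w, rfl⟩ := hsing W hWΩ
    rw [Finset.mem_singleton] at hw'
    subst hw'
    refine card_filter_erase_le (r := r) hΩ hone hv hK hWΩ hvw ?_
    intro P hP
    obtain ⟨hP, hwP⟩ := Finset.mem_filter.1 hP
    obtain ⟨A, hA, hP'⟩ := Finset.mem_biUnion.1 hP
    obtain ⟨Y, hY, rfl⟩ := Finset.mem_image.1 hP'
    obtain ⟨hAΩ, hAc, hcyc⟩ := h𝓕 A hA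
    obtain ⟨hYA, y', hy', hvy⟩ := mem_touching.1 hY
    obtain ⟨y, rfl⟩ := hsing Y (hAΩ hYA)
    rw [Finset.mem_singleton] at hy'
    subst hy'
    have hspan : insert y' (blockSpan K₀ (A.erase {y'})) = blockSpan K₀ A := by
      rw [← blockSpan_insert_singleton, Finset.insert_erase hYA]
    refine ⟨hwP, (Finset.erase_subset _ _).trans hAΩ, by
      rw [Finset.card_erase_of_mem hYA, hAc]; rfl, ?_, y', ?_, hvy, by rw [hspan]; exact hcyc⟩
    · intro z hz hvz
      obtain ⟨hzy, hzA⟩ := Finset.mem_erase.1 hz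
      obtain ⟨hwy, hwA⟩ := Finset.mem_erase.1 hwP
      by_contra hzw
      have h3 : ({{z}, {w'}, {y'}} : Finset (Finset V)) ⊆ touching G A v := by
        intro D hD
        simp only [Finset.mem_insert, Finset.mem_singleton] at hD
        rcases hD with rfl | rfl | rfl
        · exact mem_touching.2 ⟨hzA, z, by simp, hvz⟩
        · exact mem_touching.2 ⟨hwA, w', by simp, hvw⟩
        · exact hY
      have h4 := Finset.card_le_card h3
      have hzw' : ({z} : Finset V) ≠ {w'} := fun h => hzw (Finset.singleton_injective h)
      rw [htwo A hA, Finset.card_insert_of_notMem (by simp [hzw', hzy]), Finset.card_pair hwy] at h4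
      omega
    · exact hΩ.notMem_blockSpan ((Finset.erase_subset _ _).trans hAΩ) (hAΩ hYA)
        (Finset.notMem_erase _ _) (by simp)
  -- the possible completions of a path
  set Lk : Finset (Finset V) → Finset (Finset V) := fun P =>
    T.filter fun D => D ∉ P ∧ insert D P ∈ 𝓕 with hLk
  have hLkmem : ∀ A ∈ 𝓕, ∀ D ∈ touching G A v, D ∈ Lk (A.erase D) := by
    intro A hA D hD
    obtain ⟨hDA, hDv⟩ := mem_touching.1 hD
    refine Finset.mem_filter.2 ⟨mem_touching.2 ⟨(h𝓕 A hA).1 hDA, hDv⟩, Finset.notMem_erase _ _, ?_⟩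
    rw [Finset.insert_erase hDA]
    exact hA
  have hsum : ∑ A ∈ 𝓕, ∑ D ∈ touching G A v, (1 : ℝ) / (Lk (A.erase D)).card ≤ 𝓢.card := by
    have h1 : ∑ A ∈ 𝓕, ∑ D ∈ touching G A v, (1 : ℝ) / (Lk (A.erase D)).card =
        ∑ P ∈ 𝓢, ∑ D ∈ Lk P, (1 : ℝ) / (Lk P).card := by
      rw [Finset.sum_sigma', Finset.sum_sigma']
      refine Finset.sum_bij' (fun x _ => ⟨x.1.erase x.2, x.2⟩) (fun x _ => ⟨insert x.2 x.1, x.2⟩)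
        ?_ ?_ ?_ ?_ ?_
      · rintro ⟨A, D⟩ hx
        obtain ⟨hA, hD⟩ := Finset.mem_sigma.1 hx
        exact Finset.mem_sigma.2 ⟨Finset.mem_biUnion.2 ⟨A, hA, Finset.mem_image.2 ⟨D, hD, rfl⟩⟩,
          hLkmem A hA D hD⟩
      · rintro ⟨P, D⟩ hx
        obtain ⟨-, hD⟩ := Finset.mem_sigma.1 hx
        obtain ⟨hDT, -, hDF⟩ := Finset.mem_filter.1 hD
        exact Finset.mem_sigma.2 ⟨hDF, mem_touching.2
          ⟨Finset.mem_insert_self _ _, (mem_touching.1 hDT).2⟩⟩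
      · rintro ⟨A, D⟩ hx
        obtain ⟨-, hD⟩ := Finset.mem_sigma.1 hx
        simp only [Finset.insert_erase (mem_touching.1 hD).1]
      · rintro ⟨P, D⟩ hx
        obtain ⟨-, hD⟩ := Finset.mem_sigma.1 hx
        obtain ⟨-, hDP, -⟩ := Finset.mem_filter.1 hD
        simp only [Finset.erase_insert hDP]
      · rintro ⟨A, D⟩ hx
        rfl
    rw [h1]
    calc ∑ P ∈ 𝓢, ∑ D ∈ Lk P, (1 : ℝ) / (Lk P).card ≤ ∑ P ∈ 𝓢, 1 := by
          apply Finset.sum_le_sum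
          intro P _
          rw [Finset.sum_const, nsmul_eq_mul]
          rw [mul_one_div]
          exact div_self_le_one _
      _ = 𝓢.card := by simp
  have hpairs : ∀ A ∈ 𝓕, ∃ D₁ D₂, touching G A v = {D₁, D₂} ∧ D₁ ≠ D₂ ∧
      Disjoint (Lk (A.erase D₁)) (Lk (A.erase D₂)) := by
    intro A hA
    obtain ⟨D₁, D₂, hne, hpair⟩ := Finset.card_eq_two.1 (htwo A hA)
    refine ⟨D₁, D₂, hpair, hne, ?_⟩
    obtain ⟨hAΩ, -, hcyc⟩ := h𝓕 A hA
    have h1 : D₁ ∈ touching G A v := by rw [hpair]; simp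
    have h2 : D₂ ∈ touching G A v := by rw [hpair]; simp
    have hDA₁ := (mem_touching.1 h1).1
    have hDA₂ := (mem_touching.1 h2).1
    obtain ⟨w₁, rfl⟩ := hsing D₁ (hAΩ hDA₁)
    obtain ⟨w₂, rfl⟩ := hsing D₂ (hAΩ hDA₂)
    have hw : w₁ ≠ w₂ := fun h => hne (by rw [h])
    have hv₁ : G.Adj v w₁ := by
      obtain ⟨-, y, hy, hvy⟩ := mem_touching.1 h1
      rwa [Finset.mem_singleton.1 hy] at hvy
    have hv₂ : G.Adj v w₂ := by
      obtain ⟨-, y, hy, hvy⟩ := mem_touching.1 h2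
      rwa [Finset.mem_singleton.1 hy] at hvy
    set S := blockSpan K₀ A with hS
    have hvS : v ∈ S := mem_blockSpan.2 (Or.inl hv)
    have hwS₁ : w₁ ∈ S := mem_blockSpan.2 (Or.inr ⟨_, hDA₁, by simp⟩)
    have hwS₂ : w₂ ∈ S := mem_blockSpan.2 (Or.inr ⟨_, hDA₂, by simp⟩)
    obtain ⟨x₁, hx₁v, hx₁⟩ := exists_pair_of_card_eq_two (hcyc.2.1 w₁ hwS₁)
      (mem_nbrs.2 ⟨hvS, hv₁.symm⟩)
    obtain ⟨x₂, hx₂v, hx₂⟩ := exists_pair_of_card_eq_two (hcyc.2.1 w₂ hwS₂)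
      (mem_nbrs.2 ⟨hvS, hv₂.symm⟩)
    obtain ⟨hx₁S, hwx₁⟩ := mem_nbrs.1 (show x₁ ∈ nbrs G S w₁ by rw [hx₁]; simp)
    obtain ⟨hx₂S, hwx₂⟩ := mem_nbrs.1 (show x₂ ∈ nbrs G S w₂ by rw [hx₂]; simp)
    -- This needs `r > 4`: in a four-cycle the two neighbours of `v` have the same other neighbour.
    have hx : x₁ ≠ x₂ := by
      rintro rfl
      exact hcyc.no_four hr hwS₁ hwS₂ hvS hx₁S hw hx₁v.symm hv₁.symm hwx₁ hv₂.symm hwx₂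
    have hww : ¬ G.Adj w₁ w₂ := fun h => hcyc.no_triangle (by omega) hvS hwS₁ hwS₂ hv₁ h hv₂
    have hx₁w₂ : x₁ ≠ w₂ := by rintro rfl; exact hww hwx₁
    have hx₂w₁ : x₂ ≠ w₁ := by rintro rfl; exact hww hwx₂.symm
    -- if `u` completes the path missing `w`, then `u` is adjacent to the other neighbour of `w`
    have hrep : ∀ w x u : V, {w} ∈ A → x ∈ S → G.Adj w x → x ≠ w → {u} ∈ Lk (A.erase {w}) →
        {u} ∉ A → G.Adj x u ∧ CycSet G r (insert u (S.erase w)) := by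
      intro w x u hwA hxS hwx hxw hu huA
      obtain ⟨huT, huP, huF⟩ := Finset.mem_filter.1 hu
      have hSw : blockSpan K₀ (A.erase {w}) = S.erase w := by
        have h5 := blockSpan_insert_singleton (K₀ := K₀) (U := A.erase {w}) (z := w)
        rw [Finset.insert_erase hwA] at h5
        have h6 : w ∉ blockSpan K₀ (A.erase {w}) :=
          hΩ.notMem_blockSpan ((Finset.erase_subset _ _).trans hAΩ) (hAΩ hwA)
            (Finset.notMem_erase _ _) (by simp)
        rw [hS, h5, Finset.erase_insert h6]
      have hcyc' := (h𝓕 _ huF).2.2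
      rw [blockSpan_insert_singleton, hSw] at hcyc'
      refine ⟨?_, hcyc'⟩
      by_contra hxu
      have h7 := hcyc'.2.1 x (Finset.mem_insert_of_mem (Finset.mem_erase.2 ⟨hxw, hxS⟩))
      rw [nbrs_insert_of_not_adj hxu] at h7
      have h8 : w ∈ nbrs G S x :=
        mem_nbrs.2 ⟨mem_blockSpan.2 (Or.inr ⟨_, hwA, by simp⟩), hwx.symm⟩
      have h9 : nbrs G (S.erase w) x ⊆ (nbrs G S x).erase w := by
        intro z hz
        obtain ⟨hz1, hz2⟩ := mem_nbrs.1 hz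
        obtain ⟨hz3, hz4⟩ := Finset.mem_erase.1 hz1
        exact Finset.mem_erase.2 ⟨hz3, mem_nbrs.2 ⟨hz4, hz2⟩⟩
      have h10 := Finset.card_le_card h9
      rw [h7, Finset.card_erase_of_mem h8, hcyc.2.1 x hxS] at h10
      omega
    rw [Finset.disjoint_left]
    intro D hD1 hD2
    obtain ⟨hDT, hDP1, -⟩ := Finset.mem_filter.1 hD1
    obtain ⟨-, hDP2, -⟩ := Finset.mem_filter.1 hD2
    have hDA : D ∉ A := by
      intro h
      rw [Finset.mem_erase] at hDP1 hDP2
      have e1 : D = {w₁} := by by_contra h'; exact hDP1 ⟨h', h⟩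
      have e2 : D = {w₂} := by by_contra h'; exact hDP2 ⟨h', h⟩
      exact hne (e1.symm.trans e2)
    obtain ⟨hDΩ, u', hu', hvu⟩ := mem_touching.1 hDT
    obtain ⟨u, rfl⟩ := hsing D hDΩ
    rw [Finset.mem_singleton] at hu'
    subst hu'
    obtain ⟨hxu₁, hc₁⟩ := hrep w₁ x₁ u' hDA₁ hx₁S hwx₁ hwx₁.ne.symm hD1 hDA
    obtain ⟨hxu₂, -⟩ := hrep w₂ x₂ u' hDA₂ hx₂S hwx₂ hwx₂.ne.symm hD2 hDA
    have huc := hc₁.2.1 u' (Finset.mem_insert_self _ _)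
    -- A common completion takes the place of `w₁` as well as of `w₂`, and so has three neighbours
    -- on an induced cycle.
    have h3 : ({v, x₁, x₂} : Finset V) ⊆ nbrs G (insert u' (S.erase w₁)) u' := by
      intro z hz
      simp only [Finset.mem_insert, Finset.mem_singleton] at hz
      rcases hz with rfl | rfl | rfl
      · exact mem_nbrs.2 ⟨Finset.mem_insert_of_mem (Finset.mem_erase.2 ⟨hv₁.ne, hvS⟩), hvu.symm⟩
      · exact mem_nbrs.2 ⟨Finset.mem_insert_of_mem (Finset.mem_erase.2 ⟨hwx₁.ne.symm, hx₁S⟩),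
          hxu₁.symm⟩
      · exact mem_nbrs.2 ⟨Finset.mem_insert_of_mem (Finset.mem_erase.2 ⟨hx₂w₁, hx₂S⟩), hxu₂.symm⟩
    have h4 := Finset.card_le_card h3
    rw [huc, Finset.card_insert_of_notMem (by
      rw [Finset.mem_insert, Finset.mem_singleton]
      rintro (h | h)
      · exact hx₁v h.symm
      · exact hx₂v h.symm), Finset.card_pair hx] at h4
    omega
  set a : ℝ := (T.card : ℝ) with ha
  have ha0 : 0 ≤ a := by positivity
  have haN : a ≤ Ω.card := Nat.cast_le.2 (Finset.card_le_card hTΩ)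
  have hQT := sq_mul_pow_le t ha0 haN
  rcases 𝓕.eq_empty_or_nonempty with h0 | ⟨A₀, hA₀⟩
  · rw [h0]
    simp only [Finset.card_empty, Nat.cast_zero]
    positivity
  have hapos : 0 < a := by
    have h1 : touching G A₀ v ⊆ T := Finset.filter_subset_filter _ (h𝓕 A₀ hA₀).1
    have h2 := Finset.card_le_card h1
    rw [htwo A₀ hA₀] at h2
    rw [ha]
    exact_mod_cast (by omega : 0 < T.card)
  -- `1 / x + 1 / y ≥ 4 / (x + y)`, and the disjoint sets of completions have at most `a` elements
  -- together.
  have hterm : ∀ A ∈ 𝓕, 4 / a ≤ ∑ D ∈ touching G A v, (1 : ℝ) / (Lk (A.erase D)).card := by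
    intro A hA
    obtain ⟨D₁, D₂, hpair, hne, hdis⟩ := hpairs A hA
    have h1 := hLkmem A hA D₁ (by rw [hpair]; simp)
    have h2 := hLkmem A hA D₂ (by rw [hpair]; simp)
    rw [hpair, Finset.sum_pair hne]
    set x := (Lk (A.erase D₁)).card with hx
    set y := (Lk (A.erase D₂)).card with hy
    have hx0 : (0 : ℝ) < x := Nat.cast_pos.2 (Finset.card_pos.2 ⟨_, h1⟩)
    have hy0 : (0 : ℝ) < y := Nat.cast_pos.2 (Finset.card_pos.2 ⟨_, h2⟩)
    have hxy : (x : ℝ) + y ≤ a := by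
      have h3 := Finset.card_le_card (Finset.union_subset
        (Finset.filter_subset (fun D => D ∉ A.erase D₁ ∧ insert D (A.erase D₁) ∈ 𝓕) T)
        (Finset.filter_subset (fun D => D ∉ A.erase D₂ ∧ insert D (A.erase D₂) ∈ 𝓕) T))
      have h4 := Finset.card_union_of_disjoint hdis
      have h5 : (Lk (A.erase D₁) ∪ Lk (A.erase D₂)).card ≤ T.card := h3
      rw [h4] at h5
      rw [ha]
      exact_mod_cast h5
    rw [div_add_div _ _ hx0.ne' hy0.ne', div_le_div_iff₀ hapos (mul_pos hx0 hy0)]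
    nlinarith [sq_nonneg ((x : ℝ) - y), mul_le_mul_of_nonneg_left hxy (add_pos hx0 hy0).le]
  have hfin : (𝓕.card : ℝ) * (4 / a) ≤ a * Q := by
    refine le_trans ?_ (hsum.trans hP1)
    rw [← nsmul_eq_mul]
    exact Finset.card_nsmul_le_sum _ _ _ hterm
  have : (𝓕.card : ℝ) = (𝓕.card : ℝ) * (4 / a) * (a / 4) := by
    have := hapos.ne'
    field_simp
  rw [this]
  calc (𝓕.card : ℝ) * (4 / a) * (a / 4) ≤ a * Q * (a / 4) :=
        mul_le_mul_of_nonneg_right hfin (by linarith)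
    _ = (a / 2) ^ 2 * Q := by ring
    _ ≤ _ := hQT

end SingletonBlocks

/-! ### The asymptotic upper bounds with constants two and one. -/

/-- The terms `l, l + d, …, l + (s - 1) * d` of an arithmetic progression. -/
def progression (l s d : ℕ) : Set ℕ :=
  {m | ∃ j < s, m = l + j * d}

theorem IsBlockSystem.card_mul_le {V : Type*} [Fintype V] {K₀ : Finset V} {Ω : Finset (Finset V)}
    {d : ℕ} (hΩ : IsBlockSystem K₀ Ω) (hcard : ∀ D ∈ Ω, D.card = d) :
    Ω.card * d ≤ Fintype.card V := by
  have h1 : (Ω.biUnion id).card = Ω.card * d := by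
    rw [Finset.card_biUnion (t := id)
      fun D hD D' hD' h => hΩ.pairwise_disjoint D hD D' hD' h]
    simp only [id]
    rw [Finset.sum_congr rfl hcard, Finset.sum_const, smul_eq_mul]
  rw [← h1]
  exact Finset.card_le_univ _

/-- Reduction of the asymptotic upper bounds to the count of cycles composed of the base and `s`
blocks. -/
theorem asympLe_of_forall_blockSystem {r l s d : ℕ} (hs : 2 ≤ s) (hd : 0 < d)
    (hr : r = l + s * d) (hr4 : 4 ≤ r) {c : ℝ} (hc : 0 ≤ c)
    (h : ∀ δ : ℝ, 0 < δ → ∃ C : ℝ, ∀ {V : Type} [Fintype V] (G : SimpleGraph V) (K₀ : Finset V)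
      (Ω : Finset (Finset V)) (𝓕 : Finset (Finset (Finset V))), K₀.card = l →
      IsBlockSystem K₀ Ω → (∀ D ∈ Ω, D.card = d) →
      (∀ A ∈ 𝓕, A ⊆ Ω ∧ A.card = s ∧ CycSet G r (blockSpan K₀ A)) →
      (∀ D ∈ Ω, ∃ A ∈ 𝓕, D ∈ A) →
      (∀ A B, CycSet G r A → CycSet G r B → A ≠ B → (A ∩ B).card ∈ progression l s d) →
      (𝓕.card : ℝ) ≤ (c + δ) * ((Ω.card : ℝ) / s) ^ s + C * (Ω.card : ℝ) ^ (s - 1)) :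
    AsympLe (PsiCycle r (progression l s d)) c (bench r l s) := by
  apply asympLe_of_eventually hr (by omega) hd
  intro δ hδ
  obtain ⟨C, hC⟩ := h (δ / 2) (by positivity)
  obtain ⟨C', hC'⟩ := exists_blocks r l s d hs hd hr
  filter_upwards [eventually_mul_pow_le (s := s) (by omega) hd (|C| + C') (half_pos hδ),
    eventually_gt_atTop 0] with n hn hn0
  have hdR : (1 : ℝ) ≤ d := by exact_mod_cast hd
  have hm : PsiCycle r (progression l s d) n ≤
      ⌊(c + δ) * ((n : ℝ) / (s * d)) ^ s⌋₊ := by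
    apply psiCycle_le (by omega)
    intro V _ G hV hL
    apply Nat.le_floor
    have hint : ∀ A ∈ cycs G r, ∀ B ∈ cycs G r, A ≠ B →
        (A ∩ B).card ∈ (Finset.range s).image (fun j => l + j * d) := by
      intro A hA B hB hne
      rw [mem_cycs] at hA hB
      obtain ⟨j, hj, he⟩ := hL A B hA hB hne
      exact Finset.mem_image.2 ⟨j, Finset.mem_range.2 hj, he.symm⟩
    have hbase : (0 : ℝ) ≤ ((n : ℝ) / (s * d)) ^ s := by positivity
    have hnp : (0 : ℝ) ≤ (n : ℝ) ^ (s - 1) := by positivity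
    have hCn : (0 : ℝ) ≤ |C| * (n : ℝ) ^ (s - 1) := by positivity
    rcases hC' (cycs G r) (by omega) (fun A hA => (mem_cycs.1 hA).1) hint with h1 | h1
    · rw [hV] at h1
      have h1' : ((cycs G r).card : ℝ) ≤ C' * (n : ℝ) ^ (s - 1) := by exact_mod_cast h1
      nlinarith
    · obtain ⟨K₀, Ω, 𝓗, hK₀, h𝓗, hcard, hblock⟩ := h1
      rw [hV] at hcard
      have hcard' : ((cycs G r).card : ℝ) ≤ 𝓗.card + C' * (n : ℝ) ^ (s - 1) := by
        exact_mod_cast hcard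
      have hΩ : IsBlockSystem K₀ Ω := ⟨hblock.disjoint_base, hblock.pairwise_disjoint⟩
      set 𝓕 := (Ω.powersetCard s).filter fun U => blockSpan K₀ U ∈ 𝓗 with h𝓕
      have h2 : 𝓗.card ≤ 𝓕.card := by
        have h3 : 𝓗 ⊆ 𝓕.image (blockSpan K₀) := by
          intro A hA
          obtain ⟨U, hU, hUs, rfl⟩ := hblock.exists_eq A hA
          exact Finset.mem_image.2 ⟨U, Finset.mem_filter.2
            ⟨Finset.mem_powersetCard.2 ⟨hU, hUs⟩, hA⟩, rfl⟩
        exact (Finset.card_le_card h3).trans Finset.card_image_le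
      have h4 := hC G K₀ Ω 𝓕 hK₀ hΩ hblock.card_block (fun U hU => by
          obtain ⟨hU1, hU2⟩ := Finset.mem_filter.1 hU
          obtain ⟨hU3, hU4⟩ := Finset.mem_powersetCard.1 hU1
          exact ⟨hU3, hU4, mem_cycs.1 (h𝓗 hU2)⟩) (fun D hD => by
          obtain ⟨A, hA, hDA⟩ := hblock.exists_mem D hD
          obtain ⟨U, hU, hUs, rfl⟩ := hblock.exists_eq A hA
          refine ⟨U, Finset.mem_filter.2 ⟨Finset.mem_powersetCard.2 ⟨hU, hUs⟩, hA⟩, ?_⟩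
          obtain ⟨y, hy⟩ := Finset.card_pos.1 (by rw [hblock.card_block D hD]; exact hd)
          by_contra hDU
          exact hΩ.notMem_blockSpan hU hD hDU hy (hDA hy)) hL
      have h5 : (Ω.card : ℝ) * d ≤ n := by
        have := hΩ.card_mul_le hblock.card_block
        rw [hV] at this
        exact_mod_cast this
      have hs0 : (0 : ℝ) < s := by positivity
      have h6 : (Ω.card : ℝ) / s ≤ (n : ℝ) / (s * d) := by
        rw [div_le_div_iff₀ hs0 (by positivity)]
        nlinarith
      have h7 : (Ω.card : ℝ) ≤ n := by
        have : (0 : ℝ) ≤ Ω.card := by positivity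
        nlinarith
      have h8 : (𝓗.card : ℝ) ≤ 𝓕.card := by exact_mod_cast h2
      have h9 : (c + δ / 2) * ((Ω.card : ℝ) / s) ^ s ≤ (c + δ / 2) * ((n : ℝ) / (s * d)) ^ s := by
        gcongr
      have h10 : C * (Ω.card : ℝ) ^ (s - 1) ≤ |C| * (n : ℝ) ^ (s - 1) := by
        gcongr
        exact le_abs_self C
      nlinarith
  calc (PsiCycle r (progression l s d) n : ℝ) ≤ (⌊(c + δ) * ((n : ℝ) / (s * d)) ^ s⌋₊ : ℝ) := by
        exact_mod_cast hm
    _ ≤ _ := Nat.floor_le (by positivity)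

theorem asympLe_two {r l s d : ℕ} (hs : 2 ≤ s) (hd : 0 < d) (hl : 0 < l)
    (hr : r = l + s * d) (hr4 : 4 ≤ r) :
    AsympLe (PsiCycle r (progression l s d)) 2 (bench r l s) := by
  apply asympLe_of_forall_blockSystem hs hd hr hr4 (by norm_num)
  intro δ hδ
  refine ⟨0, fun {V} _ G K₀ Ω 𝓕 hK hΩ hcard h𝓕 _ _ => ?_⟩
  have hpos : ∀ D ∈ Ω, D.Nonempty := fun D hD => Finset.card_pos.1 (by rw [hcard D hD]; exact hd)
  have hN : (0 : ℝ) ≤ ((Ω.card : ℝ) / s) ^ s := by positivity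
  by_cases hedge : ∃ x ∈ K₀, (nbrs G K₀ x).Nonempty
  · have := card_le_of_base_edge hΩ hpos h𝓕 hedge
    nlinarith
  · push Not at hedge
    obtain ⟨v, hv⟩ := Finset.card_pos.1 (by rw [hK]; exact hl)
    have := card_le_two_mul hs hΩ hpos h𝓕 hv (by simpa using hedge v hv)
    nlinarith

/-- The number of edges between an independent subset of an induced cycle and its complement. -/
theorem CycSet.two_mul_card_le {V : Type*} {G : SimpleGraph V} {r : ℕ} {A K : Finset V}
    (hA : CycSet G r A) (hK : K ⊆ A) (hind : ∀ x ∈ K, nbrs G K x = ∅) : 2 * K.card ≤ r := by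
  have h1 : ∑ x ∈ K, (nbrs G (A \ K) x).card = K.card * 2 := by
    rw [Finset.sum_congr rfl (g := fun _ => 2), Finset.sum_const, smul_eq_mul]
    intro x hx
    rw [← hA.2.1 x (hK hx)]
    congr 1
    ext y
    simp only [mem_nbrs, Finset.mem_sdiff]
    constructor
    · rintro ⟨⟨h1, h2⟩, h3⟩
      exact ⟨h1, h3⟩
    · rintro ⟨h1, h3⟩
      refine ⟨⟨h1, fun h => ?_⟩, h3⟩
      have : y ∈ nbrs G K x := mem_nbrs.2 ⟨h, h3⟩
      simp [hind x hx] at this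
  have h2 : ∑ x ∈ K, (nbrs G (A \ K) x).card = ∑ y ∈ A \ K, (nbrs G K y).card := by
    have := Finset.sum_card_bipartiteAbove_eq_sum_card_bipartiteBelow (s := K) (t := A \ K) G.Adj
    simp only [Finset.bipartiteAbove, Finset.bipartiteBelow] at this
    simp only [nbrs]
    rw [this]
    simp only [G.adj_comm]
  have h3 : ∑ y ∈ A \ K, (nbrs G K y).card ≤ (A \ K).card * 2 := by
    rw [← smul_eq_mul]
    apply Finset.sum_le_card_nsmul
    intro y hy
    exact hA.card_nbrs_le hK (Finset.mem_sdiff.1 hy).1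
  have h4 := Finset.card_sdiff_add_card_eq_card hK
  rw [hA.1] at h4
  omega

/-- Here the base has more than half of the `r` vertices, so it cannot be independent and
`card_le_of_base_edge` applies. -/
theorem asympLe_one_of_large {r l s d : ℕ} (hs : 2 ≤ s) (hd : 0 < d)
    (hr : r = l + s * d) (hr4 : 4 ≤ r) (hl : s * d < l) :
    AsympLe (PsiCycle r (progression l s d)) 1 (bench r l s) := by
  apply asympLe_of_forall_blockSystem hs hd hr hr4 (by norm_num)
  intro δ hδ
  refine ⟨0, fun {V} _ G K₀ Ω 𝓕 hK hΩ hcard h𝓕 _ _ => ?_⟩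
  have hpos : ∀ D ∈ Ω, D.Nonempty := fun D hD => Finset.card_pos.1 (by rw [hcard D hD]; exact hd)
  have hN : (0 : ℝ) ≤ ((Ω.card : ℝ) / s) ^ s := by positivity
  by_cases hedge : ∃ x ∈ K₀, (nbrs G K₀ x).Nonempty
  · have := card_le_of_base_edge hΩ hpos h𝓕 hedge
    nlinarith
  · push Not at hedge
    rcases 𝓕.eq_empty_or_nonempty with rfl | ⟨A, hA⟩
    · simp only [Finset.card_empty, Nat.cast_zero]
      positivity
    · have := (h𝓕 A hA).2.2.two_mul_card_le (fun x hx => mem_blockSpan.2 (Or.inl hx))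
        (fun x hx => by simpa using hedge x hx)
      omega

theorem asympLe_one_of_consecutive {r l s : ℕ} (hs : 2 ≤ s) (hl : 0 < l)
    (hr : r = l + s * 1) (hr4 : 4 < r) :
    AsympLe (PsiCycle r (progression l s 1)) 1 (bench r l s) := by
  apply asympLe_of_forall_blockSystem hs one_pos hr (by omega) (by norm_num)
  intro δ hδ
  refine ⟨0, fun {V} _ G K₀ Ω 𝓕 hK hΩ hcard h𝓕 _ _ => ?_⟩
  have hpos : ∀ D ∈ Ω, D.Nonempty := fun D hD => Finset.card_pos.1 (by rw [hcard D hD]; omega)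
  have hN : (0 : ℝ) ≤ ((Ω.card : ℝ) / s) ^ s := by positivity
  by_cases hedge : ∃ x ∈ K₀, (nbrs G K₀ x).Nonempty
  · have := card_le_of_base_edge hΩ hpos h𝓕 hedge
    nlinarith
  · push Not at hedge
    obtain ⟨v, hv⟩ := Finset.card_pos.1 (by rw [hK]; exact hl)
    have := card_le_of_singletons hr4 hs hΩ hcard h𝓕 hv (fun x hx => by simpa using hedge x hx)
    nlinarith

/-! ### Lower bounds from graphs with a base and legs. -/

section Embedding
variable {V W : Type*} {G : SimpleGraph V} {G' : SimpleGraph W} {r : ℕ}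

theorem card_nbrs_map {f : V ↪ W} (hadj : ∀ x y, G'.Adj (f x) (f y) ↔ G.Adj x y) (A : Finset V)
    (x : V) : (nbrs G' (A.map f) (f x)).card = (nbrs G A x).card := by
  rw [← Finset.card_map f (s := nbrs G A x)]
  congr 1
  ext y
  simp only [mem_nbrs, Finset.mem_map]
  constructor
  · rintro ⟨⟨b, hb, rfl⟩, h⟩
    exact ⟨b, ⟨hb, (hadj _ _).1 h⟩, rfl⟩
  · rintro ⟨b, ⟨hb, h⟩, rfl⟩
    exact ⟨⟨b, hb, rfl⟩, (hadj _ _).2 h⟩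

theorem cycSet_map_iff {f : V ↪ W} (hadj : ∀ x y, G'.Adj (f x) (f y) ↔ G.Adj x y)
    {A : Finset V} : CycSet G' r (A.map f) ↔ CycSet G r A := by
  constructor
  · rintro ⟨h1, h2, h3⟩
    refine ⟨by rw [← h1, Finset.card_map], fun x hx => ?_, fun T hT hne hcl => ?_⟩
    · rw [← card_nbrs_map hadj, h2 _ (Finset.mem_map_of_mem f hx)]
    · apply Finset.map_injective f
      apply h3 _ (Finset.map_subset_map.2 hT) (by simpa using hne)
      intro x hx y hy hxy
      obtain ⟨a, ha, rfl⟩ := Finset.mem_map.1 hx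
      obtain ⟨b, hb, rfl⟩ := Finset.mem_map.1 hy
      exact Finset.mem_map_of_mem f (hcl a ha b hb ((hadj _ _).1 hxy))
  · rintro ⟨h1, h2, h3⟩
    refine ⟨by rw [Finset.card_map, h1], fun x hx => ?_, fun T hT hne hcl => ?_⟩
    · obtain ⟨a, ha, rfl⟩ := Finset.mem_map.1 hx
      rw [card_nbrs_map hadj, h2 a ha]
    · obtain ⟨B, hB, rfl⟩ := Finset.subset_map_iff.1 hT
      rw [h3 B hB (by simpa using hne)]
      intro x hx y hy hxy
      simpa using hcl (f x) (Finset.mem_map_of_mem f hx) (f y) (Finset.mem_map_of_mem f hy)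
        ((hadj x y).2 hxy)

/-- Lets constructions live on infinite types such as `ℕ × ℕ`: only the graph induced on the finite
set `S` counts. -/
theorem card_le_psiCycle_of_subset {n : ℕ} (hr : 3 ≤ r) {L : Set ℕ} {S : Finset V}
    (hS : S.card ≤ n)
    (hL : ∀ A ⊆ S, ∀ B ⊆ S, CycSet G r A → CycSet G r B → A ≠ B → (A ∩ B).card ∈ L)
    {𝓕 : Finset (Finset V)} (h𝓕 : ∀ A ∈ 𝓕, A ⊆ S ∧ CycSet G r A) : 𝓕.card ≤ PsiCycle r L n := by
  set f : {x // x ∈ S} ↪ V := Function.Embedding.subtype _ with hf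
  have hadj : ∀ x y, G.Adj (f x) (f y) ↔ (G.comap f).Adj x y := fun x y => Iff.rfl
  have hsub : ∀ A : Finset {x // x ∈ S}, A.map f ⊆ S := by
    intro A x hx
    obtain ⟨a, -, rfl⟩ := Finset.mem_map.1 hx
    exact a.2
  have hmap : ∀ A ⊆ S, (A.subtype (· ∈ S)).map f = A := by
    intro A hA
    exact Finset.subtype_map_of_mem hA
  have h1 : (𝓕.image fun A => A.subtype (· ∈ S)).card = 𝓕.card := by
    apply Finset.card_image_of_injOn
    intro A hA B hB h
    rw [← hmap A (h𝓕 A hA).1, ← hmap B (h𝓕 B hB).1, show A.subtype (· ∈ S) = B.subtype (· ∈ S) from h]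
  rw [← h1]
  apply card_le_psiCycle (G := G.comap f) hr (by simpa using hS)
  · intro A B hA hB hne
    have := hL _ (hsub A) _ (hsub B) ((cycSet_map_iff hadj).2 hA) ((cycSet_map_iff hadj).2 hB)
      (fun h => hne (Finset.map_injective f h))
    rw [← Finset.map_inter, Finset.card_map] at this
    convert this
  · intro B hB
    obtain ⟨A, hA, rfl⟩ := Finset.mem_image.1 hB
    rw [← cycSet_map_iff hadj, hmap A (h𝓕 A hA).1]
    exact (h𝓕 A hA).2

end Embedding

/-- The union of `K` and the legs with index in `U`. -/
noncomputable def legSpan {V ι : Type*} (K : Finset V) (leg : ι → Finset V) (U : Finset ι) :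
    Finset V :=
  K ∪ U.biUnion leg

theorem mem_legSpan {V ι : Type*} {K : Finset V} {leg : ι → Finset V} {U : Finset ι} {x : V} :
    x ∈ legSpan K leg U ↔ x ∈ K ∨ ∃ i ∈ U, x ∈ leg i := by
  simp [legSpan]

section Legs
variable {V ι : Type*} {K : Finset V} {leg : ι → Finset V} {l d : ℕ}

theorem card_legSpan (hK : K.card = l) (hleg : ∀ i, (leg i).card = d)
    (hKd : ∀ i, Disjoint K (leg i)) (hld : ∀ i j, i ≠ j → Disjoint (leg i) (leg j))
    (U : Finset ι) : (legSpan K leg U).card = l + U.card * d := by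
  rw [legSpan, Finset.card_union_of_disjoint, hK, Finset.card_biUnion fun i _ j _ h => hld i j h,
    Finset.sum_congr rfl fun i _ => hleg i, Finset.sum_const, smul_eq_mul]
  rw [Finset.disjoint_biUnion_right]
  exact fun i _ => hKd i

theorem legSpan_inter (hld : ∀ i j, i ≠ j → Disjoint (leg i) (leg j)) (U U' : Finset ι) :
    legSpan K leg U ∩ legSpan K leg U' = legSpan K leg (U ∩ U') := by
  ext x
  simp only [Finset.mem_inter, mem_legSpan]
  constructor
  · rintro ⟨h | ⟨i, hi, hx⟩, h' | ⟨j, hj, hx'⟩⟩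
    · exact Or.inl h
    · exact Or.inl h
    · exact Or.inl h'
    · by_cases hij : i = j
      · subst hij
        exact Or.inr ⟨i, ⟨hi, hj⟩, hx⟩
      · exact absurd hx' (Finset.disjoint_left.1 (hld i j hij) hx)
  · rintro (h | ⟨i, ⟨hi, hj⟩, hx⟩)
    · exact ⟨Or.inl h, Or.inl h⟩
    · exact ⟨Or.inr ⟨i, hi, hx⟩, Or.inr ⟨i, hj, hx⟩⟩

/-- If the induced cycles of a graph are composed of a base and `s` disjoint legs of `d` vertices,
then they form an intersecting family. -/
theorem card_le_psiCycle_of_legs {G : SimpleGraph V} {r s n : ℕ} (hr : 3 ≤ r) (hd : 0 < d)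
    {S : Finset V} (hS : S.card ≤ n) (hK : K.card = l) (hleg : ∀ i, (leg i).card = d)
    (hKd : ∀ i, Disjoint K (leg i)) (hld : ∀ i j, i ≠ j → Disjoint (leg i) (leg j))
    (hcyc : ∀ A ⊆ S, CycSet G r A → ∃ U : Finset ι, U.card = s ∧ A = legSpan K leg U)
    {𝓤 : Finset (Finset ι)} (h𝓤 : ∀ U ∈ 𝓤, legSpan K leg U ⊆ S ∧ CycSet G r (legSpan K leg U)) :
    𝓤.card ≤ PsiCycle r (progression l s d) n := by
  have hmem : ∀ (i : ι) (U : Finset ι), leg i ⊆ legSpan K leg U → i ∈ U := by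
    intro i U h
    obtain ⟨x, hx⟩ := Finset.card_pos.1 (by rw [hleg i]; exact hd)
    rcases mem_legSpan.1 (h hx) with h1 | ⟨j, hj, hx'⟩
    · exact absurd hx (Finset.disjoint_left.1 (hKd i) h1)
    · by_contra hi
      exact Finset.disjoint_left.1 (hld i j (fun h => hi (h ▸ hj))) hx hx'
  have hinj : Function.Injective (legSpan K leg) := by
    intro U U' h
    ext i
    constructor
    · intro hi
      apply hmem
      rw [← h]
      exact fun x hx => mem_legSpan.2 (Or.inr ⟨i, hi, hx⟩)
    · intro hi
      apply hmem
      rw [h]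
      exact fun x hx => mem_legSpan.2 (Or.inr ⟨i, hi, hx⟩)
  rw [← Finset.card_image_of_injective 𝓤 hinj]
  apply card_le_psiCycle_of_subset (G := G) hr hS
  · intro A hAS B hBS hA hB hne
    obtain ⟨U, hU, rfl⟩ := hcyc A hAS hA
    obtain ⟨U', hU', rfl⟩ := hcyc B hBS hB
    rw [legSpan_inter hld, card_legSpan hK hleg hKd hld]
    refine ⟨_, ?_, rfl⟩
    by_contra hlt
    have h1 : U ∩ U' = U :=
      Finset.eq_of_subset_of_card_le Finset.inter_subset_left (by rw [hU]; omega)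
    have h2 : U ∩ U' = U' :=
      Finset.eq_of_subset_of_card_le Finset.inter_subset_right (by rw [hU']; omega)
    exact hne (by rw [← h1, h2])
  · intro A hA
    obtain ⟨U, hU, rfl⟩ := Finset.mem_image.1 hA
    exact h𝓤 U hU

end Legs

section Cycles
variable {V : Type*} {G : SimpleGraph V} {r : ℕ} {A : Finset V}

theorem CycSet.exists_two_nbrs (hA : CycSet G r A) {x : V} (hx : x ∈ A) :
    ∃ y ∈ A, ∃ z ∈ A, y ≠ z ∧ G.Adj x y ∧ G.Adj x z := by
  obtain ⟨y, z, hyz, h⟩ := Finset.card_eq_two.1 (hA.2.1 x hx)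
  have hy : y ∈ nbrs G A x := by rw [h]; simp
  have hz : z ∈ nbrs G A x := by rw [h]; simp
  rw [mem_nbrs] at hy hz
  exact ⟨y, hy.1, z, hz.1, hyz, hy.2, hz.2⟩

/-- A vertex of an induced cycle with only two possible neighbours has both of them. -/
theorem CycSet.mem_of_nbrs (hA : CycSet G r A) {x a b : V} (hx : x ∈ A)
    (h : ∀ y ∈ A, G.Adj x y → y = a ∨ y = b) : a ∈ A ∧ b ∈ A := by
  obtain ⟨y, hy, z, hz, hyz, hxy, hxz⟩ := hA.exists_two_nbrs hx
  rcases h y hy hxy with rfl | rfl <;> rcases h z hz hxz with rfl | rfl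
  · exact absurd rfl hyz
  · exact ⟨hy, hz⟩
  · exact ⟨hz, hy⟩
  · exact absurd rfl hyz

theorem card_nbrs_eq_two {x y z : V} (hyz : y ≠ z) (hy : y ∈ A) (hz : z ∈ A) (hxy : G.Adj x y)
    (hxz : G.Adj x z) (h : ∀ w ∈ A, G.Adj x w → w = y ∨ w = z) : (nbrs G A x).card = 2 := by
  rw [← Finset.card_pair hyz]
  congr 1
  ext w
  simp only [mem_nbrs, Finset.mem_insert, Finset.mem_singleton]
  constructor
  · rintro ⟨hw, hxw⟩
    exact h w hw hxw
  · rintro (rfl | rfl)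
    · exact ⟨hy, hxy⟩
    · exact ⟨hz, hxz⟩

theorem CycSet.not_three_nbrs (hA : CycSet G r A) {x y z w : V} (hx : x ∈ A) (hy : y ∈ A)
    (hz : z ∈ A) (hw : w ∈ A) (hyz : y ≠ z) (hyw : y ≠ w) (hzw : z ≠ w) (hxy : G.Adj x y)
    (hxz : G.Adj x z) (hxw : G.Adj x w) : False := by
  have h1 : ({y, z, w} : Finset V) ⊆ nbrs G A x := by
    intro u hu
    simp only [Finset.mem_insert, Finset.mem_singleton] at hu
    rcases hu with rfl | rfl | rfl <;> simp [*]
  have h2 := Finset.card_le_card h1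
  rw [hA.2.1 x hx, Finset.card_insert_of_notMem (by simp [hyz, hyw]), Finset.card_pair hzw] at h2
  omega

end Cycles

/-- For explicit enumerations the hypotheses are case distinctions in linear arithmetic; asking only
for `a < b` halves them. -/
theorem CycSet.of_enum {V : Type*} [DecidableEq V] {G : SimpleGraph V} {r : ℕ} (hr : 3 ≤ r) (c : ℕ → V)
    (hinj : ∀ a b, a < b → b < r → c a ≠ c b)
    (hadj : ∀ a b, a < b → b < r → (G.Adj (c a) (c b) ↔ b = a + 1 ∨ (a = 0 ∧ b + 1 = r))) :
    CycSet G r ((Finset.range r).image c) := by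
  have hinj' : ∀ a < r, ∀ b < r, c a = c b → a = b := by
    intro a ha b hb h
    rcases lt_trichotomy a b with h1 | h1 | h1
    · exact absurd h (hinj a b h1 hb)
    · exact h1
    · exact absurd h.symm (hinj b a h1 ha)
  have hadj' : ∀ a < r, ∀ b < r, G.Adj (c a) (c b) →
      b = a + 1 ∨ a = b + 1 ∨ (a = 0 ∧ b + 1 = r) ∨ (b = 0 ∧ a + 1 = r) := by
    intro a ha b hb h
    rcases lt_trichotomy a b with h1 | h1 | h1
    · rcases (hadj a b h1 hb).1 h with h2 | h2 <;> omega
    · subst h1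
      exact absurd h G.irrefl
    · rcases (hadj b a h1 ha).1 h.symm with h2 | h2 <;> omega
  have hsucc : ∀ a, a + 1 < r → G.Adj (c a) (c (a + 1)) := fun a ha =>
    (hadj a (a + 1) (by omega) ha).2 (Or.inl rfl)
  have hlast : G.Adj (c 0) (c (r - 1)) := (hadj 0 (r - 1) (by omega) (by omega)).2
    (Or.inr ⟨rfl, by omega⟩)
  have hmem : ∀ a < r, c a ∈ (Finset.range r).image c := fun a ha =>
    Finset.mem_image_of_mem c (Finset.mem_range.2 ha)
  refine ⟨?_, ?_, ?_⟩
  · rw [Finset.card_image_of_injOn, Finset.card_range]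
    intro a ha b hb
    exact hinj' a (by simpa using ha) b (by simpa using hb)
  · intro x hx
    obtain ⟨a, ha, rfl⟩ := Finset.mem_image.1 hx
    rw [Finset.mem_range] at ha
    by_cases h0 : a = 0
    · subst h0
      refine card_nbrs_eq_two (y := c 1) (z := c (r - 1)) (fun h => ?_) (hmem _ (by omega))
        (hmem _ (by omega)) (hsucc 0 (by omega)) hlast ?_
      · have := hinj' 1 (by omega) _ (by omega) h
        omega
      · intro w hw h
        obtain ⟨b, hb, rfl⟩ := Finset.mem_image.1 hw
        rw [Finset.mem_range] at hb
        rcases hadj' _ ha _ hb h with h | h | h | h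
        · left; rw [h]
        · omega
        · right; congr 1; omega
        · omega
    by_cases h1 : a + 1 = r
    · have ha' : a = r - 1 := by omega
      refine card_nbrs_eq_two (y := c 0) (z := c (a - 1)) (fun h => ?_) (hmem _ (by omega))
        (hmem _ (by omega)) (by rw [ha']; exact hlast.symm) ?_ ?_
      · have := hinj' 0 (by omega) _ (by omega) h
        omega
      · have := hsucc (a - 1) (by omega)
        rw [Nat.sub_add_cancel (by omega)] at this
        exact this.symm
      · intro w hw h
        obtain ⟨b, hb, rfl⟩ := Finset.mem_image.1 hw
        rw [Finset.mem_range] at hb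
        rcases hadj' _ ha _ hb h with h | h | h | h
        · omega
        · right; congr 1; omega
        · omega
        · left; rw [h.1]
    · refine card_nbrs_eq_two (y := c (a + 1)) (z := c (a - 1)) (fun h => ?_) (hmem _ (by omega))
        (hmem _ (by omega)) (hsucc a (by omega)) ?_ ?_
      · have := hinj' (a + 1) (by omega) _ (by omega) h
        omega
      · have := hsucc (a - 1) (by omega)
        rw [Nat.sub_add_cancel (by omega)] at this
        exact this.symm
      · intro w hw h
        obtain ⟨b, hb, rfl⟩ := Finset.mem_image.1 hw
        rw [Finset.mem_range] at hb
        rcases hadj' _ ha _ hb h with h | h | h | h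
        · left; rw [h]
        · right; congr 1; omega
        · omega
        · omega
  · intro T hT hne hcl
    have hdown : ∀ a, a < r → c a ∈ T → c 0 ∈ T := by
      intro a
      induction a with
      | zero => exact fun _ h => h
      | succ a ih =>
        intro ha h
        exact ih (by omega) (hcl _ h _ (hmem a (by omega)) (hsucc a ha).symm)
    have h0 : c 0 ∈ T := by
      obtain ⟨x, hx⟩ := hne
      obtain ⟨a, ha, rfl⟩ := Finset.mem_image.1 (hT hx)
      exact hdown a (Finset.mem_range.1 ha) hx
    have hup : ∀ a, a < r → c a ∈ T := by
      intro a
      induction a with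
      | zero => exact fun _ => h0
      | succ a ih => exact fun ha => hcl _ (ih (by omega)) _ (hmem _ ha) (hsucc a ha)
    apply Finset.Subset.antisymm hT
    intro x hx
    obtain ⟨a, ha, rfl⟩ := Finset.mem_image.1 hx
    exact hup a (Finset.mem_range.1 ha)

/-! ### Theta graphs and spiders. -/

/-- Paths from the vertex `(0, 0)`, where the path with index `j` consists of the vertices `(i, j)`
with `1 ≤ i ≤ d`. Their ends are pairwise adjacent if `c` holds, and they are adjacent to the vertex
`(d + 1, 0)`. -/
def legGraph (d : ℕ) (c : Prop) : SimpleGraph (ℕ × ℕ) where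
  Adj x y := (x.1 + 1 = y.1 ∧ y.1 ≤ d + 1 ∧ (x.2 = y.2 ∨ x.1 = 0 ∨ y.1 = d + 1)) ∨
    (y.1 + 1 = x.1 ∧ x.1 ≤ d + 1 ∧ (x.2 = y.2 ∨ y.1 = 0 ∨ x.1 = d + 1)) ∨
    (c ∧ x.1 = d ∧ y.1 = d ∧ x.2 ≠ y.2)
  symm := ⟨by
    rintro x y (⟨h1, h2, h3⟩ | ⟨h1, h2, h3⟩ | ⟨h, h1, h2, h3⟩)
    · exact Or.inr (Or.inl ⟨h1, h2, h3.imp_left Eq.symm⟩)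
    · exact Or.inl ⟨h1, h2, h3.imp_left Eq.symm⟩
    · exact Or.inr (Or.inr ⟨h, h2, h1, h3.symm⟩)⟩
  loopless := ⟨by
    rintro x (⟨h1, -⟩ | ⟨h1, -⟩ | ⟨-, -, -, h3⟩)
    · omega
    · omega
    · exact h3 rfl⟩

theorem legGraph_adj {d : ℕ} {c : Prop} {a b i j : ℕ} : (legGraph d c).Adj (a, b) (i, j) ↔
    (a + 1 = i ∧ i ≤ d + 1 ∧ (b = j ∨ a = 0 ∨ i = d + 1)) ∨
    (i + 1 = a ∧ a ≤ d + 1 ∧ (b = j ∨ i = 0 ∨ a = d + 1)) ∨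
    (c ∧ a = d ∧ i = d ∧ b ≠ j) := Iff.rfl

theorem legGraph_false_adj {d a b i j : ℕ} : (legGraph d False).Adj (a, b) (i, j) ↔
    (a + 1 = i ∧ i ≤ d + 1 ∧ (b = j ∨ a = 0 ∨ i = d + 1)) ∨
    (i + 1 = a ∧ a ≤ d + 1 ∧ (b = j ∨ i = 0 ∨ a = d + 1)) := by
  rw [legGraph_adj, false_and, or_false]

theorem legGraph_true_adj {d a b i j : ℕ} : (legGraph d True).Adj (a, b) (i, j) ↔
    (a + 1 = i ∧ i ≤ d + 1 ∧ (b = j ∨ a = 0 ∨ i = d + 1)) ∨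
    (i + 1 = a ∧ a ≤ d + 1 ∧ (b = j ∨ i = 0 ∨ a = d + 1)) ∨ (a = d ∧ i = d ∧ b ≠ j) := by
  rw [legGraph_adj, true_and]

/-- The vertices `(i, j)` with `1 ≤ i ≤ d`. -/
def leg (d j : ℕ) : Finset (ℕ × ℕ) :=
  Finset.Icc 1 d ×ˢ {j}

theorem mem_leg {d j a b : ℕ} : (a, b) ∈ leg d j ↔ (1 ≤ a ∧ a ≤ d) ∧ b = j := by
  simp only [leg, Finset.mem_product, Finset.mem_Icc, Finset.mem_singleton]

theorem card_leg (d j : ℕ) : (leg d j).card = d := by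
  simp [leg]

theorem disjoint_leg (d : ℕ) {i j : ℕ} (h : i ≠ j) : Disjoint (leg d i) (leg d j) := by
  rw [Finset.disjoint_left]
  rintro ⟨a, b⟩ h1 h2
  rw [mem_leg] at h1 h2
  omega

theorem exists_pair_of_mem_powersetCard {N : ℕ} {U : Finset ℕ}
    (hU : U ∈ (Finset.range N).powersetCard 2) :
    ∃ i j, i < j ∧ j < N ∧ U = {i, j} := by
  rw [Finset.mem_powersetCard] at hU
  obtain ⟨i, j, hij, rfl⟩ := Finset.card_eq_two.1 hU.2
  have hi : i < N := Finset.mem_range.1 (hU.1 (by simp))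
  have hj : j < N := Finset.mem_range.1 (hU.1 (by simp))
  rcases lt_or_gt_of_ne hij with h | h
  · exact ⟨i, j, h, hj, rfl⟩
  · exact ⟨j, i, h, hi, Finset.pair_comm _ _⟩

theorem tendsto_choose_two : Tendsto (fun N : ℕ => ((N.choose 2 : ℕ) : ℝ) / (N : ℝ) ^ 2) atTop
    (𝓝 (1 / 2)) := by
  have h1 : Tendsto (fun N : ℕ => (1 / 2 : ℝ) - (1 / 2) / (N : ℝ)) atTop (𝓝 (1 / 2 - 0)) :=
    tendsto_const_nhds.sub (tendsto_const_div_atTop_nhds_zero_nat _)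
  rw [sub_zero] at h1
  refine h1.congr' ?_
  filter_upwards [eventually_gt_atTop 0] with N hN
  have : (N : ℝ) ≠ 0 := by positivity
  rw [Nat.cast_choose_two]
  field_simp

/-- `N` paths of `d` vertices join two poles. Inner vertices have degree two, so a cycle that enters
a leg runs along it to both poles, and it consists of two legs. All pairs of legs occur; their
number is about `2 * (N / 2) ^ 2`. -/
theorem choose_two_le_psiCycle_theta {d n N : ℕ} (hd : 0 < d) (hn : 2 + d * N ≤ n) :
    N.choose 2 ≤ PsiCycle (2 * d + 2) (progression 2 2 d) n := by
  set K : Finset (ℕ × ℕ) := {(0, 0), (d + 1, 0)} with hK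
  have hKmem : ∀ a b, (a, b) ∈ K ↔ (a = 0 ∧ b = 0) ∨ (a = d + 1 ∧ b = 0) := by
    intro a b
    simp [hK]
  have hKc : K.card = 2 := Finset.card_pair (by simp)
  have hKd : ∀ i, Disjoint K (leg d i) := by
    intro i
    rw [Finset.disjoint_left]
    rintro ⟨a, b⟩ h1 h2
    rw [hKmem] at h1
    rw [mem_leg] at h2
    omega
  have hspan : ∀ i j a b, (a, b) ∈ legSpan K (leg d) {i, j} ↔
      ((a = 0 ∧ b = 0) ∨ (a = d + 1 ∧ b = 0)) ∨ ((1 ≤ a ∧ a ≤ d) ∧ (b = i ∨ b = j)) := by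
    intro i j a b
    rw [mem_legSpan, hKmem]
    simp only [Finset.mem_insert, Finset.mem_singleton, mem_leg]
    constructor
    · rintro (h | ⟨k, h1, h2⟩)
      · exact Or.inl h
      · right; omega
    · rintro (h | ⟨h1, h2⟩)
      · exact Or.inl h
      · exact Or.inr ⟨b, h2, h1, rfl⟩
  set S : Finset (ℕ × ℕ) := K ∪ Finset.Icc 1 d ×ˢ Finset.range N with hS
  have hSmem : ∀ a b, (a, b) ∈ S ↔
      ((a = 0 ∧ b = 0) ∨ (a = d + 1 ∧ b = 0)) ∨ ((1 ≤ a ∧ a ≤ d) ∧ b < N) := by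
    intro a b
    simp [hS, hKmem]
  have hcard : ((Finset.range N).powersetCard 2).card = N.choose 2 := by simp
  rw [← hcard]
  refine card_le_psiCycle_of_legs (G := legGraph d False) (S := S) (K := K) (leg := leg d)
    (by omega) hd ?_ hKc (card_leg d) hKd (fun i j h => disjoint_leg d h) ?_ ?_
  · refine (Finset.card_union_le _ _).trans ?_
    rw [hKc, Finset.card_product]
    simpa using hn
  · intro A hAS hA
    have hstep : ∀ a b, (a, b) ∈ A → 1 ≤ a → a ≤ d →
        (if a = 1 then (0, 0) else (a - 1, b)) ∈ A ∧
        (if a = d then (d + 1, 0) else (a + 1, b)) ∈ A := by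
      intro a b hab h1 h2
      apply hA.mem_of_nbrs hab
      rintro ⟨a', b'⟩ hab' hadj
      have := (hSmem a' b').1 (hAS hab')
      rw [legGraph_false_adj] at hadj
      split_ifs <;> simp only [Prod.mk.injEq] <;> omega
    have hdown : ∀ a b, (a, b) ∈ A → 1 ≤ a → a ≤ d →
        (0, 0) ∈ A ∧ ∀ k, 1 ≤ k → k ≤ a → (k, b) ∈ A := by
      intro a b hab h1
      induction a, h1 using Nat.le_induction with
      | base =>
        intro h
        refine ⟨by simpa using (hstep 1 b hab le_rfl h).1, fun k h1 h2 => ?_⟩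
        rwa [show k = 1 by omega]
      | succ a h1 ih =>
        intro h
        have h2 := (hstep (a + 1) b hab (by omega) h).1
        rw [if_neg (by omega), Nat.add_sub_cancel] at h2
        obtain ⟨h3, h4⟩ := ih h2 (by omega)
        refine ⟨h3, fun k hk1 hk2 => ?_⟩
        rcases Nat.lt_or_ge k (a + 1) with hk | hk
        · exact h4 k hk1 (by omega)
        · rwa [show k = a + 1 by omega]
    have hup : ∀ m a b, a + m = d → (a, b) ∈ A → 1 ≤ a → (d, b) ∈ A ∧ (d + 1, 0) ∈ A := by
      intro m
      induction m with
      | zero =>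
        intro a b ha hab h1
        obtain rfl : a = d := by omega
        exact ⟨hab, by simpa using (hstep a b hab h1 le_rfl).2⟩
      | succ m ih =>
        intro a b ha hab h1
        have h2 := (hstep a b hab h1 (by omega)).2
        rw [if_neg (by omega)] at h2
        exact ih (a + 1) b (by omega) h2 (by omega)
    obtain ⟨⟨a, b⟩, habA, habK⟩ : ∃ x ∈ A, x ∉ K :=
      Finset.exists_mem_notMem_of_card_lt_card (by rw [hKc, hA.1]; omega)
    have hab := (hSmem a b).1 (hAS habA)
    rw [hKmem] at habK
    have h0 := (hdown a b habA (by omega) (by omega)).1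
    have htop := (hup (d - a) a b (by omega) habA (by omega)).2
    obtain ⟨⟨y, i⟩, hy, ⟨z, j⟩, hz, hyz, hxy, hxz⟩ := hA.exists_two_nbrs h0
    have hy' := (hSmem y i).1 (hAS hy)
    have hz' := (hSmem z j).1 (hAS hz)
    rw [legGraph_false_adj] at hxy hxz
    obtain rfl : y = 1 := by omega
    obtain rfl : z = 1 := by omega
    have hij : i ≠ j := fun h => hyz (by rw [h])
    refine ⟨{i, j}, Finset.card_pair hij, (Finset.eq_of_subset_of_card_le ?_ ?_).symm⟩
    · have hi := hdown d i (hup (d - 1) 1 i (by omega) hy le_rfl).1 hd le_rfl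
      have hj := hdown d j (hup (d - 1) 1 j (by omega) hz le_rfl).1 hd le_rfl
      rintro ⟨a, b⟩ hab
      rw [hspan] at hab
      rcases hab with (⟨rfl, rfl⟩ | ⟨rfl, rfl⟩) | ⟨⟨h1, h2⟩, rfl | rfl⟩
      · exact h0
      · exact htop
      · exact hi.2 a h1 h2
      · exact hj.2 a h1 h2
    · rw [hA.1, card_legSpan hKc (card_leg d) hKd (fun i j h => disjoint_leg d h),
        Finset.card_pair hij]
      omega
  · intro U hU
    obtain ⟨i, j, hij, hjN, rfl⟩ := exists_pair_of_mem_powersetCard hU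
    constructor
    · rintro ⟨a, b⟩ hab
      rw [hspan] at hab
      rw [hSmem]
      omega
    -- From the first pole up along leg `i`, over the second pole, and down along leg `j`.
    · set c : ℕ → ℕ × ℕ := fun k => if k = 0 then (0, 0) else if k ≤ d then (k, i) else
        if k = d + 1 then (d + 1, 0) else (2 * d + 2 - k, j) with hc
      have hcyc : CycSet (legGraph d False) (2 * d + 2) ((Finset.range (2 * d + 2)).image c) := by
        refine CycSet.of_enum (r := 2 * d + 2) (by omega) c ?_ ?_
        · intro a b hab hb
          simp only [hc]
          split_ifs <;> simp only [ne_eq, Prod.mk.injEq] <;> omega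
        · intro a b hab hb
          simp only [hc]
          split_ifs <;> rw [legGraph_false_adj] <;> omega
      have heq : (Finset.range (2 * d + 2)).image c = legSpan K (leg d) {i, j} := by
        apply Finset.eq_of_subset_of_card_le
        · intro x hx
          obtain ⟨k, hk, rfl⟩ := Finset.mem_image.1 hx
          rw [Finset.mem_range] at hk
          simp only [hc]
          split_ifs <;> rw [hspan] <;> omega
        · rw [hcyc.1, card_legSpan hKc (card_leg d) hKd (fun i j h => disjoint_leg d h),
            Finset.card_pair hij.ne]
          omega
      rwa [heq] at hcyc

/-- The legs share one centre and their ends form a clique. A cycle that avoids the centre would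
consist of ends and contain a triangle; one through the centre follows two legs, whose ends are
adjacent. `d ≥ 2` makes the cycle longer than a triangle. -/
theorem choose_two_le_psiCycle_spider {d n N : ℕ} (hd : 2 ≤ d) (hn : 1 + d * N ≤ n) :
    N.choose 2 ≤ PsiCycle (2 * d + 1) (progression 1 2 d) n := by
  set K : Finset (ℕ × ℕ) := {(0, 0)} with hK
  have hKmem : ∀ a b, (a, b) ∈ K ↔ a = 0 ∧ b = 0 := by
    intro a b
    simp [hK]
  have hKc : K.card = 1 := Finset.card_singleton _
  have hKd : ∀ i, Disjoint K (leg d i) := by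
    intro i
    rw [Finset.disjoint_left]
    rintro ⟨a, b⟩ h1 h2
    rw [hKmem] at h1
    rw [mem_leg] at h2
    omega
  have hspan : ∀ i j a b, (a, b) ∈ legSpan K (leg d) {i, j} ↔
      (a = 0 ∧ b = 0) ∨ ((1 ≤ a ∧ a ≤ d) ∧ (b = i ∨ b = j)) := by
    intro i j a b
    rw [mem_legSpan, hKmem]
    simp only [Finset.mem_insert, Finset.mem_singleton, mem_leg]
    constructor
    · rintro (h | ⟨k, h1, h2⟩)
      · exact Or.inl h
      · right; omega
    · rintro (h | ⟨h1, h2⟩)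
      · exact Or.inl h
      · exact Or.inr ⟨b, h2, h1, rfl⟩
  set S : Finset (ℕ × ℕ) := K ∪ Finset.Icc 1 d ×ˢ Finset.range N with hS
  have hSmem : ∀ a b, (a, b) ∈ S ↔ (a = 0 ∧ b = 0) ∨ ((1 ≤ a ∧ a ≤ d) ∧ b < N) := by
    intro a b
    simp [hS, hKmem]
  have hcard : ((Finset.range N).powersetCard 2).card = N.choose 2 := by simp
  rw [← hcard]
  refine card_le_psiCycle_of_legs (G := legGraph d True) (S := S) (K := K) (leg := leg d)
    (by omega) (by omega) ?_ hKc (card_leg d) hKd (fun i j h => disjoint_leg d h) ?_ ?_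
  · refine (Finset.card_union_le _ _).trans ?_
    rw [hKc, Finset.card_product]
    simpa using hn
  · intro A hAS hA
    have hstep : ∀ a b, (a, b) ∈ A → 1 ≤ a → a < d →
        (if a = 1 then (0, 0) else (a - 1, b)) ∈ A ∧ (a + 1, b) ∈ A := by
      intro a b hab h1 h2
      apply hA.mem_of_nbrs hab
      rintro ⟨a', b'⟩ hab' hadj
      have := (hSmem a' b').1 (hAS hab')
      rw [legGraph_true_adj] at hadj
      split_ifs <;> simp only [Prod.mk.injEq] <;> omega
    have hdown : ∀ a b, (a, b) ∈ A → 1 ≤ a → a < d → (0, 0) ∈ A := by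
      intro a b hab h1
      induction a, h1 using Nat.le_induction with
      | base => exact fun h => by simpa using (hstep 1 b hab le_rfl h).1
      | succ a h1 ih =>
        intro h
        have h2 := (hstep (a + 1) b hab (by omega) h).1
        rw [if_neg (by omega), Nat.add_sub_cancel] at h2
        exact ih h2 (by omega)
    have hup : ∀ b, (1, b) ∈ A → ∀ a, 1 ≤ a → a ≤ d → (a, b) ∈ A := by
      intro b hb a h1
      induction a, h1 using Nat.le_induction with
      | base => exact fun _ => hb
      | succ a h1 ih => exact fun h => (hstep a b (ih (by omega)) h1 (by omega)).2
    have h0 : (0, 0) ∈ A := by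
      by_contra h0
      have hend : ∀ a b, (a, b) ∈ A → a = d := by
        intro a b hab
        have := (hSmem a b).1 (hAS hab)
        by_contra had
        rcases this with ⟨rfl, rfl⟩ | h
        · exact h0 hab
        · exact h0 (hdown a b hab h.1.1 (by omega))
      obtain ⟨x, hx⟩ := Finset.card_pos.1 (by rw [hA.1]; omega)
      obtain ⟨⟨y, i⟩, hy, ⟨z, j⟩, hz, hyz, hxy, hxz⟩ := hA.exists_two_nbrs hx
      refine hA.no_triangle (by omega) hx hy hz hxy ?_ hxz
      have h1 := hend y i hy
      have h2 := hend z j hz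
      rw [legGraph_true_adj]
      refine Or.inr (Or.inr ⟨h1, h2, fun h => hyz ?_⟩)
      rw [h1, h2, h]
    obtain ⟨⟨y, i⟩, hy, ⟨z, j⟩, hz, hyz, hxy, hxz⟩ := hA.exists_two_nbrs h0
    have hy' := (hSmem y i).1 (hAS hy)
    have hz' := (hSmem z j).1 (hAS hz)
    rw [legGraph_true_adj] at hxy hxz
    obtain rfl : y = 1 := by omega
    obtain rfl : z = 1 := by omega
    have hij : i ≠ j := fun h => hyz (by rw [h])
    refine ⟨{i, j}, Finset.card_pair hij, (Finset.eq_of_subset_of_card_le ?_ ?_).symm⟩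
    · rintro ⟨a, b⟩ hab
      rw [hspan] at hab
      rcases hab with ⟨rfl, rfl⟩ | ⟨⟨h1, h2⟩, rfl | rfl⟩
      · exact h0
      · exact hup b hy a h1 h2
      · exact hup b hz a h1 h2
    · rw [hA.1, card_legSpan hKc (card_leg d) hKd (fun i j h => disjoint_leg d h),
        Finset.card_pair hij]
      omega
  · intro U hU
    obtain ⟨i, j, hij, hjN, rfl⟩ := exists_pair_of_mem_powersetCard hU
    constructor
    · rintro ⟨a, b⟩ hab
      rw [hspan] at hab
      rw [hSmem]
      omega
    · set c : ℕ → ℕ × ℕ := fun k => if k = 0 then (0, 0) else if k ≤ d then (k, i) else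
        (2 * d + 1 - k, j) with hc
      have hcyc : CycSet (legGraph d True) (2 * d + 1) ((Finset.range (2 * d + 1)).image c) := by
        refine CycSet.of_enum (r := 2 * d + 1) (by omega) c ?_ ?_
        · intro a b hab hb
          simp only [hc]
          split_ifs <;> simp only [ne_eq, Prod.mk.injEq] <;> omega
        · intro a b hab hb
          simp only [hc]
          split_ifs <;> rw [legGraph_true_adj] <;> omega
      have heq : (Finset.range (2 * d + 1)).image c = legSpan K (leg d) {i, j} := by
        apply Finset.eq_of_subset_of_card_le
        · intro x hx
          obtain ⟨k, hk, rfl⟩ := Finset.mem_image.1 hx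
          rw [Finset.mem_range] at hk
          simp only [hc]
          split_ifs <;> rw [hspan] <;> omega
        · rw [hcyc.1, card_legSpan hKc (card_leg d) hKd (fun i j h => disjoint_leg d h),
            Finset.card_pair hij.ne]
          omega
      rwa [heq] at hcyc

theorem asympGe_two_of_choose_two {r l d : ℕ} (hd : 0 < d) (hr : r = l + 2 * d)
    (h : ∀ n N : ℕ, l + d * N ≤ n → N.choose 2 ≤ PsiCycle r (progression l 2 d) n) :
    AsympGe (PsiCycle r (progression l 2 d)) 2 (bench r l 2) := by
  refine asympGe_of_le (p := fun N => (N.choose 2 : ℕ)) (k := d) hr (by omega) hd hd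
    tendsto_choose_two (by push_cast; ring) ?_
  intro n N _ hn
  exact_mod_cast h n N hn

theorem asympGe_two_theta {d : ℕ} (hd : 0 < d) :
    AsympGe (PsiCycle (2 * d + 2) (progression 2 2 d)) 2 (bench (2 * d + 2) 2 2) :=
  asympGe_two_of_choose_two hd (by ring) fun _ _ h => choose_two_le_psiCycle_theta hd h

theorem asympGe_two_spider {d : ℕ} (hd : 2 ≤ d) :
    AsympGe (PsiCycle (2 * d + 1) (progression 1 2 d)) 2 (bench (2 * d + 1) 1 2) :=
  asympGe_two_of_choose_two (by omega) (by ring) fun _ _ h => choose_two_le_psiCycle_spider hd h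

/-! ### Induced four-cycles through a common vertex. -/

/-- A vertex `0`, an independent set `1, …, m` of neighbours of `0`, and a clique of all larger
vertices, which are adjacent to all vertices but `0`. -/
def squareGraph (m : ℕ) : SimpleGraph ℕ where
  Adj x y := x ≠ y ∧ ((x = 0 ∧ y ≤ m) ∨ (y = 0 ∧ x ≤ m) ∨ (x ≠ 0 ∧ m < y) ∨ (y ≠ 0 ∧ m < x))
  symm := ⟨by
    rintro x y ⟨h1, h2⟩
    exact ⟨h1.symm, by tauto⟩⟩
  loopless := ⟨by
    rintro x ⟨h1, -⟩
    exact h1 rfl⟩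

theorem squareGraph_adj {m x y : ℕ} : (squareGraph m).Adj x y ↔
    x ≠ y ∧ ((x = 0 ∧ y ≤ m) ∨ (y = 0 ∧ x ≤ m) ∨ (x ≠ 0 ∧ m < y) ∨ (y ≠ 0 ∧ m < x)) := Iff.rfl

/-- Among the nonzero vertices a clique vertex would have degree three in the cycle, and the others
are independent. -/
theorem zero_mem_of_cycSet_squareGraph {m : ℕ} {A : Finset ℕ} (hA : CycSet (squareGraph m) 4 A) :
    0 ∈ A := by
  by_contra h0
  have hne : ∀ x ∈ A, x ≠ 0 := by
    rintro x hx rfl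
    exact h0 hx
  have hle : ∀ x ∈ A, x ≤ m := by
    intro x hx
    by_contra hxm
    have h1 : A.erase x ⊆ nbrs (squareGraph m) A x := by
      intro y hy
      obtain ⟨hyx, hyA⟩ := Finset.mem_erase.1 hy
      refine mem_nbrs.2 ⟨hyA, squareGraph_adj.2 ⟨hyx.symm, Or.inr (Or.inr (Or.inr ?_))⟩⟩
      exact ⟨hne y hyA, by omega⟩
    have h2 := Finset.card_le_card h1
    rw [hA.2.1 x hx, Finset.card_erase_of_mem hx, hA.1] at h2
    omega
  obtain ⟨x, hx⟩ := Finset.card_pos.1 (by rw [hA.1]; omega)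
  obtain ⟨y, hy, -, -, -, hxy, -⟩ := hA.exists_two_nbrs hx
  have := hle x hx
  have := hle y hy
  have := hne x hx
  have := hne y hy
  rw [squareGraph_adj] at hxy
  omega

/-- The cycles consist of `0`, two of `2 N` independent vertices and one of `N` clique vertices.
This makes about `2 N ^ 3` cycles while the benchmark is about `N ^ 3`, because the two neighbours
of `0` come unordered from one class. -/
theorem choose_two_mul_le_psiCycle {n N : ℕ} (hn : 1 + 3 * N ≤ n) :
    (2 * N).choose 2 * N ≤ PsiCycle 4 (progression 1 3 1) n := by
  set leg : ℕ → Finset ℕ := fun i => {i + 1} with hleg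
  have hKd : ∀ i, Disjoint ({0} : Finset ℕ) (leg i) := by simp [hleg]
  have hld : ∀ i j, i ≠ j → Disjoint (leg i) (leg j) := by
    intro i j h
    simp only [hleg, Finset.disjoint_singleton]
    omega
  have hinj : Set.InjOn (fun p : Finset ℕ × ℕ => insert (2 * N + p.2) p.1)
      ((((Finset.range (2 * N)).powersetCard 2) ×ˢ Finset.range N : Finset (Finset ℕ × ℕ)) :
        Set (Finset ℕ × ℕ)) := by
    rintro ⟨U, c⟩ hU ⟨U', c'⟩ hU' h
    simp only [Finset.mem_coe, Finset.mem_product, Finset.mem_powersetCard] at hU hU'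
    have hlt : ∀ x ∈ U, x < 2 * N := fun x hx => Finset.mem_range.1 (hU.1.1 hx)
    have hlt' : ∀ x ∈ U', x < 2 * N := fun x hx => Finset.mem_range.1 (hU'.1.1 hx)
    simp only at h
    have hU1 : (insert (2 * N + c) U).filter (· < 2 * N) = U := by
      rw [Finset.filter_insert, if_neg (by omega), Finset.filter_true_of_mem hlt]
    have hU2 : (insert (2 * N + c') U').filter (· < 2 * N) = U' := by
      rw [Finset.filter_insert, if_neg (by omega), Finset.filter_true_of_mem hlt']
    have hc : 2 * N + c ∈ insert (2 * N + c') U' := by rw [← h]; simp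
    rw [Finset.mem_insert] at hc
    have hc' : c = c' := by
      rcases hc with hc | hc
      · omega
      · have := hlt' _ hc
        omega
    rw [Prod.mk.injEq]
    exact ⟨by rw [← hU1, ← hU2, h], hc'⟩
  have hcard : (((((Finset.range (2 * N)).powersetCard 2) ×ˢ Finset.range N).image
      fun p : Finset ℕ × ℕ => insert (2 * N + p.2) p.1)).card = (2 * N).choose 2 * N := by
    rw [Finset.card_image_of_injOn hinj, Finset.card_product]
    simp
  rw [← hcard]
  refine card_le_psiCycle_of_legs (G := squareGraph (2 * N)) (S := Finset.range (1 + 3 * N))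
    (K := {0}) (leg := leg) (by omega) one_pos (by simpa using hn) (Finset.card_singleton _)
    (by simp [hleg]) hKd hld ?_ ?_
  · intro A _ hA
    have h0 := zero_mem_of_cycSet_squareGraph hA
    -- Every nonzero vertex `i + 1` is a leg of its own with index `i`, so only the membership of
    -- `0` had to be proved.
    refine ⟨(A.erase 0).image (· - 1), ?_, ?_⟩
    · rw [Finset.card_image_of_injOn, Finset.card_erase_of_mem h0, hA.1]
      intro x hx y hy h
      have hx := Finset.ne_of_mem_erase hx
      have hy := Finset.ne_of_mem_erase hy
      simp only at h
      omega
    · ext x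
      simp only [mem_legSpan, hleg, Finset.mem_singleton, Finset.mem_image, Finset.mem_erase]
      constructor
      · intro hx
        by_cases hx0 : x = 0
        · exact Or.inl hx0
        · exact Or.inr ⟨x - 1, ⟨x, ⟨hx0, hx⟩, rfl⟩, by omega⟩
      · rintro (rfl | ⟨i, ⟨y, ⟨hy0, hy⟩, rfl⟩, rfl⟩)
        · exact h0
        · rwa [Nat.sub_add_cancel (by omega)]
  · intro U hU
    obtain ⟨⟨W, c⟩, hW, rfl⟩ := Finset.mem_image.1 hU
    rw [Finset.mem_product] at hW
    obtain ⟨i, j, hij, hjN, hWij⟩ := exists_pair_of_mem_powersetCard hW.1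
    have hcN := Finset.mem_range.1 hW.2
    simp only at hWij hcN
    subst hWij
    have hspan : ∀ x, x ∈ legSpan {0} leg (insert (2 * N + c) {i, j}) ↔
        x = 0 ∨ x = 2 * N + c + 1 ∨ x = i + 1 ∨ x = j + 1 := by
      intro x
      simp [mem_legSpan, hleg]
    constructor
    · intro x hx
      rw [hspan] at hx
      rw [Finset.mem_range]
      omega
    · set e : ℕ → ℕ := fun k => if k = 0 then 0 else if k = 1 then i + 1 else
        if k = 2 then 2 * N + c + 1 else j + 1 with he
      have hcyc : CycSet (squareGraph (2 * N)) 4 ((Finset.range 4).image e) := by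
        refine CycSet.of_enum (r := 4) (by omega) e ?_ ?_
        · intro a b hab hb
          simp only [he]
          split_ifs <;> omega
        · intro a b hab hb
          simp only [he]
          split_ifs <;> rw [squareGraph_adj] <;> omega
      have heq : (Finset.range 4).image e = legSpan {0} leg (insert (2 * N + c) {i, j}) := by
        ext x
        rw [hspan, Finset.mem_image]
        constructor
        · rintro ⟨k, hk, rfl⟩
          simp only [he]
          split_ifs <;> omega
        · rintro (rfl | rfl | rfl | rfl)
          · exact ⟨0, by simp, by simp [he]⟩
          · exact ⟨2, by simp, by simp [he]⟩
          · exact ⟨1, by simp, by simp [he]⟩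
          · exact ⟨3, by simp, by simp [he]⟩
      rwa [heq] at hcyc

theorem asympGe_two_square :
    AsympGe (PsiCycle 4 (progression 1 3 1)) 2 (bench 4 1 3) := by
  refine asympGe_of_le (p := fun N => ((2 * N).choose 2 * N : ℕ)) (a := 2) (k := 3) (d := 1)
    rfl (by omega) one_pos (by omega) ?_ (by norm_num) ?_
  · have h1 : Tendsto (fun N : ℕ => (2 : ℝ) - 1 / (N : ℝ)) atTop (𝓝 (2 - 0)) :=
      tendsto_const_nhds.sub (tendsto_const_div_atTop_nhds_zero_nat _)
    rw [sub_zero] at h1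
    refine h1.congr' ?_
    filter_upwards [eventually_gt_atTop 0] with N hN
    have : (N : ℝ) ≠ 0 := by positivity
    rw [Nat.cast_mul, Nat.cast_choose_two]
    push_cast
    field_simp
  · intro n N _ hn
    exact_mod_cast choose_two_mul_le_psiCycle hn

/-! ### Parallel paths inside an induced cycle. -/

/-- An induced cycle which contains two paths `P` and `P'` with `d` vertices and common neighbours of
their first and of their last vertices has no further vertices. -/
theorem CycSet.eq_of_two_paths {V : Type*} [DecidableEq V] {G : SimpleGraph V} {A : Finset V} {d r : ℕ}
    (hA : CycSet G r A) (hd : 0 < d) {P P' : ℕ → V} {y z : V}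
    (hy : y ∈ A) (hz : z ∈ A) (hyz : y ≠ z) (hP : ∀ k < d, P k ∈ A ∧ P' k ∈ A)
    (hne : ∀ k < d, P k ≠ P' k)
    (hpath : ∀ k, k + 1 < d → G.Adj (P k) (P (k + 1)) ∧ G.Adj (P' k) (P' (k + 1)))
    (hinj : ∀ i < d, ∀ k < d, P i = P k → i = k) (hinj' : ∀ i < d, ∀ k < d, P' i = P' k → i = k)
    (hyP : G.Adj (P 0) y ∧ G.Adj (P' 0) y) (hzP : G.Adj (P (d - 1)) z ∧ G.Adj (P' (d - 1)) z)
    (hyk : ∀ k < d, y ≠ P k ∧ y ≠ P' k) (hzk : ∀ k < d, z ≠ P k ∧ z ≠ P' k) :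
    {y, z} ∪ ((Finset.range d).image P ∪ (Finset.range d).image P') = A := by
  set I : Finset V := {y, z} ∪ ((Finset.range d).image P ∪ (Finset.range d).image P') with hI
  have hyI : y ∈ I := by simp [hI]
  have hzI : z ∈ I := by simp [hI]
  have hPI : ∀ k < d, P k ∈ I := fun k hk => by
    simp only [hI, Finset.mem_union, Finset.mem_image, Finset.mem_range]
    exact Or.inr (Or.inl ⟨k, hk, rfl⟩)
  have hPI' : ∀ k < d, P' k ∈ I := fun k hk => by
    simp only [hI, Finset.mem_union, Finset.mem_image, Finset.mem_range]
    exact Or.inr (Or.inr ⟨k, hk, rfl⟩)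
  have hmem : ∀ x ∈ I, (x = y ∨ x = z) ∨ (∃ k < d, P k = x) ∨ ∃ k < d, P' k = x := by
    intro x hx
    simpa [hI, or_assoc] using hx
  have hdeg : ∀ Q : ℕ → V, (∀ k < d, Q k ∈ I) → (∀ k, k + 1 < d → G.Adj (Q k) (Q (k + 1))) →
      (∀ i < d, ∀ k < d, Q i = Q k → i = k) → G.Adj (Q 0) y → G.Adj (Q (d - 1)) z →
      (∀ k < d, y ≠ Q k) → (∀ k < d, z ≠ Q k) → ∀ k < d, 2 ≤ (nbrs G I (Q k)).card := by
    intro Q hQ hadj hinj hQy hQz hy' hz' k hk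
    rcases Nat.eq_zero_or_pos k with rfl | hk0
    · rcases Nat.lt_or_ge 1 d with h1 | h1
      · exact two_le_card_nbrs hyI (hQ 1 h1) (hy' 1 h1) hQy (hadj 0 h1)
      · obtain rfl : d = 1 := by omega
        exact two_le_card_nbrs hyI hzI hyz hQy hQz
    · have hprev : G.Adj (Q k) (Q (k - 1)) := by
        have := hadj (k - 1) (by omega)
        rw [Nat.sub_add_cancel hk0] at this
        exact this.symm
      rcases Nat.lt_or_ge (k + 1) d with h1 | h1
      · refine two_le_card_nbrs (hQ (k - 1) (by omega)) (hQ (k + 1) h1) (fun e => ?_) hprev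
          (hadj k h1)
        have := hinj _ (by omega) _ h1 e
        omega
      · obtain rfl : k = d - 1 := by omega
        exact two_le_card_nbrs hzI (hQ _ (by omega)) (hz' _ (by omega)) hQz hprev
  apply hA.eq_of_subset
  · intro x hx
    rcases hmem x hx with (rfl | rfl) | ⟨k, hk, rfl⟩ | ⟨k, hk, rfl⟩
    · exact hy
    · exact hz
    · exact (hP k hk).1
    · exact (hP k hk).2
  · exact ⟨y, hyI⟩
  · intro x hx
    rcases hmem x hx with (rfl | rfl) | ⟨k, hk, rfl⟩ | ⟨k, hk, rfl⟩
    · exact two_le_card_nbrs (hPI 0 hd) (hPI' 0 hd) (hne 0 hd) hyP.1.symm hyP.2.symm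
    · exact two_le_card_nbrs (hPI (d - 1) (by omega)) (hPI' (d - 1) (by omega))
        (hne _ (by omega)) hzP.1.symm hzP.2.symm
    · exact hdeg P hPI (fun i hi => (hpath i hi).1) hinj hyP.1 hzP.1
        (fun k hk => (hyk k hk).1) (fun k hk => (hzk k hk).1) k hk
    · exact hdeg P' hPI' (fun i hi => (hpath i hi).2) hinj' hyP.2 hzP.2
        (fun k hk => (hyk k hk).2) (fun k hk => (hzk k hk).2) k hk

/-- Two internally disjoint paths `P` and `P'` with `d` vertices which, inside the set `A`, are
attached to the same vertices. -/
structure IsTwinPaths {V : Type*} (G : SimpleGraph V) (A : Finset V) (d : ℕ) (P P' : ℕ → V)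
    (Y Z : V → Prop) : Prop where
  nbr : ∀ i < d, ∀ y ∈ A, G.Adj (P i) y →
    (i + 1 < d ∧ y = P (i + 1)) ∨ (0 < i ∧ y = P (i - 1)) ∨ (i = 0 ∧ Y y) ∨ (i + 1 = d ∧ Z y)
  nbr' : ∀ i < d, ∀ y ∈ A, G.Adj (P' i) y →
    (i + 1 < d ∧ y = P' (i + 1)) ∨ (0 < i ∧ y = P' (i - 1)) ∨ (i = 0 ∧ Y y) ∨ (i + 1 = d ∧ Z y)
  adjY : ∀ y, Y y → G.Adj (P 0) y ∧ G.Adj (P' 0) y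
  adjZ : ∀ z, Z z → G.Adj (P (d - 1)) z ∧ G.Adj (P' (d - 1)) z
  path : ∀ i, i + 1 < d → G.Adj (P i) (P (i + 1)) ∧ G.Adj (P' i) (P' (i + 1))
  inj : ∀ i < d, ∀ k < d, P i = P k → i = k
  inj' : ∀ i < d, ∀ k < d, P' i = P' k → i = k
  ne : ∀ i < d, ∀ k < d, P i ≠ P' k
  neY : ∀ y, Y y → ∀ i < d, y ≠ P i ∧ y ≠ P' i
  neZ : ∀ y, Z y → ∀ i < d, y ≠ P i ∧ y ≠ P' i
  neYZ : ∀ y, Y y → ¬ Z y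

namespace IsTwinPaths
variable {V : Type*} {G : SimpleGraph V} {A : Finset V} {d r : ℕ} {P P' : ℕ → V} {Y Z : V → Prop}

theorem swap (h : IsTwinPaths G A d P P' Y Z) : IsTwinPaths G A d P' P Y Z where
  nbr := h.nbr'
  nbr' := h.nbr
  adjY y hy := (h.adjY y hy).symm
  adjZ y hy := (h.adjZ y hy).symm
  path i hi := (h.path i hi).symm
  inj := h.inj'
  inj' := h.inj
  ne i hi k hk e := h.ne k hk i hi e.symm
  neY y hy i hi := (h.neY y hy i hi).symm
  neZ y hy i hi := (h.neZ y hy i hi).symm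
  neYZ := h.neYZ

theorem rev (h : IsTwinPaths G A d P P' Y Z) (hd : 0 < d) :
    IsTwinPaths G A d (fun i => P (d - 1 - i)) (fun i => P' (d - 1 - i)) Z Y where
  nbr i hi y hy hadj := by
    rcases h.nbr (d - 1 - i) (by omega) y hy hadj with ⟨h1, rfl⟩ | ⟨h1, rfl⟩ | ⟨h1, h2⟩ | ⟨h1, h2⟩
    · exact Or.inr (Or.inl ⟨by omega, congrArg P (by omega)⟩)
    · exact Or.inl ⟨by omega, congrArg P (by omega)⟩
    · exact Or.inr (Or.inr (Or.inr ⟨by omega, h2⟩))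
    · exact Or.inr (Or.inr (Or.inl ⟨by omega, h2⟩))
  nbr' i hi y hy hadj := by
    rcases h.nbr' (d - 1 - i) (by omega) y hy hadj with ⟨h1, rfl⟩ | ⟨h1, rfl⟩ | ⟨h1, h2⟩ | ⟨h1, h2⟩
    · exact Or.inr (Or.inl ⟨by omega, congrArg P' (by omega)⟩)
    · exact Or.inl ⟨by omega, congrArg P' (by omega)⟩
    · exact Or.inr (Or.inr (Or.inr ⟨by omega, h2⟩))
    · exact Or.inr (Or.inr (Or.inl ⟨by omega, h2⟩))
  adjY := h.adjZ
  adjZ y hy := by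
    simpa using h.adjY y hy
  path i hi := by
    have := h.path (d - 1 - (i + 1)) (by omega)
    rw [show d - 1 - (i + 1) + 1 = d - 1 - i by omega] at this
    exact ⟨this.1.symm, this.2.symm⟩
  inj i hi k hk e := by
    have := h.inj _ (by omega) _ (by omega) e
    omega
  inj' i hi k hk e := by
    have := h.inj' _ (by omega) _ (by omega) e
    omega
  ne i hi k hk := h.ne _ (by omega) _ (by omega)
  neY y hy i hi := h.neZ y hy _ (by omega)
  neZ y hy i hi := h.neY y hy _ (by omega)
  neYZ y hy hy' := h.neYZ y hy' hy

/-- If the cycle does not continue to `P (i + 1)`, both neighbours of `P i` lie on the other side.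
For `i > 0` there is only one vertex there; for `i = 0` they are two vertices of `Y`, which are also
adjacent to `P' 0` and close a four-cycle. -/
theorem mem_succ (h : IsTwinPaths G A d P P' Y Z) (hA : CycSet G r A) (hr : 4 < r) {i : ℕ}
    (hi : i + 1 < d) (hP : P i ∈ A) (hP' : P' i ∈ A) : P (i + 1) ∈ A := by
  by_contra hn
  obtain ⟨y, hy, z, hz, hyz, hxy, hxz⟩ := hA.exists_two_nbrs hP
  have key : ∀ y ∈ A, G.Adj (P i) y → (0 < i ∧ y = P (i - 1)) ∨ (i = 0 ∧ Y y) := by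
    intro y hy hxy
    rcases h.nbr i (by omega) y hy hxy with ⟨-, rfl⟩ | h1 | h1 | h1
    · exact absurd hy hn
    · exact Or.inl h1
    · exact Or.inr h1
    · omega
  rcases key y hy hxy with ⟨h1, h2⟩ | ⟨rfl, h2⟩ <;> rcases key z hz hxz with ⟨h3, h4⟩ | ⟨h3, h4⟩
  · exact hyz (h2.trans h4.symm)
  · omega
  · omega
  · exact hA.no_four hr hP hP' hy hz (h.ne 0 (by omega) 0 (by omega)) hyz hxy hxz
      (h.adjY y h2).2 (h.adjY z h4).2

theorem mem_right (h : IsTwinPaths G A d P P' Y Z) (hA : CycSet G r A) (hr : 4 < r) {i : ℕ}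
    (hP : P i ∈ A) (hP' : P' i ∈ A) {k : ℕ} (hik : i ≤ k) (hk : k < d) : P k ∈ A ∧ P' k ∈ A := by
  induction k, hik using Nat.le_induction with
  | base => exact ⟨hP, hP'⟩
  | succ k hik ih =>
    obtain ⟨h1, h2⟩ := ih (by omega)
    exact ⟨h.mem_succ hA hr hk h1 h2, h.swap.mem_succ hA hr hk h2 h1⟩

theorem exists_left (h : IsTwinPaths G A d P P' Y Z) (hA : CycSet G r A) (hr : 4 < r)
    (hd : 0 < d) (hP : P 0 ∈ A) (hP' : P' 0 ∈ A) : ∃ y ∈ A, Y y := by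
  by_contra hn
  push Not at hn
  obtain ⟨y, hy, z, hz, hyz, hxy, hxz⟩ := hA.exists_two_nbrs hP
  have key : ∀ y ∈ A, G.Adj (P 0) y → (1 < d ∧ y = P 1) ∨ (1 = d ∧ Z y) := by
    intro y hy hxy
    rcases h.nbr 0 hd y hy hxy with h1 | h1 | h1 | h1
    · exact Or.inl (by simpa using h1)
    · omega
    · exact absurd h1.2 (hn y hy)
    · exact Or.inr (by simpa using h1)
  rcases key y hy hxy with ⟨h1, h2⟩ | ⟨h1, h2⟩ <;> rcases key z hz hxz with ⟨h3, h4⟩ | ⟨h3, h4⟩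
  · exact hyz (h2.trans h4.symm)
  · omega
  · omega
  · subst h1
    exact hA.no_four hr hP hP' hy hz (h.ne 0 (by omega) 0 (by omega)) hyz hxy hxz
      (h.adjZ y h2).2 (h.adjZ z h4).2

/-- An induced cycle contains corresponding vertices of twin paths only if it consists of the two
paths and two further vertices. -/
theorem false_of_mem (h : IsTwinPaths G A d P P' Y Z) (hA : CycSet G r A) (hr : 4 < r)
    (hrd : r ≠ 2 * d + 2) {i : ℕ} (hi : i < d) (hP : P i ∈ A) (hP' : P' i ∈ A) : False := by
  have hd : 0 < d := by omega
  have hrev := h.rev hd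
  -- Moving right along the reversed paths from `d - 1 - i` to `d - 1` means moving left to the
  -- first vertices.
  have h0 : P 0 ∈ A ∧ P' 0 ∈ A := by
    have := hrev.mem_right hA hr (i := d - 1 - i) (k := d - 1)
      (by rwa [show d - 1 - (d - 1 - i) = i by omega])
      (by rwa [show d - 1 - (d - 1 - i) = i by omega]) (by omega) (by omega)
    simpa using this
  have hall : ∀ k < d, P k ∈ A ∧ P' k ∈ A := fun k hk =>
    h.mem_right hA hr h0.1 h0.2 (Nat.zero_le _) hk
  obtain ⟨y, hy, hYy⟩ := h.exists_left hA hr hd h0.1 h0.2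
  obtain ⟨z, hz, hZz⟩ := hrev.exists_left hA hr hd (by simpa using (hall (d - 1) (by omega)).1)
    (by simpa using (hall (d - 1) (by omega)).2)
  have hyz : y ≠ z := fun e => h.neYZ y hYy (e ▸ hZz)
  set I : Finset V := {y, z} ∪ ((Finset.range d).image P ∪ (Finset.range d).image P') with hI
  have hIA : I = A := hA.eq_of_two_paths hd hy hz hyz hall (fun k hk => h.ne k hk k hk) h.path
    h.inj h.inj' (h.adjY y hYy) (h.adjZ z hZz) (h.neY y hYy) (h.neZ z hZz)
  have hIc : I.card = 2 + (d + d) := by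
    rw [hI, Finset.card_union_of_disjoint, Finset.card_union_of_disjoint, Finset.card_pair hyz,
      Finset.card_image_of_injOn, Finset.card_image_of_injOn, Finset.card_range]
    · intro a ha b hb
      exact h.inj' a (by simpa using ha) b (by simpa using hb)
    · intro a ha b hb
      exact h.inj a (by simpa using ha) b (by simpa using hb)
    · rw [Finset.disjoint_left]
      intro x hx hx'
      obtain ⟨a, ha, rfl⟩ := Finset.mem_image.1 hx
      obtain ⟨b, hb, hab⟩ := Finset.mem_image.1 hx'
      exact h.ne a (Finset.mem_range.1 ha) b (Finset.mem_range.1 hb) hab.symm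
    · rw [Finset.disjoint_left]
      intro x hx hx'
      rw [Finset.mem_insert, Finset.mem_singleton] at hx
      rw [Finset.mem_union, Finset.mem_image, Finset.mem_image] at hx'
      rcases hx with rfl | rfl <;> rcases hx' with ⟨k, hk, e⟩ | ⟨k, hk, e⟩
      · exact (h.neY x hYy k (Finset.mem_range.1 hk)).1 e.symm
      · exact (h.neY x hYy k (Finset.mem_range.1 hk)).2 e.symm
      · exact (h.neZ x hZz k (Finset.mem_range.1 hk)).1 e.symm
      · exact (h.neZ x hZz k (Finset.mem_range.1 hk)).2 e.symm
  rw [hIA, hA.1] at hIc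
  omega

end IsTwinPaths

/-! ### Cyclic blow-ups and the lower bound with constant one. -/

/-- The cyclic successor relation on `{0, …, s}`. -/
def CyclicNext (s b b' : ℕ) : Prop := (b' = b + 1 ∧ b' ≤ s) ∨ (b = s ∧ b' = 0 ∧ 0 < s)

/-- Blocks `0, …, s` in a cyclic order. The block `b` consists of paths with `len b` vertices
`(b, i, j)`, where `j` is the index of the path. The ends of the paths of a block are adjacent to
the beginnings of the paths of the next block. -/
def blowGraph (s : ℕ) (len : ℕ → ℕ) : SimpleGraph (ℕ × ℕ × ℕ) where
  Adj x y := (x.1 = y.1 ∧ x.2.2 = y.2.2 ∧ (x.2.1 + 1 = y.2.1 ∨ y.2.1 + 1 = x.2.1)) ∨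
    (CyclicNext s x.1 y.1 ∧ x.2.1 + 1 = len x.1 ∧ y.2.1 = 0) ∨
    (CyclicNext s y.1 x.1 ∧ y.2.1 + 1 = len y.1 ∧ x.2.1 = 0)
  symm := ⟨by
    rintro x y (⟨h1, h2, h3⟩ | h | h)
    · exact Or.inl ⟨h1.symm, h2.symm, h3.symm⟩
    · exact Or.inr (Or.inr h)
    · exact Or.inr (Or.inl h)⟩
  loopless := ⟨by
    rintro x (⟨-, -, h⟩ | ⟨h, -⟩ | ⟨h, -⟩)
    · omega
    · unfold CyclicNext at h; omega
    · unfold CyclicNext at h; omega⟩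

theorem blowGraph_adj {s : ℕ} {len : ℕ → ℕ} {b i j b' i' j' : ℕ} :
    (blowGraph s len).Adj (b, i, j) (b', i', j') ↔
    (b = b' ∧ j = j' ∧ (i + 1 = i' ∨ i' + 1 = i)) ∨
    (CyclicNext s b b' ∧ i + 1 = len b ∧ i' = 0) ∨
    (CyclicNext s b' b ∧ i' + 1 = len b' ∧ i = 0) := Iff.rfl

/-- `F b` is the path selected in block `b`. With at least three blocks, the next and the previous
vertex of the cyclic order are different. -/
theorem cycSet_blowGraph {s r : ℕ} {len F : ℕ → ℕ} (hs : 2 ≤ s) (hlen : ∀ b, 0 < len b)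
    {A : Finset (ℕ × ℕ × ℕ)} (hAr : A.card = r)
    (hA : ∀ b i j, (b, i, j) ∈ A ↔ b ≤ s ∧ i < len b ∧ j = F b) :
    CycSet (blowGraph s len) r A := by
  have hsucc : ∀ b i, i + 1 < len b → (blowGraph s len).Adj (b, i, F b) (b, i + 1, F b) :=
    fun b i _ => blowGraph_adj.2 (Or.inl ⟨rfl, rfl, Or.inl rfl⟩)
  have hnext : ∀ b b', CyclicNext s b b' →
      (blowGraph s len).Adj (b, len b - 1, F b) (b', 0, F b') := by
    intro b b' h
    have := hlen b
    exact blowGraph_adj.2 (Or.inr (Or.inl ⟨h, by omega, rfl⟩))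
  have hmem : ∀ b i, b ≤ s → i < len b → (b, i, F b) ∈ A := fun b i h1 h2 =>
    (hA b i _).2 ⟨h1, h2, rfl⟩
  refine ⟨hAr, ?_, ?_⟩
  · rintro ⟨b, i, j⟩ hx
    obtain ⟨hb, hi, rfl⟩ := (hA b i j).1 hx
    -- the next vertex
    obtain ⟨y₁, y₂, hy, hxy, hyu⟩ : ∃ y₁ y₂, (y₁, y₂, F y₁) ∈ A ∧
        (blowGraph s len).Adj (b, i, F b) (y₁, y₂, F y₁) ∧
        ((i + 1 < len b ∧ y₁ = b ∧ y₂ = i + 1) ∨ (i + 1 = len b ∧ CyclicNext s b y₁ ∧ y₂ = 0)) := by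
      by_cases h1 : i + 1 < len b
      · exact ⟨b, i + 1, hmem _ _ hb h1, hsucc b i h1, Or.inl ⟨h1, rfl, rfl⟩⟩
      · have h2 : i = len b - 1 := by omega
        have h3 : i + 1 = len b := by omega
        rw [h2]
        by_cases hbs : b < s
        · exact ⟨b + 1, 0, hmem _ _ (by omega) (hlen _), hnext _ _ (Or.inl ⟨rfl, hbs⟩),
            Or.inr ⟨by omega, Or.inl ⟨rfl, hbs⟩, rfl⟩⟩
        · exact ⟨0, 0, hmem _ _ (by omega) (hlen _), hnext _ _ (Or.inr ⟨by omega, rfl, by omega⟩),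
            Or.inr ⟨by omega, Or.inr ⟨by omega, rfl, by omega⟩, rfl⟩⟩
    obtain ⟨z₁, z₂, hz, hxz, hzu⟩ : ∃ z₁ z₂, (z₁, z₂, F z₁) ∈ A ∧
        (blowGraph s len).Adj (b, i, F b) (z₁, z₂, F z₁) ∧
        ((0 < i ∧ z₁ = b ∧ z₂ + 1 = i) ∨ (i = 0 ∧ CyclicNext s z₁ b ∧ z₂ + 1 = len z₁)) := by
      by_cases h1 : 0 < i
      · refine ⟨b, i - 1, hmem _ _ hb (by omega), ?_, Or.inl ⟨h1, rfl, by omega⟩⟩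
        have := hsucc b (i - 1) (by omega)
        rw [Nat.sub_add_cancel h1] at this
        exact this.symm
      · obtain rfl : i = 0 := by omega
        have hl : ∀ b, len b - 1 < len b := fun b => Nat.sub_lt (hlen b) one_pos
        have hl' : ∀ b, len b - 1 + 1 = len b := fun b => Nat.sub_add_cancel (hlen b)
        by_cases hb0 : 0 < b
        · have hc : CyclicNext s (b - 1) b := Or.inl ⟨by omega, hb⟩
          exact ⟨b - 1, len (b - 1) - 1, hmem _ _ (by omega) (hl _), (hnext _ _ hc).symm,
            Or.inr ⟨rfl, hc, hl' _⟩⟩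
        · have hc : CyclicNext s s b := Or.inr ⟨rfl, by omega, by omega⟩
          exact ⟨s, len s - 1, hmem _ _ le_rfl (hl _), (hnext _ _ hc).symm,
            Or.inr ⟨rfl, hc, hl' _⟩⟩
    refine card_nbrs_eq_two (y := (y₁, y₂, F y₁)) (z := (z₁, z₂, F z₁)) ?_ hy hz hxy hxz ?_
    · intro h
      simp only [Prod.mk.injEq] at h
      unfold CyclicNext at hyu hzu
      omega
    · rintro ⟨b', i', j'⟩ hw hadj
      obtain ⟨hb', hi', rfl⟩ := (hA b' i' j').1 hw
      have hpos : (b' = y₁ ∧ i' = y₂) ∨ (b' = z₁ ∧ i' = z₂) := by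
        rw [blowGraph_adj] at hadj
        rcases hadj with ⟨rfl, -, h | h⟩ | ⟨h, h1, h2⟩ | ⟨h, h1, h2⟩
        · left; omega
        · right; omega
        · left
          unfold CyclicNext at hyu h
          omega
        · right
          have hz1 : b' = z₁ := by
            unfold CyclicNext at hzu h
            omega
          subst hz1
          omega
      rcases hpos with ⟨rfl, rfl⟩ | ⟨rfl, rfl⟩
      · exact Or.inl rfl
      · exact Or.inr rfl
  · intro T hT hne hcl
    have hleft : ∀ b i, (b, i, F b) ∈ T → (b, 0, F b) ∈ T := by
      intro b i
      induction i with
      | zero => exact id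
      | succ i ih =>
        intro h
        obtain ⟨h1, h2, -⟩ := (hA _ _ _).1 (hT h)
        exact ih (hcl _ h _ (hmem b i h1 (by omega)) (hsucc b i h2).symm)
    have hzero : ∀ b, (b, 0, F b) ∈ T → (0, 0, F 0) ∈ T := by
      intro b
      induction b with
      | zero => exact id
      | succ b ih =>
        intro h
        obtain ⟨h1, h2, -⟩ := (hA _ _ _).1 (hT h)
        exact ih (hleft b (len b - 1) (hcl _ h _ (hmem b _ (by omega)
          (Nat.sub_lt (hlen b) one_pos)) (hnext b (b + 1) (Or.inl ⟨rfl, h1⟩)).symm))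
    have h0 : (0, 0, F 0) ∈ T := by
      obtain ⟨⟨b, i, j⟩, hx⟩ := hne
      obtain ⟨-, -, rfl⟩ := (hA _ _ _).1 (hT hx)
      exact hzero b (hleft b i hx)
    have hright : ∀ b, b ≤ s → (b, 0, F b) ∈ T → ∀ i, i < len b → (b, i, F b) ∈ T := by
      intro b hb h i
      induction i with
      | zero => exact fun _ => h
      | succ i ih =>
        intro hi
        exact hcl _ (ih (by omega)) _ (hmem b _ hb hi) (hsucc b i hi)
    have hall : ∀ b, b ≤ s → (b, 0, F b) ∈ T := by
      intro b
      induction b with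
      | zero => exact fun _ => h0
      | succ b ih =>
        intro hb
        exact hcl _ (hright b (by omega) (ih (by omega)) _ (Nat.sub_lt (hlen b) one_pos)) _
          (hmem _ _ hb (hlen _)) (hnext b (b + 1) (Or.inl ⟨rfl, hb⟩))
    apply Finset.Subset.antisymm hT
    rintro ⟨b, i, j⟩ hx
    obtain ⟨hb, hi, rfl⟩ := (hA _ _ _).1 hx
    exact hright b hb (hall b hb) i hi

/-- The lengths of the blocks: block `0` has `l` vertices and the others have `d` vertices. -/
def blockLen (l d b : ℕ) : ℕ := if b = 0 then l else d

/-- Two paths of one block are twin paths, attached to the same vertices, so a cycle through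
corresponding vertices of both has exactly `2 d + 2` vertices. Block `0` has only the path with
index `0`. -/
theorem twin_eq_of_cycSet_blowGraph {s l d r : ℕ} (hs : 2 ≤ s) (hd : 0 < d) (hr : 4 < r)
    (hrd : r ≠ 2 * d + 2) {A : Finset (ℕ × ℕ × ℕ)}
    (hAS : ∀ b i j, (b, i, j) ∈ A → b ≤ s ∧ i < blockLen l d b ∧ (b = 0 → j = 0))
    (hA : CycSet (blowGraph s (blockLen l d)) r A) {b i j j' : ℕ} (h : (b, i, j) ∈ A)
    (h' : (b, i, j') ∈ A) : j = j' := by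
  obtain ⟨hb, hi, h0⟩ := hAS _ _ _ h
  rcases Nat.eq_zero_or_pos b with rfl | hb0
  · rw [h0 rfl, (hAS _ _ _ h').2.2 rfl]
  by_contra hne
  have hlen : blockLen l d b = d := if_neg (by omega)
  rw [hlen] at hi
  have htwin : IsTwinPaths (blowGraph s (blockLen l d)) A d (fun k => (b, k, j))
      (fun k => (b, k, j'))
      (fun y => CyclicNext s y.1 b ∧ y.2.1 + 1 = blockLen l d y.1)
      (fun z => CyclicNext s b z.1 ∧ z.2.1 = 0) := by
    have hnbr : ∀ j, ∀ i < d, ∀ y ∈ A, (blowGraph s (blockLen l d)).Adj (b, i, j) y →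
        (i + 1 < d ∧ y = (b, i + 1, j)) ∨ (0 < i ∧ y = (b, i - 1, j)) ∨
        (i = 0 ∧ CyclicNext s y.1 b ∧ y.2.1 + 1 = blockLen l d y.1) ∨
        (i + 1 = d ∧ CyclicNext s b y.1 ∧ y.2.1 = 0) := by
      rintro j i hi ⟨b', i', j₁⟩ hy hadj
      obtain ⟨-, hi', -⟩ := hAS _ _ _ hy
      rw [blowGraph_adj, hlen] at hadj
      rcases hadj with ⟨rfl, rfl, rfl | rfl⟩ | ⟨h1, h2, h3⟩ | ⟨h1, h2, h3⟩
      · exact Or.inl ⟨by omega, rfl⟩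
      · exact Or.inr (Or.inl ⟨by omega, rfl⟩)
      · exact Or.inr (Or.inr (Or.inr ⟨h2, h1, h3⟩))
      · exact Or.inr (Or.inr (Or.inl ⟨h3, h1, h2⟩))
    refine ⟨hnbr j, hnbr j', ?_, ?_, ?_, ?_, ?_, ?_, ?_, ?_, ?_⟩
    · rintro ⟨b', i', j₁⟩ ⟨h1, h2⟩
      exact ⟨blowGraph_adj.2 (Or.inr (Or.inr ⟨h1, h2, rfl⟩)),
        blowGraph_adj.2 (Or.inr (Or.inr ⟨h1, h2, rfl⟩))⟩
    · rintro ⟨b', i', j₁⟩ ⟨h1, h2⟩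
      have h3 : d - 1 + 1 = blockLen l d b := by omega
      exact ⟨blowGraph_adj.2 (Or.inr (Or.inl ⟨h1, h3, h2⟩)),
        blowGraph_adj.2 (Or.inr (Or.inl ⟨h1, h3, h2⟩))⟩
    · intro i _
      exact ⟨blowGraph_adj.2 (Or.inl ⟨rfl, rfl, Or.inl rfl⟩),
        blowGraph_adj.2 (Or.inl ⟨rfl, rfl, Or.inl rfl⟩)⟩
    · intro i _ k _ e
      simpa using e
    · intro i _ k _ e
      simpa using e
    · intro i _ k _ e
      simp only [Prod.mk.injEq] at e
      exact hne e.2.2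
    · rintro ⟨b', i', j₁⟩ ⟨h1, -⟩ k _
      simp only [CyclicNext] at h1
      simp only [ne_eq, Prod.mk.injEq]
      omega
    · rintro ⟨b', i', j₁⟩ ⟨h1, -⟩ k _
      simp only [CyclicNext] at h1
      simp only [ne_eq, Prod.mk.injEq]
      omega
    · rintro ⟨b', i', j₁⟩ ⟨h1, -⟩ ⟨h2, -⟩
      simp only [CyclicNext] at h1 h2
      omega
  exact htwin.false_of_mem hA hr hrd hi h h'

/-- The cycle has at most one vertex at each position `(b, i)`, and there are only `l + s d = r`
positions, so each is occupied exactly once. Consecutive positions in a block then belong to the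
same path. -/
theorem exists_of_cycSet_blowGraph {s l d r : ℕ} (hs : 2 ≤ s) (hd : 0 < d) (hr : 4 < r)
    (hrd : r ≠ 2 * d + 2) (hrl : r = l + s * d) {A : Finset (ℕ × ℕ × ℕ)}
    (hAS : ∀ b i j, (b, i, j) ∈ A → b ≤ s ∧ i < blockLen l d b ∧ (b = 0 → j = 0))
    (hA : CycSet (blowGraph s (blockLen l d)) r A) :
    ∃ F : ℕ → ℕ, F 0 = 0 ∧ ∀ b i, b ≤ s → i < blockLen l d b → (b, i, F b) ∈ A := by
  have htwin : ∀ b i j j', (b, i, j) ∈ A → (b, i, j') ∈ A → j = j' := fun b i j j' h h' =>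
    twin_eq_of_cycSet_blowGraph hs hd hr hrd hAS hA h h'
  set Pos : Finset (ℕ × ℕ) := {0} ×ˢ Finset.range l ∪ Finset.Icc 1 s ×ˢ Finset.range d with hPos
  have hPosmem : ∀ b i, (b, i) ∈ Pos ↔ b ≤ s ∧ i < blockLen l d b := by
    intro b i
    simp only [hPos, Finset.mem_union, Finset.mem_product, Finset.mem_singleton, Finset.mem_range,
      Finset.mem_Icc, blockLen]
    split_ifs <;> omega
  have hPosc : Pos.card ≤ r := by
    refine (Finset.card_union_le _ _).trans ?_
    rw [Finset.card_product, Finset.card_product]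
    simp [hrl]
  have himg : A.image (fun x => (x.1, x.2.1)) = Pos := by
    apply Finset.eq_of_subset_of_card_le
    · intro p hp
      obtain ⟨⟨b, i, j⟩, hx, rfl⟩ := Finset.mem_image.1 hp
      obtain ⟨h1, h2, -⟩ := hAS _ _ _ hx
      exact (hPosmem b i).2 ⟨h1, h2⟩
    · rw [Finset.card_image_of_injOn, hA.1]
      · exact hPosc
      · rintro ⟨b, i, j⟩ hx ⟨b', i', j'⟩ hx' h
        simp only [Prod.mk.injEq] at h
        obtain ⟨rfl, rfl⟩ := h
        rw [htwin b i j j' hx hx']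
  have hex : ∀ b i, b ≤ s → i < blockLen l d b → ∃ j, (b, i, j) ∈ A := by
    intro b i hb hi
    have := (hPosmem b i).2 ⟨hb, hi⟩
    rw [← himg] at this
    obtain ⟨⟨b', i', j⟩, hx, h⟩ := Finset.mem_image.1 this
    simp only [Prod.mk.injEq] at h
    obtain ⟨rfl, rfl⟩ := h
    exact ⟨j, hx⟩
  have hsame : ∀ b i j j', (b, i, j) ∈ A → (b, i + 1, j') ∈ A → j = j' := by
    intro b i j j' h h'
    obtain ⟨hb, hi, hj0⟩ := hAS _ _ _ h
    obtain ⟨-, hi', hj0'⟩ := hAS _ _ _ h'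
    rcases Nat.eq_zero_or_pos b with rfl | hb0
    · rw [hj0 rfl, hj0' rfl]
    -- Position `i + 1` is occupied by a vertex of another path, so both neighbours of `(b, i, j)`
    -- would have to be at the one preceding position, which holds a single vertex.
    by_contra hne
    have hcase : ∀ y ∈ A, (blowGraph s (blockLen l d)).Adj (b, i, j) y →
        (0 < i ∧ y = (b, i - 1, j)) ∨ (i = 0 ∧ y.1 = b - 1 ∧ y.2.1 + 1 = blockLen l d (b - 1)) := by
      rintro ⟨b', i', j₁⟩ hy hadj
      rw [blowGraph_adj] at hadj
      rcases hadj with ⟨rfl, rfl, rfl | rfl⟩ | ⟨h1, h2, h3⟩ | ⟨h1, h2, h3⟩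
      · exact absurd (htwin _ _ _ _ hy h') hne
      · exact Or.inl ⟨by omega, rfl⟩
      · omega
      · have hb' : b' = b - 1 := by
          unfold CyclicNext at h1
          omega
        subst hb'
        exact Or.inr ⟨h3, rfl, h2⟩
    obtain ⟨⟨y₁, y₂, y₃⟩, hy, ⟨z₁, z₂, z₃⟩, hz, hyz, hxy, hxz⟩ := hA.exists_two_nbrs h
    apply hyz
    rcases hcase _ hy hxy with ⟨h1, h2⟩ | ⟨h1, h2, h3⟩ <;>
      rcases hcase _ hz hxz with ⟨h4, h5⟩ | ⟨h4, h5, h6⟩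
    · rw [h2, h5]
    · omega
    · omega
    · simp only at h2 h3 h5 h6
      have e1 : y₁ = z₁ := by omega
      have e2 : y₂ = z₂ := by omega
      subst e1 e2
      rw [htwin _ _ _ _ hy hz]
  refine ⟨fun b => if h : b ≤ s ∧ 0 < blockLen l d b ∧ b ≠ 0 then (hex b 0 h.1 h.2.1).choose else 0,
    dif_neg (by simp), ?_⟩
  intro b i hb
  beta_reduce
  rcases Nat.eq_zero_or_pos b with rfl | hb0
  · intro hi
    rw [dif_neg (by simp)]
    obtain ⟨j, hj⟩ := hex 0 i hb hi
    have hj0 := (hAS _ _ _ hj).2.2 rfl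
    subst hj0
    exact hj
  · have hl : 0 < blockLen l d b := by
      rw [blockLen, if_neg (by omega)]
      exact hd
    rw [dif_pos ⟨hb, hl, by omega⟩]
    induction i with
    | zero => exact fun _ => (hex b 0 hb hl).choose_spec
    | succ i ih =>
      intro hi
      obtain ⟨j, hj⟩ := hex b (i + 1) hb hi
      have := hsame _ _ _ _ (ih (by omega)) hj
      rwa [this]

/-- Block `0` is the base, and each of the `s` other blocks offers `N` paths. Without `r ≠ 2 * d +
2`, two paths of one block could lie on an induced `r`-cycle. -/
theorem pow_le_psiCycle {s l d r n N : ℕ} (hs : 2 ≤ s) (hd : 0 < d) (hl : 0 < l)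
    (hr : 4 < r) (hrd : r ≠ 2 * d + 2) (hrl : r = l + s * d) (hn : l + s * d * N ≤ n) :
    N ^ s ≤ PsiCycle r (progression l s d) n := by
  set K : Finset (ℕ × ℕ × ℕ) := (Finset.range l).image fun i => (0, i, 0) with hK
  set leg : ℕ × ℕ → Finset (ℕ × ℕ × ℕ) := fun p => (Finset.range d).image fun i => (p.1 + 1, i, p.2)
    with hleg
  have hKmem : ∀ b i j, (b, i, j) ∈ K ↔ b = 0 ∧ i < l ∧ j = 0 := by
    intro b i j
    simp only [hK, Finset.mem_image, Finset.mem_range, Prod.mk.injEq]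
    constructor
    · rintro ⟨i, hi, rfl, rfl, rfl⟩
      exact ⟨rfl, hi, rfl⟩
    · rintro ⟨rfl, hi, rfl⟩
      exact ⟨i, hi, rfl, rfl, rfl⟩
  have hlegmem : ∀ p b i j, (b, i, j) ∈ leg p ↔ b = p.1 + 1 ∧ i < d ∧ j = p.2 := by
    intro p b i j
    simp only [hleg, Finset.mem_image, Finset.mem_range, Prod.mk.injEq]
    constructor
    · rintro ⟨i, hi, rfl, rfl, rfl⟩
      exact ⟨rfl, hi, rfl⟩
    · rintro ⟨rfl, hi, rfl⟩
      exact ⟨i, hi, rfl, rfl, rfl⟩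
  have hKc : K.card = l := by
    rw [hK, Finset.card_image_of_injective _ (fun a b h => by simpa using h), Finset.card_range]
  have hlegc : ∀ p, (leg p).card = d := by
    intro p
    rw [hleg, Finset.card_image_of_injective _ (fun a b h => by simpa using h), Finset.card_range]
  have hKd : ∀ p, Disjoint K (leg p) := by
    intro p
    rw [Finset.disjoint_left]
    rintro ⟨b, i, j⟩ h1 h2
    rw [hKmem] at h1
    rw [hlegmem] at h2
    omega
  have hld : ∀ p q, p ≠ q → Disjoint (leg p) (leg q) := by
    rintro ⟨p₁, p₂⟩ ⟨q₁, q₂⟩ hpq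
    rw [Finset.disjoint_left]
    rintro ⟨b, i, j⟩ h1 h2
    rw [hlegmem] at h1 h2
    apply hpq
    simp only at h1 h2
    rw [Prod.mk.injEq]
    omega
  set S : Finset (ℕ × ℕ × ℕ) := K ∪ Finset.Icc 1 s ×ˢ Finset.range d ×ˢ Finset.range N with hS
  have hSmem : ∀ b i j, (b, i, j) ∈ S → b ≤ s ∧ i < blockLen l d b ∧ (b = 0 → j = 0) := by
    intro b i j h
    simp only [hS, Finset.mem_union, hKmem, Finset.mem_product, Finset.mem_Icc,
      Finset.mem_range] at h
    unfold blockLen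
    split_ifs <;> omega
  set V : (Fin s → Fin N) → Finset (ℕ × ℕ) := fun f =>
    Finset.univ.image fun b : Fin s => ((b : ℕ), (f b : ℕ))
    with hV
  have hVmem : ∀ f b j, (b, j) ∈ V f ↔ ∃ h : b < s, j = f ⟨b, h⟩ := by
    intro f b j
    simp only [hV, Finset.mem_image, Finset.mem_univ, true_and, Prod.mk.injEq]
    constructor
    · rintro ⟨b, rfl, rfl⟩
      exact ⟨b.2, rfl⟩
    · rintro ⟨h, rfl⟩
      exact ⟨⟨b, h⟩, rfl, rfl⟩
  have hVc : ∀ f, (V f).card = s := by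
    intro f
    rw [hV, Finset.card_image_of_injective, Finset.card_univ, Fintype.card_fin]
    intro a b h
    simp only [Prod.mk.injEq] at h
    exact Fin.ext h.1
  have hVinj : Function.Injective V := by
    intro f g h
    ext b
    have : ((b : ℕ), (f b : ℕ)) ∈ V g := by
      rw [← h, hVmem]
      exact ⟨b.2, rfl⟩
    exact ((hVmem _ _ _).1 this).2
  have hcard : (Finset.univ.image V).card = N ^ s := by
    rw [Finset.card_image_of_injective _ hVinj]
    simp
  rw [← hcard]
  refine card_le_psiCycle_of_legs (G := blowGraph s (blockLen l d)) (S := S) (K := K) (leg := leg)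
    (by omega) hd ?_ hKc hlegc hKd hld ?_ ?_
  · refine (Finset.card_union_le _ _).trans ?_
    rw [hKc, Finset.card_product, Finset.card_product]
    simpa [mul_assoc] using hn
  · intro A hAS hA
    obtain ⟨F, hF0, hF⟩ := exists_of_cycSet_blowGraph hs hd hr hrd hrl
      (fun b i j h => hSmem b i j (hAS h)) hA
    have hUc : ((Finset.range s).image fun b => (b, F (b + 1))).card = s := by
      rw [Finset.card_image_of_injective _ (fun a b h => by simp only [Prod.mk.injEq] at h; exact h.1),
        Finset.card_range]
    refine ⟨(Finset.range s).image fun b => (b, F (b + 1)), hUc,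
      (Finset.eq_of_subset_of_card_le ?_ ?_).symm⟩
    · rintro ⟨b, i, j⟩ hx
      rw [mem_legSpan, hKmem] at hx
      rcases hx with ⟨rfl, hi, rfl⟩ | ⟨p, hp, hx⟩
      · have := hF 0 i (by omega) hi
        rwa [hF0] at this
      · obtain ⟨b', hb', rfl⟩ := Finset.mem_image.1 hp
        obtain ⟨rfl, hi, rfl⟩ := (hlegmem _ _ _ _).1 hx
        rw [Finset.mem_range] at hb'
        exact hF _ i hb' hi
    · rw [hA.1, card_legSpan hKc hlegc hKd hld, hUc, hrl]
  · intro U hU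
    obtain ⟨f, -, rfl⟩ := Finset.mem_image.1 hU
    -- Legs are indexed by `b < s` but belong to block `b + 1`, as block `0` is the base.
    set F : ℕ → ℕ := fun b => if h : 0 < b ∧ b - 1 < s then f ⟨b - 1, h.2⟩ else 0 with hF
    have hF0 : F 0 = 0 := by simp [hF]
    have hF1 : ∀ b (h : b < s), F (b + 1) = f ⟨b, h⟩ := by
      intro b h
      simp [hF, h]
    have hmem : ∀ b i j, (b, i, j) ∈ legSpan K leg (V f) ↔
        b ≤ s ∧ i < blockLen l d b ∧ j = F b := by
      intro b i j
      rw [mem_legSpan, hKmem]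
      constructor
      · rintro (⟨rfl, hi, rfl⟩ | ⟨⟨b', j'⟩, hp, hx⟩)
        · exact ⟨by omega, hi, hF0.symm⟩
        · obtain ⟨hb', rfl⟩ := (hVmem _ _ _).1 hp
          obtain ⟨rfl, hi, rfl⟩ := (hlegmem _ _ _ _).1 hx
          exact ⟨hb', hi, (hF1 b' hb').symm⟩
      · rintro ⟨hb, hi, rfl⟩
        rcases b with _ | b
        · exact Or.inl ⟨rfl, hi, hF0⟩
        · exact Or.inr ⟨(b, f ⟨b, hb⟩), (hVmem _ _ _).2 ⟨hb, rfl⟩,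
            (hlegmem _ _ _ _).2 ⟨rfl, hi, hF1 b hb⟩⟩
    constructor
    · rintro ⟨b, i, j⟩ hx
      obtain ⟨hb, hi, rfl⟩ := (hmem _ _ _).1 hx
      simp only [hS, Finset.mem_union, hKmem, Finset.mem_product, Finset.mem_Icc, Finset.mem_range]
      rcases b with _ | b
      · exact Or.inl ⟨rfl, hi, hF0⟩
      · refine Or.inr ⟨⟨by omega, hb⟩, hi, ?_⟩
        rw [hF1 b hb]
        exact Fin.isLt _
    · refine cycSet_blowGraph hs (fun b => ?_) ?_ hmem
      · unfold blockLen
        split_ifs <;> assumption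
      · rw [card_legSpan hKc hlegc hKd hld, hVc, hrl]

theorem asympGe_one {s l d r : ℕ} (hs : 2 ≤ s) (hd : 0 < d) (hl : 0 < l)
    (hr : 4 < r) (hrd : r ≠ 2 * d + 2) (hrl : r = l + s * d) :
    AsympGe (PsiCycle r (progression l s d)) 1 (bench r l s) := by
  refine asympGe_of_le (p := fun N => ((N ^ s : ℕ) : ℝ)) (a := 1) (k := s * d) hrl (by omega) hd
    (Nat.mul_pos (by omega) hd) ?_ (by push_cast; ring) ?_
  · refine tendsto_const_nhds.congr' ?_
    filter_upwards [eventually_gt_atTop 0] with N hN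
    have : (N : ℝ) ≠ 0 := by positivity
    push_cast
    field_simp
  · intro n N _ hn
    exact_mod_cast pow_le_psiCycle hs hd hl hr hrd hrl hn

/-! ### The combinatorics of leg ends around a ring. -/

/-- The number of pairs `x ∈ P`, `y ∈ Q` with `x < y`. -/
noncomputable def ltPairs (P Q : Finset ℕ) : ℕ := ∑ x ∈ P, (Q.filter (x < ·)).card

theorem ltPairs_eq (P Q : Finset ℕ) : ltPairs P Q = ∑ y ∈ Q, (P.filter (· < y)).card := by
  unfold ltPairs
  have := Finset.sum_card_bipartiteAbove_eq_sum_card_bipartiteBelow (s := P) (t := Q)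
    (fun x y : ℕ => x < y)
  simpa only [Finset.bipartiteAbove, Finset.bipartiteBelow] using this

/-- Pairs `x < y` form a bipartite graph with nested neighbourhoods, here with degrees at most two
and without four-cycles. Every non-isolated `x` is below the maximum of `Q`, so there are at most
two of them. If there are two, the larger one has at most one neighbour, as its neighbours are
shared by the smaller one. -/
theorem ltPairs_le_three {P Q : Finset ℕ} (h1 : ∀ x ∈ P, (Q.filter (x < ·)).card ≤ 2)
    (h2 : ∀ y ∈ Q, (P.filter (· < y)).card ≤ 2)
    (h3 : ∀ x ∈ P, ∀ x' ∈ P, ∀ y ∈ Q, ∀ y' ∈ Q, x < x' → y < y' → x' < y → False) :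
    ltPairs P Q ≤ 3 := by
  rcases Q.eq_empty_or_nonempty with rfl | hQ
  · simp [ltPairs]
  set y := Q.max' hQ with hy
  have hyQ : y ∈ Q := Q.max'_mem hQ
  have hsum : ltPairs P Q = ∑ x ∈ P.filter (· < y), (Q.filter (x < ·)).card := by
    unfold ltPairs
    rw [Finset.sum_filter]
    apply Finset.sum_congr rfl
    intro x _
    split_ifs with hxy
    · rfl
    · rw [Finset.card_eq_zero, Finset.filter_eq_empty_iff]
      intro z hz hxz
      exact hxy (lt_of_lt_of_le hxz (Q.le_max' z hz))
  have hc := h2 y hyQ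
  rw [hsum]
  rcases Nat.lt_or_ge (P.filter (· < y)).card 2 with hlt | hge
  · have : ∑ x ∈ P.filter (· < y), (Q.filter (x < ·)).card ≤ (P.filter (· < y)).card • 2 :=
      Finset.sum_le_card_nsmul _ _ _ fun x hx => h1 x (Finset.mem_filter.1 hx).1
    rw [smul_eq_mul] at this
    omega
  · obtain ⟨a, b, hab, he⟩ := Finset.card_eq_two.1 (le_antisymm hc hge)
    have key : ∀ a b, a < b → P.filter (· < y) = {a, b} →
        ∑ x ∈ P.filter (· < y), (Q.filter (x < ·)).card ≤ 3 := by
      intro a b hab he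
      have ha : a ∈ P := (Finset.mem_filter.1 (show a ∈ P.filter (· < y) by rw [he]; simp)).1
      have hb : b ∈ P := (Finset.mem_filter.1 (show b ∈ P.filter (· < y) by rw [he]; simp)).1
      rw [he, Finset.sum_pair hab.ne]
      have h4 := h1 a ha
      have h5 : (Q.filter (b < ·)).card ≤ 1 := by
        rw [Finset.card_le_one]
        intro u hu v hv
        rw [Finset.mem_filter] at hu hv
        by_contra huv
        rcases lt_or_gt_of_ne huv with h | h
        · exact h3 a ha b hb u hu.1 v hv.1 hab h hu.2
        · exact h3 a ha b hb v hv.1 u hu.1 hab h hv.2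
      omega
    rcases lt_or_gt_of_ne hab with h | h
    · exact key a b h he
    · exact key b a h (by rw [he, Finset.pair_comm])

/-- The pattern of the ends of the legs in an induced cycle of the ring graph: `T t` are the indices
of the ends of type `t`, and if the base vertex of type `t` is in the cycle, which is denoted by
`S t`, then the legs of type `t` in the cycle have the indices `l t` and `l' t`. -/
structure IsRingPattern {m : ℕ} (T : ZMod m → Finset ℕ) (S : ZMod m → Prop) (l l' : ZMod m → ℕ) :
    Prop where
  lt : ∀ t, S t → l t < l' t
  mem : ∀ t, S t → l t ∈ T t
  mem' : ∀ t, S t → l' t ∈ T t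
  le' : ∀ t, S t → ∀ x ∈ T (t + 1), x ≤ l' t
  ge : ∀ t, S (t + 1) → ∀ x ∈ T t, l (t + 1) ≤ x
  card_gt : ∀ t, S t → ((T (t + 1)).filter (l t < ·)).card = 1
  card_lt : ∀ t, S (t + 1) → ((T t).filter (· < l' (t + 1))).card = 1
  degree : ∀ t, ltPairs (T t) (T (t + 1)) + ltPairs (T (t + 1)) (T (t + 1 + 1)) +
    (if S (t + 1) then 2 else 0) = 2 * (T (t + 1)).card
  le_three : ∀ t, ltPairs (T t) (T (t + 1)) ≤ 3

namespace IsRingPattern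
variable {m : ℕ} {T : ZMod m → Finset ℕ} {S : ZMod m → Prop} {l l' : ZMod m → ℕ}

/-- By `card_gt` and `card_lt`, `l' (t + 1)` is the only partner of `l t` and conversely. Any other
pair `x < y` would have `l' (t + 1) ≤ x < y`, which makes `y` a second partner of `l t`. -/
theorem ltPairs_le_one (h : IsRingPattern T S l l') {t : ZMod m} (h1 : S t) (h2 : S (t + 1))
    (hlt : l t < l' (t + 1)) : ltPairs (T t) (T (t + 1)) ≤ 1 := by
  have hgt : ∀ y ∈ T (t + 1), l t < y → y = l' (t + 1) := by
    intro y hy hly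
    exact Finset.card_le_one.1 (h.card_gt t h1).le y (Finset.mem_filter.2 ⟨hy, hly⟩) _
      (Finset.mem_filter.2 ⟨h.mem' _ h2, hlt⟩)
  have hlt' : ∀ x ∈ T t, x < l' (t + 1) → x = l t := by
    intro x hx hxl
    exact Finset.card_le_one.1 (h.card_lt t h2).le x (Finset.mem_filter.2 ⟨hx, hxl⟩) _
      (Finset.mem_filter.2 ⟨h.mem _ h1, hlt⟩)
  unfold ltPairs
  calc ∑ x ∈ T t, ((T (t + 1)).filter (x < ·)).card
      ≤ ∑ x ∈ T t, if x = l t then 1 else 0 := by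
        apply Finset.sum_le_sum
        intro x hx
        split_ifs with hxl
        · rw [hxl, h.card_gt t h1]
        · rw [Nat.le_zero, Finset.card_eq_zero, Finset.filter_eq_empty_iff]
          intro y hy hxy
          have h3 : l' (t + 1) ≤ x := by
            by_contra h4
            exact hxl (hlt' x hx (by omega))
          have h5 := hgt y hy (by omega)
          omega
    _ ≤ 1 := by
        rw [Finset.sum_ite_eq' (T t) (l t) fun _ => 1]
        split_ifs <;> omega

/-- If the base vertices of types `s - 1` and `s + 1` are in the cycle, then there are at most two
ends of type `s`. -/
theorem card_le_two (h : IsRingPattern T S l l') {p s : ZMod m} (hp : s = p + 1) (h1 : S p)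
    (h2 : S (s + 1)) (hl : l p < l' (s + 1)) : (T s).card ≤ 2 := by
  subst hp
  have h3 := h.card_gt p h1
  have h4 := h.card_lt (p + 1) h2
  have h5 : T (p + 1) ⊆ (T (p + 1)).filter (l p < ·) ∪ (T (p + 1)).filter (· < l' (p + 1 + 1)) := by
    intro x hx
    rw [Finset.mem_union, Finset.mem_filter, Finset.mem_filter]
    by_cases h6 : l p < x
    · exact Or.inl ⟨hx, h6⟩
    · exact Or.inr ⟨hx, by omega⟩
  have h6 := (Finset.card_le_card h5).trans (Finset.card_union_le _ _)
  omega

/-- The extreme elements among the ends of type `s`. -/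
theorem exists_mem_mem (h : IsRingPattern T S l l') {p s : ZMod m} (hp : s = p + 1) (h1 : S p)
    (h2 : S (s + 1)) : ∃ x ∈ T s, ∃ y ∈ T s, l p < x ∧ y < l' (s + 1) ∧ x ≤ l' p ∧
      l (s + 1) ≤ y ∧ ((x = y ∧ (T s).card ≤ 1) ∨ (l' (s + 1) ≤ x ∧ y ≤ l p)) := by
  subst hp
  obtain ⟨x, hx⟩ := Finset.card_eq_one.1 (h.card_gt p h1)
  obtain ⟨y, hy⟩ := Finset.card_eq_one.1 (h.card_lt (p + 1) h2)
  have hx' := Finset.mem_filter.1 (show x ∈ (T (p + 1)).filter (l p < ·) by rw [hx]; simp)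
  have hy' := Finset.mem_filter.1 (show y ∈ (T (p + 1)).filter (· < l' (p + 1 + 1)) by
    rw [hy]; simp)
  refine ⟨x, hx'.1, y, hy'.1, hx'.2, hy'.2, h.le' p h1 x hx'.1, h.ge _ h2 y hy'.1, ?_⟩
  by_cases hxy : x = y
  · refine Or.inl ⟨hxy, ?_⟩
    rw [← Finset.card_singleton x]
    apply Finset.card_le_card
    intro z hz
    by_cases hzl : l p < z
    · rw [← hx]
      exact Finset.mem_filter.2 ⟨hz, hzl⟩
    · rw [hxy, ← hy]
      exact Finset.mem_filter.2 ⟨hz, by omega⟩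
  · right
    constructor
    · by_contra hlt
      have : x ∈ (T (p + 1)).filter (· < l' (p + 1 + 1)) :=
        Finset.mem_filter.2 ⟨hx'.1, by omega⟩
      rw [hy, Finset.mem_singleton] at this
      exact hxy this
    · by_contra hlt
      have : y ∈ (T (p + 1)).filter (l p < ·) := Finset.mem_filter.2 ⟨hy'.1, by omega⟩
      rw [hx, Finset.mem_singleton] at this
      exact hxy this.symm

/-- An absent base vertex must be compensated by extra ends, as `hsum` says, while `degree` and
`le_three` bound the number of ends from above. Two absent types violate this by arithmetic. If only
`s` is absent, there are at most two ends of type `s`; either there is at most one, or the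
inequalities leave at most one adjacent pair between the two present types, and both are too few. -/
theorem three {T : ZMod 3 → Finset ℕ} {S : ZMod 3 → Prop} {l l' : ZMod 3 → ℕ}
    (h : IsRingPattern T S l l')
    (hsum : ∑ t, (if S t then 2 else 5) ≤ ∑ t, (T t).card) (t : ZMod 3) : S t := by
  by_contra hs
  obtain ⟨s, hs⟩ : ∃ s, ¬ S s := ⟨t, hs⟩
  have hsum' : ∀ f : ZMod 3 → ℕ, ∑ t, f t = f s + f (s + 1) + f (s + 1 + 1) := by
    intro f
    rw [← Equiv.sum_comp (Equiv.addLeft s) f]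
    have : ∀ g : ZMod 3 → ℕ, ∑ t, g t = g 0 + g 1 + g 2 := fun g => Fin.sum_univ_three g
    rw [this]
    simp only [Equiv.coe_addLeft, add_zero]
    rw [add_assoc s 1 1]
    rfl
  have h3 : s + 1 + 1 + 1 = s := by
    rw [add_assoc, add_assoc]
    have : (1 + (1 + 1) : ZMod 3) = 0 := by decide
    rw [this, add_zero]
  rw [hsum', hsum', if_neg hs] at hsum
  have d0 := h.degree s
  have d1 := h.degree (s + 1)
  have d2 := h.degree (s + 1 + 1)
  rw [h3] at d1 d2
  rw [if_neg hs] at d2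
  have e0 := h.le_three s
  have e1 := h.le_three (s + 1)
  have e2 := h.le_three (s + 1 + 1)
  rw [h3] at e2
  by_cases h1 : S (s + 1)
  swap
  · rw [if_neg h1] at hsum d0
    split_ifs at hsum d1 <;> omega
  by_cases h2 : S (s + 1 + 1)
  swap
  · rw [if_neg h2] at hsum d1
    rw [if_pos h1] at hsum d0
    omega
  rw [if_pos h1] at hsum d0
  rw [if_pos h2] at hsum d1
  have q1 := h.lt _ h1
  have q2 := h.lt _ h2
  have q3 := h.le' _ h1 _ (h.mem' _ h2)
  have q4 := h.ge _ h2 _ (h.mem _ h1)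
  have hc := h.card_le_two h3.symm h2 h1 (by omega)
  obtain ⟨x, hx, y, hy, r1, r2, r3, r4, r5⟩ := h.exists_mem_mem h3.symm h2 h1
  rcases r5 with ⟨rfl, r5⟩ | ⟨r5, r5'⟩
  · omega
  · have := h.ltPairs_le_one h1 h2 (by omega)
    omega

/-- The same balance as in `three`. Consecutive absent types are excluded first; then both
neighbours of an absent type are present, and the opposite type is treated in two cases. -/
theorem four {T : ZMod 4 → Finset ℕ} {S : ZMod 4 → Prop} {l l' : ZMod 4 → ℕ}
    (h : IsRingPattern T S l l')
    (hsum : ∑ t, (if S t then 2 else 5) ≤ ∑ t, (T t).card) (t : ZMod 4) : S t := by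
  have hsum' : ∀ (s : ZMod 4) (f : ZMod 4 → ℕ),
      ∑ t, f t = f s + f (s + 1) + f (s + 1 + 1) + f (s + 1 + 1 + 1) := by
    intro s f
    rw [← Equiv.sum_comp (Equiv.addLeft s) f]
    have : ∀ g : ZMod 4 → ℕ, ∑ t, g t = g 0 + g 1 + g 2 + g 3 := fun g => Fin.sum_univ_four g
    rw [this]
    simp only [Equiv.coe_addLeft, add_zero]
    rw [add_assoc s 1 1, add_assoc s (1 + 1) 1]
    rfl
  have h4 : ∀ s : ZMod 4, s + 1 + 1 + 1 + 1 = s := by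
    intro s
    rw [add_assoc, add_assoc, add_assoc]
    have : (1 + (1 + (1 + 1)) : ZMod 4) = 0 := by decide
    rw [this, add_zero]
  -- no two consecutive types are missing
  have hcons : ∀ s, ¬ S s → ¬ S (s + 1) → False := by
    intro s hs h1
    rw [hsum' s, hsum' s, if_neg hs, if_neg h1] at hsum
    have d0 := h.degree s
    have d1 := h.degree (s + 1)
    have d2 := h.degree (s + 1 + 1)
    have d3 := h.degree (s + 1 + 1 + 1)
    rw [h4] at d2 d3
    rw [if_neg hs] at d3
    rw [if_neg h1] at d0
    have e0 := h.le_three s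
    have e1 := h.le_three (s + 1)
    have e2 := h.le_three (s + 1 + 1)
    have e3 := h.le_three (s + 1 + 1 + 1)
    rw [h4] at e3
    by_cases h2 : S (s + 1 + 1)
    swap
    · rw [if_neg h2] at hsum d1
      split_ifs at hsum d2 <;> omega
    by_cases h3 : S (s + 1 + 1 + 1)
    swap
    · rw [if_neg h3] at hsum d2
      rw [if_pos h2] at hsum d1
      omega
    rw [if_pos h2] at hsum d1
    rw [if_pos h3] at hsum d2
    -- now `T s ≤ l' (s + 3)` and `l (s + 2) ≤ T (s + 1)`
    by_cases hlt : l (s + 1 + 1) < l' (s + 1 + 1 + 1)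
    · have := h.ltPairs_le_one h2 h3 hlt
      omega
    -- Now every end of type `s` is at most every end of type `s + 1`. With three ends in both types
    -- this makes at least six adjacent pairs, against `le_three`; `erase` allows for one equality.
    · have hle : ∀ x ∈ T s, x ≤ l' (s + 1 + 1 + 1) := fun x hx =>
        h.le' _ h3 x (by rw [h4]; exact hx)
      have hge : ∀ x ∈ T (s + 1), l (s + 1 + 1) ≤ x := h.ge _ h2
      have hn0 : (T s).card = 3 := by omega
      have hn1 : (T (s + 1)).card = 3 := by omega
      have hsm : ∀ v ∈ T s, 2 ≤ ((T (s + 1)).filter (v < ·)).card := by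
        intro v hv
        have hsub : (T (s + 1)).erase v ⊆ (T (s + 1)).filter (v < ·) := by
          intro x hx
          obtain ⟨hxv, hx⟩ := Finset.mem_erase.1 hx
          have := hge x hx
          have := hle v hv
          exact Finset.mem_filter.2 ⟨hx, by omega⟩
        have := Finset.card_le_card hsub
        have := Finset.pred_card_le_card_erase (s := T (s + 1)) (a := v)
        omega
      have hE : (T s).card • 2 ≤ ltPairs (T s) (T (s + 1)) :=
        Finset.card_nsmul_le_sum _ _ _ hsm
      rw [smul_eq_mul] at hE
      omega
  by_contra hs
  obtain ⟨s, hs⟩ : ∃ s, ¬ S s := ⟨t, hs⟩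
  have h1 : S (s + 1) := by
    by_contra h1
    exact hcons s hs h1
  have h3 : S (s + 1 + 1 + 1) := by
    by_contra h3
    exact hcons _ h3 (by rw [h4]; exact hs)
  rw [hsum' s, hsum' s, if_neg hs, if_pos h1, if_pos h3] at hsum
  have d0 := h.degree s
  have d1 := h.degree (s + 1)
  have d2 := h.degree (s + 1 + 1)
  have d3 := h.degree (s + 1 + 1 + 1)
  rw [h4] at d2 d3
  rw [if_neg hs] at d3
  rw [if_pos h1] at d0
  rw [if_pos h3] at d2
  have e0 := h.le_three s
  have e1 := h.le_three (s + 1)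
  have e2 := h.le_three (s + 1 + 1)
  have e3 := h.le_three (s + 1 + 1 + 1)
  rw [h4] at e3
  have q1 := h.lt _ h1
  have q3 := h.lt _ h3
  obtain ⟨x, hx, y, hy, r1, r2, r3, r4, r5⟩ := h.exists_mem_mem (h4 s).symm h3 h1
  by_cases h2 : S (s + 1 + 1)
  · rw [if_pos h2] at hsum d1
    have q2 := h.lt _ h2
    have p1 := h.le' _ h1 _ (h.mem' _ h2)
    have p2 := h.le' _ h2 _ (h.mem' _ h3)
    have p3 := h.ge _ h2 _ (h.mem _ h1)
    have p4 := h.ge _ h3 _ (h.mem _ h2)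
    have hc := h.card_le_two (h4 s).symm h3 h1 (by omega)
    rcases r5 with ⟨rfl, r5⟩ | ⟨r5, r5'⟩
    · by_cases g1 : l (s + 1) < l' (s + 1 + 1)
      · have := h.ltPairs_le_one h1 h2 g1
        omega
      · have := h.ltPairs_le_one h2 h3 (by omega)
        omega
    · have := h.ltPairs_le_one h1 h2 (by omega)
      have := h.ltPairs_le_one h2 h3 (by omega)
      omega
  · rw [if_neg h2] at hsum d1
    have hn0 : (T s).card = 3 := by omega
    have hn2 : (T (s + 1 + 1)).card = 3 := by omega
    -- Three ends of the types `s` and `s + 2` contradict `card_le_two` unless `l (s + 1) < l' (s +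
    -- 1) ≤ l (s + 3) < l' (s + 3) ≤ l (s + 1)`, which is circular.
    have c1 : l' (s + 1) ≤ l (s + 1 + 1 + 1) := by
      by_contra hlt
      have := h.card_le_two (h4 s).symm h3 h1 (by omega)
      omega
    have c2 : l' (s + 1 + 1 + 1) ≤ l (s + 1) := by
      by_contra hlt
      have := h.card_le_two (s := s + 1 + 1) rfl h1 h3 (by omega)
      omega
    omega

end IsRingPattern

/-! ### Rings of spiders. -/

/-- Legs `(t, i, j)`, `1 ≤ i ≤ len t`, of types `t ∈ ℤ/m` and with indices `j`, where all legs of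
type `t` are attached to the vertex `(t, 0, 0)`. The ends of two legs of the types `t` and `t + 1`
are adjacent if the first one has the smaller index. -/
def ringGraph {m : ℕ} (len : ZMod m → ℕ) : SimpleGraph (ZMod m × ℕ × ℕ) where
  Adj x y := (x.1 = y.1 ∧ x.2.1 + 1 = y.2.1 ∧ (x.2.2 = y.2.2 ∨ x.2.1 = 0)) ∨
    (y.1 = x.1 ∧ y.2.1 + 1 = x.2.1 ∧ (y.2.2 = x.2.2 ∨ y.2.1 = 0)) ∨
    (y.1 = x.1 + 1 ∧ x.2.1 = len x.1 ∧ y.2.1 = len y.1 ∧ x.2.2 < y.2.2) ∨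
    (x.1 = y.1 + 1 ∧ y.2.1 = len y.1 ∧ x.2.1 = len x.1 ∧ y.2.2 < x.2.2)
  symm := ⟨by
    rintro x y (h | h | h | h)
    · exact Or.inr (Or.inl h)
    · exact Or.inl h
    · exact Or.inr (Or.inr (Or.inr h))
    · exact Or.inr (Or.inr (Or.inl h))⟩
  loopless := ⟨by
    rintro x (⟨-, h, -⟩ | ⟨-, h, -⟩ | ⟨-, -, -, h⟩ | ⟨-, -, -, h⟩) <;> omega⟩

section Ring
variable {m : ℕ} {len : ZMod m → ℕ}

theorem ringGraph_adj {t t' : ZMod m} {i j i' j' : ℕ} :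
    (ringGraph len).Adj (t, i, j) (t', i', j') ↔
    (t = t' ∧ i + 1 = i' ∧ (j = j' ∨ i = 0)) ∨ (t' = t ∧ i' + 1 = i ∧ (j' = j ∨ i' = 0)) ∨
    (t' = t + 1 ∧ i = len t ∧ i' = len t' ∧ j < j') ∨
    (t = t' + 1 ∧ i' = len t' ∧ i = len t ∧ j' < j) := Iff.rfl

theorem ringGraph_adj_base (t : ZMod m) (j : ℕ) : (ringGraph len).Adj (t, 0, 0) (t, 1, j) :=
  ringGraph_adj.2 (Or.inl ⟨rfl, rfl, Or.inr rfl⟩)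

theorem ringGraph_adj_succ (t : ZMod m) (i j : ℕ) :
    (ringGraph len).Adj (t, i, j) (t, i + 1, j) :=
  ringGraph_adj.2 (Or.inl ⟨rfl, rfl, Or.inl rfl⟩)

theorem ringGraph_adj_end (t : ZMod m) {j j' : ℕ} (h : j < j') :
    (ringGraph len).Adj (t, len t, j) (t + 1, len (t + 1), j') :=
  ringGraph_adj.2 (Or.inr (Or.inr (Or.inl ⟨rfl, rfl, rfl, h⟩)))

theorem forall_of_forall_add_one [NeZero m] {p : ZMod m → Prop} (h : ∀ t, p t → p (t + 1))
    {t : ZMod m} (ht : p t) (t' : ZMod m) : p t' := by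
  have h1 : ∀ k : ℕ, p (t + k) := by
    intro k
    induction k with
    | zero => simpa using ht
    | succ k ih => simpa [add_assoc] using h _ ih
  have h2 := h1 (t' - t).val
  rwa [ZMod.natCast_zmod_val, add_sub_cancel] at h2

/-- Shows in the end that the legs of all types in a cycle have the same two indices. -/
theorem eq_of_cyclic_antitone [NeZero m] {g : ZMod m → ℕ} (h : ∀ t, g (t + 1) ≤ g t)
    (t t' : ZMod m) : g t = g t' := by
  apply le_antisymm
  · exact forall_of_forall_add_one (p := fun u => g u ≤ g t') (fun u hu => (h u).trans hu) le_rfl t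
  · exact forall_of_forall_add_one (p := fun u => g u ≤ g t) (fun u hu => (h u).trans hu) le_rfl t'

/-- The vertices of the legs with index `j`. -/
def ringLeg [NeZero m] (len : ZMod m → ℕ) (j : ℕ) : Finset (ZMod m × ℕ × ℕ) :=
  (Finset.univ.sigma fun t => Finset.Icc 1 (len t)).map
    ⟨fun p => (p.1, p.2, j), by
      rintro ⟨a, b⟩ ⟨a', b'⟩ h
      simp only [Prod.mk.injEq] at h
      obtain ⟨rfl, rfl, -⟩ := h
      rfl⟩

/-- The vertices to which the legs are attached. -/
def ringBase (m : ℕ) [NeZero m] : Finset (ZMod m × ℕ × ℕ) :=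
  Finset.univ.map ⟨fun t => (t, 0, 0), by
    intro a b h
    simpa using h⟩

theorem mem_ringLeg [NeZero m] {t : ZMod m} {i j b : ℕ} :
    (t, i, b) ∈ ringLeg len j ↔ (1 ≤ i ∧ i ≤ len t) ∧ b = j := by
  rw [ringLeg, Finset.mem_map]
  constructor
  · rintro ⟨⟨u, k⟩, h, h'⟩
    change (u, k, j) = (t, i, b) at h'
    simp only [Prod.mk.injEq] at h'
    obtain ⟨rfl, rfl, rfl⟩ := h'
    rw [Finset.mem_sigma, Finset.mem_Icc] at h
    exact ⟨h.2, rfl⟩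
  · rintro ⟨h, rfl⟩
    exact ⟨⟨t, i⟩, Finset.mem_sigma.2 ⟨Finset.mem_univ _, Finset.mem_Icc.2 h⟩, rfl⟩

theorem mem_ringBase [NeZero m] {t : ZMod m} {i b : ℕ} :
    (t, i, b) ∈ ringBase m ↔ i = 0 ∧ b = 0 := by
  rw [ringBase, Finset.mem_map]
  constructor
  · rintro ⟨u, -, h⟩
    change (u, 0, 0) = (t, i, b) at h
    simp only [Prod.mk.injEq] at h
    exact ⟨h.2.1.symm, h.2.2.symm⟩
  · rintro ⟨rfl, rfl⟩
    exact ⟨t, Finset.mem_univ _, rfl⟩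

theorem card_ringLeg [NeZero m] (j : ℕ) : (ringLeg len j).card = ∑ t, len t := by
  simp [ringLeg]

theorem card_ringBase [NeZero m] : (ringBase m).card = m := by
  simp [ringBase, ZMod.card]

theorem disjoint_ringBase [NeZero m] (j : ℕ) : Disjoint (ringBase m) (ringLeg len j) := by
  rw [Finset.disjoint_left]
  rintro ⟨t, i, b⟩ h1 h2
  rw [mem_ringBase] at h1
  rw [mem_ringLeg] at h2
  omega

theorem disjoint_ringLeg [NeZero m] {j j' : ℕ} (h : j ≠ j') :
    Disjoint (ringLeg len j) (ringLeg len j') := by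
  rw [Finset.disjoint_left]
  rintro ⟨t, i, b⟩ h1 h2
  rw [mem_ringLeg] at h1 h2
  omega

theorem card_ringSpan [NeZero m] (U : Finset ℕ) :
    (legSpan (ringBase m) (ringLeg len) U).card = m + U.card * ∑ t, len t :=
  card_legSpan card_ringBase card_ringLeg disjoint_ringBase (fun _ _ h => disjoint_ringLeg h) U

/-- The cycle climbs leg `j` of type `t`, crosses to the end of leg `j'` of type `t + 1`, descends
to the base vertex of that type, and continues in the same way around the ring. -/
theorem cycSet_ringGraph [NeZero m] (hm : ∀ t : ZMod m, t + 1 ≠ t) (hlen : ∀ t, 2 ≤ len t)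
    {j j' : ℕ} (hj : j < j') : CycSet (ringGraph len) (m + 2 * ∑ t, len t)
      (legSpan (ringBase m) (ringLeg len) {j, j'}) := by
  set A := legSpan (ringBase m) (ringLeg len) {j, j'} with hA
  have hmem : ∀ t i b, (t, i, b) ∈ A ↔
      (i = 0 ∧ b = 0) ∨ ((1 ≤ i ∧ i ≤ len t) ∧ (b = j ∨ b = j')) := by
    intro t i b
    rw [hA, mem_legSpan, mem_ringBase]
    simp only [Finset.mem_insert, Finset.mem_singleton, mem_ringLeg]
    constructor
    · rintro (h | ⟨k, h1, h2⟩)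
      · exact Or.inl h
      · right; omega
    · rintro (h | ⟨h1, h2⟩)
      · exact Or.inl h
      · exact Or.inr ⟨b, h2, h1, rfl⟩
  refine ⟨by rw [card_ringSpan, Finset.card_pair hj.ne], ?_, ?_⟩
  · rintro ⟨t, i, b⟩ hx
    have hl := hlen t
    rcases (hmem t i b).1 hx with ⟨rfl, rfl⟩ | ⟨⟨h1, h2⟩, hb⟩
    · refine card_nbrs_eq_two (y := (t, 1, j)) (z := (t, 1, j')) (by simpa using hj.ne)
        ((hmem _ _ _).2 (by omega)) ((hmem _ _ _).2 (by omega)) (ringGraph_adj_base t j)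
        (ringGraph_adj_base t j') ?_
      rintro ⟨t', i', b'⟩ hw hadj
      rw [hmem] at hw
      rw [ringGraph_adj] at hadj
      rcases hadj with ⟨rfl, h⟩ | ⟨rfl, h⟩ | ⟨rfl, h⟩ | ⟨rfl, h⟩
      · simp only [Prod.mk.injEq, true_and]; omega
      · omega
      · omega
      · omega
    have hprev : ∃ u v, (t, u, v) ∈ A ∧ (ringGraph len).Adj (t, i, b) (t, u, v) ∧ u + 1 = i ∧
        (u = 0 ∧ v = 0 ∨ 0 < u ∧ v = b) := by
      by_cases hi : i = 1
      · subst hi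
        exact ⟨0, 0, (hmem _ _ _).2 (by omega), (ringGraph_adj_base t b).symm, rfl,
          Or.inl ⟨rfl, rfl⟩⟩
      · obtain ⟨k, rfl⟩ : ∃ k, i = k + 1 := ⟨i - 1, by omega⟩
        exact ⟨k, b, (hmem _ _ _).2 (by omega), (ringGraph_adj_succ t k b).symm, rfl,
          Or.inr ⟨by omega, rfl⟩⟩
    obtain ⟨u, v, huv, huadj, hui, hu0⟩ := hprev
    have hnext : ∃ y, y ∈ A ∧ (ringGraph len).Adj (t, i, b) y ∧
        ((i < len t ∧ y = (t, i + 1, b)) ∨ (i = len t ∧ b = j ∧ y = (t + 1, len (t + 1), j')) ∨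
        (i = len t ∧ b = j' ∧ ∃ t', t = t' + 1 ∧ y = (t', len t', j))) := by
      by_cases hi : i < len t
      · exact ⟨_, (hmem _ _ _).2 (by omega), ringGraph_adj_succ t i b, Or.inl ⟨hi, rfl⟩⟩
      · obtain rfl : i = len t := by omega
        have hl1 := hlen (t + 1)
        have hl2 := hlen (t - 1)
        rcases hb with rfl | rfl
        · exact ⟨(t + 1, len (t + 1), j'), (hmem _ _ _).2 (by omega), ringGraph_adj_end t hj,
            Or.inr (Or.inl ⟨rfl, rfl, rfl⟩)⟩
        · refine ⟨(t - 1, len (t - 1), j), (hmem _ _ _).2 (by omega), ?_,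
            Or.inr (Or.inr ⟨rfl, rfl, t - 1, by ring, rfl⟩)⟩
          have := ringGraph_adj_end (len := len) (t - 1) hj
          rw [sub_add_cancel] at this
          exact this.symm
    obtain ⟨y, hy, hyadj, hyc⟩ := hnext
    refine card_nbrs_eq_two (y := y) (z := (t, u, v)) ?_ hy huv hyadj huadj ?_
    · rintro rfl
      rcases hyc with ⟨h, h'⟩ | ⟨h, h', h''⟩ | ⟨h, h', t', h'', h'''⟩
      · simp only [Prod.mk.injEq, true_and] at h'
        omega
      · simp only [Prod.mk.injEq] at h''
        exact hm t h''.1.symm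
      · simp only [Prod.mk.injEq] at h'''
        rw [← h'''.1] at h''
        exact hm t h''.symm
    · rintro ⟨t', i', b'⟩ hw hadj
      rw [hmem] at hw
      rw [ringGraph_adj] at hadj
      rcases hadj with ⟨rfl, h⟩ | ⟨rfl, h⟩ | ⟨rfl, h⟩ | ⟨rfl, h⟩
      · left
        rcases hyc with ⟨h3, h'⟩ | ⟨h3, h', h''⟩ | ⟨h3, h', t', h'', h'''⟩
        · rw [h']
          simp only [Prod.mk.injEq, true_and]
          omega
        · omega
        · omega
      · right
        simp only [Prod.mk.injEq, true_and]
        omega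
      · left
        have hl1 := hlen (t + 1)
        rcases hyc with ⟨h3, h'⟩ | ⟨h3, h', h''⟩ | ⟨h3, h', t', h'', h'''⟩
        · omega
        · rw [h'']
          simp only [Prod.mk.injEq, true_and]
          omega
        · omega
      · left
        have hl1 := hlen t'
        rcases hyc with ⟨h3, h'⟩ | ⟨h3, h', h''⟩ | ⟨h3, h', t'', h'', h'''⟩
        · omega
        · omega
        · obtain rfl : t' = t'' := add_right_cancel h''
          rw [h''']
          simp only [Prod.mk.injEq, true_and]
          omega
  · intro T hT hne hcl
    have hdown : ∀ t i b, (t, i, b) ∈ T → (t, 0, 0) ∈ T := by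
      intro t i b
      induction i with
      | zero =>
        intro h
        obtain ⟨-, rfl⟩ : (0 : ℕ) = 0 ∧ b = 0 := by
          have := (hmem _ _ _).1 (hT h)
          omega
        exact h
      | succ i ih =>
        intro h
        have h1 := (hmem _ _ _).1 (hT h)
        rcases Nat.eq_zero_or_pos i with rfl | hi
        · exact hcl _ h _ ((hmem _ _ _).2 (by omega)) (ringGraph_adj_base t b).symm
        · exact ih (hcl _ h _ ((hmem _ _ _).2 (by omega)) (ringGraph_adj_succ t i b).symm)
    have hup : ∀ t b, (b = j ∨ b = j') → (t, 0, 0) ∈ T → ∀ i, 1 ≤ i → i ≤ len t →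
        (t, i, b) ∈ T := by
      intro t b hb h i h1
      induction i, h1 using Nat.le_induction with
      | base =>
        intro hi
        exact hcl _ h _ ((hmem _ _ _).2 (by omega)) (ringGraph_adj_base t b)
      | succ i h1 ih =>
        intro hi
        exact hcl _ (ih (by omega)) _ ((hmem _ _ _).2 (by omega)) (ringGraph_adj_succ t i b)
    have hall : ∀ t, (t, 0, 0) ∈ T := by
      obtain ⟨⟨t₀, i₀, b₀⟩, h0⟩ := hne
      refine forall_of_forall_add_one (p := fun t => (t, 0, 0) ∈ T) (fun t ht => ?_)
        (hdown t₀ i₀ b₀ h0)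
      have hl := hlen t
      have hl' := hlen (t + 1)
      have h1 := hup t j (Or.inl rfl) ht (len t) (by omega) le_rfl
      exact hdown _ _ _ (hcl _ h1 _ ((hmem _ _ _).2 (by omega)) (ringGraph_adj_end t hj))
    apply Finset.Subset.antisymm hT
    rintro ⟨t, i, b⟩ hx
    rcases (hmem _ _ _).1 hx with ⟨rfl, rfl⟩ | ⟨h, hb⟩
    · exact hall t
    · exact hup t b hb (hall t) i h.1 h.2

end Ring

section Ring
variable {m : ℕ} {len : ZMod m → ℕ}

theorem ring_step {r : ℕ} {A : Finset (ZMod m × ℕ × ℕ)} (hA : CycSet (ringGraph len) r A)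
    (hAS : ∀ t i j, (t, i, j) ∈ A → (i = 0 ∧ j = 0) ∨ (1 ≤ i ∧ i ≤ len t)) {t : ZMod m} {i j : ℕ}
    (h : (t, i, j) ∈ A) (h1 : 1 ≤ i) (h2 : i < len t) :
    (if i = 1 then (t, 0, 0) else (t, i - 1, j)) ∈ A ∧ (t, i + 1, j) ∈ A := by
  apply hA.mem_of_nbrs h
  rintro ⟨t', i', j'⟩ hw hadj
  have := hAS _ _ _ hw
  rw [ringGraph_adj] at hadj
  rcases hadj with ⟨rfl, h⟩ | ⟨rfl, h⟩ | ⟨rfl, h⟩ | ⟨rfl, h⟩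
  · right
    simp only [Prod.mk.injEq, true_and]
    omega
  · left
    split_ifs <;> simp only [Prod.mk.injEq, true_and] <;> omega
  · omega
  · omega

/-- Inner leg vertices have degree two, so a cycle through one of them contains the whole leg and
its base vertex. -/
theorem ring_leg {r : ℕ} {A : Finset (ZMod m × ℕ × ℕ)} (hA : CycSet (ringGraph len) r A)
    (hAS : ∀ t i j, (t, i, j) ∈ A → (i = 0 ∧ j = 0) ∨ (1 ≤ i ∧ i ≤ len t)) {t : ZMod m} {i j : ℕ}
    (h : (t, i, j) ∈ A) (h1 : 1 ≤ i) (h2 : i < len t) :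
    (t, 0, 0) ∈ A ∧ ∀ k, 1 ≤ k → k ≤ len t → (t, k, j) ∈ A := by
  have hdown : ∀ i, 1 ≤ i → i < len t → (t, i, j) ∈ A → (t, 0, 0) ∈ A ∧ (t, 1, j) ∈ A := by
    intro i h1
    induction i, h1 using Nat.le_induction with
    | base =>
      intro h2 h
      have := (ring_step hA hAS h le_rfl h2).1
      rw [if_pos rfl] at this
      exact ⟨this, h⟩
    | succ i h1 ih =>
      intro h2 h
      have := (ring_step hA hAS h (by omega) h2).1
      rw [if_neg (by omega), Nat.add_sub_cancel] at this
      exact ih (by omega) this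
  obtain ⟨h3, h4⟩ := hdown i h1 h2 h
  refine ⟨h3, fun k hk => ?_⟩
  induction k, hk using Nat.le_induction with
  | base => exact fun _ => h4
  | succ k hk ih => exact fun hk' => (ring_step hA hAS (ih (by omega)) hk (by omega)).2

/-- The legs of type `t` in an induced cycle which contains the base vertex of type `t`. -/
theorem ring_base {r : ℕ} {A : Finset (ZMod m × ℕ × ℕ)} (hA : CycSet (ringGraph len) r A)
    (hAS : ∀ t i j, (t, i, j) ∈ A → (i = 0 ∧ j = 0) ∨ (1 ≤ i ∧ i ≤ len t))
    (hlen : ∀ t, 2 ≤ len t) {t : ZMod m} (h : (t, 0, 0) ∈ A) :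
    ∃ l l', l < l' ∧ (∀ k, 1 ≤ k → k ≤ len t → (t, k, l) ∈ A ∧ (t, k, l') ∈ A) ∧
      ∀ j, (t, 1, j) ∈ A → j = l ∨ j = l' := by
  have hl := hlen t
  have hnbr : ∀ y ∈ A, (ringGraph len).Adj (t, 0, 0) y → ∃ j, y = (t, 1, j) := by
    rintro ⟨t', i', j'⟩ hw hadj
    have := hAS _ _ _ hw
    rw [ringGraph_adj] at hadj
    rcases hadj with ⟨rfl, h⟩ | ⟨rfl, h⟩ | ⟨rfl, h⟩ | ⟨rfl, h⟩
    · obtain rfl : i' = 1 := by omega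
      exact ⟨j', rfl⟩
    · omega
    · omega
    · omega
  have key : ∀ l l', l < l' → (t, 1, l) ∈ A → (t, 1, l') ∈ A →
      (∀ k, 1 ≤ k → k ≤ len t → (t, k, l) ∈ A ∧ (t, k, l') ∈ A) ∧
      ∀ j, (t, 1, j) ∈ A → j = l ∨ j = l' := by
    intro l l' hll h1 h2
    refine ⟨fun k hk hk' => ⟨(ring_leg hA hAS h1 le_rfl (by omega)).2 k hk hk',
      (ring_leg hA hAS h2 le_rfl (by omega)).2 k hk hk'⟩, fun j hj => ?_⟩
    by_contra hne
    push Not at hne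
    exact hA.not_three_nbrs h h1 h2 hj (by simpa using hll.ne) (by simpa using hne.1.symm)
      (by simpa using hne.2.symm) (ringGraph_adj_base t l) (ringGraph_adj_base t l')
      (ringGraph_adj_base t j)
  obtain ⟨y, hy, z, hz, hyz, hxy, hxz⟩ := hA.exists_two_nbrs h
  obtain ⟨j, rfl⟩ := hnbr y hy hxy
  obtain ⟨j', rfl⟩ := hnbr z hz hxz
  have hjj : j ≠ j' := by
    rintro rfl
    exact hyz rfl
  rcases lt_or_gt_of_ne hjj with hlt | hlt
  · exact ⟨j, j', hlt, key j j' hlt hy hz⟩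
  · exact ⟨j', j, hlt, key j' j hlt hz hy⟩

/-- The indices of the legs of type `t` whose ends belong to `A`. -/
noncomputable def ringEnds (len : ZMod m → ℕ) (A : Finset (ZMod m × ℕ × ℕ)) (t : ZMod m) :
    Finset ℕ :=
  (A.filter fun x => x.1 = t ∧ x.2.1 = len t).image fun x => x.2.2

theorem mem_ringEnds {A : Finset (ZMod m × ℕ × ℕ)} {t : ZMod m} {j : ℕ} :
    j ∈ ringEnds len A t ↔ (t, len t, j) ∈ A := by
  simp only [ringEnds, Finset.mem_image, Finset.mem_filter]
  constructor
  · rintro ⟨⟨t', i, b⟩, ⟨h, h1, h2⟩, h3⟩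
    simp only at h1 h2 h3
    subst h1 h2 h3
    exact h
  · intro h
    exact ⟨_, ⟨h, rfl, rfl⟩, rfl⟩

/-- The degree of an end, split into its leg, the larger ends of the next type and the smaller ends
of the previous type; `t + 1 + 1 ≠ t` keeps these two types apart. -/
theorem ring_card_nbrs {r : ℕ} {A : Finset (ZMod m × ℕ × ℕ)} (hA : CycSet (ringGraph len) r A)
    (hAS : ∀ t i j, (t, i, j) ∈ A → (i = 0 ∧ j = 0) ∨ (1 ≤ i ∧ i ≤ len t))
    (hlen : ∀ t, 2 ≤ len t) (hm : ∀ t : ZMod m, t + 1 ≠ t) (hm2 : ∀ t : ZMod m, t + 1 + 1 ≠ t)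
    {t : ZMod m} {j : ℕ} (hj : j ∈ ringEnds len A (t + 1)) :
    (if (t + 1, len (t + 1) - 1, j) ∈ A then 1 else 0) +
      ((ringEnds len A (t + 1 + 1)).filter (j < ·)).card +
      ((ringEnds len A t).filter (· < j)).card = 2 := by
  rw [mem_ringEnds] at hj
  have hl := hlen (t + 1)
  rw [← hA.2.1 _ hj]
  have hinj : ∀ (u : ZMod m), Function.Injective fun b : ℕ => (u, len u, b) := by
    intro u a b h
    simpa using h
  set X : Finset (ZMod m × ℕ × ℕ) :=
    if (t + 1, len (t + 1) - 1, j) ∈ A then {(t + 1, len (t + 1) - 1, j)} else ∅ with hX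
  set Y := ((ringEnds len A (t + 1 + 1)).filter (j < ·)).image
    fun b => (t + 1 + 1, len (t + 1 + 1), b) with hY
  set Z := ((ringEnds len A t).filter (· < j)).image fun b => (t, len t, b) with hZ
  have hXmem : ∀ y, y ∈ X ↔ (t + 1, len (t + 1) - 1, j) ∈ A ∧ y = (t + 1, len (t + 1) - 1, j) := by
    intro y
    rw [hX]
    split_ifs with h <;> simp [h]
  have hXc : X.card = if (t + 1, len (t + 1) - 1, j) ∈ A then 1 else 0 := by
    rw [hX]
    split_ifs <;> simp
  have hYc : Y.card = ((ringEnds len A (t + 1 + 1)).filter (j < ·)).card :=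
    Finset.card_image_of_injective _ (hinj _)
  have hZc : Z.card = ((ringEnds len A t).filter (· < j)).card :=
    Finset.card_image_of_injective _ (hinj _)
  have hYmem : ∀ y ∈ Y, ∃ b, (t + 1 + 1, len (t + 1 + 1), b) ∈ A ∧ j < b ∧
      y = (t + 1 + 1, len (t + 1 + 1), b) := by
    intro y hy
    obtain ⟨b, hb, rfl⟩ := Finset.mem_image.1 hy
    rw [Finset.mem_filter, mem_ringEnds] at hb
    exact ⟨b, hb.1, hb.2, rfl⟩
  have hZmem : ∀ y ∈ Z, ∃ b, (t, len t, b) ∈ A ∧ b < j ∧ y = (t, len t, b) := by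
    intro y hy
    obtain ⟨b, hb, rfl⟩ := Finset.mem_image.1 hy
    rw [Finset.mem_filter, mem_ringEnds] at hb
    exact ⟨b, hb.1, hb.2, rfl⟩
  have hXY : Disjoint X Y := by
    rw [Finset.disjoint_left]
    intro y h1 h2
    obtain ⟨b, -, -, rfl⟩ := hYmem y h2
    have := ((hXmem _).1 h1).2
    simp only [Prod.mk.injEq] at this
    exact hm _ this.1
  have hXYZ : Disjoint (X ∪ Y) Z := by
    rw [Finset.disjoint_left]
    intro y h1 h2
    obtain ⟨b, -, -, rfl⟩ := hZmem y h2
    rcases Finset.mem_union.1 h1 with h1 | h1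
    · have := ((hXmem _).1 h1).2
      simp only [Prod.mk.injEq] at this
      exact hm _ this.1.symm
    · obtain ⟨b', -, -, h3⟩ := hYmem _ h1
      simp only [Prod.mk.injEq] at h3
      exact hm2 _ h3.1.symm
  rw [← hXc, ← hYc, ← hZc, ← Finset.card_union_of_disjoint hXY,
    ← Finset.card_union_of_disjoint hXYZ]
  congr 1
  ext y
  rw [mem_nbrs, Finset.mem_union, Finset.mem_union]
  constructor
  · rintro ((h | h) | h)
    · obtain ⟨h1, rfl⟩ := (hXmem _).1 h
      refine ⟨h1, ?_⟩
      have := ringGraph_adj_succ (len := len) (t + 1) (len (t + 1) - 1) j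
      rw [Nat.sub_add_cancel (by omega)] at this
      exact this.symm
    · obtain ⟨b, h1, h2, rfl⟩ := hYmem _ h
      exact ⟨h1, ringGraph_adj_end _ h2⟩
    · obtain ⟨b, h1, h2, rfl⟩ := hZmem _ h
      exact ⟨h1, (ringGraph_adj_end _ h2).symm⟩
  · obtain ⟨t', i', j'⟩ := y
    rintro ⟨hw, hadj⟩
    rw [ringGraph_adj] at hadj
    rcases hadj with ⟨rfl, h1, h2⟩ | ⟨rfl, h1, h2⟩ | ⟨rfl, h1, h2, h3⟩ | ⟨h0, h1, h2, h3⟩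
    · have := hAS _ _ _ hw
      omega
    · obtain rfl : j' = j := by omega
      obtain rfl : i' = len (t + 1) - 1 := by omega
      exact Or.inl (Or.inl ((hXmem _).2 ⟨hw, rfl⟩))
    · subst h2
      exact Or.inl (Or.inr (Finset.mem_image.2 ⟨j', Finset.mem_filter.2
        ⟨mem_ringEnds.2 hw, h3⟩, rfl⟩))
    · obtain rfl : t' = t := (add_right_cancel h0).symm
      subst h1
      exact Or.inr (Finset.mem_image.2 ⟨j', Finset.mem_filter.2 ⟨mem_ringEnds.2 hw, h3⟩, rfl⟩)

/-- The two legs, their base vertex and `z` would form a cycle of `2 * len t + 2` vertices inside a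
longer induced cycle. -/
theorem ring_no_short {r : ℕ} {A : Finset (ZMod m × ℕ × ℕ)} (hA : CycSet (ringGraph len) r A)
    (hlen : ∀ t, 2 ≤ len t) {t : ZMod m} (hr : 2 * len t + 2 < r) (h0 : (t, 0, 0) ∈ A) {l l' : ℕ}
    (hll : l < l') (hleg : ∀ k, 1 ≤ k → k ≤ len t → (t, k, l) ∈ A ∧ (t, k, l') ∈ A)
    {z : ZMod m × ℕ × ℕ} (hz : z ∈ A) (hzt : z.1 ≠ t)
    (h1 : (ringGraph len).Adj (t, len t, l) z) (h2 : (ringGraph len).Adj (t, len t, l') z) :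
    False := by
  have hl := hlen t
  have hne : ∀ k b, z ≠ (t, k, b) := by
    rintro k b rfl
    exact hzt rfl
  have h3 : len t - 1 + 1 = len t := by omega
  have := hA.eq_of_two_paths (d := len t) (P := fun k => (t, k + 1, l))
    (P' := fun k => (t, k + 1, l')) (y := (t, 0, 0)) (z := z) (by omega) h0 hz (hne 0 0).symm
    (fun k hk => hleg (k + 1) (by omega) hk) (fun k _ => by simpa using hll.ne)
    (fun k _ => ⟨ringGraph_adj_succ _ _ _, ringGraph_adj_succ _ _ _⟩)
    (fun i _ k _ h => by simpa using h) (fun i _ k _ h => by simpa using h)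
    ⟨(ringGraph_adj_base t l).symm, (ringGraph_adj_base t l').symm⟩
    ⟨by simpa only [h3] using h1, by simpa only [h3] using h2⟩ (fun k _ => by simp)
    (fun k _ => ⟨hne _ _, hne _ _⟩)
  have hc : A.card ≤ 2 + (len t + len t) := by
    rw [← this]
    refine (Finset.card_union_le _ _).trans (add_le_add Finset.card_le_two ?_)
    refine (Finset.card_union_le _ _).trans (add_le_add ?_ ?_) <;>
    · refine Finset.card_image_le.trans ?_
      simp
  rw [hA.1] at hc
  omega

end Ring

section Ring
variable {m : ℕ} {len : ZMod m → ℕ}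

/-- `le'` and `ge` hold since an end adjacent to both leg ends of a type would close a short cycle.
Consequently `l t` has no neighbour among the ends of the previous type and `l' t` none among those
of the next; besides its leg, each has exactly one neighbour on the other side, which is `card_gt`
and `card_lt`. Summing degrees over the ends of one type gives `degree`. -/
theorem isRingPattern_of_cycSet {r : ℕ} {A : Finset (ZMod m × ℕ × ℕ)}
    (hA : CycSet (ringGraph len) r A)
    (hAS : ∀ t i j, (t, i, j) ∈ A → (i = 0 ∧ j = 0) ∨ (1 ≤ i ∧ i ≤ len t))
    (hlen : ∀ t, 2 ≤ len t) (hm : ∀ t : ZMod m, t + 1 ≠ t) (hm2 : ∀ t : ZMod m, t + 1 + 1 ≠ t)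
    (hr : ∀ t, 2 * len t + 2 < r) (l l' : ZMod m → ℕ)
    (hll : ∀ t, (t, 0, 0) ∈ A → l t < l' t)
    (hleg : ∀ t, (t, 0, 0) ∈ A → ∀ k, 1 ≤ k → k ≤ len t → (t, k, l t) ∈ A ∧ (t, k, l' t) ∈ A)
    (huniq : ∀ t, (t, 0, 0) ∈ A → ∀ j, (t, 1, j) ∈ A → j = l t ∨ j = l' t) :
    IsRingPattern (ringEnds len A) (fun t => (t, 0, 0) ∈ A) l l' := by
  have hmem : ∀ t, (t, 0, 0) ∈ A → l t ∈ ringEnds len A t ∧ l' t ∈ ringEnds len A t := by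
    intro t h
    have := hleg t h (len t) (by have := hlen t; omega) le_rfl
    exact ⟨mem_ringEnds.2 this.1, mem_ringEnds.2 this.2⟩
  have hle : ∀ t, (t, 0, 0) ∈ A → ∀ x ∈ ringEnds len A (t + 1), x ≤ l' t := by
    intro t h x hx
    by_contra hlt
    have h1 := hll t h
    exact ring_no_short hA hlen (hr t) h h1 (hleg t h) (mem_ringEnds.1 hx) (hm t)
      (ringGraph_adj_end t (by omega)) (ringGraph_adj_end t (by omega))
  have hge : ∀ t, (t + 1, 0, 0) ∈ A → ∀ x ∈ ringEnds len A t, l (t + 1) ≤ x := by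
    intro t h x hx
    by_contra hlt
    have h1 := hll _ h
    exact ring_no_short hA hlen (hr _) h h1 (hleg _ h) (mem_ringEnds.1 hx) (hm t).symm
      (ringGraph_adj_end t (by omega)).symm (ringGraph_adj_end t (by omega)).symm
  have hprev : ∀ t j, (t, len t - 1, j) ∈ A ↔ (t, 0, 0) ∈ A ∧ (j = l t ∨ j = l' t) := by
    intro t j
    have hl := hlen t
    constructor
    · intro h
      have h1 := ring_leg hA hAS h (by omega) (by omega)
      exact ⟨h1.1, huniq t h1.1 j (h1.2 1 le_rfl (by omega))⟩
    · rintro ⟨h, rfl | rfl⟩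
      · exact (hleg t h _ (by omega) (by omega)).1
      · exact (hleg t h _ (by omega) (by omega)).2
  have hdeg : ∀ t, ∀ j ∈ ringEnds len A (t + 1),
      (if (t + 1, 0, 0) ∈ A ∧ (j = l (t + 1) ∨ j = l' (t + 1)) then 1 else 0) +
      ((ringEnds len A (t + 1 + 1)).filter (j < ·)).card +
      ((ringEnds len A t).filter (· < j)).card = 2 := by
    intro t j hj
    have := ring_card_nbrs hA hAS hlen hm hm2 hj
    simp only [hprev] at this
    convert this
  have hsub : ∀ t : ZMod m, ∃ u, t = u + 1 := fun t => ⟨t - 1, by ring⟩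
  refine ⟨hll, fun t h => (hmem t h).1, fun t h => (hmem t h).2, hle, hge, ?_, ?_, ?_, ?_⟩
  · intro t h
    obtain ⟨u, rfl⟩ := hsub t
    have h1 := hdeg u _ (hmem _ h).1
    rw [if_pos ⟨h, Or.inl rfl⟩] at h1
    have h2 : (ringEnds len A u).filter (· < l (u + 1)) = ∅ := by
      rw [Finset.filter_eq_empty_iff]
      intro x hx
      have := hge u h x hx
      omega
    rw [h2, Finset.card_empty] at h1
    omega
  · intro t h
    have h1 := hdeg t _ (hmem _ h).2
    rw [if_pos ⟨h, Or.inr rfl⟩] at h1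
    have h2 : (ringEnds len A (t + 1 + 1)).filter (l' (t + 1) < ·) = ∅ := by
      rw [Finset.filter_eq_empty_iff]
      intro x hx
      have := hle _ h x hx
      omega
    rw [h2, Finset.card_empty] at h1
    omega
  · intro t
    have h1 := Finset.sum_congr rfl (hdeg t)
    rw [Finset.sum_add_distrib, Finset.sum_add_distrib, ← ltPairs_eq, Finset.sum_const,
      smul_eq_mul] at h1
    have h2 : ∑ j ∈ ringEnds len A (t + 1),
        (if (t + 1, 0, 0) ∈ A ∧ (j = l (t + 1) ∨ j = l' (t + 1)) then 1 else 0) =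
        if (t + 1, 0, 0) ∈ A then 2 else 0 := by
      split_ifs with h
      · rw [← Finset.sum_filter, Finset.sum_const, smul_eq_mul, mul_one,
          ← Finset.card_pair (hll _ h).ne]
        congr 1
        ext j
        simp only [Finset.mem_filter, Finset.mem_insert, Finset.mem_singleton]
        constructor
        · exact fun h' => h'.2.2
        · rintro (rfl | rfl)
          · exact ⟨(hmem _ h).1, h, Or.inl rfl⟩
          · exact ⟨(hmem _ h).2, h, Or.inr rfl⟩
      · apply Finset.sum_eq_zero
        intro j _
        rw [if_neg fun h' => h h'.1]
    have h3 : ∀ x : ℕ, x + ∑ j ∈ ringEnds len A (t + 1),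
          ((ringEnds len A (t + 1 + 1)).filter (j < ·)).card +
        ltPairs (ringEnds len A t) (ringEnds len A (t + 1)) = (ringEnds len A (t + 1)).card * 2 →
        ltPairs (ringEnds len A t) (ringEnds len A (t + 1)) +
          ltPairs (ringEnds len A (t + 1)) (ringEnds len A (t + 1 + 1)) + x =
        2 * (ringEnds len A (t + 1)).card := by
      intro x hx
      change x + ltPairs (ringEnds len A (t + 1)) (ringEnds len A (t + 1 + 1)) + _ = _ at hx
      omega
    apply h3
    convert h1
    convert h2.symm
  · intro t
    apply ltPairs_le_three
    · intro x hx
      obtain ⟨u, rfl⟩ := hsub t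
      have := hdeg u x hx
      omega
    · intro y hy
      have := hdeg t y hy
      omega
    · intro x hx x' hx' y hy y' hy' h1 h2 h3
      rw [mem_ringEnds] at hx hx' hy hy'
      refine hA.no_four (by have := hr t; have := hlen t; omega) hx hx' hy hy' ?_ ?_
        (ringGraph_adj_end t (by omega)) (ringGraph_adj_end t (by omega))
        (ringGraph_adj_end t (by omega)) (ringGraph_adj_end t (by omega))
      · simpa using h1.ne
      · simpa using h2.ne

/-- Counting vertices by type. Besides ends, a present base vertex contributes itself and the `2 *
(len t - 1)` inner vertices of two legs, an absent one nothing. The total `∑ (1 + 2 * len t)` then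
requires two ends for a present type and `1 + 2 * len t ≥ 5` for an absent one. -/
theorem ring_sum_le [NeZero m] {A : Finset (ZMod m × ℕ × ℕ)}
    (hAc : A.card = m + 2 * ∑ t, len t)
    (hA : CycSet (ringGraph len) (m + 2 * ∑ t, len t) A)
    (hAS : ∀ t i j, (t, i, j) ∈ A → (i = 0 ∧ j = 0) ∨ (1 ≤ i ∧ i ≤ len t))
    (hlen : ∀ t, 2 ≤ len t) (l l' : ZMod m → ℕ)
    (huniq : ∀ t, (t, 0, 0) ∈ A → ∀ j, (t, 1, j) ∈ A → j = l t ∨ j = l' t) :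
    ∑ t, (if (t, 0, 0) ∈ A then 2 else 5) ≤ ∑ t, (ringEnds len A t).card := by
  have h1 : A.card = ∑ t, (A.filter fun x => x.1 = t).card :=
    Finset.card_eq_sum_card_fiberwise fun _ _ => Finset.mem_coe.2 (Finset.mem_univ _)
  have h2 : ∀ t, (A.filter fun x => x.1 = t).card ≤
      (ringEnds len A t).card + if (t, 0, 0) ∈ A then 2 * len t - 1 else 0 := by
    intro t
    have hl := hlen t
    have h3 : (A.filter fun x => x.1 = t) ⊆ ((ringEnds len A t).image fun j => (t, len t, j)) ∪
        (if (t, 0, 0) ∈ A then insert (t, 0, 0)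
          ((Finset.Ico 1 (len t) ×ˢ {l t, l' t}).image fun p => (t, p.1, p.2)) else ∅) := by
      rintro ⟨t', i, j⟩ hx0
      obtain ⟨hx, ht⟩ := Finset.mem_filter.1 hx0
      clear hx0
      simp only at ht
      subst ht
      rw [Finset.mem_union]
      rcases hAS _ _ _ hx with ⟨rfl, rfl⟩ | ⟨hi1, hi2⟩
      · right
        rw [if_pos hx]
        exact Finset.mem_insert_self _ _
      · by_cases hi : i = len t'
        · left
          subst hi
          exact Finset.mem_image.2 ⟨j, mem_ringEnds.2 hx, rfl⟩
        · right
          have h4 := ring_leg hA hAS hx hi1 (by omega)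
          rw [if_pos h4.1]
          refine Finset.mem_insert_of_mem (Finset.mem_image.2 ⟨(i, j), ?_, rfl⟩)
          rw [Finset.mem_product, Finset.mem_Ico, Finset.mem_insert, Finset.mem_singleton]
          exact ⟨⟨hi1, by simp only; omega⟩, huniq _ h4.1 j (h4.2 1 le_rfl (by omega))⟩
    refine (Finset.card_le_card h3).trans ((Finset.card_union_le _ _).trans
      (add_le_add Finset.card_image_le ?_))
    split_ifs
    · refine (Finset.card_insert_le _ _).trans ?_
      have h5 := Finset.card_image_le (s := Finset.Ico 1 (len t) ×ˢ {l t, l' t})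
        (f := fun p : ℕ × ℕ => (t, p.1, p.2))
      rw [Finset.card_product, Nat.card_Ico] at h5
      have h6 : ({l t, l' t} : Finset ℕ).card ≤ 2 := Finset.card_le_two
      have h7 := Nat.mul_le_mul_left (len t - 1) h6
      omega
    · simp
  have h3 : ∑ t, (if (t, 0, 0) ∈ A then 2 else 5) +
      ∑ t, (if (t, 0, 0) ∈ A then 2 * len t - 1 else 0) ≤ ∑ t, (1 + 2 * len t) := by
    rw [← Finset.sum_add_distrib]
    apply Finset.sum_le_sum
    intro t _
    have hl := hlen t
    split_ifs <;> omega
  have h4 : ∑ t, (1 + 2 * len t) = m + 2 * ∑ t, len t := by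
    rw [Finset.sum_add_distrib, ← Finset.mul_sum]
    simp [ZMod.card]
  have h5 := Finset.sum_le_sum fun t (_ : t ∈ Finset.univ) => h2 t
  rw [← h1, Finset.sum_add_distrib, hAc] at h5
  omega

/-- Once all base vertices are known to be in the cycle, `ge` and `le'` make `l` and `l'`
nonincreasing around the ring, hence constant. -/
theorem exists_of_cycSet_ringGraph [NeZero m] {A : Finset (ZMod m × ℕ × ℕ)}
    (hA : CycSet (ringGraph len) (m + 2 * ∑ t, len t) A)
    (hAS : ∀ t i j, (t, i, j) ∈ A → (i = 0 ∧ j = 0) ∨ (1 ≤ i ∧ i ≤ len t))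
    (hlen : ∀ t, 2 ≤ len t) (hm : ∀ t : ZMod m, t + 1 ≠ t) (hm2 : ∀ t : ZMod m, t + 1 + 1 ≠ t)
    (hfull : ∀ (T : ZMod m → Finset ℕ) (S : ZMod m → Prop) (l l' : ZMod m → ℕ),
      IsRingPattern T S l l' → ∑ t, (if S t then 2 else 5) ≤ ∑ t, (T t).card → ∀ t, S t) :
    ∃ U : Finset ℕ, U.card = 2 ∧ A = legSpan (ringBase m) (ringLeg len) U := by
  have hex := fun t (h : (t, 0, 0) ∈ A) => ring_base hA hAS hlen h
  choose! l l' hll hleg huniq using hex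
  have hr : ∀ t, 2 * len t + 2 < m + 2 * ∑ t, len t := by
    intro t
    have h1 : len t + len (t + 1) ≤ ∑ t, len t := by
      rw [← Finset.sum_pair (hm t).symm]
      exact Finset.sum_le_sum_of_subset (Finset.subset_univ _)
    have := hlen (t + 1)
    omega
  have hpat := isRingPattern_of_cycSet hA hAS hlen hm hm2 hr l l' hll hleg huniq
  have hS : ∀ t, (t, 0, 0) ∈ A :=
    hfull _ _ l l' hpat (by convert ring_sum_le hA.1 hA hAS hlen l l' huniq)
  have hl : ∀ t, l t = l 0 := fun t =>
    eq_of_cyclic_antitone (fun t => hpat.ge t (hS _) _ (hpat.mem t (hS t))) t 0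
  have hl' : ∀ t, l' t = l' 0 := fun t =>
    eq_of_cyclic_antitone (fun t => hpat.le' t (hS _) _ (hpat.mem' _ (hS _))) t 0
  have hc := Finset.card_pair (hll 0 (hS 0)).ne
  refine ⟨{l 0, l' 0}, hc, (Finset.eq_of_subset_of_card_le ?_ ?_).symm⟩
  · rintro ⟨t, i, b⟩ hx
    rw [mem_legSpan, mem_ringBase] at hx
    rcases hx with ⟨rfl, rfl⟩ | ⟨j, hj, hx⟩
    · exact hS t
    · obtain ⟨⟨h1, h2⟩, rfl⟩ := mem_ringLeg.1 hx
      have := hleg t (hS t) i h1 h2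
      rw [hl, hl'] at this
      rw [Finset.mem_insert, Finset.mem_singleton] at hj
      rcases hj with rfl | rfl
      · exact this.1
      · exact this.2
  · rw [hA.1, card_ringSpan, hc]

theorem choose_two_le_psiCycle_ring [NeZero m] (hlen : ∀ t, 2 ≤ len t)
    (hm : ∀ t : ZMod m, t + 1 ≠ t) (hm2 : ∀ t : ZMod m, t + 1 + 1 ≠ t)
    (hfull : ∀ (T : ZMod m → Finset ℕ) (S : ZMod m → Prop) (l l' : ZMod m → ℕ),
      IsRingPattern T S l l' → ∑ t, (if S t then 2 else 5) ≤ ∑ t, (T t).card → ∀ t, S t)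
    {n N : ℕ} (hn : m + (∑ t, len t) * N ≤ n) :
    N.choose 2 ≤ PsiCycle (m + 2 * ∑ t, len t) (progression m 2 (∑ t, len t)) n := by
  have hcard : ((Finset.range N).powersetCard 2).card = N.choose 2 := by simp
  have hd : 2 ≤ ∑ t, len t :=
    (hlen 0).trans (Finset.single_le_sum (fun _ _ => Nat.zero_le _) (Finset.mem_univ _))
  have hm0 : 0 < m := Nat.pos_of_ne_zero (NeZero.ne m)
  rw [← hcard]
  refine card_le_psiCycle_of_legs (G := ringGraph len)
    (S := legSpan (ringBase m) (ringLeg len) (Finset.range N)) (by omega) (by omega) ?_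
    card_ringBase card_ringLeg disjoint_ringBase (fun _ _ h => disjoint_ringLeg h) ?_ ?_
  · rw [card_ringSpan, Finset.card_range, mul_comm]
    exact hn
  · intro A hAS hA
    refine exists_of_cycSet_ringGraph hA (fun t i j h => ?_) hlen hm hm2 hfull
    rcases mem_legSpan.1 (hAS h) with h | ⟨k, -, h⟩
    · exact Or.inl (mem_ringBase.1 h)
    · exact Or.inr (mem_ringLeg.1 h).1
  · intro U hU
    obtain ⟨i, j, hij, hj, rfl⟩ := exists_pair_of_mem_powersetCard hU
    refine ⟨?_, cycSet_ringGraph hm hlen hij⟩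
    intro x hx
    rcases mem_legSpan.1 hx with h | ⟨k, hk, h⟩
    · exact mem_legSpan.2 (Or.inl h)
    · exact mem_legSpan.2 (Or.inr ⟨k, (Finset.mem_powersetCard.1 hU).1 hk, h⟩)

end Ring

/-- Every type gets length two, and type `0` takes the rest. -/
theorem exists_leg_lengths {m d : ℕ} [NeZero m] (hd : 2 * m < d) :
    ∃ len : ZMod m → ℕ, (∀ t, 2 ≤ len t) ∧ ∑ t, len t = d := by
  have hm0 : 0 < m := Nat.pos_of_ne_zero (NeZero.ne m)
  refine ⟨fun t => 2 + if t = 0 then d - 2 * m else 0, fun t => by simp, ?_⟩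
  rw [Finset.sum_add_distrib, Finset.sum_ite_eq' Finset.univ (0 : ZMod m) fun _ => d - 2 * m]
  simp [ZMod.card]
  omega

theorem asympGe_two_ring {l d : ℕ} (hl : l = 3 ∨ l = 4) (hd : 2 * l < d) :
    AsympGe (PsiCycle (l + 2 * d) (progression l 2 d)) 2 (bench (l + 2 * d) l 2) := by
  refine asympGe_two_of_choose_two (by omega) rfl fun n N hn => ?_
  rcases hl with rfl | rfl
  · obtain ⟨len, hlen, rfl⟩ := exists_leg_lengths hd
    exact choose_two_le_psiCycle_ring hlen (by decide) (by decide)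
      (fun T S l l' h hsum => h.three hsum) hn
  · obtain ⟨len, hlen, rfl⟩ := exists_leg_lengths hd
    exact choose_two_le_psiCycle_ring hlen (by decide) (by decide)
      (fun T S l l' h hsum => h.four hsum) hn

/-! ### Three matchings of a cubic graph, and the constant `4 / 3`. -/

/-- The vertices `(x, true)` and `(x, false)` with `x ∈ {0, d}` are identified. -/
def level (d : ℕ) (b : Bool) (x : ℕ) : ℕ × Bool := if x = 0 ∨ x = d then (x, false) else (x, b)

/-- The ends of the `x`-th edge of the `i`-th matching, in a factorization of a cubic graph on
`2 * d` vertices into three perfect matchings. -/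
def matchEnds (d : ℕ) (i : Fin 3) (x : ℕ) : Finset (ℕ × Bool) :=
  if i = 0 then {level d true x, level d false (x + 1)}
  else if i = 1 then {level d false x, level d true (x + 1)}
  else if x = 0 then {(0, false), (d, false)} else {(x, true), (x, false)}

/-- The index of the edge of the `i`-th matching at a given vertex. -/
def matchPos (d : ℕ) (i : Fin 3) (k : ℕ × Bool) : ℕ :=
  if i = 0 then if k.1 = 0 then 0 else if k.1 = d then d - 1 else if k.2 then k.1 else k.1 - 1
  else if i = 1 then
    if k.1 = 0 then 0 else if k.1 = d then d - 1 else if k.2 then k.1 - 1 else k.1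
  else if k.1 = d then 0 else k.1

/-- The cubic graph is a ladder closed at both ends: levels `0` and `d` hold one vertex, those
between them two. Matchings `0` and `1` join consecutive levels; matching `2` consists of the rungs
and of the edge between the two extreme vertices. -/
def matchBase (d : ℕ) : Finset (ℕ × Bool) :=
  (Finset.range (d + 1) ×ˢ {false}) ∪ (Finset.Ico 1 d ×ˢ {true})

theorem mem_matchBase {d x : ℕ} {b : Bool} :
    (x, b) ∈ matchBase d ↔ x ≤ d ∧ (b = true → 0 < x ∧ x < d) := by
  cases b <;> simp [matchBase] <;> omega

theorem card_matchBase {d : ℕ} (hd : 0 < d) : (matchBase d).card = 2 * d := by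
  rw [matchBase, Finset.card_union_of_disjoint]
  · simp
    omega
  · rw [Finset.disjoint_left]
    rintro ⟨x, b⟩ h1 h2
    simp only [Finset.mem_product, Finset.mem_singleton] at h1 h2
    rw [h1.2] at h2
    simp at h2

theorem matchPos_le {d : ℕ} (i : Fin 3) {k : ℕ × Bool} : matchPos d i k ≤ k.1 := by
  unfold matchPos
  split_ifs <;> omega

theorem matchPos_lt {d : ℕ} (hd : 0 < d) (i : Fin 3) {k : ℕ × Bool} (hk : k ∈ matchBase d) :
    matchPos d i k < d := by
  obtain ⟨y, b⟩ := k
  rw [mem_matchBase] at hk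
  unfold matchPos
  split_ifs <;> simp_all <;> omega

theorem matchEnds_zero {d x : ℕ} : matchEnds d 0 x = {level d true x, level d false (x + 1)} := rfl

theorem matchEnds_one {d x : ℕ} : matchEnds d 1 x = {level d false x, level d true (x + 1)} := rfl

theorem matchEnds_two {d x : ℕ} : matchEnds d 2 x =
    if x = 0 then {(0, false), (d, false)} else {(x, true), (x, false)} := rfl

theorem level_mem {d x : ℕ} {b : Bool} (hx : x ≤ d) : level d b x ∈ matchBase d := by
  unfold level
  split_ifs with h
  · exact mem_matchBase.2 ⟨hx, by simp⟩
  · exact mem_matchBase.2 ⟨hx, fun _ => by omega⟩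

theorem level_fst {d x : ℕ} {b : Bool} : (level d b x).1 = x := by
  unfold level
  split_ifs <;> rfl

theorem level_eq {d x : ℕ} {b : Bool} (h : (x, b) ∈ matchBase d) : level d b x = (x, b) := by
  rw [mem_matchBase] at h
  unfold level
  split_ifs with h'
  · cases b
    · rfl
    · have := h.2 rfl
      omega
  · rfl

theorem matchEnds_subset {d x : ℕ} (i : Fin 3) (hx : x < d) : matchEnds d i x ⊆ matchBase d := by
  fin_cases i
  · intro k hk
    rcases Finset.mem_insert.1 hk with rfl | hk
    · exact level_mem (by omega)
    · rw [Finset.mem_singleton.1 hk]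
      exact level_mem (by omega)
  · intro k hk
    rcases Finset.mem_insert.1 hk with rfl | hk
    · exact level_mem (by omega)
    · rw [Finset.mem_singleton.1 hk]
      exact level_mem (by omega)
  · change matchEnds d 2 x ⊆ _
    rw [matchEnds_two]
    split_ifs with h <;> intro k hk <;> rw [Finset.mem_insert, Finset.mem_singleton] at hk <;>
      rcases hk with rfl | rfl <;> rw [mem_matchBase] <;> refine ⟨by omega, ?_⟩ <;> simp <;> omega

theorem card_matchEnds {d x : ℕ} (hd : 0 < d) (i : Fin 3) : (matchEnds d i x).card = 2 := by
  fin_cases i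
  · refine Finset.card_pair fun h => ?_
    have := congrArg Prod.fst h
    rw [level_fst, level_fst] at this
    omega
  · refine Finset.card_pair fun h => ?_
    have := congrArg Prod.fst h
    rw [level_fst, level_fst] at this
    omega
  · change (matchEnds d 2 x).card = 2
    rw [matchEnds_two]
    split_ifs with h <;> apply Finset.card_pair <;> simp
    omega

theorem mem_matchEnds {d x : ℕ} {i : Fin 3} {k : ℕ × Bool} (hk : k ∈ matchBase d) (hx : x < d) :
    k ∈ matchEnds d i x ↔ matchPos d i k = x := by
  obtain ⟨y, b⟩ := k
  rw [mem_matchBase] at hk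
  fin_cases i
  · change (y, b) ∈ ({level d true x, level d false (x + 1)} : Finset _) ↔
      (if y = 0 then 0 else if y = d then d - 1 else if b then y else y - 1) = x
    rw [Finset.mem_insert, Finset.mem_singleton]
    unfold level
    cases b <;> split_ifs <;> simp_all <;> omega
  · change (y, b) ∈ ({level d false x, level d true (x + 1)} : Finset _) ↔
      (if y = 0 then 0 else if y = d then d - 1 else if b then y - 1 else y) = x
    rw [Finset.mem_insert, Finset.mem_singleton]
    unfold level
    cases b <;> split_ifs <;> simp_all <;> omega
  · change (y, b) ∈ matchEnds d 2 x ↔ (if y = d then 0 else y) = x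
    rw [matchEnds_two]
    cases b <;> split_ifs <;> simp_all <;> omega

/-- The vertices are those of `matchBase d` and copies, indexed by `j`, of the edges of the three
matchings. Copies of edges of the same matching with different indices are adjacent. -/
def trioGraph (d : ℕ) : SimpleGraph ((ℕ × Bool) ⊕ (Fin 3 × ℕ × ℕ)) where
  Adj
    | Sum.inl k, Sum.inr (i, _, x) => k ∈ matchEnds d i x
    | Sum.inr (i, _, x), Sum.inl k => k ∈ matchEnds d i x
    | Sum.inr (i, j, _), Sum.inr (i', j', _) => i = i' ∧ j ≠ j'
    | Sum.inl _, Sum.inl _ => False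
  symm := ⟨by
    rintro (k | ⟨i, j, x⟩) (k' | ⟨i', j', x'⟩) h
    · exact h
    · exact h
    · exact h
    · exact ⟨h.1.symm, h.2.symm⟩⟩
  loopless := ⟨by
    rintro (k | ⟨i, j, x⟩) h
    · exact h
    · exact h.2 rfl⟩

def trioLeg (d : ℕ) (p : Fin 3 × ℕ) : Finset ((ℕ × Bool) ⊕ (Fin 3 × ℕ × ℕ)) :=
  (Finset.range d).map ⟨fun x => Sum.inr (p.1, p.2, x), fun x y h => by simpa using h⟩

def trioBase (d : ℕ) : Finset ((ℕ × Bool) ⊕ (Fin 3 × ℕ × ℕ)) :=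
  (matchBase d).map ⟨Sum.inl, Sum.inl_injective⟩

section Trio
variable {d : ℕ}

theorem inl_mem_trioBase {k : ℕ × Bool} : Sum.inl k ∈ trioBase d ↔ k ∈ matchBase d := by
  simp [trioBase]

theorem inr_notMem_trioBase {p : Fin 3 × ℕ × ℕ} : Sum.inr p ∉ trioBase d := by
  simp [trioBase]

theorem inl_notMem_trioLeg {k : ℕ × Bool} {p : Fin 3 × ℕ} : Sum.inl k ∉ trioLeg d p := by
  simp [trioLeg]

theorem inr_mem_trioLeg {i : Fin 3} {j x : ℕ} {p : Fin 3 × ℕ} :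
    Sum.inr (i, j, x) ∈ trioLeg d p ↔ p = (i, j) ∧ x < d := by
  obtain ⟨i', j'⟩ := p
  simp only [trioLeg, Finset.mem_map, Finset.mem_range, Prod.mk.injEq]
  constructor
  · rintro ⟨y, hy, h⟩
    have h : (i', j', y) = (i, j, x) := Sum.inr_injective h
    simp only [Prod.mk.injEq] at h
    exact ⟨⟨h.1, h.2.1⟩, h.2.2 ▸ hy⟩
  · rintro ⟨⟨rfl, rfl⟩, hx⟩
    exact ⟨x, hx, rfl⟩

theorem card_trioLeg (p : Fin 3 × ℕ) : (trioLeg d p).card = d := by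
  simp [trioLeg]

theorem card_trioBase (hd : 0 < d) : (trioBase d).card = 2 * d := by
  simp [trioBase, card_matchBase hd]

theorem disjoint_trioBase (p : Fin 3 × ℕ) : Disjoint (trioBase d) (trioLeg d p) := by
  rw [Finset.disjoint_left]
  rintro (k | q) h h'
  · exact inl_notMem_trioLeg h'
  · exact inr_notMem_trioBase h

theorem disjoint_trioLeg {p q : Fin 3 × ℕ} (hpq : p ≠ q) :
    Disjoint (trioLeg d p) (trioLeg d q) := by
  rw [Finset.disjoint_left]
  rintro (k | ⟨i, j, x⟩) h h'
  · exact inl_notMem_trioLeg h'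
  · exact hpq ((inr_mem_trioLeg.1 h).1.trans (inr_mem_trioLeg.1 h').1.symm)

theorem inl_mem_trioSpan {k : ℕ × Bool} {U : Finset (Fin 3 × ℕ)} :
    Sum.inl k ∈ legSpan (trioBase d) (trioLeg d) U ↔ k ∈ matchBase d := by
  rw [mem_legSpan, inl_mem_trioBase]
  constructor
  · rintro (h | ⟨p, -, h⟩)
    · exact h
    · exact absurd h inl_notMem_trioLeg
  · exact Or.inl

theorem inr_mem_trioSpan {i : Fin 3} {j x : ℕ} {U : Finset (Fin 3 × ℕ)} :
    Sum.inr (i, j, x) ∈ legSpan (trioBase d) (trioLeg d) U ↔ (i, j) ∈ U ∧ x < d := by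
  rw [mem_legSpan]
  constructor
  · rintro (h | ⟨p, hp, h⟩)
    · exact absurd h inr_notMem_trioBase
    · obtain ⟨rfl, hx⟩ := inr_mem_trioLeg.1 h
      exact ⟨hp, hx⟩
  · rintro ⟨hp, hx⟩
    exact Or.inr ⟨_, hp, inr_mem_trioLeg.2 ⟨rfl, hx⟩⟩

/-- Two matchings make up a connected graph. -/
theorem forall_of_matchEnds {P : ℕ × Bool → Prop} (i₀ : Fin 3)
    (hP : ∀ i ≠ i₀, ∀ x < d, ∀ k ∈ matchEnds d i x, ∀ k' ∈ matchEnds d i x, P k → P k')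
    {k k' : ℕ × Bool} (hk : k ∈ matchBase d) (hk' : k' ∈ matchBase d) (h : P k) : P k' := by
  have h0 : i₀ ≠ 0 → ∀ x < d, (P (level d true x) ↔ P (level d false (x + 1))) := fun h x hx =>
    ⟨hP 0 h.symm x hx _ (by simp [matchEnds_zero]) _ (by simp [matchEnds_zero]),
      hP 0 h.symm x hx _ (by simp [matchEnds_zero]) _ (by simp [matchEnds_zero])⟩
  have h1 : i₀ ≠ 1 → ∀ x < d, (P (level d false x) ↔ P (level d true (x + 1))) := fun h x hx =>
    ⟨hP 1 h.symm x hx _ (by simp [matchEnds_one]) _ (by simp [matchEnds_one]),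
      hP 1 h.symm x hx _ (by simp [matchEnds_one]) _ (by simp [matchEnds_one])⟩
  have h2 : i₀ ≠ 2 → ∀ x ≤ d, (P (level d false x) ↔ P (level d true x)) := by
    intro h x hx
    by_cases hx' : x = 0 ∨ x = d
    · unfold level
      rw [if_pos hx', if_pos hx']
    · unfold level
      rw [if_neg hx', if_neg hx']
      have hm : ∀ b, (x, b) ∈ matchEnds d 2 x := by
        intro b
        rw [matchEnds_two, if_neg (by omega)]
        cases b <;> simp
      exact ⟨hP 2 h.symm x (by omega) _ (hm _) _ (hm _), hP 2 h.symm x (by omega) _ (hm _) _ (hm _)⟩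
  have key : ∀ x ≤ d, ∀ b, P (level d b x) ↔ P (level d false 0) := by
    intro x
    induction x with
    | zero =>
      intro _ b
      simp [level]
    | succ x ih =>
      intro hx
      have ih := ih (by omega)
      have e0 := fun h => h0 h x (by omega)
      have e1 := fun h => h1 h x (by omega)
      have e2 := fun h => h2 h (x + 1) (by omega)
      have ht : ∀ Q : Bool → Prop, Q true ∧ Q false → ∀ b, Q b := fun Q h b => by
        cases b
        · exact h.2
        · exact h.1
      apply ht
      rw [ih] at e0 e1
      by_cases hi0 : i₀ = 0
      · have e1 := e1 (by rw [hi0]; decide)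
        have e2 := e2 (by rw [hi0]; decide)
        exact ⟨e1.symm, e2.trans e1.symm⟩
      · have e0 := e0 hi0
        by_cases hi1 : i₀ = 1
        · have e2 := e2 (by rw [hi1]; decide)
          exact ⟨e2.symm.trans e0.symm, e0.symm⟩
        · exact ⟨(e1 hi1).symm, e0.symm⟩
  obtain ⟨x, b⟩ := k
  obtain ⟨x', b'⟩ := k'
  have e1 := key x (mem_matchBase.1 hk).1 b
  have e2 := key x' (mem_matchBase.1 hk').1 b'
  rw [level_eq hk] at e1
  rw [level_eq hk'] at e2
  exact e2.2 (e1.1 h)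

theorem mem_trioIndex {i₀ i : Fin 3} {J : Fin 3 → ℕ} {j : ℕ} :
    (i, j) ∈ (Finset.univ.erase i₀).image (fun i => (i, J i)) ↔ i ≠ i₀ ∧ j = J i := by
  simp only [Finset.mem_image, Finset.mem_erase, Finset.mem_univ, and_true, Prod.mk.injEq]
  constructor
  · rintro ⟨i', h, rfl, rfl⟩
    exact ⟨h, rfl⟩
  · rintro ⟨h, rfl⟩
    exact ⟨i, h, rfl, rfl⟩

theorem card_trioIndex (i₀ : Fin 3) (J : Fin 3 → ℕ) :
    ((Finset.univ.erase i₀).image (fun i => (i, J i))).card = 2 := by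
  rw [Finset.card_image_of_injective _ fun i i' h => (Prod.mk.inj h).1,
    Finset.card_erase_of_mem (Finset.mem_univ _)]
  simp

theorem card_trioSpan (hd : 0 < d) (U : Finset (Fin 3 × ℕ)) :
    (legSpan (trioBase d) (trioLeg d) U).card = 2 * d + U.card * d :=
  card_legSpan (card_trioBase hd) card_trioLeg disjoint_trioBase
    (fun _ _ h => disjoint_trioLeg h) U

/-- `i₀` is the matching left out and `J i` the copy of matching `i` in use. The other two matchings
form a Hamiltonian cycle, which the edge vertices subdivide. -/
theorem cycSet_trioGraph (hd : 2 ≤ d) (i₀ : Fin 3) (J : Fin 3 → ℕ) :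
    CycSet (trioGraph d) (4 * d) (legSpan (trioBase d) (trioLeg d)
      ((Finset.univ.erase i₀).image (fun i => (i, J i)))) := by
  refine ⟨?_, ?_, ?_⟩
  · rw [card_trioSpan (by omega), card_trioIndex]
    ring
  · rintro (k | ⟨i, j, x⟩) h
    · rw [inl_mem_trioSpan] at h
      have h1 : nbrs (trioGraph d) (legSpan (trioBase d) (trioLeg d)
          ((Finset.univ.erase i₀).image (fun i => (i, J i)))) (Sum.inl k) =
          (Finset.univ.erase i₀).image fun i => Sum.inr (i, J i, matchPos d i k) := by
        ext v
        rw [mem_nbrs, Finset.mem_image]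
        constructor
        · rintro ⟨hv, hadj⟩
          rcases v with k' | ⟨i, j, x⟩
          · exact hadj.elim
          · rw [inr_mem_trioSpan, mem_trioIndex] at hv
            obtain ⟨⟨hi, rfl⟩, hx⟩ := hv
            have h2 : k ∈ matchEnds d i x := hadj
            rw [mem_matchEnds h hx] at h2
            exact ⟨i, Finset.mem_erase.2 ⟨hi, Finset.mem_univ _⟩, by rw [h2]⟩
        · rintro ⟨i, hi, rfl⟩
          have hlt := matchPos_lt (by omega : 0 < d) i h
          rw [inr_mem_trioSpan, mem_trioIndex]
          exact ⟨⟨⟨(Finset.mem_erase.1 hi).1, rfl⟩, hlt⟩, (mem_matchEnds h hlt).2 rfl⟩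
      rw [h1, Finset.card_image_of_injective _ fun i i' h => (Prod.mk.inj (Sum.inr_injective h)).1,
        Finset.card_erase_of_mem (Finset.mem_univ _)]
      simp
    · rw [inr_mem_trioSpan, mem_trioIndex] at h
      obtain ⟨⟨hi, rfl⟩, hx⟩ := h
      have h1 : nbrs (trioGraph d) (legSpan (trioBase d) (trioLeg d)
          ((Finset.univ.erase i₀).image (fun i => (i, J i)))) (Sum.inr (i, J i, x)) =
          (matchEnds d i x).map ⟨Sum.inl, Sum.inl_injective⟩ := by
        ext v
        rw [mem_nbrs, Finset.mem_map]
        constructor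
        · rintro ⟨hv, hadj⟩
          rcases v with k' | ⟨i', j', x'⟩
          · exact ⟨k', hadj, rfl⟩
          · rw [inr_mem_trioSpan, mem_trioIndex] at hv
            obtain ⟨rfl, h3⟩ : i = i' ∧ J i ≠ j' := hadj
            exact absurd hv.1.2.symm h3
        · rintro ⟨k, hk, rfl⟩
          exact ⟨inl_mem_trioSpan.2 (matchEnds_subset i hx hk), hk⟩
      rw [h1, Finset.card_map, card_matchEnds (by omega)]
  · intro T hT hne hcl
    have hinr : ∀ i j x, Sum.inr (i, j, x) ∈ T → ∀ k ∈ matchEnds d i x, Sum.inl k ∈ T := by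
      intro i j x h k hk
      have hx := (inr_mem_trioSpan.1 (hT h)).2
      exact hcl _ h _ (inl_mem_trioSpan.2 (matchEnds_subset i hx hk)) hk
    have hinl : ∀ i ≠ i₀, ∀ x < d, ∀ k ∈ matchEnds d i x, Sum.inl k ∈ T →
        Sum.inr (i, J i, x) ∈ T := fun i hi x hx k hk h =>
      hcl _ h _ (inr_mem_trioSpan.2 ⟨mem_trioIndex.2 ⟨hi, rfl⟩, hx⟩) hk
    obtain ⟨k₀, hk₀⟩ : ∃ k, Sum.inl k ∈ T := by
      obtain ⟨k | ⟨i, j, x⟩, h⟩ := hne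
      · exact ⟨k, h⟩
      · obtain ⟨k, hk⟩ := Finset.card_pos.1
          (by rw [card_matchEnds (by omega : 0 < d) i (x := x)]; omega)
        exact ⟨k, hinr _ _ _ h k hk⟩
    have hall : ∀ k ∈ matchBase d, Sum.inl k ∈ T := fun k hk =>
      forall_of_matchEnds (P := fun k => Sum.inl k ∈ T) i₀
        (fun i hi x hx k hk k' hk' h => hinr _ _ _ (hinl i hi x hx k hk h) k' hk')
        (inl_mem_trioSpan.1 (hT hk₀)) hk hk₀
    refine Finset.Subset.antisymm hT ?_
    rintro (k | ⟨i, j, x⟩) h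
    · exact hall k (inl_mem_trioSpan.1 h)
    · obtain ⟨h1, hx⟩ := inr_mem_trioSpan.1 h
      obtain ⟨hi, rfl⟩ := mem_trioIndex.1 h1
      obtain ⟨k, hk⟩ := Finset.card_pos.1
        (by rw [card_matchEnds (by omega : 0 < d) i (x := x)]; omega)
      exact hinl i hi x hx k hk (hall k (matchEnds_subset i hx hk))

end Trio

section Trio
variable {d N : ℕ} {A : Finset ((ℕ × Bool) ⊕ (Fin 3 × ℕ × ℕ))}

/-- Two copies of one edge are adjacent and have the same base neighbours. Avoiding triangles, the
other neighbour of `(i, j, x)` must be `(i, j', y)`, and that of `(i, j', x)` must be `(i, j, z)`;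
but these four vertices span a four-cycle. -/
theorem trio_index_unique (hd : 2 ≤ d) (hA : CycSet (trioGraph d) (4 * d) A)
    {i : Fin 3} {j j' x : ℕ} (h : Sum.inr (i, j, x) ∈ A) (h' : Sum.inr (i, j', x) ∈ A) :
    j = j' := by
  by_contra hj
  have hadj : (trioGraph d).Adj (Sum.inr (i, j, x)) (Sum.inr (i, j', x)) := ⟨rfl, hj⟩
  have hother : ∀ {j j'}, j ≠ j' → Sum.inr (i, j, x) ∈ A → Sum.inr (i, j', x) ∈ A →
      ∃ j₁ y, Sum.inr (i, j₁, y) ∈ A ∧ j₁ = j' ∧ y ≠ x := by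
    intro j j' hj h h'
    have hadj : (trioGraph d).Adj (Sum.inr (i, j, x)) (Sum.inr (i, j', x)) := ⟨rfl, hj⟩
    obtain ⟨a, ha, b, hb, hab, hxa, hxb⟩ := hA.exists_two_nbrs h
    obtain ⟨w, hw, hne, hjw⟩ : ∃ w ∈ A, w ≠ Sum.inr (i, j', x) ∧
        (trioGraph d).Adj (Sum.inr (i, j, x)) w := by
      by_cases ha' : a = Sum.inr (i, j', x)
      · exact ⟨b, hb, fun h => hab (ha'.trans h.symm), hxb⟩
      · exact ⟨a, ha, ha', hxa⟩
    rcases w with k | ⟨i', j₁, y⟩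
    · have hk : k ∈ matchEnds d i x := hjw
      exact (hA.no_triangle (by omega) h h' hw hadj hk hjw).elim
    · obtain ⟨rfl, hj₁⟩ : i = i' ∧ j ≠ j₁ := hjw
      by_cases h1 : j' = j₁
      · refine ⟨j₁, y, hw, h1.symm, fun hy => hne ?_⟩
        rw [hy, h1]
      · exact (hA.no_triangle (by omega) h h' hw hadj ⟨rfl, h1⟩ ⟨rfl, hj₁⟩).elim
  obtain ⟨_, y, hy, rfl, hyx⟩ := hother hj h h'
  obtain ⟨_, z, hz, rfl, hzx⟩ := hother (Ne.symm hj) h' h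
  refine hA.no_four (by omega) h hz h' hy ?_ ?_ ⟨rfl, hj⟩ ⟨rfl, hj⟩ ⟨rfl, hj⟩ ⟨rfl, hj⟩
  · simpa using hzx.symm
  · simpa using hyx.symm

/-- Double counting. With `B` base vertices and `C` edge vertices in the cycle, `B + C = 4 d`. Every
edge vertex has two ends; a base vertex meets two edge vertices if it is in the cycle and at most
three otherwise, so `2 C ≤ 6 d - B`. Together `B ≥ 2 d`, which is the size of the whole base. -/
theorem trio_base_subset (hd : 2 ≤ d) (hA : CycSet (trioGraph d) (4 * d) A)
    (hbase : ∀ k, Sum.inl k ∈ A → k ∈ matchBase d)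
    (hlt : ∀ i j x, Sum.inr (i, j, x) ∈ A → x < d) : ∀ k ∈ matchBase d, Sum.inl k ∈ A := by
  set C := A.filter fun v => v.isRight with hC
  set B := A.filter fun v => ¬ v.isRight with hB
  let E : (ℕ × Bool) → (ℕ × Bool) ⊕ (Fin 3 × ℕ × ℕ) → Prop := fun k v =>
    (trioGraph d).Adj (Sum.inl k) v
  have hCmem : ∀ v ∈ C, ∃ i j x, v = Sum.inr (i, j, x) ∧ v ∈ A := by
    rintro (k | ⟨i, j, x⟩) h
    · simp [hC] at h
    · exact ⟨i, j, x, rfl, (Finset.mem_filter.1 h).1⟩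
  have h1 : ∑ k ∈ matchBase d, (C.bipartiteAbove E k).card = C.card * 2 := by
    rw [Finset.sum_card_bipartiteAbove_eq_sum_card_bipartiteBelow, ← smul_eq_mul,
      ← Finset.sum_const]
    refine Finset.sum_congr rfl fun v hv => ?_
    obtain ⟨i, j, x, rfl, hv⟩ := hCmem v hv
    rw [← card_matchEnds (by omega : 0 < d) i (x := x)]
    congr 1
    ext k
    rw [Finset.mem_bipartiteBelow]
    exact ⟨fun h => h.2, fun h => ⟨matchEnds_subset i (hlt _ _ _ hv) h, h⟩⟩
  have h3 : ∀ k ∈ matchBase d, (C.bipartiteAbove E k).card ≤ 3 := by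
    intro k hk
    have := Finset.card_le_card_of_injOn (t := (Finset.univ : Finset (Fin 3)))
      (s := C.bipartiteAbove E k)
      (fun v : (ℕ × Bool) ⊕ (Fin 3 × ℕ × ℕ) => v.elim (fun _ => 0) fun p => p.1)
      (fun _ _ => Finset.mem_coe.2 (Finset.mem_univ _)) ?_
    · simpa using this
    · intro v hv w hw hvw
      obtain ⟨hv, hkv⟩ := (Finset.mem_bipartiteAbove _).1 (Finset.mem_coe.1 hv)
      obtain ⟨hw, hkw⟩ := (Finset.mem_bipartiteAbove _).1 (Finset.mem_coe.1 hw)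
      obtain ⟨i, j, x, rfl, hv⟩ := hCmem v hv
      obtain ⟨i', j', x', rfl, hw⟩ := hCmem w hw
      obtain rfl : i = i' := hvw
      have e1 := (mem_matchEnds hk (hlt _ _ _ hv)).1 hkv
      have e2 := (mem_matchEnds hk (hlt _ _ _ hw)).1 hkw
      obtain rfl : x = x' := e1.symm.trans e2
      rw [trio_index_unique hd hA hv hw]
  have h2 : ∀ k ∈ matchBase d, Sum.inl k ∈ A → (C.bipartiteAbove E k).card = 2 := by
    intro k hk hkA
    rw [← hA.2.1 _ hkA]
    congr 1
    ext v
    rw [Finset.mem_bipartiteAbove, mem_nbrs, hC, Finset.mem_filter]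
    constructor
    · exact fun h => ⟨h.1.1, h.2⟩
    · rintro ⟨h, h'⟩
      rcases v with k' | p
      · exact h'.elim
      · exact ⟨⟨h, rfl⟩, h'⟩
  have hBc : B.card = ((matchBase d).filter fun k => Sum.inl k ∈ A).card := by
    rw [← Finset.card_map ⟨Sum.inl, Sum.inl_injective⟩ (s := (matchBase d).filter _)]
    congr 1
    ext v
    simp only [hB, Finset.mem_filter, Finset.mem_map]
    constructor
    · rintro ⟨h, h'⟩
      rcases v with k | p
      · exact ⟨k, ⟨hbase k h, h⟩, rfl⟩
      · simp at h'
    · rintro ⟨k, ⟨-, h⟩, rfl⟩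
      exact ⟨h, by simp⟩
  have h4 : ∑ k ∈ matchBase d, (C.bipartiteAbove E k).card ≤
      ∑ k ∈ matchBase d, (3 - if Sum.inl k ∈ A then 1 else 0) := by
    refine Finset.sum_le_sum fun k hk => ?_
    split_ifs with h
    · exact (h2 k hk h).le
    · exact h3 k hk
  have h5 : ∑ k ∈ matchBase d, (3 - if Sum.inl k ∈ A then 1 else 0) + B.card = 2 * d * 3 := by
    rw [hBc, Finset.card_filter, ← Finset.sum_add_distrib, ← card_matchBase (by omega : 0 < d),
      ← smul_eq_mul, ← Finset.sum_const]
    refine Finset.sum_congr rfl fun k _ => ?_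
    split_ifs <;> rfl
  have h6 : C.card + B.card = 4 * d := by
    rw [← hA.1, hC, hB, Finset.card_filter_add_card_filter_not]
  have h7 : ((matchBase d).filter fun k => Sum.inl k ∈ A) = matchBase d := by
    apply Finset.eq_of_subset_of_card_le (Finset.filter_subset _ _)
    rw [card_matchBase (by omega)]
    omega
  intro k hk
  rw [← h7] at hk
  exact (Finset.mem_filter.1 hk).2

/-- With the whole base in the cycle, an edge vertex already has two neighbours there, so a copy
with another index would be a third. -/
theorem trio_index_eq (hA : CycSet (trioGraph d) (4 * d) A) (hd : 2 ≤ d)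
    (hlt : ∀ i j x, Sum.inr (i, j, x) ∈ A → x < d) (hall : ∀ k ∈ matchBase d, Sum.inl k ∈ A)
    {i : Fin 3} {j j' x x' : ℕ} (h : Sum.inr (i, j, x) ∈ A) (h' : Sum.inr (i, j', x') ∈ A) :
    j = j' := by
  by_contra hj
  obtain ⟨a, b, hab, he⟩ := Finset.card_eq_two.1 (card_matchEnds (by omega : 0 < d) i (x := x))
  have ha : a ∈ matchEnds d i x := by rw [he]; simp
  have hb : b ∈ matchEnds d i x := by rw [he]; simp
  exact hA.not_three_nbrs h (hall _ (matchEnds_subset i (hlt _ _ _ h) ha))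
    (hall _ (matchEnds_subset i (hlt _ _ _ h) hb)) h' (by simpa using hab) (by simp) (by simp)
    ha hb ⟨rfl, hj⟩

theorem two_of_three {p : Fin 3 → Prop} (h : (Finset.univ.filter p).card = 2) :
    (¬ p 0 ∧ p 1 ∧ p 2) ∨ (p 0 ∧ ¬ p 1 ∧ p 2) ∨ (p 0 ∧ p 1 ∧ ¬ p 2) := by
  rw [Finset.card_filter, Fin.sum_univ_three] at h
  by_cases h0 : p 0 <;> by_cases h1 : p 1 <;> by_cases h2 : p 2 <;> simp_all

/-- A system of edges that covers every vertex twice, and is not confined to a lower part of the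
graph, consists of two of the three matchings. -/
theorem exists_matching_of_two {u : Fin 3 → ℕ → Prop} (hd : 2 ≤ d)
    (hu : ∀ k ∈ matchBase d, (Finset.univ.filter fun i => u i (matchPos d i k)).card = 2)
    (hconn : ∀ x, 0 < x → x < d → ¬ u 2 0 → ¬ u 0 x → ¬ u 1 x → False) :
    ∃ i₀ : Fin 3, ∀ i, ∀ x < d, u i x ↔ i ≠ i₀ := by
  have h0 := two_of_three (hu (0, false) (mem_matchBase.2 ⟨by omega, by simp⟩))
  have ht : ∀ x, 0 < x → x < d → _ := fun x h h' =>
    two_of_three (hu (x, true) (mem_matchBase.2 ⟨by omega, fun _ => ⟨h, h'⟩⟩))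
  have hf : ∀ x, 0 < x → x < d → _ := fun x h h' =>
    two_of_three (hu (x, false) (mem_matchBase.2 ⟨by omega, by simp⟩))
  have p0 : ∀ x, x < d → (0 < x → matchPos d 0 (x, true) = x ∧ matchPos d 1 (x, true) = x - 1 ∧
      matchPos d 2 (x, true) = x ∧ matchPos d 0 (x, false) = x - 1 ∧ matchPos d 1 (x, false) = x ∧
      matchPos d 2 (x, false) = x) := by
    intro x hx hx0
    simp [matchPos, hx0.ne', hx.ne]
  have q : matchPos d 0 (0, false) = 0 ∧ matchPos d 1 (0, false) = 0 ∧
      matchPos d 2 (0, false) = 0 := by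
    simp [matchPos]
  rw [q.1, q.2.1, q.2.2] at h0
  -- If the edge between the extreme vertices is in use, exactly one of the matchings `0` and `1`
  -- starts at level `0`, and this choice propagates upwards together with all rungs. Otherwise both
  -- start, and the first rung could only close the system off below, which `hconn` forbids.
  by_cases h2 : u 2 0
  · have key : ∀ x < d, (u 0 x ↔ u 0 0) ∧ (u 1 x ↔ u 1 0) ∧ u 2 x := by
      intro x
      induction x with
      | zero => exact fun _ => ⟨Iff.rfl, Iff.rfl, h2⟩
      | succ x ih =>
        intro hx
        have ih := ih (by omega)
        have e := p0 (x + 1) hx (by omega)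
        have e1 := ht (x + 1) (by omega) hx
        have e2 := hf (x + 1) (by omega) hx
        simp only [e, Nat.add_sub_cancel] at e1 e2
        grind
    by_cases h00 : u 0 0
    · refine ⟨1, fun i x hx => ?_⟩
      have := key x hx
      fin_cases i <;> simp <;> tauto
    · refine ⟨0, fun i x hx => ?_⟩
      have := key x hx
      fin_cases i <;> simp <;> tauto
  · have key : ∀ x < d, u 0 x ∧ u 1 x ∧ ¬ u 2 x := by
      intro x
      induction x with
      | zero =>
        rcases h0 with h | h | h
        · exact absurd h.2.2 h2
        · exact absurd h.2.2 h2
        · exact fun _ => h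
      | succ x ih =>
        intro hx
        obtain ⟨i1, i2, -⟩ := ih (by omega)
        have e := p0 (x + 1) hx (by omega)
        have e1 := ht (x + 1) (by omega) hx
        have e2 := hf (x + 1) (by omega) hx
        have e3 := hconn (x + 1) (by omega) hx h2
        simp only [e, Nat.add_sub_cancel] at e1 e2
        rcases e1 with e1 | e1 | e1
        · rcases e2 with e2 | e2 | e2
          · exact absurd i1 e2.1
          · exact (e3 e1.1 e2.2.1).elim
          · exact absurd e1.2.2 e2.2.2
        · exact absurd i2 e1.2.1
        · rcases e2 with e2 | e2 | e2
          · exact absurd i1 e2.1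
          · exact absurd e2.2.2 e1.2.2
          · exact ⟨e1.1, e2.2.1, e1.2.2⟩
    refine ⟨2, fun i x hx => ?_⟩
    obtain ⟨k0, k1, k2⟩ := key x hx
    fin_cases i
    · exact iff_of_true k0 (by decide)
    · exact iff_of_true k1 (by decide)
    · exact iff_of_false k2 (by decide)

theorem exists_of_cycSet_trioGraph (hd : 2 ≤ d) (hA : CycSet (trioGraph d) (4 * d) A)
    (hbase : ∀ k, Sum.inl k ∈ A → k ∈ matchBase d)
    (hlt : ∀ i j x, Sum.inr (i, j, x) ∈ A → x < d) :
    ∃ U : Finset (Fin 3 × ℕ), U.card = 2 ∧ A = legSpan (trioBase d) (trioLeg d) U := by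
  have hall := trio_base_subset hd hA hbase hlt
  have huniq : ∀ {i : Fin 3} {j j' x x' : ℕ}, Sum.inr (i, j, x) ∈ A → Sum.inr (i, j', x') ∈ A →
      j = j' := fun h h' => trio_index_eq hA hd hlt hall h h'
  set u : Fin 3 → ℕ → Prop := fun i x => ∃ j, Sum.inr (i, j, x) ∈ A with hu
  have hcount : ∀ k ∈ matchBase d,
      (Finset.univ.filter fun i => u i (matchPos d i k)).card = 2 := by
    intro k hk
    rw [← hA.2.1 _ (hall k hk)]
    symm
    apply Finset.card_nbij (fun v : (ℕ × Bool) ⊕ (Fin 3 × ℕ × ℕ) => v.elim (fun _ => 0) fun p => p.1)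
    · rintro (k' | ⟨i, j, x⟩) hv
      · exact ((mem_nbrs.1 hv).2).elim
      · obtain ⟨hv, hadj⟩ := mem_nbrs.1 hv
        have e := (mem_matchEnds hk (hlt _ _ _ hv)).1 hadj
        exact Finset.mem_coe.2 (Finset.mem_filter.2 ⟨Finset.mem_univ _, j, by simpa [e] using hv⟩)
    · rintro (k' | ⟨i, j, x⟩) hv (k'' | ⟨i', j', x'⟩) hw hvw
      · exact ((mem_nbrs.1 hv).2).elim
      · exact ((mem_nbrs.1 hv).2).elim
      · exact ((mem_nbrs.1 hw).2).elim
      · obtain ⟨hv, hadj⟩ := mem_nbrs.1 hv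
        obtain ⟨hw, hadj'⟩ := mem_nbrs.1 hw
        obtain rfl : i = i' := hvw
        have e := (mem_matchEnds hk (hlt _ _ _ hv)).1 hadj
        have e' := (mem_matchEnds hk (hlt _ _ _ hw)).1 hadj'
        rw [huniq hv hw, ← e, ← e']
    · intro i hi
      obtain ⟨-, j, hj⟩ := Finset.mem_filter.1 (Finset.mem_coe.1 hi)
      exact ⟨_, Finset.mem_coe.2 (mem_nbrs.2 ⟨hj, (mem_matchEnds hk (hlt _ _ _ hj)).2 rfl⟩), rfl⟩
  -- If neither the extreme edge nor an edge leading up from level `x` is used, the part up to level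
  -- `x` is closed, yet it misses the vertex of level `d`.
  have hconn : ∀ x, 0 < x → x < d → ¬ u 2 0 → ¬ u 0 x → ¬ u 1 x → False := by
    intro x hx0 hxd h2 h0 h1
    have hT := hA.2.2 (A.filter fun v => v.elim (fun k => k.1 ≤ x) (fun p => p.2.2 ≤ x))
      (Finset.filter_subset _ _) ?_ ?_
    · have htop : Sum.inl (d, false) ∈ A := hall _ (mem_matchBase.2 ⟨le_rfl, by simp⟩)
      rw [← hT] at htop
      have := (Finset.mem_filter.1 htop).2
      simp only [Sum.elim_inl] at this
      omega
    · exact ⟨Sum.inl (0, false), Finset.mem_filter.2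
        ⟨hall _ (mem_matchBase.2 ⟨by omega, by simp⟩), Nat.zero_le _⟩⟩
    · rintro (k | ⟨i, j, y⟩) hv (k' | ⟨i', j', y'⟩) hw hadj
      · exact hadj.elim
      · obtain ⟨hv, hle⟩ := Finset.mem_filter.1 hv
        have e := (mem_matchEnds (hbase _ hv) (hlt _ _ _ hw)).1 hadj
        have e' := matchPos_le (d := d) i' (k := k)
        simp only [Sum.elim_inl] at hle
        exact Finset.mem_filter.2 ⟨hw, by simp only [Sum.elim_inr]; omega⟩
      · obtain ⟨hv, hle⟩ := Finset.mem_filter.1 hv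
        have hk' : k' ∈ matchEnds d i y := hadj
        simp only [Sum.elim_inr] at hle
        refine Finset.mem_filter.2 ⟨hw, ?_⟩
        simp only [Sum.elim_inl]
        have hui : u i y := ⟨j, hv⟩
        have hyx : i ≠ 2 → y ≠ x := by
          rintro hi rfl
          fin_cases i
          · exact h0 hui
          · exact h1 hui
          · exact hi rfl
        by_cases hi2 : i = 2
        · subst hi2
          rw [matchEnds_two] at hk'
          split_ifs at hk' with hy
          · exact absurd (hy ▸ hui) h2
          · rw [Finset.mem_insert, Finset.mem_singleton] at hk'
            rcases hk' with rfl | rfl <;> exact hle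
        · have := hyx hi2
          fin_cases i
          · change k' ∈ matchEnds d 0 y at hk'
            rw [matchEnds_zero, Finset.mem_insert, Finset.mem_singleton] at hk'
            rcases hk' with rfl | rfl <;> rw [level_fst] <;> omega
          · change k' ∈ matchEnds d 1 y at hk'
            rw [matchEnds_one, Finset.mem_insert, Finset.mem_singleton] at hk'
            rcases hk' with rfl | rfl <;> rw [level_fst] <;> omega
          · exact absurd rfl hi2
      · obtain ⟨rfl, hj⟩ : i = i' ∧ j ≠ j' := hadj
        exact absurd (huniq (Finset.mem_filter.1 hv).1 hw) hj
  obtain ⟨i₀, hi₀⟩ := exists_matching_of_two hd hcount hconn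
  have hex : ∀ i, ∃ j, i ≠ i₀ → ∀ x < d, Sum.inr (i, j, x) ∈ A := by
    intro i
    by_cases hi : i = i₀
    · exact ⟨0, fun h => absurd hi h⟩
    · obtain ⟨j, hj⟩ := (hi₀ i 0 (by omega)).2 hi
      refine ⟨j, fun _ x hx => ?_⟩
      obtain ⟨j', hj'⟩ := (hi₀ i x hx).2 hi
      rwa [huniq hj hj']
  choose J hJ using hex
  refine ⟨(Finset.univ.erase i₀).image fun i => (i, J i), card_trioIndex i₀ J,
    (Finset.eq_of_subset_of_card_le ?_ ?_).symm⟩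
  · rintro (k | ⟨i, j, x⟩) h
    · exact hall k (inl_mem_trioSpan.1 h)
    · obtain ⟨h1, hx⟩ := inr_mem_trioSpan.1 h
      obtain ⟨hi, rfl⟩ := mem_trioIndex.1 h1
      exact hJ i hi x hx
  · rw [hA.1, card_trioSpan (by omega), card_trioIndex]
    omega

/-- Three choices of the omitted matching and `N ^ 2` of the copies. On `2 d + 3 d N` vertices the
benchmark is `(3 N / 2) ^ 2`, and `3 / (9 / 4) = 4 / 3`. -/
theorem mul_sq_le_psiCycle_trio (hd : 2 ≤ d) {n : ℕ} (hn : 2 * d + 3 * d * N ≤ n) :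
    3 * N ^ 2 ≤ PsiCycle (4 * d) (progression (2 * d) 2 d) n := by
  -- The matchings in use are `i₀ + 1` and `i₀ + 2` modulo three; they take the copies `p.1` and
  -- `p.2`.
  set J : Fin 3 → ℕ × ℕ → Fin 3 → ℕ := fun i₀ p i => if i = i₀ + 1 then p.1 else p.2 with hJ
  set F : Fin 3 × (ℕ × ℕ) → Finset (Fin 3 × ℕ) := fun q =>
    (Finset.univ.erase q.1).image fun i => (i, J q.1 q.2 i) with hF
  have hinj : Function.Injective F := by
    rintro ⟨i₀, a, b⟩ ⟨i₁, a', b'⟩ h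
    have hmem : ∀ i j, (i ≠ i₀ ∧ j = J i₀ (a, b) i) ↔ (i ≠ i₁ ∧ j = J i₁ (a', b') i) := by
      intro i j
      rw [← mem_trioIndex, ← mem_trioIndex]
      exact iff_of_eq (congrArg ((i, j) ∈ ·) h)
    have hi : i₀ = i₁ := by
      by_contra hne
      exact ((hmem i₁ _).1 ⟨fun h => hne h.symm, rfl⟩).1 rfl
    subst hi
    have e : ∀ i : Fin 3, i + 1 ≠ i ∧ i + 2 ≠ i ∧ i + 2 ≠ i + 1 := by decide
    obtain ⟨e1, e2, e3⟩ := e i₀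
    have h1 := ((hmem _ _).1 ⟨e1, rfl⟩).2
    have h2 := ((hmem _ _).1 ⟨e2, rfl⟩).2
    simp only [hJ, if_true, if_neg e3] at h1 h2
    rw [h1, h2]
  have hcard : (((Finset.univ : Finset (Fin 3)) ×ˢ (Finset.range N ×ˢ Finset.range N)).image
      F).card = 3 * N ^ 2 := by
    rw [Finset.card_image_of_injective _ hinj]
    simp [pow_two]
  rw [← hcard]
  refine card_le_psiCycle_of_legs (G := trioGraph d)
    (S := legSpan (trioBase d) (trioLeg d) (Finset.univ ×ˢ Finset.range N)) (by omega) (by omega)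
    ?_ (card_trioBase (by omega)) card_trioLeg disjoint_trioBase (fun _ _ h => disjoint_trioLeg h)
    ?_ ?_
  · rw [card_trioSpan (by omega)]
    simp only [Finset.card_product, Finset.card_univ, Fintype.card_fin, Finset.card_range]
    exact (by ring : 2 * d + 3 * N * d = 2 * d + 3 * d * N).trans_le hn
  · intro A hAS hA
    exact exists_of_cycSet_trioGraph hd hA (fun k h => inl_mem_trioSpan.1 (hAS h))
      fun i j x h => (inr_mem_trioSpan.1 (hAS h)).2
  · intro U hU
    obtain ⟨⟨i₀, p⟩, hp, rfl⟩ := Finset.mem_image.1 hU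
    refine ⟨?_, cycSet_trioGraph hd i₀ _⟩
    rintro (k | ⟨i, j, x⟩) h
    · exact inl_mem_trioSpan.2 (inl_mem_trioSpan.1 h)
    · obtain ⟨h1, hx⟩ := inr_mem_trioSpan.1 h
      obtain ⟨-, rfl⟩ := mem_trioIndex.1 h1
      simp only [Finset.mem_product, Finset.mem_univ, true_and, Finset.mem_range] at hp
      refine inr_mem_trioSpan.2 ⟨Finset.mem_product.2 ⟨Finset.mem_univ _, Finset.mem_range.2 ?_⟩, hx⟩
      simp only [hJ]
      split_ifs
      · exact hp.1
      · exact hp.2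

end Trio

theorem asympGe_four_thirds {d : ℕ} (hd : 2 ≤ d) :
    AsympGe (PsiCycle (4 * d) (progression (2 * d) 2 d)) (4 / 3) (bench (4 * d) (2 * d) 2) := by
  refine asympGe_of_le (p := fun N => ((3 * N ^ 2 : ℕ) : ℝ)) (a := 3) (k := 3 * d) (d := d)
    (by omega) (by omega) (by omega) (by omega) ?_ (by push_cast; ring) ?_
  · refine tendsto_const_nhds.congr' ?_
    filter_upwards [eventually_gt_atTop 0] with N hN
    have : (N : ℝ) ≠ 0 := by positivity
    push_cast
    field_simp
  · intro n N _ hn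
    exact_mod_cast mul_sq_le_psiCycle_trio hd hn

/-! ### Flawless factorizations from exchangeable blocks. -/

theorem ncard_setOf_eq {W : Type*} [Fintype W] (p : W → Prop) :
    {x | p x}.ncard = (Finset.univ.filter p).card := by
  rw [← Set.ncard_coe_finset]
  simp

/-- A symmetric relation that has one neighbour for each vertex and colour describes a flawless
factorization, if closed sets with respect to two colours are trivial and connected `2`-regular
subgraphs have only two colours. -/
theorem mem_flawlessDegrees {n m : ℕ} (hn : 0 < n) {R : Fin m → Fin n → Fin n → Prop}
    (hsymm : ∀ i a b, R i a b → R i b a) (hirr : ∀ i a, ¬ R i a a)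
    (huniq : ∀ i a, ∃! b, R i a b) (hdisj : ∀ i j a b, R i a b → R j a b → i = j)
    (hperf : ∀ i j, i ≠ j → ∀ T : Finset (Fin n), T.Nonempty →
      (∀ a ∈ T, ∀ b, R i a b ∨ R j a b → b ∈ T) → T = Finset.univ)
    (hflaw : ∀ H : SimpleGraph (Fin n), (∀ a, (Finset.univ.filter (H.Adj a)).card = 2) →
      (∀ T : Finset (Fin n), T.Nonempty → (∀ a ∈ T, ∀ b, H.Adj a b → b ∈ T) → T = Finset.univ) →
      (∀ a b, H.Adj a b → ∃ i, R i a b) →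
      ∃ i j, i ≠ j ∧ ∀ a b, H.Adj a b ↔ R i a b ∨ R j a b) :
    m ∈ flawlessDegrees n := by
  choose f hf hf' using huniq
  let Q : SimpleGraph (Fin n) :=
    { Adj := fun a b => ∃ i, R i a b
      symm := ⟨fun a b ⟨i, h⟩ => ⟨i, hsymm _ _ _ h⟩⟩
      loopless := ⟨fun a ⟨i, h⟩ => hirr _ _ h⟩ }
  let M : Fin m → Q.Subgraph := fun i =>
    { verts := Set.univ
      Adj := R i
      adj_sub := fun h => ⟨i, h⟩
      edge_vert := fun _ => trivial
      symm := ⟨fun a b h => hsymm _ _ _ h⟩ }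
  have hedge : ∀ i a b, s(a, b) ∈ (M i).edgeSet ↔ R i a b := fun i a b => Iff.rfl
  have : NeZero n := ⟨hn.ne'⟩
  refine ⟨Q, M, ?_, ⟨?_, ?_, ?_, ?_⟩⟩
  · intro a
    have h1 : Q.neighborSet a = Set.range fun i => f i a := by
      ext b
      constructor
      · rintro ⟨i, h⟩
        exact ⟨i, (hf' i a b h).symm⟩
      · rintro ⟨i, rfl⟩
        exact ⟨i, hf i a⟩
    rw [h1, ← Set.image_univ, Set.ncard_image_of_injective, Set.ncard_univ, Nat.card_fin]
    intro i j hij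
    have h2 := hf i a
    simp only at hij
    rw [hij] at h2
    exact hdisj _ _ _ _ h2 (hf j a)
  · intro i
    exact ⟨fun a _ => ⟨f i a, hf i a, fun b h => hf' i a b h⟩, fun a => trivial⟩
  · intro e
    induction e using Sym2.ind with
    | _ a b =>
      rintro ⟨i, h⟩
      exact ⟨i, h, fun j hj => hdisj _ _ _ _ hj h⟩
  · intro i j hij
    obtain ⟨H, hH⟩ : ∃ H : SimpleGraph (Fin n), ∀ a b, H.Adj a b ↔ R i a b ∨ R j a b :=
      ⟨{ Adj := fun a b => R i a b ∨ R j a b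
         symm := ⟨fun a b h => h.imp (hsymm _ _ _) (hsymm _ _ _)⟩
         loopless := ⟨fun a h => h.elim (hirr _ _) (hirr _ _)⟩ }, fun _ _ => Iff.rfl⟩
    have hHQ : H ≤ Q := fun a b h =>
      ((hH a b).1 h).elim (fun h => ⟨i, h⟩) (fun h => ⟨j, h⟩)
    have h2 : ∀ a, (Finset.univ.filter (H.Adj a)).card = 2 := by
      intro a
      have hne : f i a ≠ f j a := fun h => hij (hdisj i j a _ (hf i a) (h ▸ hf j a))
      rw [← Finset.card_pair hne]
      congr 1
      ext b
      simp only [Finset.mem_filter, Finset.mem_univ, true_and, Finset.mem_insert,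
        Finset.mem_singleton, hH]
      constructor
      · rintro (h | h)
        · exact Or.inl (hf' _ _ _ h)
        · exact Or.inr (hf' _ _ _ h)
      · rintro (rfl | rfl)
        · exact Or.inl (hf i a)
        · exact Or.inr (hf j a)
    obtain ⟨v, p, hp, hlen⟩ := exists_hamiltonian_of_two_regular H h2
      (preconnected_of_closed H fun T hT h =>
        hperf i j hij T hT fun a ha b hab => h a ha b ((hH a b).2 hab))
    have hpH : p.IsHamiltonianCycle :=
      SimpleGraph.Walk.isHamiltonianCycle_iff_isCycle_and_length_eq.2 ⟨hp, hlen⟩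
    refine ⟨v, p.mapLe hHQ, ?_, ?_⟩
    · have := hpH.map (f := SimpleGraph.Hom.ofLE hHQ) Function.bijective_id
      convert this
    · ext e
      induction e using Sym2.ind with
      | _ a b =>
        rw [Set.mem_ofPred_eq, SimpleGraph.Walk.edges_mapLe_eq_edges, Set.mem_union, hedge, hedge,
          ← SimpleGraph.Walk.adj_toSubgraph_iff_mem_edges]
        -- The cycle uses two edges at each vertex and `H` has no more, so the cycle uses all of
        -- `H`.
        have h3 : p.toSubgraph.neighborSet a = H.neighborSet a := by
          apply Set.eq_of_subset_of_ncard_le (p.toSubgraph.neighborSet_subset a) _ (Set.toFinite _)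
          rw [hp.ncard_neighborSet_toSubgraph_eq_two (hpH.mem_support a)]
          change {b | H.Adj a b}.ncard ≤ 2
          rw [ncard_setOf_eq, h2]
        exact (Set.ext_iff.1 h3 b).trans (hH a b)
  · intro v p hp
    have hadj : ∀ a b, p.toSubgraph.spanningCoe.Adj a b ↔ s(a, b) ∈ p.edges := fun a b =>
      SimpleGraph.Walk.adj_toSubgraph_iff_mem_edges
    have h2 : ∀ a, (Finset.univ.filter (p.toSubgraph.spanningCoe.Adj a)).card = 2 := by
      intro a
      rw [← ncard_setOf_eq]
      exact hp.isCycle.ncard_neighborSet_toSubgraph_eq_two (hp.mem_support a)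
    have hconn : ∀ T : Finset (Fin n), T.Nonempty →
        (∀ a ∈ T, ∀ b, p.toSubgraph.spanningCoe.Adj a b → b ∈ T) → T = Finset.univ := by
      intro T hT hcl
      have hc := p.toSubgraph_connected
      obtain ⟨u, hu⟩ := hT
      ext w
      simp only [Finset.mem_univ, iff_true]
      have hr := hc.coe.preconnected ⟨u, p.mem_verts_toSubgraph.2 (hp.mem_support u)⟩
        ⟨w, p.mem_verts_toSubgraph.2 (hp.mem_support w)⟩
      exact closed_of_reachable (T := {x : p.toSubgraph.verts | x.1 ∈ T})
        (fun x hx y hxy => hcl _ hx _ hxy) hu hr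
    obtain ⟨i, j, hij, h⟩ := hflaw p.toSubgraph.spanningCoe h2 hconn fun a b h =>
      p.toSubgraph.adj_sub h
    refine ⟨i, j, hij, ?_⟩
    ext e
    induction e using Sym2.ind with
    | _ a b =>
      rw [Set.mem_ofPred_eq, ← hadj, h]
      exact Iff.rfl

section Bipartite
variable {V : Type*} {G : SimpleGraph V} {K C : Finset V}

theorem sum_card_nbrs_comm (G : SimpleGraph V) (K C : Finset V) :
    ∑ k ∈ K, (nbrs G C k).card = ∑ v ∈ C, (nbrs G K v).card := by
  have := Finset.sum_card_bipartiteAbove_eq_sum_card_bipartiteBelow (s := K) (t := C) G.Adj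
  refine Eq.trans (Finset.sum_congr rfl fun k _ => ?_)
    (this.trans (Finset.sum_congr rfl fun v _ => ?_))
  · congr 1
  · congr 1
    ext k
    rw [mem_nbrs, Finset.mem_bipartiteBelow, G.adj_comm]

/-- A `2`-regular connected bipartite graph is a cycle. -/
theorem CycSet.of_bipartite {r : ℕ} (hKC : Disjoint K C)
    (hKi : ∀ x ∈ K, ∀ y ∈ K, ¬ G.Adj x y) (hCi : ∀ x ∈ C, ∀ y ∈ C, ¬ G.Adj x y)
    (hC : ∀ v ∈ C, (nbrs G K v).card = 2) (hK : ∀ k ∈ K, (nbrs G C k).card = 2)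
    (hconn : ∀ T ⊆ K, T.Nonempty →
      (∀ x ∈ T, ∀ y ∈ K, ∀ v ∈ C, G.Adj x v → G.Adj y v → y ∈ T) → T = K)
    (hr : r = 2 * K.card) : CycSet G r (K ∪ C) := by
  have h1 := sum_card_nbrs_comm G K C
  rw [Finset.sum_congr rfl hC, Finset.sum_congr rfl hK, Finset.sum_const, Finset.sum_const,
    smul_eq_mul, smul_eq_mul] at h1
  refine ⟨?_, ?_, ?_⟩
  · rw [Finset.card_union_of_disjoint hKC]
    omega
  · intro x hx
    rcases Finset.mem_union.1 hx with hx | hx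
    · rw [← hK x hx]
      congr 1
      ext v
      rw [mem_nbrs, mem_nbrs, Finset.mem_union]
      exact ⟨fun h => ⟨h.1.resolve_left fun h' => hKi x hx v h' h.2, h.2⟩,
        fun h => ⟨Or.inr h.1, h.2⟩⟩
    · rw [← hC x hx]
      congr 1
      ext v
      rw [mem_nbrs, mem_nbrs, Finset.mem_union]
      exact ⟨fun h => ⟨h.1.resolve_right fun h' => hCi x hx v h' h.2, h.2⟩,
        fun h => ⟨Or.inl h.1, h.2⟩⟩
  · intro T hT hne hcl
    have hTC : ∀ v ∈ C, ∀ x ∈ K, G.Adj x v → (x ∈ T ↔ v ∈ T) := fun v hv x hx hxv =>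
      ⟨fun h => hcl x h v (Finset.mem_union_right _ hv) hxv,
        fun h => hcl v h x (Finset.mem_union_left _ hx) hxv.symm⟩
    have hex : ∀ v ∈ C, ∃ x ∈ K, G.Adj x v := by
      intro v hv
      obtain ⟨x, hx⟩ := Finset.card_pos.1 (by rw [hC v hv]; omega)
      rw [mem_nbrs] at hx
      exact ⟨x, hx.1, hx.2.symm⟩
    have hTK := hconn (T ∩ K) Finset.inter_subset_right ?_ ?_
    · have hKT : K ⊆ T := fun x hx => by
        rw [← hTK] at hx
        exact (Finset.mem_inter.1 hx).1
      refine Finset.Subset.antisymm hT (Finset.union_subset hKT fun v hv => ?_)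
      obtain ⟨x, hx, hxv⟩ := hex v hv
      exact (hTC v hv x hx hxv).1 (hKT hx)
    · obtain ⟨v, hv⟩ := hne
      rcases Finset.mem_union.1 (hT hv) with h | h
      · exact ⟨v, Finset.mem_inter.2 ⟨hv, h⟩⟩
      · obtain ⟨x, hx, hxv⟩ := hex v h
        exact ⟨x, Finset.mem_inter.2 ⟨(hTC v h x hx hxv).2 hv, hx⟩⟩
    · intro x hx y hy v hv hxv hyv
      obtain ⟨hx, hx'⟩ := Finset.mem_inter.1 hx
      exact Finset.mem_inter.2 ⟨(hTC v hv y hy hyv).2 ((hTC v hv x hx' hxv).1 hx), hy⟩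

/-- An independent half of the vertices of an induced cycle alternates with the other half. -/
theorem CycSet.card_nbrs_of_half {r : ℕ} (hA : CycSet G r (K ∪ C)) (hKC : Disjoint K C)
    (hKi : ∀ x ∈ K, ∀ y ∈ K, ¬ G.Adj x y) (hcard : K.card = C.card) :
    (∀ k ∈ K, (nbrs G C k).card = 2) ∧ (∀ v ∈ C, (nbrs G K v).card = 2) ∧
      ∀ v ∈ C, ∀ w ∈ C, ¬ G.Adj v w := by
  have hK : ∀ k ∈ K, (nbrs G C k).card = 2 := by
    intro k hk
    rw [← hA.2.1 k (Finset.mem_union_left _ hk)]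
    congr 1
    ext v
    rw [mem_nbrs, mem_nbrs, Finset.mem_union]
    exact ⟨fun h => ⟨Or.inr h.1, h.2⟩,
      fun h => ⟨h.1.resolve_left fun h' => hKi k hk v h' h.2, h.2⟩⟩
  have hle : ∀ v ∈ C, (nbrs G K v).card ≤ 2 := fun v hv => by
    rw [← hA.2.1 v (Finset.mem_union_right _ hv)]
    exact Finset.card_le_card (nbrs_mono Finset.subset_union_left v)
  have hC : ∀ v ∈ C, (nbrs G K v).card = 2 := by
    rw [← Finset.sum_eq_sum_iff_of_le hle, ← sum_card_nbrs_comm, Finset.sum_congr rfl hK,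
      Finset.sum_const, Finset.sum_const, hcard]
  refine ⟨hK, hC, fun v hv w hw hvw => ?_⟩
  have h1 : nbrs G K v = nbrs G (K ∪ C) v := by
    apply Finset.eq_of_subset_of_card_le (nbrs_mono Finset.subset_union_left v)
    rw [hC v hv, hA.2.1 v (Finset.mem_union_right _ hv)]
  have h2 : w ∈ nbrs G (K ∪ C) v := mem_nbrs.2 ⟨Finset.mem_union_right _ hw, hvw⟩
  rw [← h1, mem_nbrs] at h2
  exact Finset.disjoint_left.1 hKC h2.1 hw

end Bipartite

/-- The sets `F i` represent the edges of pairwise edge-disjoint perfect matchings on `K`. -/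
structure IsFactorSystem {V ι : Type*} (G : SimpleGraph V) (K : Finset V) (F : ι → Finset V) :
    Prop where
  disjoint : ∀ i, Disjoint K (F i)
  pairwise : ∀ i j, i ≠ j → Disjoint (F i) (F j)
  indep : ∀ i j, ∀ v ∈ F i, ∀ w ∈ F j, ¬ G.Adj v w
  card_ends : ∀ i, ∀ v ∈ F i, (nbrs G K v).card = 2
  card_edges : ∀ i, ∀ x ∈ K, (nbrs G (F i) x).card = 1
  unique : ∀ i j, ∀ v ∈ F i, ∀ w ∈ F j, ∀ x ∈ K, ∀ y ∈ K, x ≠ y → G.Adj x v → G.Adj y v →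
    G.Adj x w → G.Adj y w → v = w

section Factor
variable {V ι : Type*} {G : SimpleGraph V} {K : Finset V} {F F' : ι → Finset V}

/-- The independent set `K` is half of each cycle, so the cycle alternates between `K` and the edge
vertices. A vertex of `K` has two neighbours in the union of any two factors; comparing three
factors shows that it has one in each. Distinct factors share no edge since that would give a
four-cycle. -/
theorem isFactorSystem_of_cycSet {d : ℕ} (hd : 2 ≤ d) (hι : ∀ i j : ι, ∃ k, k ≠ i ∧ k ≠ j)
    (hKi : ∀ x ∈ K, ∀ y ∈ K, ¬ G.Adj x y) (hK : K.card = 2 * d) (hF : ∀ i, (F i).card = d)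
    (hKF : ∀ i, Disjoint K (F i)) (hFF : ∀ i j, i ≠ j → Disjoint (F i) (F j))
    (hcyc : ∀ i j, i ≠ j → CycSet G (4 * d) (K ∪ (F i ∪ F j))) : IsFactorSystem G K F := by
  have hdis : ∀ i j, Disjoint K (F i ∪ F j) := fun i j =>
    Finset.disjoint_union_right.2 ⟨hKF i, hKF j⟩
  have key := fun i j (hij : i ≠ j) => (hcyc i j hij).card_nbrs_of_half (hdis i j) hKi
    (by rw [Finset.card_union_of_disjoint (hFF i j hij), hF, hF]; omega)
  have hsum : ∀ i j, i ≠ j → ∀ x ∈ K, (nbrs G (F i) x).card + (nbrs G (F j) x).card = 2 := by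
    intro i j hij x hx
    rw [← (key i j hij).1 x hx, nbrs, nbrs, nbrs, Finset.filter_union,
      Finset.card_union_of_disjoint]
    exact Finset.disjoint_filter_filter (hFF i j hij)
  have hone : ∀ i, ∀ x ∈ K, (nbrs G (F i) x).card = 1 := by
    intro i x hx
    obtain ⟨j, hj, -⟩ := hι i i
    obtain ⟨k, hk, hk'⟩ := hι i j
    have h1 := hsum i j hj.symm x hx
    have h2 := hsum i k hk.symm x hx
    have h3 := hsum j k hk'.symm x hx
    omega
  refine ⟨hKF, hFF, ?_, ?_, hone, ?_⟩
  · intro i j v hv w hw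
    by_cases hij : i = j
    · subst hij
      obtain ⟨k, hk, -⟩ := hι i i
      exact (key i k hk.symm).2.2 v (Finset.mem_union_left _ hv) w (Finset.mem_union_left _ hw)
    · exact (key i j hij).2.2 v (Finset.mem_union_left _ hv) w (Finset.mem_union_right _ hw)
  · intro i v hv
    obtain ⟨j, hj, -⟩ := hι i i
    exact (key i j hj.symm).2.1 v (Finset.mem_union_left _ hv)
  · intro i j v hv w hw x hx y hy hxy h1 h2 h3 h4
    by_cases hij : i = j
    · subst hij
      exact Finset.card_le_one.1 (hone i x hx).le v (mem_nbrs.2 ⟨hv, h1⟩) w (mem_nbrs.2 ⟨hw, h3⟩)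
    · by_contra hvw
      exact (hcyc i j hij).no_four (by omega) (Finset.mem_union_left _ hx)
        (Finset.mem_union_left _ hy) (Finset.mem_union_right _ (Finset.mem_union_left _ hv))
        (Finset.mem_union_right _ (Finset.mem_union_right _ hw)) hxy hvw h1 h3 h2 h4

/-- The vertices that represent the edges of `H`. -/
noncomputable def edgeReps {α : Type*} [Fintype ι] (G : SimpleGraph V) (F : ι → Finset V)
    (κ : α → V) (H : SimpleGraph α) : Finset V :=
  (Finset.univ.biUnion F).filter fun v => ∃ a b, H.Adj a b ∧ G.Adj (κ a) v ∧ G.Adj (κ b) v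

theorem mem_edgeReps {α : Type*} [Fintype ι] {κ : α → V} {H : SimpleGraph α} {v : V} :
    v ∈ edgeReps G F κ H ↔ (∃ i, v ∈ F i) ∧ ∃ a b, H.Adj a b ∧ G.Adj (κ a) v ∧ G.Adj (κ b) v := by
  simp [edgeReps]

theorem IsFactorSystem.eq_or_eq (hF : IsFactorSystem G K F) {i : ι} {v x y z : V} (hv : v ∈ F i)
    (hx : x ∈ K) (hy : y ∈ K) (hz : z ∈ K) (hxy : x ≠ y) (hxv : G.Adj x v) (hyv : G.Adj y v)
    (hzv : G.Adj z v) : z = x ∨ z = y := by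
  have h1 : ({x, y} : Finset V) = nbrs G K v := by
    apply Finset.eq_of_subset_of_card_le
    · intro w hw
      rw [Finset.mem_insert, Finset.mem_singleton] at hw
      rcases hw with rfl | rfl
      · exact mem_nbrs.2 ⟨hx, hxv.symm⟩
      · exact mem_nbrs.2 ⟨hy, hyv.symm⟩
    · rw [hF.card_ends i v hv, Finset.card_pair hxy]
  have h2 : z ∈ nbrs G K v := mem_nbrs.2 ⟨hz, hzv.symm⟩
  rw [← h1] at h2
  simpa using h2

/-- The Hamiltonian cycle `H`, subdivided by the vertices that represent its edges, is induced
because both colour classes are independent. -/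
theorem IsFactorSystem.cycSet_edgeReps {α : Type*} [Fintype α] [Fintype ι] {κ : α ↪ V}
    {H : SimpleGraph α} (hF : IsFactorSystem G (Finset.univ.map κ) F)
    (hKi : ∀ x ∈ Finset.univ.map κ, ∀ y ∈ Finset.univ.map κ, ¬ G.Adj x y)
    (h2 : ∀ a, (Finset.univ.filter (H.Adj a)).card = 2)
    (hconn : ∀ T : Finset α, T.Nonempty → (∀ a ∈ T, ∀ b, H.Adj a b → b ∈ T) → T = Finset.univ)
    (hH : ∀ a b, H.Adj a b → ∃ i, ∃ v ∈ F i, G.Adj (κ a) v ∧ G.Adj (κ b) v) :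
    CycSet G (2 * Fintype.card α) (Finset.univ.map κ ∪ edgeReps G F κ H) := by
  have hκ : ∀ a, κ a ∈ Finset.univ.map κ := fun a =>
    Finset.mem_map.2 ⟨a, Finset.mem_univ _, rfl⟩
  refine CycSet.of_bipartite ?_ hKi ?_ ?_ ?_ ?_ (by simp)
  · rw [Finset.disjoint_left]
    intro x hx hx'
    obtain ⟨⟨i, hi⟩, -⟩ := mem_edgeReps.1 hx'
    exact Finset.disjoint_left.1 (hF.disjoint i) hx hi
  · intro x hx y hy
    obtain ⟨⟨i, hi⟩, -⟩ := mem_edgeReps.1 hx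
    obtain ⟨⟨j, hj⟩, -⟩ := mem_edgeReps.1 hy
    exact hF.indep i j x hi y hj
  · intro v hv
    obtain ⟨⟨i, hi⟩, -⟩ := mem_edgeReps.1 hv
    exact hF.card_ends i v hi
  · intro x hx
    obtain ⟨a, -, rfl⟩ := Finset.mem_map.1 hx
    rw [← h2 a]
    have hex : ∀ b, ∃ v, H.Adj a b → (∃ i, v ∈ F i) ∧ G.Adj (κ a) v ∧ G.Adj (κ b) v := by
      intro b
      by_cases h : H.Adj a b
      · obtain ⟨i, v, hv, h'⟩ := hH a b h
        exact ⟨v, fun _ => ⟨⟨i, hv⟩, h'⟩⟩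
      · exact ⟨κ a, fun h' => absurd h' h⟩
    choose g hg using hex
    symm
    apply Finset.card_nbij g
    · intro b hb
      have hab : H.Adj a b := by simpa using hb
      exact Finset.mem_coe.2 (mem_nbrs.2
        ⟨mem_edgeReps.2 ⟨(hg b hab).1, a, b, hab, (hg b hab).2⟩, (hg b hab).2.1⟩)
    · intro b hb b' hb' hbb
      have hab : H.Adj a b := by simpa using hb
      have hab' : H.Adj a b' := by simpa using hb'
      obtain ⟨⟨i, hi⟩, h3, h4⟩ := hg b hab
      obtain ⟨-, h5, h6⟩ := hg b' hab'
      rw [← hbb] at h5 h6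
      rcases hF.eq_or_eq hi (hκ a) (hκ b) (hκ b') (κ.injective.ne hab.ne) h3 h4 h6 with h | h
      · exact absurd (κ.injective h).symm hab'.ne
      · exact (κ.injective h).symm
    · intro v hv
      obtain ⟨hv, hav⟩ := mem_nbrs.1 (Finset.mem_coe.1 hv)
      obtain ⟨⟨i, hi⟩, b, c, hbc, hb, hc⟩ := mem_edgeReps.1 hv
      have : ∃ b', H.Adj a b' ∧ G.Adj (κ b') v := by
        rcases hF.eq_or_eq hi (hκ b) (hκ c) (hκ a) (κ.injective.ne hbc.ne) hb hc hav with h | h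
        · rw [κ.injective h]
          exact ⟨c, hbc, hc⟩
        · rw [κ.injective h]
          exact ⟨b, hbc.symm, hb⟩
      obtain ⟨b', hab, hb'⟩ := this
      obtain ⟨⟨j, hj⟩, h3, h4⟩ := hg b' hab
      exact ⟨b', by simpa using hab,
        (hF.unique i j v hi _ hj _ (hκ a) _ (hκ b') (κ.injective.ne hab.ne) hav hb' h3 h4).symm⟩
  · intro T hT hne hcl
    have h1 := hconn (Finset.univ.filter fun a => κ a ∈ T) ?_ ?_
    · refine Finset.Subset.antisymm hT fun x hx => ?_
      obtain ⟨a, -, rfl⟩ := Finset.mem_map.1 hx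
      have : a ∈ Finset.univ.filter fun a => κ a ∈ T := by
        rw [h1]
        exact Finset.mem_univ _
      exact (Finset.mem_filter.1 this).2
    · obtain ⟨x, hx⟩ := hne
      obtain ⟨a, -, rfl⟩ := Finset.mem_map.1 (hT hx)
      exact ⟨a, Finset.mem_filter.2 ⟨Finset.mem_univ _, hx⟩⟩
    · intro a ha b hab
      obtain ⟨i, v, hv, hav, hbv⟩ := hH a b hab
      exact Finset.mem_filter.2 ⟨Finset.mem_univ _, hcl _ (Finset.mem_filter.1 ha).2 _ (hκ b) v
        (mem_edgeReps.2 ⟨⟨i, hv⟩, a, b, hab, hav, hbv⟩) hav hbv⟩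

end Factor

section Twins
variable {V ι : Type*} {G : SimpleGraph V} {K : Finset V} {F F' : ι → Finset V}

/-- The set of neighbourhoods in `K` of the vertices of a block. -/
noncomputable def traces (G : SimpleGraph V) (K D : Finset V) : Finset (Finset V) :=
  D.image (nbrs G K)

theorem exists_adj_of_traces_eq {D D' : Finset V} (h : traces G K D = traces G K D') {x y v : V}
    (hv : v ∈ D) (hx : x ∈ K) (hy : y ∈ K) (hxv : G.Adj x v) (hyv : G.Adj y v) :
    ∃ w ∈ D', G.Adj x w ∧ G.Adj y w := by
  have h1 : nbrs G K v ∈ traces G K D' := by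
    rw [← h]
    exact Finset.mem_image_of_mem _ hv
  obtain ⟨w, hw, hvw⟩ := Finset.mem_image.1 h1
  have h2 : ∀ z ∈ K, G.Adj z v → G.Adj z w := by
    intro z hz hzv
    have : z ∈ nbrs G K v := mem_nbrs.2 ⟨hz, hzv.symm⟩
    rw [← hvw] at this
    exact (mem_nbrs.1 this).2.symm
  exact ⟨w, hw, h2 x hx hxv, h2 y hy hyv⟩

/-- A Hamiltonian cycle in the union of the perfect matchings uses each of them completely or not
at all, if every matching can be replaced by a copy of it. -/
theorem subset_or_disjoint_edgeReps {α : Type*} [Fintype α] [Fintype ι] {κ : α ↪ V}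
    {H : SimpleGraph α} {d : ℕ} (hα : Fintype.card α = 2 * d)
    (hF : IsFactorSystem G (Finset.univ.map κ) F) (hFc : ∀ i, (F i).card = d) (i₀ : ι)
    (hF' : IsFactorSystem G (Finset.univ.map κ) F')
    (hFF' : ∀ i, traces G (Finset.univ.map κ) (F i) = traces G (Finset.univ.map κ) (F' i))
    (hne : ∀ i ≠ i₀, F' i = F i) (hdis : Disjoint (F i₀) (F' i₀))
    (hKi : ∀ x ∈ Finset.univ.map κ, ∀ y ∈ Finset.univ.map κ, ¬ G.Adj x y)
    {S : Finset V} (hKS : Finset.univ.map κ ⊆ S) (hFS : ∀ i, F i ⊆ S) (hFS' : ∀ i, F' i ⊆ S)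
    (hint : ∀ A ⊆ S, ∀ B ⊆ S, CycSet G (4 * d) A → CycSet G (4 * d) B → A ≠ B →
      (A ∩ B).card ∈ progression (2 * d) 2 d)
    (h2 : ∀ a, (Finset.univ.filter (H.Adj a)).card = 2)
    (hconn : ∀ T : Finset α, T.Nonempty → (∀ a ∈ T, ∀ b, H.Adj a b → b ∈ T) → T = Finset.univ)
    (hH : ∀ a b, H.Adj a b → ∃ i, ∃ v ∈ F i, G.Adj (κ a) v ∧ G.Adj (κ b) v) :
    F i₀ ⊆ edgeReps G F κ H ∨ Disjoint (F i₀) (edgeReps G F κ H) := by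
  have hκ : ∀ a, κ a ∈ Finset.univ.map κ := fun a =>
    Finset.mem_map.2 ⟨a, Finset.mem_univ _, rfl⟩
  have hr : 2 * Fintype.card α = 4 * d := by omega
  have hA := hF.cycSet_edgeReps hKi h2 hconn hH
  have hB := hF'.cycSet_edgeReps (H := H) hKi h2 hconn (by
    intro a b hab
    obtain ⟨i, v, hv, hav, hbv⟩ := hH a b hab
    exact ⟨i, exists_adj_of_traces_eq (hFF' i) hv (hκ a) (hκ b) hav hbv⟩)
  rw [hr] at hA hB
  set C := edgeReps G F κ H with hC
  set C' := edgeReps G F' κ H with hC'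
  have hKC : Disjoint (Finset.univ.map κ) C := by
    rw [Finset.disjoint_left]
    intro x hx hx'
    obtain ⟨⟨i, hi⟩, -⟩ := mem_edgeReps.1 hx'
    exact Finset.disjoint_left.1 (hF.disjoint i) hx hi
  have hinter : (Finset.univ.map κ ∪ C) ∩ (Finset.univ.map κ ∪ C') =
      Finset.univ.map κ ∪ (C \ F i₀) := by
    rw [← Finset.union_inter_distrib_left]
    congr 1
    ext v
    rw [Finset.mem_inter, Finset.mem_sdiff]
    refine and_congr_right fun hv => ?_
    obtain ⟨⟨i, hi⟩, hv'⟩ := mem_edgeReps.1 hv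
    constructor
    · intro h hvi
      obtain ⟨⟨j, hj⟩, -⟩ := mem_edgeReps.1 h
      by_cases hji : j = i₀
      · subst hji
        exact Finset.disjoint_left.1 hdis hvi hj
      · rw [hne j hji] at hj
        exact Finset.disjoint_left.1 (hF.pairwise j i₀ hji) hj hvi
    · intro h
      have hi₀ : i ≠ i₀ := fun h' => h (h' ▸ hi)
      exact mem_edgeReps.2 ⟨⟨i, by rwa [hne i hi₀]⟩, hv'⟩
  have hCc : C.card = 2 * d := by
    have := hA.1
    rw [Finset.card_union_of_disjoint hKC, Finset.card_map, Finset.card_univ] at this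
    omega
  rw [or_iff_not_imp_right]
  intro hndis
  have hpos : 0 < (F i₀ ∩ C).card := by
    rw [Finset.card_pos, ← Finset.not_disjoint_iff_nonempty_inter]
    exact hndis
  -- The same Hamiltonian cycle realized with the copy of `F i₀` misses exactly the vertices of `F
  -- i₀ ∩ C`. The intersection must have `2 d` or `3 d` of the `4 d` vertices, and `F i₀` has only
  -- `d`, so it is used completely.
  have h4 : ((Finset.univ.map κ ∪ C) ∩ (Finset.univ.map κ ∪ C')).card + (F i₀ ∩ C).card =
      4 * d := by
    rw [hinter, Finset.card_union_of_disjoint (Finset.disjoint_of_subset_right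
      Finset.sdiff_subset hKC), Finset.card_map, Finset.card_univ, Finset.inter_comm]
    have := Finset.card_sdiff_add_card_inter C (F i₀)
    omega
  have hAB : Finset.univ.map κ ∪ C ≠ Finset.univ.map κ ∪ C' := by
    intro h
    rw [← h, Finset.inter_self, hA.1] at h4
    omega
  have hsub : ∀ {E : ι → Finset V}, (∀ i, E i ⊆ S) →
      Finset.univ.map κ ∪ edgeReps G E κ H ⊆ S := by
    intro E hE
    refine Finset.union_subset hKS fun v hv => ?_
    obtain ⟨⟨i, hi⟩, -⟩ := mem_edgeReps.1 hv
    exact hE i hi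
  obtain ⟨j, hj, h5⟩ := hint _ (hsub hFS) _ (hsub hFS') hA hB hAB
  rw [h5] at h4
  have h6 : F i₀ ∩ C = F i₀ := by
    apply Finset.eq_of_subset_of_card_le Finset.inter_subset_left
    rw [hFc]
    have h7 := Finset.card_le_card (Finset.inter_subset_left : F i₀ ∩ C ⊆ F i₀)
    rw [hFc] at h7
    interval_cases j <;> omega
  rw [← h6]
  exact Finset.inter_subset_right

/-- The `2 d` edge vertices are a disjoint union of factors of size `d`. -/
theorem card_filter_subset_edgeReps {α : Type*} [Fintype α] [Fintype ι] {κ : α ↪ V}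
    {H : SimpleGraph α} {d : ℕ} (hd : 0 < d) (hFc : ∀ i, (F i).card = d)
    (hFF : ∀ i j, i ≠ j → Disjoint (F i) (F j)) (hC : (edgeReps G F κ H).card = 2 * d)
    (h : ∀ i, F i ⊆ edgeReps G F κ H ∨ Disjoint (F i) (edgeReps G F κ H)) :
    (Finset.univ.filter fun i => F i ⊆ edgeReps G F κ H).card = 2 := by
  have h1 : (Finset.univ.filter fun i => F i ⊆ edgeReps G F κ H).biUnion F =
      edgeReps G F κ H := by
    ext v
    rw [Finset.mem_biUnion]
    constructor
    · rintro ⟨i, hi, hv⟩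
      exact (Finset.mem_filter.1 hi).2 hv
    · intro hv
      obtain ⟨⟨i, hi⟩, -⟩ := mem_edgeReps.1 hv
      refine ⟨i, Finset.mem_filter.2 ⟨Finset.mem_univ _, (h i).resolve_right fun h' => ?_⟩, hi⟩
      exact Finset.disjoint_left.1 h' hi hv
  have h2 := Finset.card_biUnion (s := Finset.univ.filter fun i => F i ⊆ edgeReps G F κ H)
    fun i _ j _ hij => hFF i j hij
  rw [h1, hC, Finset.sum_congr rfl fun i _ => hFc i, Finset.sum_const, smul_eq_mul] at h2
  exact Nat.eq_of_mul_eq_mul_right hd h2.symm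

theorem IsFactorSystem.existsUnique (hF : IsFactorSystem G K F) (i : ι) {x : V} (hx : x ∈ K) :
    ∃! y, y ∈ K ∧ x ≠ y ∧ ∃ v ∈ F i, G.Adj x v ∧ G.Adj y v := by
  obtain ⟨v, hv⟩ := Finset.card_eq_one.1 (hF.card_edges i x hx)
  have hv' : v ∈ F i ∧ G.Adj x v := mem_nbrs.1 (by rw [hv]; exact Finset.mem_singleton_self v)
  have hxv : x ∈ nbrs G K v := mem_nbrs.2 ⟨hx, hv'.2.symm⟩
  obtain ⟨y, hy⟩ := Finset.card_pos.1 (by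
    rw [Finset.card_erase_of_mem hxv, hF.card_ends i v hv'.1]; omega)
  obtain ⟨hyx, hy⟩ := Finset.mem_erase.1 hy
  obtain ⟨hyK, hvy⟩ := mem_nbrs.1 hy
  refine ⟨y, ⟨hyK, hyx.symm, v, hv'.1, hv'.2, hvy.symm⟩, ?_⟩
  rintro z ⟨hz, hxz, w, hw, hxw, hzw⟩
  have h1 : w ∈ nbrs G (F i) x := mem_nbrs.2 ⟨hw, hxw⟩
  rw [hv, Finset.mem_singleton] at h1
  subst h1
  exact (hF.eq_or_eq hw hx hyK hz hyx.symm hxw hvy.symm hzw).resolve_left hxz.symm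

/-- Perfect matchings in which every two make up a Hamiltonian cycle, and each of which can be
replaced by a copy of it, form a flawless factorization. -/
theorem mem_flawlessDegrees_of_twins {m d : ℕ} {F F' : Fin m → Finset V} (hd : 2 ≤ d) (hm : 3 ≤ m)
    (hKi : ∀ x ∈ K, ∀ y ∈ K, ¬ G.Adj x y) (hK : K.card = 2 * d)
    (hFc : ∀ i, (F i).card = d) (hFc' : ∀ i, (F' i).card = d)
    (hKF : ∀ i, Disjoint K (F i)) (hKF' : ∀ i, Disjoint K (F' i))
    (hFF : ∀ i j, i ≠ j → Disjoint (F i) (F j)) (hFF' : ∀ i j, Disjoint (F i) (F' j))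
    (htr : ∀ i, traces G K (F i) = traces G K (F' i))
    (hcyc : ∀ i j, i ≠ j → CycSet G (4 * d) (K ∪ (F i ∪ F j)))
    (hcyc' : ∀ i j, i ≠ j → CycSet G (4 * d) (K ∪ (F i ∪ F' j)))
    {S : Finset V} (hKS : K ⊆ S) (hFS : ∀ i, F i ⊆ S) (hFS' : ∀ i, F' i ⊆ S)
    (hint : ∀ A ⊆ S, ∀ B ⊆ S, CycSet G (4 * d) A → CycSet G (4 * d) B → A ≠ B →
      (A ∩ B).card ∈ progression (2 * d) 2 d) : m ∈ flawlessDegrees (2 * d) := by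
  have hι : ∀ i j : Fin m, ∃ k, k ≠ i ∧ k ≠ j := by
    intro i j
    by_contra hcon
    push Not at hcon
    have h1 : (Finset.univ : Finset (Fin m)) ⊆ {i, j} := by
      intro k _
      rw [Finset.mem_insert, Finset.mem_singleton]
      by_cases h : k = i
      · exact Or.inl h
      · exact Or.inr (hcon k h)
    have h2 := (Finset.card_le_card h1).trans Finset.card_le_two
    rw [Finset.card_univ, Fintype.card_fin] at h2
    omega
  obtain ⟨κ, hκK⟩ : ∃ κ : Fin (2 * d) ↪ V, Finset.univ.map κ = K := by
    refine ⟨(K.equivFinOfCardEq hK).symm.toEmbedding.trans (Function.Embedding.subtype _), ?_⟩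
    ext x
    simp only [Finset.mem_map, Finset.mem_univ, true_and]
    constructor
    · rintro ⟨a, rfl⟩
      exact ((K.equivFinOfCardEq hK).symm a).2
    · intro hx
      exact ⟨K.equivFinOfCardEq hK ⟨x, hx⟩, by simp⟩
  subst hκK
  have hκ : ∀ a, κ a ∈ Finset.univ.map κ := fun a =>
    Finset.mem_map.2 ⟨a, Finset.mem_univ _, rfl⟩
  have hF := isFactorSystem_of_cycSet hd hι hKi hK hFc hKF hFF hcyc
  -- Exchanging a single factor for its copy gives the second system needed in
  -- `subset_or_disjoint_edgeReps`.
  have hG : ∀ i₀, IsFactorSystem G (Finset.univ.map κ) (Function.update F i₀ (F' i₀)) := by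
    intro i₀
    have e0 : Function.update F i₀ (F' i₀) i₀ = F' i₀ := Function.update_self _ _ _
    have e1 : ∀ i ≠ i₀, Function.update F i₀ (F' i₀) i = F i := fun i hi =>
      Function.update_of_ne hi _ _
    apply isFactorSystem_of_cycSet hd hι hKi hK
    · intro i
      by_cases hi : i = i₀
      · subst hi; rw [e0]; exact hFc' _
      · rw [e1 i hi]; exact hFc _
    · intro i
      by_cases hi : i = i₀
      · subst hi; rw [e0]; exact hKF' _
      · rw [e1 i hi]; exact hKF _
    · intro i j hij
      by_cases hi : i = i₀
      · subst hi
        rw [e0, e1 j hij.symm]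
        exact (hFF' _ _).symm
      · rw [e1 i hi]
        by_cases hj : j = i₀
        · subst hj; rw [e0]; exact hFF' _ _
        · rw [e1 j hj]; exact hFF _ _ hij
    · intro i j hij
      by_cases hi : i = i₀
      · subst hi
        rw [e0, e1 j hij.symm, Finset.union_comm (F' i)]
        exact hcyc' _ _ hij.symm
      · rw [e1 i hi]
        by_cases hj : j = i₀
        · subst hj; rw [e0]; exact hcyc' _ _ hij
        · rw [e1 j hj]; exact hcyc _ _ hij
  refine mem_flawlessDegrees (by omega)
    (R := fun i a b => a ≠ b ∧ ∃ v ∈ F i, G.Adj (κ a) v ∧ G.Adj (κ b) v) ?_ ?_ ?_ ?_ ?_ ?_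
  · rintro i a b ⟨hab, v, hv, h1, h2⟩
    exact ⟨hab.symm, v, hv, h2, h1⟩
  · exact fun i a h => h.1 rfl
  · intro i a
    obtain ⟨y, ⟨hy, hay, hv⟩, huniq⟩ := hF.existsUnique i (hκ a)
    obtain ⟨b, -, rfl⟩ := Finset.mem_map.1 hy
    refine ⟨b, ⟨fun h => hay (by rw [h]), hv⟩, ?_⟩
    rintro c ⟨hac, hc⟩
    exact κ.injective (huniq _ ⟨hκ c, κ.injective.ne hac, hc⟩)
  · rintro i j a b ⟨hab, v, hv, hav, hbv⟩ ⟨-, w, hw, haw, hbw⟩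
    by_contra hij
    have := hF.unique i j v hv w hw _ (hκ a) _ (hκ b) (κ.injective.ne hab) hav hbv haw hbw
    subst this
    exact Finset.disjoint_left.1 (hFF i j hij) hv hw
  · intro i j hij T hT hcl
    have hKc := (hcyc i j hij).2.2 (T.map κ ∪ (F i ∪ F j).filter fun v => ∃ a ∈ T, G.Adj (κ a) v)
      ?_ ?_ ?_
    · ext a
      simp only [Finset.mem_univ, iff_true]
      have h1 : κ a ∈ T.map κ ∪ (F i ∪ F j).filter fun v => ∃ a ∈ T, G.Adj (κ a) v := by
        rw [hKc]
        exact Finset.mem_union_left _ (hκ a)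
      rcases Finset.mem_union.1 h1 with h1 | h1
      · obtain ⟨b, hb, hab⟩ := Finset.mem_map.1 h1
        rwa [← κ.injective hab]
      · have h2 := Finset.disjoint_union_right.2 ⟨hKF i, hKF j⟩
        exact absurd (Finset.mem_filter.1 h1).1 (Finset.disjoint_left.1 h2 (hκ a))
    · apply Finset.union_subset_union
      · exact Finset.map_subset_map.2 (Finset.subset_univ _)
      · exact Finset.filter_subset _ _
    · obtain ⟨a, ha⟩ := hT
      exact ⟨κ a, Finset.mem_union_left _ (Finset.mem_map.2 ⟨a, ha, rfl⟩)⟩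
    · intro x hx y hy hxy
      rcases Finset.mem_union.1 hx with hx | hx
      · obtain ⟨a, ha, rfl⟩ := Finset.mem_map.1 hx
        rcases Finset.mem_union.1 hy with hy | hy
        · exact absurd hxy (hKi _ (hκ a) _ hy)
        · exact Finset.mem_union_right _ (Finset.mem_filter.2 ⟨hy, a, ha, hxy⟩)
      · obtain ⟨hx, a, ha, hax⟩ := Finset.mem_filter.1 hx
        have hx' : ∃ k, (k = i ∨ k = j) ∧ x ∈ F k := by
          rcases Finset.mem_union.1 hx with h | h
          · exact ⟨i, Or.inl rfl, h⟩
          · exact ⟨j, Or.inr rfl, h⟩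
        obtain ⟨k, hk, hxk⟩ := hx'
        rcases Finset.mem_union.1 hy with hy | hy
        · obtain ⟨b, -, rfl⟩ := Finset.mem_map.1 hy
          refine Finset.mem_union_left _ (Finset.mem_map.2 ⟨b, ?_, rfl⟩)
          by_cases hab : a = b
          · exact hab ▸ ha
          · refine hcl a ha b ?_
            rcases hk with rfl | rfl
            · exact Or.inl ⟨hab, x, hxk, hax, hxy.symm⟩
            · exact Or.inr ⟨hab, x, hxk, hax, hxy.symm⟩
        · rcases Finset.mem_union.1 hy with hy | hy
          · exact absurd hxy (hF.indep _ _ _ hxk _ hy)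
          · exact absurd hxy (hF.indep _ _ _ hxk _ hy)
  · intro H h2 hconn hH
    have hH' : ∀ a b, H.Adj a b → ∃ i, ∃ v ∈ F i, G.Adj (κ a) v ∧ G.Adj (κ b) v := by
      intro a b hab
      obtain ⟨i, -, h⟩ := hH a b hab
      exact ⟨i, h⟩
    have hsd : ∀ i, F i ⊆ edgeReps G F κ H ∨ Disjoint (F i) (edgeReps G F κ H) := by
      intro i
      refine subset_or_disjoint_edgeReps (by simp) hF hFc i (hG i) ?_ ?_ ?_ hKi hKS hFS ?_
        hint h2 hconn hH'
      · intro j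
        by_cases hj : j = i
        · subst hj
          rw [Function.update_self]
          exact htr _
        · rw [Function.update_of_ne hj]
      · exact fun j hj => Function.update_of_ne hj _ _
      · rw [Function.update_self]
        exact hFF' i i
      · intro j
        by_cases hj : j = i
        · subst hj
          rw [Function.update_self]
          exact hFS' _
        · rw [Function.update_of_ne hj]
          exact hFS _
    have hCc : (edgeReps G F κ H).card = 2 * d := by
      have h1 := (hF.cycSet_edgeReps hKi h2 hconn hH').1
      rw [Finset.card_union_of_disjoint, Finset.card_map, Finset.card_univ, Fintype.card_fin] at h1
      · omega
      · rw [Finset.disjoint_left]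
        intro x hx hx'
        obtain ⟨⟨i, hi⟩, -⟩ := mem_edgeReps.1 hx'
        exact Finset.disjoint_left.1 (hKF i) hx hi
    obtain ⟨i, j, hij, hIJ⟩ := Finset.card_eq_two.1
      (card_filter_subset_edgeReps (by omega) hFc hFF hCc hsd)
    have hmem : ∀ k, F k ⊆ edgeReps G F κ H ↔ k = i ∨ k = j := by
      intro k
      have : k ∈ Finset.univ.filter (fun i => F i ⊆ edgeReps G F κ H) ↔ k ∈ ({i, j} : Finset _) := by
        rw [hIJ]
      simpa using this
    refine ⟨i, j, hij, fun a b => ⟨fun hab => ?_, fun hab => ?_⟩⟩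
    · obtain ⟨k, hne, v, hv, hav, hbv⟩ := hH a b hab
      have hvC : v ∈ edgeReps G F κ H := mem_edgeReps.2 ⟨⟨k, hv⟩, a, b, hab, hav, hbv⟩
      have hk := (hmem k).1 ((hsd k).resolve_right fun h => Finset.disjoint_left.1 h hv hvC)
      rcases hk with rfl | rfl
      · exact Or.inl ⟨hne, v, hv, hav, hbv⟩
      · exact Or.inr ⟨hne, v, hv, hav, hbv⟩
    · have h3 : ∃ k, (k = i ∨ k = j) ∧ a ≠ b ∧ ∃ v ∈ F k, G.Adj (κ a) v ∧ G.Adj (κ b) v := by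
        rcases hab with h | h
        · exact ⟨i, Or.inl rfl, h⟩
        · exact ⟨j, Or.inr rfl, h⟩
      obtain ⟨k, hk, hne, v, hv, hav, hbv⟩ := h3
      obtain ⟨-, a', b', hab', ha', hb'⟩ := mem_edgeReps.1 ((hmem k).2 hk hv)
      have e := fun c (h : G.Adj (κ c) v) =>
        hF.eq_or_eq hv (hκ a') (hκ b') (hκ c) (κ.injective.ne hab'.ne) ha' hb' h
      rcases e a hav with h | h <;> rcases e b hbv with h' | h' <;>
        rw [κ.injective.eq_iff] at h h' <;> subst h <;> subst h'
      · exact absurd rfl hne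
      · exact hab'
      · exact hab'.symm
      · exact absurd rfl hne

end Twins

/-! ### Turán's bound for graphs with few cliques, by sampling. -/

/-- A map on the image of `g` extends freely to the remaining elements of `β`. -/
theorem card_filter_comp {α β W : Type*} [Fintype α] [Fintype β] [Fintype W]
    [DecidableEq α] [DecidableEq β] {g : α → β}
    (hg : Function.Injective g) (p : (α → W) → Prop) :
    (Finset.univ.filter fun φ : β → W => p (φ ∘ g)).card =
      (Finset.univ.filter p).card * Fintype.card W ^ (Fintype.card β - Fintype.card α) := by
  have h0 := Finset.card_eq_sum_card_fiberwise (f := fun φ : β → W => φ ∘ g)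
    (s := Finset.univ.filter fun φ : β → W => p (φ ∘ g)) (t := Finset.univ.filter p)
    fun φ hφ => by simpa using hφ
  rw [h0, ← smul_eq_mul, ← Finset.sum_const]
  refine Finset.sum_congr rfl fun ψ hψ => ?_
  have h1 : ((Finset.univ.filter fun φ : β → W => p (φ ∘ g)).filter fun φ => φ ∘ g = ψ) =
      Fintype.piFinset fun b => Finset.univ.filter fun w => ∀ a, g a = b → w = ψ a := by
    ext φ
    simp only [Finset.mem_filter, Finset.mem_univ, true_and, Fintype.mem_piFinset]
    constructor
    · rintro ⟨-, rfl⟩ b a rfl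
      rfl
    · intro h
      have : φ ∘ g = ψ := funext fun a => h (g a) a rfl
      exact ⟨this ▸ (Finset.mem_filter.1 hψ).2, this⟩
  have h2 : ∀ b, (Finset.univ.filter fun w : W => ∀ a, g a = b → w = ψ a).card =
      if b ∈ Finset.univ.image g then 1 else Fintype.card W := by
    intro b
    split_ifs with hb
    · obtain ⟨a, -, rfl⟩ := Finset.mem_image.1 hb
      rw [Finset.card_eq_one]
      refine ⟨ψ a, ?_⟩
      ext w
      simp only [Finset.mem_filter, Finset.mem_univ, true_and, Finset.mem_singleton]
      exact ⟨fun h => h a rfl, fun h a' ha' => hg ha' ▸ h⟩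
    · rw [Finset.filter_true_of_mem, Finset.card_univ]
      exact fun w _ a ha => absurd (Finset.mem_image.2 ⟨a, Finset.mem_univ _, ha⟩) hb
  rw [h1, Fintype.card_piFinset, Finset.prod_congr rfl fun b _ => h2 b, Finset.prod_ite,
    Finset.prod_const_one, one_mul, Finset.prod_const]
  congr 1
  rw [Finset.filter_not, Finset.card_sdiff_of_subset (Finset.filter_subset _ _), Finset.card_univ,
    Finset.filter_mem_eq_inter, Finset.univ_inter, Finset.card_image_of_injective _ hg,
    Finset.card_univ]

/-- The number of ordered pairs of adjacent vertices. -/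
noncomputable def numArcs {W : Type*} [Fintype W] (Γ : SimpleGraph W) : ℕ :=
  (Finset.univ.filter fun p : W × W => Γ.Adj p.1 p.2).card

theorem numArcs_eq {W : Type*} [Fintype W] (Γ : SimpleGraph W) :
    numArcs Γ = 2 * Γ.edgeFinset.card := by
  rw [← SimpleGraph.sum_degrees_eq_twice_card_edges, numArcs, Finset.card_filter,
    Fintype.sum_prod_type]
  refine Finset.sum_congr rfl fun x _ => ?_
  rw [← Finset.card_filter, ← SimpleGraph.card_neighborFinset_eq_degree]
  congr 1
  ext y
  simp

theorem mul_numArcs_le_of_cliqueFree {T : ℕ} {Γ : SimpleGraph (Fin T)} {f : ℕ}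
    (hf : 0 < f) (h : Γ.CliqueFree (f + 1)) : f * numArcs Γ ≤ (f - 1) * T ^ 2 := by
  have h1 := (SimpleGraph.isTuranMaximal_turanGraph (n := T) hf).2 h
  have h2 := SimpleGraph.mul_card_edgeFinset_turanGraph_le (n := T) (r := f)
  rw [numArcs_eq]
  calc f * (2 * Γ.edgeFinset.card) = 2 * f * Γ.edgeFinset.card := by ring
    _ ≤ _ := (Nat.mul_le_mul_left _ h1).trans h2

/-- The tuples that span a clique. -/
noncomputable def cliqueTuples {W : Type*} [Fintype W] (Γ : SimpleGraph W) (k : ℕ) :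
    Finset (Fin k → W) :=
  Finset.univ.filter fun ψ => ∀ i j, i ≠ j → Γ.Adj (ψ i) (ψ j)

theorem exists_of_not_cliqueFree {W : Type*} [Fintype W] {Γ : SimpleGraph W} {k : ℕ}
    (h : ¬ Γ.CliqueFree k) : ∃ g : Fin k → W, Function.Injective g ∧
      ∀ i j, i ≠ j → Γ.Adj (g i) (g j) := by
  have e := SimpleGraph.topEmbeddingOfNotCliqueFree h
  exact ⟨e, e.injective, fun i j hij => e.map_adj_iff.2 (by simpa using hij)⟩

/-- Union bound over the positions of a clique in the sample. -/
theorem card_bad_le {W : Type*} [Fintype W] (Γ : SimpleGraph W) (k T : ℕ) :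
    (Finset.univ.filter fun φ : Fin T → W => ¬ (Γ.comap φ).CliqueFree k).card ≤
      T ^ k * ((cliqueTuples Γ k).card * Fintype.card W ^ (T - k)) := by
  have h1 : (Finset.univ.filter fun φ : Fin T → W => ¬ (Γ.comap φ).CliqueFree k) ⊆
      (Finset.univ.filter fun g : Fin k → Fin T => Function.Injective g).biUnion fun g =>
        Finset.univ.filter fun φ : Fin T → W => ∀ i j, i ≠ j → Γ.Adj ((φ ∘ g) i) ((φ ∘ g) j) := by
    intro φ hφ
    obtain ⟨g, hg, hadj⟩ := exists_of_not_cliqueFree (Finset.mem_filter.1 hφ).2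
    refine Finset.mem_biUnion.2 ⟨g, Finset.mem_filter.2 ⟨Finset.mem_univ _, hg⟩,
      Finset.mem_filter.2 ⟨Finset.mem_univ _, hadj⟩⟩
  refine (Finset.card_le_card h1).trans ((Finset.card_biUnion_le_card_mul _ _ _ ?_).trans
    (Nat.mul_le_mul_right _ ?_))
  · intro g hg
    have h2 := card_filter_comp (W := W) (Finset.mem_filter.1 hg).2
      fun ψ => ∀ i j, i ≠ j → Γ.Adj (ψ i) (ψ j)
    rw [Fintype.card_fin, Fintype.card_fin] at h2
    refine le_of_eq ?_
    rw [cliqueTuples]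
    convert h2
  · refine (Finset.card_filter_le _ _).trans ?_
    simp

/-- Double counting: each of the `T * (T - 1)` pairs of distinct positions carries an arc in the
same number of samples. -/
theorem sum_numArcs_comap {W : Type*} [Fintype W] (Γ : SimpleGraph W) (T : ℕ) :
    ∑ φ : Fin T → W, numArcs (Γ.comap φ) =
      T * (T - 1) * (numArcs Γ * Fintype.card W ^ (T - 2)) := by
  have h1 := Finset.sum_card_bipartiteAbove_eq_sum_card_bipartiteBelow
    (s := (Finset.univ : Finset (Fin T → W))) (t := (Finset.univ : Finset (Fin T × Fin T)))
    fun φ p => Γ.Adj (φ p.1) (φ p.2)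
  have h2 : ∀ p : Fin T × Fin T, (Finset.univ.filter fun φ : Fin T → W =>
      Γ.Adj (φ p.1) (φ p.2)).card = if p.1 = p.2 then 0 else
        numArcs Γ * Fintype.card W ^ (T - 2) := by
    rintro ⟨a, b⟩
    split_ifs with hab
    · simp only at hab
      subst hab
      simp
    · have h3 := card_filter_comp (α := Fin 2) (W := W) (g := ![a, b]) (by
        intro i j hij
        fin_cases i <;> fin_cases j <;> simp_all [eq_comm])
        fun ψ => Γ.Adj (ψ 0) (ψ 1)
      have h4 : (Finset.univ.filter fun ψ : Fin 2 → W => Γ.Adj (ψ 0) (ψ 1)).card = numArcs Γ := by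
        apply Finset.card_equiv (finTwoArrowEquiv W)
        simp
      rw [h4, Fintype.card_fin, Fintype.card_fin] at h3
      rw [← h3]
      congr 1
  refine Eq.trans h1 ?_
  have h5 : ∀ p : Fin T × Fin T, (Finset.univ.bipartiteBelow
      (fun (φ : Fin T → W) (p : Fin T × Fin T) => Γ.Adj (φ p.1) (φ p.2)) p).card = _ := h2
  rw [Finset.sum_congr rfl fun p _ => h5 p, Finset.sum_ite, Finset.sum_const_zero, zero_add,
    Finset.sum_const, smul_eq_mul]
  congr 1
  have h6 : (Finset.univ.filter fun p : Fin T × Fin T => ¬ p.1 = p.2) =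
      (Finset.univ : Finset (Fin T)).offDiag := by
    ext p
    simp
  rw [h6, Finset.offDiag_card]
  simp [Nat.mul_sub]

/-- A graph with few cliques of size `f + 1` has not many more edges than a Turán graph. -/
theorem mul_numArcs_le {W : Type*} [Fintype W] (Γ : SimpleGraph W) {f c T : ℕ} (hf : 0 < f)
    (hT : f + 1 ≤ T) (hT2 : 2 ≤ T)
    (hc : (cliqueTuples Γ (f + 1)).card ≤ c * Fintype.card W ^ f) :
    f * (T - 1) * numArcs Γ ≤ (f - 1) * T * Fintype.card W ^ 2 +
      f * T ^ (f + 2) * c * Fintype.card W := by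
  set N := Fintype.card W with hN
  rcases Nat.eq_zero_or_pos N with hN0 | hN0
  · have : IsEmpty W := Fintype.card_eq_zero_iff.1 hN0
    have h0 : numArcs Γ = 0 := by
      rw [numArcs, Finset.card_eq_zero]
      exact Finset.eq_empty_of_isEmpty _
    rw [h0]
    simp
  -- `T` vertices are sampled with repetition. A sample without a clique of size `f + 1` obeys
  -- Turán's bound; for the few others the trivial bound `T ^ 2` is good enough.
  have h1 : ∀ φ : Fin T → W, f * numArcs (Γ.comap φ) ≤ (f - 1) * T ^ 2 +
      if ¬ (Γ.comap φ).CliqueFree (f + 1) then f * T ^ 2 else 0 := by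
    intro φ
    by_cases h : ¬ (Γ.comap φ).CliqueFree (f + 1)
    · rw [if_pos h]
      refine le_trans (Nat.mul_le_mul_left f ?_) (Nat.le_add_left _ _)
      refine (Finset.card_filter_le _ _).trans ?_
      simp [pow_two]
    · rw [if_neg h]
      exact mul_numArcs_le_of_cliqueFree hf (not_not.1 h)
  have h2 := Finset.sum_le_sum fun φ (_ : φ ∈ Finset.univ) => h1 φ
  rw [← Finset.mul_sum, sum_numArcs_comap, Finset.sum_add_distrib, Finset.sum_const,
    ← Finset.sum_filter, Finset.sum_const, smul_eq_mul, smul_eq_mul, Finset.card_univ,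
    Fintype.card_fun, Fintype.card_fin, ← hN] at h2
  have h3 := (card_bad_le Γ (f + 1) T).trans
    (Nat.mul_le_mul_left _ (Nat.mul_le_mul_right _ hc))
  rw [← hN] at h3
  have h4 := h2.trans (Nat.add_le_add_left (Nat.mul_le_mul_right (f * T ^ 2) h3) _)
  have e1 : N ^ T = N ^ 2 * N ^ (T - 2) := by rw [← pow_add]; congr 1; omega
  have e2 : N ^ f * N ^ (T - (f + 1)) = N * N ^ (T - 2) := by
    rw [← pow_add, ← pow_succ']; congr 1; omega
  have hpos : 0 < T * N ^ (T - 2) := Nat.mul_pos (by omega) (pow_pos hN0 _)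
  refine Nat.le_of_mul_le_mul_left ?_ hpos
  calc T * N ^ (T - 2) * (f * (T - 1) * numArcs Γ)
      = f * (T * (T - 1) * (numArcs Γ * N ^ (T - 2))) := by ring
    _ ≤ _ := h4
    _ = (f - 1) * T ^ 2 * N ^ T +
          T ^ (f + 1) * (c * (N ^ f * N ^ (T - (f + 1)))) * (f * T ^ 2) := by ring
    _ = _ := by
        rw [e1, e2]
        ring

theorem traces_mem_powerset {V : Type*} {G : SimpleGraph V} {K D : Finset V} :
    traces G K D ∈ K.powerset.powerset := by
  rw [Finset.mem_powerset]
  intro X hX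
  obtain ⟨v, -, rfl⟩ := Finset.mem_image.1 hX
  exact Finset.mem_powerset.2 (Finset.filter_subset _ _)

/-- `trioGraph d` with two copies of each matching meets the hypotheses of
`mem_flawlessDegrees_of_twins`. -/
theorem three_le_flawlessNumber {d : ℕ} (hd : 2 ≤ d) : 3 ≤ flawlessNumber (2 * d) := by
  apply (flawlessNumber_isGreatest (by omega : 0 < 2 * d)).2
  set S := legSpan (trioBase d) (trioLeg d) (Finset.univ ×ˢ Finset.range 2) with hS
  have hleg : ∀ i, ∀ j < 2, trioLeg d (i, j) ⊆ S := fun i j hj x hx =>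
    mem_legSpan.2 (Or.inr ⟨(i, j), Finset.mem_product.2
      ⟨Finset.mem_univ _, Finset.mem_range.2 hj⟩, hx⟩)
  have hthird : ∀ i j : Fin 3, i ≠ j → ∃ k, Finset.univ.erase k = {i, j} := by decide
  have hcyc : ∀ i j : Fin 3, i ≠ j → ∀ J : Fin 3 → ℕ, CycSet (trioGraph d) (4 * d)
      (trioBase d ∪ (trioLeg d (i, J i) ∪ trioLeg d (j, J j))) := by
    intro i j hij J
    obtain ⟨k, hk⟩ := hthird i j hij
    have := cycSet_trioGraph hd k J
    rw [hk] at this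
    convert this using 1
    ext v
    simp [mem_legSpan]
  refine mem_flawlessDegrees_of_twins (G := trioGraph d) (K := trioBase d) (S := S)
    (F := fun i => trioLeg d (i, 0)) (F' := fun i => trioLeg d (i, 1)) hd le_rfl ?_
    (card_trioBase (by omega)) (fun _ => card_trioLeg _) (fun _ => card_trioLeg _)
    (fun _ => disjoint_trioBase _) (fun _ => disjoint_trioBase _)
    (fun i j hij => disjoint_trioLeg (by simpa using hij))
    (fun i j => disjoint_trioLeg (by simp)) ?_
    (fun i j hij => by convert hcyc i j hij fun _ => 0) ?_
    (fun x hx => mem_legSpan.2 (Or.inl hx)) (fun i => hleg i 0 (by omega))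
    (fun i => hleg i 1 (by omega)) ?_
  · rintro (k | p) hx (k' | p') hy hadj
    · exact hadj
    · exact inr_notMem_trioBase hy
    · exact inr_notMem_trioBase hx
    · exact inr_notMem_trioBase hx
  · intro i
    ext X
    simp only [traces, Finset.mem_image]
    have key : ∀ j x, nbrs (trioGraph d) (trioBase d) (Sum.inr (i, j, x)) =
        (trioBase d).filter fun v => v.elim (fun k => k ∈ matchEnds d i x) fun _ => False := by
      intro j x
      ext v
      rw [mem_nbrs, Finset.mem_filter]
      refine and_congr_right fun hv => ?_
      rcases v with k | p
      · exact Iff.rfl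
      · exact absurd hv inr_notMem_trioBase
    constructor
    · rintro ⟨k | ⟨i', j, x⟩, hv, rfl⟩
      · exact absurd hv inl_notMem_trioLeg
      · obtain ⟨h, hx⟩ := inr_mem_trioLeg.1 hv
        obtain ⟨rfl, rfl⟩ := Prod.mk.inj h
        exact ⟨Sum.inr (i, 1, x), inr_mem_trioLeg.2 ⟨rfl, hx⟩, by rw [key, key]⟩
    · rintro ⟨k | ⟨i', j, x⟩, hv, rfl⟩
      · exact absurd hv inl_notMem_trioLeg
      · obtain ⟨h, hx⟩ := inr_mem_trioLeg.1 hv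
        obtain ⟨rfl, rfl⟩ := Prod.mk.inj h
        exact ⟨Sum.inr (i, 0, x), inr_mem_trioLeg.2 ⟨rfl, hx⟩, by rw [key, key]⟩
  · intro i j hij
    have := hcyc i j hij fun k => if k = i then 0 else 1
    simp only [if_true, if_neg hij.symm] at this
    convert this
  · intro A hAS B hBS hA hB hne
    have hcl : ∀ A ⊆ S, CycSet (trioGraph d) (4 * d) A →
        ∃ U : Finset (Fin 3 × ℕ), U.card = 2 ∧ A = legSpan (trioBase d) (trioLeg d) U :=
      fun A hAS hA => exists_of_cycSet_trioGraph hd hA (fun k h => inl_mem_trioSpan.1 (hAS h))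
        fun i j x h => (inr_mem_trioSpan.1 (hAS h)).2
    obtain ⟨U, hU, rfl⟩ := hcl A hAS hA
    obtain ⟨U', hU', rfl⟩ := hcl B hBS hB
    rw [legSpan_inter fun _ _ h => disjoint_trioLeg h, card_trioSpan (by omega)]
    refine ⟨_, not_le.1 fun hle => hne ?_, rfl⟩
    have key : ∀ I ⊆ U, I ⊆ U' → 2 ≤ I.card → U = U' := fun I h h' hI =>
      (Finset.eq_of_subset_of_card_le h (by omega)).symm.trans
        (Finset.eq_of_subset_of_card_le h' (by omega))
    have hle' : 2 ≤ (U ∩ U').card := le_of_le_of_eq hle (by congr!)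
    rw [key _ Finset.inter_subset_left Finset.inter_subset_right hle']

/-- If in every clique some member is determined, up to `c` choices, by the others, then there are
few cliques. -/
theorem card_cliqueTuples_le {W α : Type*} [Fintype W] {Γ : SimpleGraph W} {f : ℕ} (t : W → α)
    (R : Finset α) (ht : ∀ w, t w ∈ R)
    (h : ∀ ψ ∈ cliqueTuples Γ (f + 1), ∃ i, ∀ w, t w = t (ψ i) →
      (∀ j, j ≠ i → Γ.Adj (ψ j) w) → w = ψ i) :
    (cliqueTuples Γ (f + 1)).card ≤ (f + 1) * R.card * Fintype.card W ^ f := by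
  choose! e he using h
  -- A clique is encoded by the determined position, the value of `t` there, and its other `f`
  -- members.
  have h1 := Finset.card_le_card_of_injOn (s := cliqueTuples Γ (f + 1))
    (t := (Finset.univ : Finset (Fin (f + 1))) ×ˢ R ×ˢ (Finset.univ : Finset (Fin f → W)))
    (fun ψ => (e ψ, t (ψ (e ψ)), fun j => ψ ((e ψ).succAbove j))) ?_ ?_
  · refine h1.trans ?_
    simp [Finset.card_product, mul_assoc]
  · intro ψ _
    simp [ht]
  · intro ψ hψ ψ' hψ' heq
    simp only [Prod.mk.injEq] at heq
    obtain ⟨e1, e2, e3⟩ := heq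
    have hne : ∀ j, j ≠ e ψ → ψ j = ψ' j := by
      intro j hj
      obtain ⟨k, rfl⟩ := Fin.exists_succAbove_eq hj
      have := congrFun e3 k
      rw [this, e1]
    have h2 : ψ' (e ψ) = ψ (e ψ) := by
      refine he ψ hψ _ ?_ ?_
      · rw [e2, e1]
      · intro j hj
        rw [hne j hj]
        exact (Finset.mem_filter.1 hψ').2 _ _ hj
    funext j
    by_cases hj : j = e ψ
    · rw [hj, h2]
    · exact hne j hj

theorem two_mul_card_le_numArcs {V : Type*} {Ω : Finset V} {𝓕 : Finset (Finset V)}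
    {Γ : SimpleGraph Ω} (h𝓕 : ∀ A ∈ 𝓕, A ⊆ Ω ∧ A.card = 2)
    (hΓ : ∀ D D' : Ω, D ≠ D' → {D.1, D'.1} ∈ 𝓕 → Γ.Adj D D') : 2 * 𝓕.card ≤ numArcs Γ := by
  have h1 : 𝓕 ⊆ Γ.edgeFinset.image fun e => (e.map Subtype.val).toFinset := by
    intro A hA
    obtain ⟨hAΩ, hA2⟩ := h𝓕 A hA
    obtain ⟨D, D', hne, rfl⟩ := Finset.card_eq_two.1 hA2
    have hadj := hΓ ⟨D, hAΩ (by simp)⟩ ⟨D', hAΩ (by simp)⟩ (by simpa using hne) hA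
    refine Finset.mem_image.2 ⟨s(⟨D, hAΩ (by simp)⟩, ⟨D', hAΩ (by simp)⟩), ?_, ?_⟩
    · rw [SimpleGraph.mem_edgeFinset]
      exact hadj
    · ext x
      simp
  rw [numArcs_eq]
  exact Nat.mul_le_mul_left 2 ((Finset.card_le_card h1).trans Finset.card_image_le)

/-! ### The upper bound for a base of `2 d` vertices. -/

section Block
variable {V : Type*} {G : SimpleGraph V} {K₀ : Finset V} {Ω : Finset (Finset V)} {d : ℕ}

/-- Two blocks are adjacent if they make up an induced cycle together with the base. -/
def blockGraph (G : SimpleGraph V) (K₀ : Finset V) (Ω : Finset (Finset V)) (r : ℕ) :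
    SimpleGraph Ω where
  Adj D D' := D ≠ D' ∧ CycSet G r (K₀ ∪ (D.1 ∪ D'.1))
  symm := ⟨fun D D' h => ⟨h.1.symm, by rw [Finset.union_comm D'.1]; exact h.2⟩⟩
  loopless := ⟨fun _ h => h.1 rfl⟩

/-- If every member of the clique could be exchanged for another block with the same traces,
`mem_flawlessDegrees_of_twins` would give a flawless factorization with `m` factors. -/
theorem exists_no_twin [Fintype V] (hd : 2 ≤ d) (hΩ : IsBlockSystem K₀ Ω)
    (hcard : ∀ D ∈ Ω, D.card = d)
    (hKi : ∀ x ∈ K₀, ∀ y ∈ K₀, ¬ G.Adj x y) (hK : K₀.card = 2 * d)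
    (hint : ∀ A B, CycSet G (4 * d) A → CycSet G (4 * d) B → A ≠ B →
      (A ∩ B).card ∈ progression (2 * d) 2 d)
    {m : ℕ} (hm : 3 ≤ m) (hmf : m ∉ flawlessDegrees (2 * d)) {ψ : Fin m → Ω}
    (hψ : ψ ∈ cliqueTuples (blockGraph G K₀ Ω (4 * d)) m) :
    ∃ i, ∀ D : Ω, traces G K₀ D.1 = traces G K₀ (ψ i).1 →
      (∀ j, j ≠ i → (blockGraph G K₀ Ω (4 * d)).Adj (ψ j) D) → D = ψ i := by
  by_contra hcon
  push Not at hcon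
  choose ψ' htr hadj hne using hcon
  have hψ := (Finset.mem_filter.1 hψ).2
  have hdis : ∀ {D D' : Ω}, D ≠ D' → Disjoint D.1 D'.1 := fun {D D'} h =>
    hΩ.pairwise_disjoint _ D.2 _ D'.2 fun h' => h (Subtype.ext h')
  refine hmf (mem_flawlessDegrees_of_twins (G := G) (K := K₀) (S := Finset.univ)
    (F := fun i => (ψ i).1) (F' := fun i => (ψ' i).1) hd hm hKi hK (fun i => hcard _ (ψ i).2)
    (fun i => hcard _ (ψ' i).2) (fun i => (hΩ.disjoint_base _ (ψ i).2).symm)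
    (fun i => (hΩ.disjoint_base _ (ψ' i).2).symm) (fun i j hij => hdis (hψ i j hij).1)
    (fun i j => ?_) (fun i => (htr i).symm) (fun i j hij => (hψ i j hij).2)
    (fun i j hij => (hadj j i hij).2) (Finset.subset_univ _) (fun _ => Finset.subset_univ _)
    (fun _ => Finset.subset_univ _) fun A _ B _ => hint A B)
  by_cases hij : i = j
  · subst hij
    exact hdis (hne i).symm
  · exact hdis (hadj j i hij).1

end Block

/-- Sampling `T` vertices loses a factor `T / (T - 1) ≤ 1 + δ / 2`. The Turán density `1 - 1 / f` of
`N ^ 2 / 2` pairs is `2 - 2 / f` in units of `(N / 2) ^ 2`. -/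
theorem le_of_mul_le_turan {f T δ p N a : ℝ} (hf : 0 < f) (hδ : 0 < δ)
    (hT : 1 ≤ T - 1) (hTδ : 2 / δ ≤ T - 1) (hp : 0 ≤ p) (hN : 0 ≤ N)
    (h : f * (T - 1) * (2 * a) ≤ (f - 1) * T * N ^ 2 + f * p * N) :
    a ≤ (2 - 2 / f + δ) * (N / (2 : ℕ)) ^ 2 + p * N ^ (2 - 1) := by
  have h1 : 2 ≤ (T - 1) * δ := (div_le_iff₀ hδ).1 hTδ
  have hpos : 0 < 2 * f * (T - 1) := mul_pos (mul_pos two_pos hf) (by linarith)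
  refine le_of_mul_le_mul_left ?_ hpos
  have e : 2 * f * (T - 1) * ((2 - 2 / f + δ) * (N / (2 : ℕ)) ^ 2 + p * N ^ (2 - 1)) =
      (f - 1) * (T - 1) * N ^ 2 + f * ((T - 1) * δ) / 2 * N ^ 2 + 2 * f * (T - 1) * (p * N) := by
    push_cast
    field_simp
  rw [e]
  have h2 : f * 2 * N ^ 2 ≤ f * ((T - 1) * δ) * N ^ 2 :=
    mul_le_mul_of_nonneg_right (mul_le_mul_of_nonneg_left h1 hf.le) (sq_nonneg N)
  have hpN : 0 ≤ f * (p * N) := mul_nonneg hf.le (mul_nonneg hp hN)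
  have h3 : 1 * (f * (p * N)) ≤ (T - 1) * (f * (p * N)) := mul_le_mul_of_nonneg_right hT hpN
  have h4 := sq_nonneg N
  nlinarith

theorem asympLe_flawless {d : ℕ} (hd : 2 ≤ d) :
    AsympLe (PsiCycle (4 * d) (progression (2 * d) 2 d)) (2 - 2 / (flawlessNumber (2 * d) : ℝ))
      (bench (4 * d) (2 * d) 2) := by
  set f := flawlessNumber (2 * d) with hf
  have hf3 : 3 ≤ f := three_le_flawlessNumber hd
  have hfR : (3 : ℝ) ≤ f := by exact_mod_cast hf3
  have hf0 : (0 : ℝ) < f := by linarith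
  have hc1 : (1 : ℝ) ≤ 2 - 2 / f := by
    have : 2 / (f : ℝ) ≤ 1 := (div_le_one hf0).2 (by linarith)
    linarith
  have hmf : f + 1 ∉ flawlessDegrees (2 * d) := fun h => by
    have := (flawlessNumber_isGreatest (by omega : 0 < 2 * d)).2 h
    omega
  apply asympLe_of_forall_blockSystem (le_refl 2) (by omega) (by omega) (by omega) (by linarith)
  intro δ hδ
  obtain ⟨T₀, hT₀⟩ := exists_nat_ge (2 / δ)
  set T := T₀ + f + 2 with hT
  -- The double exponential bounds the number of possible traces of a block, which are sets of
  -- subsets of the base.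
  set c := (f + 1) * 2 ^ 2 ^ (2 * d) with hc
  refine ⟨(T : ℝ) ^ (f + 2) * c, fun {V} _ G K₀ Ω 𝓕 hK hΩ hcard h𝓕 _ hint => ?_⟩
  have hpos : ∀ D ∈ Ω, D.Nonempty := fun D hD =>
    Finset.card_pos.1 (by rw [hcard D hD]; omega)
  have hC : (0 : ℝ) ≤ (T : ℝ) ^ (f + 2) * c * (Ω.card : ℝ) ^ (2 - 1) := by positivity
  by_cases hedge : ∃ x ∈ K₀, (nbrs G K₀ x).Nonempty
  · have h1 := card_le_of_base_edge hΩ hpos h𝓕 hedge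
    have h2 : (0 : ℝ) ≤ ((Ω.card : ℝ) / (2 : ℕ)) ^ 2 := by positivity
    have h3 := mul_le_mul_of_nonneg_right (by linarith : 1 ≤ 2 - 2 / (f : ℝ) + δ) h2
    exact h1.trans ((one_mul _).symm.le.trans (h3.trans (le_add_of_nonneg_right hC)))
  · push Not at hedge
    have hKi : ∀ x ∈ K₀, ∀ y ∈ K₀, ¬ G.Adj x y := fun x hx y hy hxy => by
      have : y ∈ nbrs G K₀ x := mem_nbrs.2 ⟨hy, hxy⟩
      rw [hedge x hx] at this
      exact Finset.notMem_empty _ this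
    have hclq : (cliqueTuples (blockGraph G K₀ Ω (4 * d)) (f + 1)).card ≤
        c * Fintype.card Ω ^ f := by
      have := card_cliqueTuples_le (Γ := blockGraph G K₀ Ω (4 * d)) (f := f)
        (fun D => traces G K₀ D.1) K₀.powerset.powerset (fun _ => traces_mem_powerset)
        fun ψ hψ => exists_no_twin hd hΩ hcard hKi hK hint (by omega) hmf hψ
      rwa [Finset.card_powerset, Finset.card_powerset, hK] at this
    have harc : 2 * 𝓕.card ≤ numArcs (blockGraph G K₀ Ω (4 * d)) := by
      refine two_mul_card_le_numArcs (fun A hA => ⟨(h𝓕 A hA).1, (h𝓕 A hA).2.1⟩) ?_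
      intro D D' hne hA
      refine ⟨hne, ?_⟩
      have := (h𝓕 _ hA).2.2
      simpa [blockSpan] using this
    have hmain := mul_numArcs_le (blockGraph G K₀ Ω (4 * d)) (T := T) (by omega : 0 < f)
      (by omega) (by omega) hclq
    rw [Fintype.card_coe] at hmain
    have h1 := (Nat.mul_le_mul_left (f * (T - 1)) harc).trans hmain
    have h2 : (f : ℝ) * (T - 1) * (2 * 𝓕.card) ≤ (f - 1) * T * (Ω.card : ℝ) ^ 2 +
        f * T ^ (f + 2) * c * Ω.card := by
      have h3 : ((f * (T - 1) * (2 * 𝓕.card) : ℕ) : ℝ) ≤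
          ((f - 1) * T * Ω.card ^ 2 + f * T ^ (f + 2) * c * Ω.card : ℕ) := by exact_mod_cast h1
      push_cast [Nat.cast_sub (by omega : 1 ≤ f), Nat.cast_sub (by omega : 1 ≤ T)] at h3
      exact h3
    have hu : (1 : ℝ) ≤ (T : ℝ) - 1 ∧ 2 / δ ≤ (T : ℝ) - 1 := by
      have hf1 : (0 : ℝ) ≤ T₀ := Nat.cast_nonneg _
      rw [hT]
      push_cast
      constructor <;> linarith
    exact le_of_mul_le_turan hf0 hδ hu.1 hu.2 (by positivity) (by positivity)
      (by rwa [mul_assoc (f : ℝ) ((T : ℝ) ^ (f + 2)) (c : ℝ)] at h2)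

end CycleIntersect

/-! ### Assembly of the cases. -/

open CycleIntersect in
theorem theorem1p6 (r s d : ℕ) (ℓ : ℕ → ℕ) (L : Set ℕ)
    (hr : 4 ≤ r) (hs : 1 < s)
    (hL : L = ℓ '' Set.Icc 1 s)
    (hLr : L ⊆ Set.Icc 1 (r - 1))
    (hmono : StrictMonoOn ℓ (Set.Icc 1 s))
    (hAP : ∀ i ∈ Set.Ico 1 s, ℓ (i + 1) = ℓ i + d)
    (hAPr : r = ℓ s + d) :
    (d = 1 →
      ((ℓ 1, s) ∉ ({(1, 3), (2, 2)} : Set (ℕ × ℕ)) →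
        AsympEq (PsiCycle r L) 1 (bench r (ℓ 1) s)) ∧
      ((ℓ 1, s) ∈ ({(1, 3), (2, 2)} : Set (ℕ × ℕ)) →
        AsympEq (PsiCycle r L) 2 (bench r (ℓ 1) s))) ∧
    (2 ≤ d →
      AsympGe (PsiCycle r L) 1 (bench r (ℓ 1) s) ∧
      AsympLe (PsiCycle r L) 2 (bench r (ℓ 1) s)) ∧
    (2 ≤ d → s * d < ℓ 1 → AsympEq (PsiCycle r L) 1 (bench r (ℓ 1) s)) ∧
    (2 ≤ d → s = 2 → ℓ 1 < 2 * d → ℓ 1 ∈ ({1, 2} : Set ℕ) →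
      AsympEq (PsiCycle r L) 2 (bench r (ℓ 1) s)) ∧
    (2 ≤ d → s = 2 → (ℓ 1 : ℝ) < (d : ℝ) / 2 → ℓ 1 ∈ ({3, 4} : Set ℕ) →
      AsympEq (PsiCycle r L) 2 (bench r (ℓ 1) s)) ∧
    (2 ≤ d → s = 2 → ℓ 1 = 2 * d →
      AsympGe (PsiCycle r L) (4 / 3) (bench r (ℓ 1) s) ∧
      AsympLe (PsiCycle r L) (2 - 2 / (flawlessNumber (ℓ 1) : ℝ)) (bench r (ℓ 1) s)) := by
  have hℓ : ∀ i, i < s → ℓ (i + 1) = ℓ 1 + i * d := by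
    intro i
    induction i with
    | zero => intro _; simp
    | succ i ih =>
      intro hi
      rw [hAP (i + 1) ⟨by omega, hi⟩, ih (by omega)]
      ring
  have hr' : r = ℓ 1 + s * d := by
    have := hℓ (s - 1) (by omega)
    rw [Nat.sub_add_cancel (by omega)] at this
    rw [hAPr, this, add_assoc, ← Nat.succ_mul, Nat.succ_eq_add_one, Nat.sub_add_cancel (by omega)]
  have hL' : L = progression (ℓ 1) s d := by
    rw [hL]
    ext m
    constructor
    · rintro ⟨i, ⟨hi1, hi2⟩, rfl⟩
      refine ⟨i - 1, by omega, ?_⟩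
      rw [← hℓ (i - 1) (by omega), Nat.sub_add_cancel hi1]
    · rintro ⟨j, hj, rfl⟩
      exact ⟨j + 1, ⟨by omega, hj⟩, hℓ j hj⟩
  have hd : 0 < d := by
    have h1 := hmono (a := 1) (b := 2) ⟨le_rfl, by omega⟩ ⟨by omega, hs⟩ (by omega)
    have h2 := hAP 1 ⟨le_rfl, hs⟩
    norm_num at h2
    omega
  have hl : 0 < ℓ 1 := (hLr (by rw [hL]; exact ⟨1, ⟨le_rfl, by omega⟩, rfl⟩)).1
  have hs' : 0 < s := by omega
  have heq : ∀ {c : ℝ}, AsympGe (PsiCycle r L) c (bench r (ℓ 1) s) →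
      AsympLe (PsiCycle r L) c (bench r (ℓ 1) s) → AsympEq (PsiCycle r L) c (bench r (ℓ 1) s) :=
    asympEq_of hr' hs' hd
  clear hL hLr hmono hAP hAPr hℓ
  generalize ℓ 1 = l at *
  subst hL'
  have hle2 := asympLe_two hs hd hl hr' hr
  have hge1 : 2 ≤ d → AsympGe (PsiCycle r (progression l s d)) 1 (bench r l s) := by
    intro hd2
    -- The length that the blow-up cannot handle. With `d ≥ 2` it forces `s = 2` and `l = 2`, where
    -- the theta graph serves.
    by_cases hrd : r = 2 * d + 2
    · obtain rfl : s = 2 := by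
        by_contra hne
        have h3 : 3 * d ≤ s * d := Nat.mul_le_mul_right d (by omega)
        omega
      obtain rfl : l = 2 := by omega
      subst hrd
      exact (asympGe_two_theta hd).mono hr' hs' hd (by norm_num)
    · have h3 : 2 * d ≤ s * d := Nat.mul_le_mul_right d hs
      exact asympGe_one hs hd hl (by omega) hrd hr'
  refine ⟨?_, fun hd2 => ⟨hge1 hd2, hle2⟩, fun hd2 hsd => heq (hge1 hd2)
    (asympLe_one_of_large hs hd hr' hr hsd), ?_, ?_, ?_⟩
  · rintro rfl
    simp only [Set.mem_insert_iff, Set.mem_singleton_iff, Prod.mk.injEq]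
    constructor
    · intro hne
      -- For `d = 1`, the equation `l + s = 4` has only the two excluded solutions.
      have hr5 : 4 < r := by omega
      exact heq (asympGe_one hs hd hl hr5 (by omega) hr')
        (asympLe_one_of_consecutive hs hl hr' hr5)
    · rintro (⟨rfl, rfl⟩ | ⟨rfl, rfl⟩)
      · have h := asympGe_two_square
        rw [show 4 = r by omega] at h
        exact heq h hle2
      · have h := asympGe_two_theta one_pos
        rw [show 2 * 1 + 2 = r by omega] at h
        exact heq h hle2
  · rintro hd2 rfl - hl12
    simp only [Set.mem_insert_iff, Set.mem_singleton_iff] at hl12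
    rcases hl12 with rfl | rfl
    · obtain rfl : r = 2 * d + 1 := by omega
      exact heq (asympGe_two_spider hd2) hle2
    · obtain rfl : r = 2 * d + 2 := by omega
      exact heq (asympGe_two_theta hd) hle2
  · rintro hd2 rfl hld hl34
    have hld' : 2 * l < d := by
      have : 2 * (l : ℝ) < d := by linarith
      exact_mod_cast this
    subst hr'
    exact heq (asympGe_two_ring (by simpa using hl34) hld') hle2
  · intro hd2 hs2 hl2
    subst hs2
    subst hl2
    obtain rfl : r = 4 * d := by rw [hr']; ring
    exact ⟨asympGe_four_thirds hd2, asympLe_flawless hd2⟩
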